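/- **Spin-$s$ duality.** Let $n\ge 4$, $s\ge 2$; work on $\mathbb R^n$ with $\eta=\mathrm{diag}(-1,1,\dots,1)$. All fields are smooth; round/square brackets denote unit-weight (anti)symmetrization; $\varepsilon$ is the Levi-Civita symbol. For actions $S=\int L$ with $L$ quadratic, $S[\varphi+\delta]-S[\varphi]=\int (L(\varphi+\delta)-L(\varphi))$ is used with $\varphi$ smooth and $\delta$ smooth with compact support; "$S_1=S_2$" means equality of all these differences, field equations mean vanishing first variation for compactly supported variations, and gauge invariance is under compactly supported parameters. *Fields.* $e_{\mu|a_1\dots a_{s-1}}$, $B_{\mu\nu|a_1\dots a_{s-1}}$, $Y_{\mu\nu|a_1\dots a_{s-1}}$, $Y_{\lambda\mu\nu|a_1\dots a_{s-1}}$, $\psi_{\rho\lambda\mu\nu|a_1\dots a_{s-1}}$, $\phi_{b_1\dots b_{n-4}|a_2\dots a_s}$ and $\xi_{a_1\dots a_{s-1}}$ are antisymmetric in the indices before the bar and symmetric and traceless in the others ($\xi$ has only the latter). Parameters $\alpha_{\mu|a_1\dots a_{s-1}}$ satisfy in addition $\alpha_{(\mu|a_1\dots a_{s-1})}=0$ and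 $\alpha^{\mu}{}_{|\mu a_2\dots a_{s-1}}=0$. The spin connection $\omega_{\mu|b|a_1\dots a_{s-1}}$ satisfies, for each $\mu$, the same algebraic conditions in $b|a_1\dots a_{s-1}$. **1. Parent action.** Vasiliev's first-order action is $$S[e,\omega]=-2\int d^nx\Big[\big(B_{a_1[\nu|\mu]a_2\dots}-\tfrac1{2(s-1)}B_{\nu\mu|a_1\dots}\big)K^{\mu\nu|a_1\dots}+\big(2B^{\rho}{}_{\mu|a_2\dots a_{s-1}\rho}+(s-2)B^{\rho}{}_{a_2|a_3\dots a_{s-1}\mu\rho}\big)K^{\mu\nu|a_2\dots}{}_{\nu}\Big],$$ $B_{\mu b|a}=2\omega_{[\mu|b]|a}$, $K^{\mu\nu|a}=\partial^{[\mu}e^{\nu]|a}-\tfrac14B^{\mu\nu|a}$. Every $B$ comes from some $\omega$. The map $B\mapsto Y$, where $Y_{\mu\nu|a}$ is the projection (antisymmetric in $\mu\nu$, symmetric in the $a_i$) of $$B_{a_1\mu|\nu a_2\dots}-\tfrac1{2(s-1)}B_{\mu\nu|a_1\dots}+2\eta_{\mu a_1}B^{\lambda}{}_{\nu|\lambda a_2\dots}+(s-2)\eta_{\mu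 a_1}B^{\lambda}{}_{a_2|\lambda\nu a_3\dots},$$ is a bijection from the fields $B$ onto the fields $Y$, and in terms of $(e,Y)$ Vasiliev's Lagrangian becomes, pointwise, that of the parent action $$S[e,Y]=-2\int d^nx\Big[Y_{\mu\nu|a_1\dots}\partial^{[\nu}e^{\mu]|a_1\dots}+\tfrac{(s-1)^2}{s}\Big[-Y_{\mu\nu|a_1\dots}Y^{\mu a_1|\nu a_2\dots}+\tfrac{s-2}{2(s-1)}Y_{\mu\nu|a_1\dots}Y^{\mu\nu|a_1\dots}$$ $$+\tfrac1{n+s-4}\big[(s-3)Y_{\mu\nu|a_1\dots a_{s-2}}{}^{\mu}Y^{\nu\rho|a_1\dots a_{s-2}}{}_{\rho}-(s-2)Y_{\mu\nu|a_1\dots a_{s-2}}{}^{\mu}Y^{a_1\rho|\nu a_2\dots a_{s-2}}{}_{\rho}\big]\Big]\Big].$$ It is invariant under $\delta e_{\mu|a_1\dots a_{s-1}}=\partial_\mu\xi_{a_1\dots a_{s-1}}+\alpha_{\mu|a_1\dots a_{s-1}}$, $\delta Y^{\mu\nu|}{}_{a_1\dots a_{s-1}}=3\,\partial_\lambda\big(\delta^{[\lambda}_{(a_1}\alpha^{\mu|\nu]}{}_{a_2\dots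 a_{s-1})}\big)$. **2. Elimination of $Y$.** For given $e$, the field equation of $Y$ has exactly one solution, namely the image of $B_{\mu\nu|a}=2\partial_{[\mu}e_{\nu]|a}$. The field $h_{\mu a_1\dots a_{s-1}}=e_{(\mu|a_1\dots a_{s-1})}$ is double-traceless, every symmetric double-traceless $h$ arises (from a compactly supported $e$ if $h$ is compactly supported), and $e,e'$ give the same $h$ iff $e-e'$ is of $\alpha$-type. The action obtained by eliminating $Y$ equals $\frac{s}{s-1}$ times the Fronsdal action of $h$, with Lagrangian ($h'$ the trace of $h$, $\partial\cdot$ the divergence) $$-\tfrac12(\partial_\lambda h)^2+\tfrac s2(\partial\cdot h)^2+\tfrac{s(s-1)}2(\partial\cdot\partial\cdot h)\,h'+\tfrac{s(s-1)}4(\partial_\lambda h')^2+\tfrac{s(s-1)(s-2)}8(\partial\cdot h')^2 .$$ **3. $e$ as a Lagrange multiplier.** The field equation of $e$ is $\partial^\mu Y_{\mu\nu|a}=0$, and it holds iff $Y_{\mu\nu|a}=\partial^\lambda Y_{\lambda\mu\nu|a}$ for some $Y_{\lambda\mu\nu|a}$; one has $\partial^\lambda Y_{\lambda\mu\nu|a}=0$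 iff $Y_{\lambda\mu\nu|a}=\partial^\rho\psi_{\rho\lambda\mu\nu|a}$ for some $\psi$. In both cases the potential can be chosen compactly supported if the field is. A dual field is a $T_{b_1\dots b_{n-3}|a_2\dots a_s}$, antisymmetric in the $b$'s, symmetric in the $a$'s, with $T_{[b_1\dots b_{n-3}|a_2]\dots a_s}=0$ (mixed symmetry $[n-3,1,\dots,1]$) and $T_{b|a_2\dots}\eta^{a_2a_3}\eta^{a_4a_5}=0=T_{b|a_2\dots}\eta^{b_1a_2}\eta^{a_3a_4}$. For each $Y_{\lambda\mu\nu|a}$ there is exactly one dual field $T$ such that $$Y^{\lambda\mu\nu|}{}_{a_1\dots a_{s-1}}=X^{\lambda\mu\nu|}{}_{a_1\dots a_{s-1}}+\delta^{[\lambda}_{(a_1}Z^{\mu\nu]|}{}_{a_2\dots a_{s-1})},\qquad X^{\lambda\mu\nu|}{}_{a}=\tfrac1{(n-3)!}\varepsilon^{\lambda\mu\nu b_1\dots b_{n-3}}T_{b_1\dots b_{n-3}|a}$$ with some $X,Z$ (antisymmetric in the indices before the bar, symmetric in the others) free of mixed traces. Every dual field $T$ arises (from a compactly supported $Y_{\lambda\mu\nu|a}$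 if $T$ is compactly supported), and two potentials have the same $T$ iff they differ by $3\,\delta^{[\lambda}_{(a_1}\alpha^{\mu|\nu]}{}_{a_2\dots a_{s-1})}$ for some $\alpha$. At $Y_{\mu\nu|a}=\partial^\lambda Y_{\lambda\mu\nu|a}$ the parent action equals the dual action $$S[T]=-\tfrac{2(s-1)}{s(n-3)!}\int d^nx\Big[\partial^eT^{b_1\dots b_{n-3}|a_2\dots a_s}\partial_eT_{b_1\dots b_{n-3}|a_2\dots a_s}-(n-3)\,\partial_eT^{eb_2\dots|a_2\dots}\partial^fT_{fb_2\dots|a_2\dots}$$ $$+(s-1)\Big[-\partial_eT^{b_1\dots|ea_3\dots}\partial^fT_{b_1\dots|fa_3\dots}-2(n-3)T_g{}^{b_2\dots|ga_3\dots}\partial^{ef}T_{eb_2\dots|fa_3\dots}-(s-2)T^{b_1\dots|c}{}_c{}^{a_4\dots}\partial^{ef}T_{b_1\dots|efa_4\dots}$$ $$-(n-3)\partial^eT_g{}^{b_2\dots|ga_3\dots}\partial_eT^f{}_{b_2\dots|fa_3\dots}-\tfrac{s-2}2\partial^eT^{b_1\dots|c}{}_c{}^{a_4\dots}\partial_eT_{b_1\dots|}{}^d{}_{da_4\dots}+(n-3)(n-4)\partial_eT_g{}^{eb_3\dots|ga_3\dots}\partial^hT^f{}_{hb_3\dots|fa_3\dots}$$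 $$-(s-2)(n-3)\partial_eT_g{}^{b_2\dots|gea_4\dots}\partial^fT_{fb_2\dots|}{}^c{}_{ca_4\dots}+\tfrac{(s-2)(n-3)}4\partial_eT^{eb_2\dots|c}{}_c{}^{a_4\dots}\partial^fT_{fb_2\dots|}{}^d{}_{da_4\dots}-\tfrac{(s-2)(s-3)}4\partial_eT^{b_1\dots|c}{}_c{}^{ea_5\dots}\partial^fT_{b_1\dots|}{}^d{}_{dfa_5\dots}\Big]\Big].$$ **4. Gauge symmetries.** The shift of the potential by $\partial^\rho\psi_{\rho\lambda\mu\nu|a}$ changes $T$ by $$\delta_\phi T_{b_1\dots b_{n-3}|a_2\dots a_s}=\partial_{[b_1}\phi_{b_2\dots b_{n-3}]|a_2\dots a_s}+\tfrac{(s-1)(n-2)}{n+s-4}\,\partial_f\phi_{c_1\dots c_{n-4}|ga_3\dots a_s}\,\delta^{[fgc_1\dots c_{n-4}]}_{[a_2b_1\dots b_{n-3}]}$$ (right side symmetrized in the $a_i$), with $\phi_{b_1\dots b_{n-4}|a}=\frac{n-3}{4!}\,\varepsilon_{b_1\dots b_{n-4}\rho\lambda\mu\nu}\psi^{\rho\lambda\mu\nu|}{}_a$;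 all parameters $\phi$ arise this way. For every $\phi$, $\delta_\phi T$ is again a dual field, and the dual action is invariant under $T\to T+\delta_\phi T$. **5. $n=4$.** The dual field is $T_{b|a_2\dots a_s}$, totally symmetric and double-traceless, $T\mapsto T_{(b|a_2\dots a_s)}$ identifies the dual fields with the Fronsdal fields, the dual Lagrangian equals $\frac{4(s-1)}{s}$ times the Fronsdal Lagrangian of $T$, and $\delta_\phi T=\partial_{(b}\phi_{a_2\dots a_s)}$. **6. $n=5$, $s=2$.** Dual fields are the $T_{ab|c}$ with $T_{ab|c}=-T_{ba|c}$, $T_{[ab|c]}=0$; the dual Lagrangian is Curtright's, $$-\tfrac12\big[\partial^aT^{bc|d}\partial_aT_{bc|d}-2\partial_aT^{ab|c}\partial^dT_{db|c}-\partial_aT^{bc|a}\partial^dT_{bc|d}-4T_a{}^{b|a}\partial^{cd}T_{cb|d}-2\partial_aT_b{}^{c|b}\partial^aT^d{}_{c|d}+2\partial_aT_b{}^{a|b}\partial^cT^d{}_{c|d}\big],$$ and for $\phi_{ab}=-2(S_{ab}+A_{ab})$, with $S$ symmetric and $A$ antisymmetric, the gauge transformation is Curtright's, $\delta T_{ab|c}=-2\partial_{[a}S_{b]c}-\frac13[\partial_aA_{bc}+\partial_bA_{ca}-2\partial_cA_{ab}]$.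 -/

import Mathlib

open scoped ContDiff

namespace SpinDuality

noncomputable section

/-! Tensor fields on Minkowski space `ℝⁿ`, `η = diag(-1, 1, …, 1)`.  All indices are written
downstairs; every contraction carries the factor `η` of the contracted index. -/

/-- `Ten n p q`: fields `T_{b₁…b_p | a₁…a_q}(x)` with two groups of indices; `T b a x` is the
component with indices `b`, `a` at the point `x`. -/
abbrev Ten (n p q : ℕ) : Type :=
  (Fin p → Fin n) → (Fin q → Fin n) → (Fin n → ℝ) → ℝ

/-- Diagonal entries of the mostly plus Minkowski metric. -/
def eta {n : ℕ} (μ : Fin n) : ℝ := if (μ : ℕ) = 0 then -1 else 1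

/-- The partial derivative `∂_μ f`. -/
def pd {n : ℕ} (μ : Fin n) (f : (Fin n → ℝ) → ℝ) : (Fin n → ℝ) → ℝ :=
  fun x => fderiv ℝ f x (Pi.single μ 1)

variable {n p q : ℕ}

/-- All components are `C^∞`. -/
def IsSmooth (T : Ten n p q) : Prop := ∀ b a, ContDiff ℝ ∞ (T b a)

/-- All components have compact support. -/
def IsCompactlySupported (T : Ten n p q) : Prop := ∀ b a, HasCompactSupport (T b a)

/-- Antisymmetric in the first group of indices and symmetric in the second one. -/
def IsBiSym (T : Ten n p q) : Prop :=
  ∀ (σ : Equiv.Perm (Fin p)) (τ : Equiv.Perm (Fin q)) (b : Fin p → Fin n) (a : Fin q → Fin n)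
    (x : Fin n → ℝ),
    T (b ∘ σ) (a ∘ τ) x = ((Equiv.Perm.sign σ : ℤ) : ℝ) * T b a x

/-- Unit-weight antisymmetrization `[b₁…b_p]`. -/
def asym (T : Ten n p q) : Ten n p q := fun b a x =>
  (1 / (p.factorial : ℝ)) *
    ∑ σ : Equiv.Perm (Fin p), ((Equiv.Perm.sign σ : ℤ) : ℝ) * T (b ∘ σ) a x

/-- Unit-weight symmetrization `(a₁…a_q)`. -/
def sym (T : Ten n p q) : Ten n p q := fun b a x =>
  (1 / (q.factorial : ℝ)) * ∑ τ : Equiv.Perm (Fin q), T b (a ∘ τ) x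

/-- Full contraction `A_{b|a} B^{b|a}`. -/
def contr (A B : Ten n p q) : (Fin n → ℝ) → ℝ := fun x =>
  ∑ b : Fin p → Fin n, ∑ a : Fin q → Fin n,
    (∏ i, eta (b i)) * (∏ j, eta (a j)) * A b a x * B b a x

/-- `∂_μ A^{b|a} ∂^μ A_{b|a}`. -/
def kin (A : Ten n p q) : (Fin n → ℝ) → ℝ := fun x =>
  ∑ μ : Fin n, eta μ * contr (fun b a => pd μ (A b a)) (fun b a => pd μ (A b a)) x

/-- Trace in the second group: `T_{b | c}{}^{c}{}_{a₃…a_q}` (zero if `q ≤ 1`). -/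
def trA : {q : ℕ} → Ten n p q → Ten n p (q - 1 - 1)
  | 0, _ => 0
  | 1, _ => 0
  | _ + 2, T => fun b a x => ∑ c, eta c * T b (Matrix.vecCons c (Matrix.vecCons c a)) x

/-- Mixed trace: `T^{c}{}_{b₂…b_p | c a₂…a_q}` (zero if `p = 0` or `q = 0`). -/
def trM : {p q : ℕ} → Ten n p q → Ten n (p - 1) (q - 1)
  | 0, _, _ => 0
  | _ + 1, 0, _ => 0
  | _ + 1, _ + 1, T => fun b a x => ∑ c, eta c * T (Matrix.vecCons c b) (Matrix.vecCons c a) x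

/-- Divergence on the first group: `∂^c T_{c b₂…b_p | a}` (zero if `p = 0`). -/
def divB : {p : ℕ} → Ten n p q → Ten n (p - 1) q
  | 0, _ => 0
  | _ + 1, T => fun b a x => ∑ c, eta c * pd c (T (Matrix.vecCons c b) a) x

/-- Divergence on the second group: `∂^c T_{b | c a₂…a_q}` (zero if `q = 0`). -/
def divA : {q : ℕ} → Ten n p q → Ten n p (q - 1)
  | 0, _ => 0
  | _ + 1, T => fun b a x => ∑ c, eta c * pd c (T b (Matrix.vecCons c a)) x

/-- `∂_{b₁} T_{b₂…b_p | a}`. -/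
def grad : {p : ℕ} → Ten n (p - 1) q → Ten n p q
  | 0, _ => 0
  | _ + 1, T => fun b a => pd (b 0) (T (Matrix.vecTail b) a)

/-- Exchange of `b₁` and `a₁`: `T_{a₁ b₂…b_p | b₁ a₂…a_q}` (zero if `p = 0` or `q = 0`). -/
def swap : {p q : ℕ} → Ten n p q → Ten n p q
  | 0, _, _ => 0
  | _ + 1, 0, _ => 0
  | _ + 1, _ + 1, T => fun b a =>
      T (Matrix.vecCons (a 0) (Matrix.vecTail b)) (Matrix.vecCons (b 0) (Matrix.vecTail a))

/-- `η_{b₁ a₁} V_{b₂…b_p | a₂…a_q}`. -/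
def etaMix : {p q : ℕ} → Ten n (p - 1) (q - 1) → Ten n p q
  | 0, _, _ => 0
  | _ + 1, 0, _ => 0
  | _ + 1, _ + 1, V => fun b a x =>
      (if b 0 = a 0 then eta (b 0) else 0) * V (Matrix.vecTail b) (Matrix.vecTail a) x

/-- `T_{b₁…b_p | a₁ a₂…a_q}` seen as having first group `b₁, …, b_p, a₁`; in particular
`asym (pull T)` is `T_{[b₁…b_p | a₁] a₂…a_q}`. -/
def pull : {q : ℕ} → Ten n p q → Ten n (p + 1) (q - 1)
  | 0, _ => 0
  | _ + 1, T => fun b a => T (fun i => b i.castSucc) (Matrix.vecCons (b (Fin.last p)) a)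

/-- Inverse of `pull`: `M_{b₁…b_p a₁ | a₂…a_q}` seen as having groups `b` and `a`. -/
def unpull : {q : ℕ} → Ten n (p + 1) (q - 1) → Ten n p q
  | 0, _ => 0
  | _ + 1, M => fun b a => M (Fin.snoc (α := fun _ => Fin n) b (a 0)) (Matrix.vecTail a)

/-- Total symmetrization `e_{(μ | a₁…a_{s-1})}`, a tensor with `s` symmetric indices. -/
def symPart : (s : ℕ) → Ten n 1 (s - 1) → Ten n 0 s
  | 0, _ => 0
  | _ + 1, e => sym (fun _ a => e ![a 0] (Matrix.vecTail a))

/-- The Levi-Civita symbol `ε_{f(0)…f(n-1)}`, normalized by `ε_{01…(n-1)} = 1`. -/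
def leviCivita (f : Fin n → Fin n) : ℝ :=
  Matrix.det (Matrix.of fun i j => if f i = j then (1 : ℝ) else 0)

/-- `ε_{b₁…b_k c₁…c_p}` for `k + p = n`. -/
def epsilon {k : ℕ} (b : Fin k → Fin n) (c : Fin p → Fin n) : ℝ :=
  if h : n = k + p then leviCivita (fun i => Fin.append b c (Fin.cast h i)) else 0

/-- `ε_{b₁…b_k}{}^{c₁…c_p} A_{c₁…c_p | a}` for `k + p = n`. -/
def epsDual {k : ℕ} (A : Ten n p q) : Ten n k q := fun b a x =>
  ∑ c : Fin p → Fin n, (∏ i, eta (c i)) * epsilon b c * A c a x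

/-! ### Classes of fields -/

/-- Smooth fields `F_{b₁…b_p|a₁…a_q}`, antisymmetric in the `b`'s, symmetric and traceless in
the `a`'s.  With `q = s - 1` this is the class of the generalized vielbein `e` (`p = 1`), of `B` and
`Y` (`p = 2`), of the potential of `Y` (`p = 3`), and of the gauge parameters `ξ` (`p = 0`), `ψ`
(`p = 4`) and `φ` (`p = n - 4`). -/
def IsTracelessForm (F : Ten n p q) : Prop := IsSmooth F ∧ IsBiSym F ∧ trA F = 0

/-- The algebraic conditions on the parameter `α_{μ|a₁…a_{s-1}}`: symmetric and traceless in the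
`a`'s, `α_{(μ|a₁…a_{s-1})} = 0` and `α^μ_{|μ a₂…a_{s-1}} = 0`. -/
def IsHook (s : ℕ) (α : Ten n 1 (s - 1)) : Prop :=
  IsBiSym α ∧ symPart s α = 0 ∧ trM α = 0 ∧ trA α = 0

/-- Generalized spin connections `Ω_{μ|b|a₁…a_{s-1}}`; the first group of indices is `(μ, b)`,
without symmetry, and for each `μ` the components `Ω_{μ|b|a}` are of the type `IsHook`. -/
def IsSpinConnection (s : ℕ) (Ω : Ten n 2 (s - 1)) : Prop :=
  IsSmooth Ω ∧ ∀ μ : Fin n, IsHook s (fun b a => Ω (Matrix.vecCons μ b) a)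

/-- Fronsdal fields: symmetric and double-traceless. -/
def IsFronsdalField {s : ℕ} (h : Ten n 0 s) : Prop :=
  IsSmooth h ∧ IsBiSym h ∧ trA (trA h) = 0

/-- Dual fields `T_{b₁…b_{n-3}|a₂…a_s}`: antisymmetric in the `b`'s, symmetric in the `a`'s,
`T_{[b₁…b_{n-3}|a₂]…a_s} = 0` (mixed symmetry `[n-3,1,…,1]`), with vanishing double traces. -/
def IsDualField (s : ℕ) (T : Ten n (n - 3) (s - 1)) : Prop :=
  IsSmooth T ∧ IsBiSym T ∧ asym (pull T) = 0 ∧ trA (trA T) = 0 ∧ trA (trM T) = 0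

/-! ### Actions -/

/-- `S[φ + δ] - S[φ]` for the action `S = ∫ L`; for quadratic Lagrangians it makes sense for
arbitrary smooth `φ` and compactly supported `δ`, and it is `S[δ]` when `φ = 0`. -/
def actionDiff {V : Type} [Add V] (L : V → (Fin n → ℝ) → ℝ) (φ δ : V) : ℝ :=
  ∫ x, (L (φ + δ) x - L φ x)

/-- The field `φ` solves the field equations of `S = ∫ L`: the first variation of `S` vanishes for
all variations `δ` in the class `D`. -/
def IsStationaryPoint {V : Type} [AddCommGroup V] [Module ℝ V] (L : V → (Fin n → ℝ) → ℝ)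
    (D : V → Prop) (φ : V) : Prop :=
  ∀ δ, D δ → HasDerivAt (fun t : ℝ => actionDiff L φ (t • δ)) 0 0

/-- Compactly supported fields of the class `IsTracelessForm`. -/
def IsVariation (F : Ten n p q) : Prop := IsTracelessForm F ∧ IsCompactlySupported F

/-- `B_{μν|a} = 2 Ω_{[μ|ν]|a}`. -/
def bOfOmega (Ω : Ten n 2 q) : Ten n 2 q := (2 : ℝ) • asym Ω

/-- Vasiliev's first-order Lagrangian in dimension `n`, with `K = ∂_{[μ}e_{ν]} - B/4`:
`-2 [(B_{a₁[ν|μ]a₂…} - B_{νμ|a₁…}/(2(s-1))) K^{μν|a₁…}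
  + (2 B^ρ_{μ|a₂…ρ} + (s-2) B^ρ_{a₂|a₃…μρ}) K^{μν|a₂…}_ν]`. -/
def vasilievLagrangian (s : ℕ) (e : Ten n 1 (s - 1)) (B : Ten n 2 (s - 1)) :
    (Fin n → ℝ) → ℝ :=
  let K : Ten n 2 (s - 1) := asym (grad e) - (1 / 4 : ℝ) • B
  (-2 : ℝ) • (contr (swap B + (1 / (2 * ((s : ℝ) - 1))) • B) K
    - contr ((2 : ℝ) • trM B + ((s : ℝ) - 2) • swap (trM B)) (trM K))

/-- The field `Y`, coefficient of `∂^{[ν}e^{μ]|a}`: the projection, antisymmetric in `μν` and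
symmetric in the `a`'s, of `B_{a₁μ|νa₂…} - B_{μν|a₁…}/(2(s-1)) + 2 η_{μa₁} B^λ_{ν|λa₂…}
+ (s-2) η_{μa₁} B^λ_{a₂|λνa₃…}`. -/
def yOfB (s : ℕ) (B : Ten n 2 (s - 1)) : Ten n 2 (s - 1) :=
  asym (sym (-swap B - (1 / (2 * ((s : ℝ) - 1))) • B
    + etaMix ((2 : ℝ) • trM B + ((s : ℝ) - 2) • swap (trM B))))

/-- The parent Lagrangian
`-2 [Y_{μν|a₁…}∂^{[ν}e^{μ]|a₁…} + ((s-1)²/s) [-Y_{μν|a₁…}Y^{μa₁|νa₂…}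
  + (s-2)/(2(s-1)) Y_{μν|a₁…}Y^{μν|a₁…} + (1/(n+s-4)) [(s-3) Y_{μν|a…}^μ Y^{νρ|a…}_ρ
  - (s-2) Y_{μν|a₁…}^μ Y^{a₁ρ|νa₂…}_ρ]]]`. -/
def parentLagrangian (s : ℕ) (e : Ten n 1 (s - 1)) (Y : Ten n 2 (s - 1)) :
    (Fin n → ℝ) → ℝ :=
  let de : Ten n 2 (s - 1) := asym (grad e)
  let W : Ten n 1 (s - 1 - 1) := trM Y
  (-2 : ℝ) • (-contr Y de + (((s : ℝ) - 1) ^ 2 / s) • (-contr Y (swap Y)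
    + (((s : ℝ) - 2) / (2 * ((s : ℝ) - 1))) • contr Y Y
    + (1 / ((n : ℝ) + s - 4)) • (-(((s : ℝ) - 3) • contr W W)
      + ((s : ℝ) - 2) • contr W (swap W))))

/-- The Fronsdal Lagrangian. -/
def fronsdalLagrangian {s : ℕ} (h : Ten n 0 s) : (Fin n → ℝ) → ℝ :=
  (-1 / 2 : ℝ) • kin h
    + ((s : ℝ) / 2) • contr (divA h) (divA h)
    + ((s : ℝ) * (s - 1) / 2) • contr (divA (divA h)) (trA h)
    + ((s : ℝ) * (s - 1) / 4) • kin (trA h)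
    + ((s : ℝ) * (s - 1) * (s - 2) / 8) • contr (divA (trA h)) (divA (trA h))

/-- The Lagrangian of the dual field `T_{b₁…b_{n-3}|a₂…a_s}`. -/
def dualLagrangian (s : ℕ) (T : Ten n (n - 3) (s - 1)) : (Fin n → ℝ) → ℝ :=
  (-(2 * ((s : ℝ) - 1)) / (s * ((n - 3).factorial : ℝ))) •
    (kin T - ((n : ℝ) - 3) • contr (divB T) (divB T)
      + ((s : ℝ) - 1) • (-contr (divA T) (divA T)
        - (2 * ((n : ℝ) - 3)) • contr (trM T) (divA (divB T))
        - ((s : ℝ) - 2) • contr (trA T) (divA (divA T))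
        - ((n : ℝ) - 3) • kin (trM T)
        - (((s : ℝ) - 2) / 2) • kin (trA T)
        + (((n : ℝ) - 3) * ((n : ℝ) - 4)) • contr (divB (trM T)) (divB (trM T))
        - (((s : ℝ) - 2) * ((n : ℝ) - 3)) • contr (divA (trM T)) (divB (trA T))
        + (((s : ℝ) - 2) * ((n : ℝ) - 3) / 4) • contr (divB (trA T)) (divB (trA T))
        - (((s : ℝ) - 2) * ((s : ℝ) - 3) / 4) • contr (divA (trA T)) (divA (trA T))))

/-! ### Dual field and gauge transformations -/

/-- The field `T` is the dual of the potential `Y_{λμν|a}`: one has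
`Y^{λμν|}_{a₁…} = X^{λμν|}_{a₁…} + δ^{[λ}_{(a₁} Z^{μν]|}_{a₂…)}` with `X` and `Z` free of mixed
traces, and `X^{λμν|}_a = (1/(n-3)!) ε^{λμν b₁…b_{n-3}} T_{b₁…b_{n-3}|a}`. -/
def IsDualTo (s : ℕ) (Y : Ten n 3 (s - 1)) (T : Ten n (n - 3) (s - 1)) : Prop :=
  ∃ (X : Ten n 3 (s - 1)) (Z : Ten n 2 (s - 1 - 1)),
    IsBiSym X ∧ trM X = 0 ∧ IsBiSym Z ∧ trM Z = 0 ∧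
    Y = X + asym (sym (etaMix Z)) ∧
    X = (1 / ((n - 3).factorial : ℝ)) • epsDual T

/-- `δ^{[λ}_{(a₁} α^{μ|ν]}_{a₂…a_{s-1})}`. -/
def shift (s : ℕ) (α : Ten n 1 (s - 1)) : Ten n 3 (s - 1) :=
  asym (sym (etaMix (pull α)))

/-- The gauge variation of the dual field,
`∂_{[b₁}φ_{b₂…b_{n-3}]|a₂…a_s}
  + ((s-1)(n-2)/(n+s-4)) ∂_f φ_{c₁…c_{n-4}|g a₃…a_s} δ^{[fgc₁…c_{n-4}]}_{[a₂b₁…b_{n-3}]}`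
symmetrized in the `a`'s; the last contraction is `-∂_{[b₁}φ_{b₂…b_{n-3}|a₂]a₃…a_s}`. -/
def dualGauge (s : ℕ) (φ : Ten n (n - 4) (s - 1)) : Ten n (n - 3) (s - 1) :=
  let D : Ten n (n - 3) (s - 1) := asym (grad φ)
  sym (D - (((s : ℝ) - 1) * ((n : ℝ) - 2) / ((n : ℝ) + s - 4)) • unpull (asym (pull D)))

/-- The gauge variation `∂_{(μ₁} ξ_{μ₂…μ_s)}` of a Fronsdal field. -/
def fronsdalGauge (s : ℕ) (ξ : Ten n 0 (s - 1)) : Ten n 0 s := symPart s (grad ξ)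

/-- Curtright's Lagrangian in five dimensions for `T_{bc|d}`:
`-½ [∂^a T^{bc|d}∂_a T_{bc|d} - 2 ∂_a T^{ab|c}∂^d T_{db|c} - ∂_a T^{bc|a}∂^d T_{bc|d}
  - 4 T_a^{b|a}∂^{cd}T_{cb|d} - 2 ∂_a T_b^{c|b}∂^a T^d_{c|d} + 2 ∂_a T_b^{a|b}∂^c T^d_{c|d}]`. -/
def curtrightLagrangian (T : Ten 5 2 1) : (Fin 5 → ℝ) → ℝ :=
  let t : Fin 5 → Fin 5 → Fin 5 → (Fin 5 → ℝ) → ℝ := fun b c d => T ![b, c] ![d]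
  fun x => -(1 / 2) * ∑ a, ∑ b, ∑ c, ∑ d, eta a * eta b * eta c * eta d *
    (pd a (t b c d) x * pd a (t b c d) x
      - 2 * (pd a (t a b c) x * pd d (t d b c) x)
      - pd a (t b c a) x * pd d (t b c d) x
      - 4 * (t a b a x * pd c (pd d (t c b d)) x)
      - 2 * (pd a (t b c b) x * pd a (t d c d) x)
      + 2 * (pd a (t b a b) x * pd c (t d c d) x))

end

end SpinDuality

open SpinDuality

set_option linter.unusedSimpArgs false
set_option linter.unnecessarySeqFocus false

namespace SpinDuality

noncomputable section

/-! ### Smooth scalars -/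

/-! All tensor fields are treated at once, as vectors of a Fock space. An index of the first,
antisymmetric group is created by a fermionic operator `th c` and removed by `d c`; an index of the
second, symmetric group is created by a bosonic operator `u c` and removed by `D c`. Traces,
metrics, divergences, gradients and the operators that move an index from one group to the other are
bilinear in these operators and the derivatives. Their commutators and anticommutators close, so a
tensor identity becomes normal ordering followed by a comparison of coefficients. The combinatorial
factors of unit-weight symmetrization are absorbed once and for all in the translation `ev` and in
the pairing `pair`. For this pairing `opS` and `opR`, `opM` and `opM'`, `opA` and `opA'` are
adjoint, and after integration divergences are minus the adjoints of gradients.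

In this language the parent Lagrangian is `(s-1)! (2⟨Y, Gb e⟩ - ⟨Y, xF Y⟩)`, where `xF` is symmetric
and inverse to the map `yF : B ↦ Y` on traceless fields (`vasiliev_ev`, `parent_ev`, `xF_yF`,
`yF_xF`). Stationarity in `Y` says `xF Y = Gb e`, and the value of the Lagrangian there is `(s-1)!
⟨Gb e, yF (Gb e)⟩`. By `Db_yF_Gb` the operator `Db yF Gb` is the Fronsdal operator placed between
`opR` and `opS`, up to the image of `opA'`, which a traceless `e` does not see; hence only the
symmetric part of `e` survives. Stationarity in `e` says `Db Y = 0`. This is solved by a Poincaré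
lemma for divergences, carried out one coordinate at a time, in a version for all smooth fields and
a version with compact support (`exists_opDb_eq`, `exists_opDb_eq_cs`).

A potential `f` splits into a part `xPart f` free of mixed traces and a multiple of the mixed
metric. The Hodge operator exchanges `opM` with `opR` and `opDb` with `opGb`, so that absence of
mixed traces turns into the Young symmetry of `T = star (xPart f)`, and tracelessness of `f` into
the double-trace conditions (`isDualField_dualF`, `potF_spec`). The potentials with `T = 0` are
exactly the `α`-shifts (`exists_hook`); a shift changes `xF (Db f)` only by a gradient (`Db_shift`),
which is orthogonal to divergences. The parent action at `Y = Db f` therefore depends on `T` alone,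
and `pair_dualOp` computes it on a convenient potential. The gauge symmetry of `T` is the image of
`f ↦ f + Db ψ`, which leaves `Db f` unchanged.

In four dimensions dual fields have the form `opR h` with `h` a Fronsdal field, and the dual
Lagrangian is evaluated on them. For spin two in five dimensions the comparison with Curtright's
theory is made in components. -/

/-- Smooth real functions on `ℝⁿ`. -/
def smoothSubmodule (n : ℕ) : Submodule ℝ ((Fin n → ℝ) → ℝ) where
  carrier := {f | ContDiff ℝ ∞ f}
  add_mem' {f g} hf hg := by
    have hf : ContDiff ℝ ∞ f := hf
    have hg : ContDiff ℝ ∞ g := hg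
    exact hf.add hg
  zero_mem' := (contDiff_const : ContDiff ℝ ∞ fun _ : Fin n → ℝ => (0 : ℝ))
  smul_mem' c f hf := by
    have hf : ContDiff ℝ ∞ f := hf
    exact contDiff_const.smul hf

/-- The space of smooth real functions on `ℝⁿ`. -/
def Sm (n : ℕ) : Type := smoothSubmodule n

instance (n : ℕ) : AddCommGroup (Sm n) := inferInstanceAs (AddCommGroup (smoothSubmodule n))

instance (n : ℕ) : Module ℝ (Sm n) := inferInstanceAs (Module ℝ (smoothSubmodule n))

@[ext] lemma Sm.ext {n : ℕ} {f g : Sm n} (h : ∀ x, f.1 x = g.1 x) : f = g :=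
  Subtype.ext (funext h)

@[simp] lemma Sm.coe_add {n : ℕ} (f g : Sm n) (x) : (f + g).1 x = f.1 x + g.1 x := rfl
@[simp] lemma Sm.coe_sub {n : ℕ} (f g : Sm n) (x) : (f - g).1 x = f.1 x - g.1 x := rfl
@[simp] lemma Sm.coe_neg {n : ℕ} (f : Sm n) (x) : (-f).1 x = -f.1 x := rfl
@[simp] lemma Sm.coe_zero {n : ℕ} (x : Fin n → ℝ) : (0 : Sm n).1 x = 0 := rfl
@[simp] lemma Sm.coe_smul {n : ℕ} (c : ℝ) (f : Sm n) (x) : (c • f).1 x = c * f.1 x := rfl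

lemma Sm.smooth {n : ℕ} (f : Sm n) : ContDiff ℝ ∞ f.1 := f.2

@[simp] lemma Sm.coe_sum {n : ℕ} {ι : Type*} (s : Finset ι) (f : ι → Sm n) (x : Fin n → ℝ) :
    (∑ i ∈ s, f i : Sm n).1 x = ∑ i ∈ s, (f i).1 x := by
  induction s using Finset.cons_induction with
  | empty => rfl
  | cons i s hi ih => rw [Finset.sum_cons, Finset.sum_cons, ← ih]; rfl

lemma contDiff_pd {n : ℕ} (μ : Fin n) {f : (Fin n → ℝ) → ℝ} (hf : ContDiff ℝ ∞ f) :
    ContDiff ℝ ∞ (pd μ f) :=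
  (hf.fderiv_right (m := ∞) (by norm_cast)).clm_apply contDiff_const

lemma Sm.differentiable {n : ℕ} (f : Sm n) : Differentiable ℝ f.1 :=
  f.smooth.differentiable (by simp)

/-- The partial derivative on smooth functions. -/
def pdS {n : ℕ} (μ : Fin n) : Sm n →ₗ[ℝ] Sm n where
  toFun f := ⟨pd μ f.1, contDiff_pd μ f.2⟩
  map_add' f g := by
    ext x
    change fderiv ℝ (f.1 + g.1) x _ = _
    rw [fderiv_add (f.differentiable x) (g.differentiable x)]
    rfl
  map_smul' c f := by
    ext x
    change fderiv ℝ (c • f.1) x _ = _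
    rw [fderiv_const_smul (f.differentiable x)]
    rfl

lemma pdS_comm {n : ℕ} (μ ν : Fin n) (f : Sm n) : pdS μ (pdS ν f) = pdS ν (pdS μ f) := by
  ext x
  have hd : DifferentiableAt ℝ (fderiv ℝ f.1) x :=
    (f.smooth.fderiv_right (m := ∞) (by norm_cast)).differentiable (by simp) x
  have h (a b : Fin n) : pd a (pd b f.1) x
      = fderiv ℝ (fderiv ℝ f.1) x (Pi.single a 1) (Pi.single b 1) := by
    have : pd b f.1 = fun y => fderiv ℝ f.1 y (Pi.single b 1) := rfl
    rw [this, pd, fderiv_clm_apply hd (by fun_prop)]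
    simp
  have hs : IsSymmSndFDerivAt ℝ f.1 x :=
    (f.smooth.contDiffAt).isSymmSndFDerivAt (by rw [minSmoothness_of_isRCLikeNormedField]; exact WithTop.coe_le_coe.2 le_top)
  change pd μ (pd ν f.1) x = pd ν (pd μ f.1) x
  rw [h, h]
  exact hs _ _

/-! ### Families of tensors -/

variable {n : ℕ}

/-- Families of tensors of all ranks. -/
abbrev Fam (n : ℕ) : Type := ∀ p q : ℕ, (Fin p → Fin n) → (Fin q → Fin n) → Sm n

lemma exists_cons {α : Type*} {k : ℕ} (a : Fin (k + 1) → α) :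
    ∃ x a', a = Matrix.vecCons x a' := ⟨a 0, Matrix.vecTail a, (Matrix.cons_head_tail a).symm⟩

/-- Symmetry of a family is imposed for adjacent transpositions only, as these generate the
symmetric group. A transposition that avoids the head acts on the tail, which permits inductions on
the number of indices. -/
lemma vecCons_comp_swap_succ {α : Type*} {k : ℕ} (x : α) (a : Fin (k + 1) → α) (i : Fin k) :
    Matrix.vecCons x a ∘ Equiv.swap i.succ.castSucc i.succ.succ
      = Matrix.vecCons x (a ∘ Equiv.swap i.castSucc i.succ) := by
  funext j
  refine Fin.cases ?_ (fun j => ?_) j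
  · rw [Function.comp_apply, Equiv.swap_apply_of_ne_of_ne] <;> simp [Fin.ext_iff]
  · simp only [Function.comp_apply, Matrix.cons_val_succ, Equiv.swap_apply_def, ← Fin.succ_castSucc,
      Fin.succ_inj]
    split_ifs <;> simp

lemma vecCons_comp_swap_zero {α : Type*} {k : ℕ} (x y : α) (a : Fin k → α) :
    Matrix.vecCons x (Matrix.vecCons y a)
      ∘ Equiv.swap (Fin.castSucc (0 : Fin (k + 1))) (Fin.succ (0 : Fin (k + 1)))
      = Matrix.vecCons y (Matrix.vecCons x a) := by
  funext j
  refine Fin.cases ?_ (fun j => ?_) j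
  · simp
  · refine Fin.cases ?_ (fun j => ?_) j
    · simp
    · rw [Function.comp_apply, Equiv.swap_apply_of_ne_of_ne] <;> simp [Fin.ext_iff]

/-- Families of smooth tensors, antisymmetric in the first and symmetric in the second group of
indices, with finitely many non-zero members. -/
def fockSubmodule (n : ℕ) : Submodule ℝ (Fam n) where
  carrier := {f | (∀ p q (i : Fin p) b a,
      f (p + 1) q (b ∘ Equiv.swap i.castSucc i.succ) a = -f (p + 1) q b a) ∧
    (∀ p q (i : Fin q) b a, f p (q + 1) b (a ∘ Equiv.swap i.castSucc i.succ) = f p (q + 1) b a) ∧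
    -- Finitely many non-zero members make `pair` a finite sum and start the induction on the top
    -- degree in `fock_induction`.
    ∃ N, ∀ p q, N ≤ p ∨ N ≤ q → f p q = 0}
  add_mem' := by
    rintro f g ⟨hf, hf', N, hN⟩ ⟨hg, hg', N', hN'⟩
    refine ⟨fun p q i b a => ?_, fun p q i b a => ?_, max N N', fun p q h => ?_⟩
    · simp only [Pi.add_apply, hf, hg, neg_add]
    · simp only [Pi.add_apply, hf', hg']
    · simp only [Pi.add_apply, hN p q (by omega), hN' p q (by omega), add_zero]
  zero_mem' := ⟨by simp, by simp, 0, by simp⟩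
  smul_mem' := by
    rintro c f ⟨hf, hf', N, hN⟩
    refine ⟨fun p q i b a => ?_, fun p q i b a => ?_, N, fun p q h => ?_⟩
    · simp only [Pi.smul_apply, hf, smul_neg]
    · simp only [Pi.smul_apply, hf']
    · simp only [Pi.smul_apply, hN p q h, smul_zero]

/-- The space of families of tensor fields. -/
def Fock (n : ℕ) : Type := fockSubmodule n

instance : AddCommGroup (Fock n) := inferInstanceAs (AddCommGroup (fockSubmodule n))

instance : Module ℝ (Fock n) := inferInstanceAs (Module ℝ (fockSubmodule n))

lemma fock_anti (f : Fock n) {p q : ℕ} (x y : Fin n) (b : Fin p → Fin n) (a : Fin q → Fin n) :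
    f.1 (p + 2) q (Matrix.vecCons x (Matrix.vecCons y b)) a
      = -f.1 (p + 2) q (Matrix.vecCons y (Matrix.vecCons x b)) a := by
  rw [← f.2.1 (p + 1) q 0, vecCons_comp_swap_zero]

lemma fock_symm (f : Fock n) {p q : ℕ} (x y : Fin n) (b : Fin p → Fin n) (a : Fin q → Fin n) :
    f.1 p (q + 2) b (Matrix.vecCons x (Matrix.vecCons y a))
      = f.1 p (q + 2) b (Matrix.vecCons y (Matrix.vecCons x a)) := by
  rw [← f.2.2.1 p (q + 1) 0, vecCons_comp_swap_zero]

@[ext] lemma Fock.ext {f g : Fock n} (h : ∀ p q b a, f.1 p q b a = g.1 p q b a) : f = g :=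
  Subtype.ext (by funext p q b a; exact h p q b a)

@[simp] lemma Fock.add_val (f g : Fock n) (p q b a) :
    (f + g).1 p q b a = f.1 p q b a + g.1 p q b a := rfl
@[simp] lemma Fock.sub_val (f g : Fock n) (p q b a) :
    (f - g).1 p q b a = f.1 p q b a - g.1 p q b a := rfl
@[simp] lemma Fock.neg_val (f : Fock n) (p q b a) : (-f).1 p q b a = -f.1 p q b a := rfl
@[simp] lemma Fock.smul_val (c : ℝ) (f : Fock n) (p q b a) :
    (c • f).1 p q b a = c • f.1 p q b a := rfl
@[simp] lemma Fock.zero_val (p q b a) : (0 : Fock n).1 p q b a = 0 := rfl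
@[simp] lemma Fock.sum_val {ι : Type*} (s : Finset ι) (f : ι → Fock n) (p q b a) :
    (∑ i ∈ s, f i).1 p q b a = ∑ i ∈ s, (f i).1 p q b a := by
  induction s using Finset.cons_induction with
  | empty => rfl
  | cons i s hi ih => rw [Finset.sum_cons, Finset.sum_cons, Fock.add_val, ih]

/-! ### Elementary operators -/

/-- Insertion of an index in the second group. -/
def uRaw (c : Fin n) (f : Fam n) : Fam n := fun p q b =>
  match q with
  | 0 => fun _ => 0
  | q + 1 => fun a => ∑ i : Fin (q + 1), if a i = c then f p q b (a ∘ i.succAbove) else 0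

/-- Alternating insertion of an index in the first group. -/
def thRaw (c : Fin n) (f : Fam n) : Fam n := fun p q =>
  match p with
  | 0 => fun _ _ => 0
  | p + 1 => fun b a =>
      ∑ i : Fin (p + 1), if b i = c then (-1 : ℝ) ^ (i : ℕ) • f p q (b ∘ i.succAbove) a else 0

lemma vecCons_comp_succAbove_succ {α : Type*} {k : ℕ} (x : α) (a : Fin (k + 1) → α)
    (i : Fin (k + 1)) :
    Matrix.vecCons x a ∘ i.succ.succAbove = Matrix.vecCons x (a ∘ i.succAbove) := by
  funext j
  refine Fin.cases ?_ (fun j => ?_) j <;> simp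

lemma vecCons_comp_succAbove_zero {α : Type*} {k : ℕ} (x : α) (a : Fin k → α) :
    Matrix.vecCons x a ∘ (0 : Fin (k + 1)).succAbove = a := by
  funext j; simp

/-- The inserted index is either the head or lies in the tail. Read as a statement about removal of
the head, this recursion is the commutation relation `D_u`. -/
lemma uRaw_cons (c x : Fin n) (f : Fam n) (p q : ℕ) (b : Fin p → Fin n) (a : Fin q → Fin n) :
    uRaw c f p (q + 1) b (Matrix.vecCons x a) = (if x = c then f p q b a else 0)
      + uRaw c (fun p q b a => f p (q + 1) b (Matrix.vecCons x a)) p q b a := by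
  cases q with
  | zero =>
    have : Matrix.vecCons x a ∘ Fin.succ = a := vecCons_comp_succAbove_zero x a
    simp [uRaw, this]
  | succ q =>
    simp only [uRaw]
    rw [Fin.sum_univ_succ, vecCons_comp_succAbove_zero]
    simp only [Matrix.cons_val_zero, Matrix.cons_val_succ, vecCons_comp_succAbove_succ]
    rfl

/-- Passing over the head costs one sign in the alternating sum; the recursion is the
anticommutation relation `d_th`. -/
lemma thRaw_cons (c x : Fin n) (f : Fam n) (p q : ℕ) (b : Fin p → Fin n) (a : Fin q → Fin n) :
    thRaw c f (p + 1) q (Matrix.vecCons x b) a = (if x = c then f p q b a else 0)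
      - thRaw c (fun p q b a => f (p + 1) q (Matrix.vecCons x b) a) p q b a := by
  cases p with
  | zero =>
    have : Matrix.vecCons x b ∘ Fin.succ = b := vecCons_comp_succAbove_zero x b
    simp [thRaw, this]
  | succ p =>
    simp only [thRaw]
    rw [Fin.sum_univ_succ, vecCons_comp_succAbove_zero, sub_eq_add_neg, ← Finset.sum_neg_distrib]
    simp only [Matrix.cons_val_zero, Matrix.cons_val_succ, vecCons_comp_succAbove_succ,
      Fin.val_zero, pow_zero, one_smul, Fin.val_succ, pow_succ, mul_neg, mul_one, neg_smul]
    congr 1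
    refine Finset.sum_congr rfl fun i _ => ?_
    split_ifs
    · rfl
    · exact neg_zero.symm

lemma uRaw_add (c : Fin n) (f g : Fam n) : uRaw c (f + g) = uRaw c f + uRaw c g := by
  funext p q b a
  cases q with
  | zero => simp [uRaw]
  | succ q =>
    simp only [uRaw, Pi.add_apply, ← Finset.sum_add_distrib]
    exact Finset.sum_congr rfl fun i _ => by split_ifs <;> simp

lemma uRaw_smul (c : Fin n) (r : ℝ) (f : Fam n) : uRaw c (r • f) = r • uRaw c f := by
  funext p q b a
  cases q with
  | zero => simp [uRaw]
  | succ q =>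
    simp only [uRaw, Pi.smul_apply, Finset.smul_sum]
    exact Finset.sum_congr rfl fun i _ => by split_ifs <;> simp

lemma thRaw_add (c : Fin n) (f g : Fam n) : thRaw c (f + g) = thRaw c f + thRaw c g := by
  funext p q b a
  cases p with
  | zero => simp [thRaw]
  | succ p =>
    simp only [thRaw, Pi.add_apply, ← Finset.sum_add_distrib]
    exact Finset.sum_congr rfl fun i _ => by split_ifs <;> simp

lemma thRaw_smul (c : Fin n) (r : ℝ) (f : Fam n) : thRaw c (r • f) = r • thRaw c f := by
  funext p q b a
  cases p with
  | zero => simp [thRaw]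
  | succ p =>
    simp only [thRaw, Pi.smul_apply, Finset.smul_sum]
    exact Finset.sum_congr rfl fun i _ => by split_ifs <;> simp [smul_comm r]

lemma uRaw_bound {f : Fam n} {N : ℕ} (h : ∀ p q, N ≤ p ∨ N ≤ q → f p q = 0) (c : Fin n) (p q : ℕ)
    (hpq : N + 1 ≤ p ∨ N + 1 ≤ q) : uRaw c f p q = 0 := by
  funext b a
  cases q with
  | zero => rfl
  | succ q => simp [uRaw, h p q (by omega)]

lemma thRaw_bound {f : Fam n} {N : ℕ} (h : ∀ p q, N ≤ p ∨ N ≤ q → f p q = 0) (c : Fin n) (p q : ℕ)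
    (hpq : N + 1 ≤ p ∨ N + 1 ≤ q) : thRaw c f p q = 0 := by
  funext b a
  cases p with
  | zero => rfl
  | succ p => simp [thRaw, h p q (by omega)]

/-- Induction on the number of indices. The exchange of the first two is visible after applying
`uRaw_cons` twice; any other adjacent exchange acts on the tail. -/
lemma uRaw_symm (c : Fin n) : ∀ (q : ℕ) (f : Fam n)
    (_ : ∀ p q (i : Fin q) b a, f p (q + 1) b (a ∘ Equiv.swap i.castSucc i.succ) = f p (q + 1) b a)
    (p : ℕ) (i : Fin q) (b) (a : Fin (q + 1) → Fin n),
    uRaw c f p (q + 1) b (a ∘ Equiv.swap i.castSucc i.succ) = uRaw c f p (q + 1) b a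
  | 0, _, _, _, i, _, _ => i.elim0
  | q + 1, f, hf, p, i, b, a => by
    obtain ⟨x, a, rfl⟩ := exists_cons a
    refine Fin.cases ?_ (fun i => ?_) i
    · obtain ⟨y, a, rfl⟩ := exists_cons a
      rw [vecCons_comp_swap_zero]
      have h2 : (fun p q b a => f p (q + 1 + 1) b (Matrix.vecCons y (Matrix.vecCons x a)))
          = (fun p q b a => f p (q + 1 + 1) b (Matrix.vecCons x (Matrix.vecCons y a))) := by
        funext p q b a
        rw [← hf p (q + 1) 0, vecCons_comp_swap_zero]
      simp only [uRaw_cons, h2]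
      abel
    · rw [vecCons_comp_swap_succ, uRaw_cons, uRaw_cons]
      rw [uRaw_symm c q _ (fun p q i b a => ?_), hf]
      rw [← vecCons_comp_swap_succ, hf]

lemma thRaw_anti (c : Fin n) : ∀ (p : ℕ) (f : Fam n)
    (_ : ∀ p q (i : Fin p) b a, f (p + 1) q (b ∘ Equiv.swap i.castSucc i.succ) a
      = -f (p + 1) q b a)
    (q : ℕ) (i : Fin p) (b : Fin (p + 1) → Fin n) (a),
    thRaw c f (p + 1) q (b ∘ Equiv.swap i.castSucc i.succ) a = -thRaw c f (p + 1) q b a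
  | 0, _, _, _, i, _, _ => i.elim0
  | p + 1, f, hf, q, i, b, a => by
    obtain ⟨x, b, rfl⟩ := exists_cons b
    refine Fin.cases ?_ (fun i => ?_) i
    · obtain ⟨y, b, rfl⟩ := exists_cons b
      rw [vecCons_comp_swap_zero]
      have h2 : (fun p q b a => f (p + 1 + 1) q (Matrix.vecCons y (Matrix.vecCons x b)) a)
          = -(fun p q b a => f (p + 1 + 1) q (Matrix.vecCons x (Matrix.vecCons y b)) a) := by
        funext p q b a
        change _ = -_
        rw [← hf (p + 1) q 0, vecCons_comp_swap_zero]
      have h3 (g : Fam n) : thRaw c (-g) p q b a = -thRaw c g p q b a := by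
        cases p with
        | zero => simp [thRaw]
        | succ p =>
          simp only [thRaw, Pi.neg_apply, smul_neg, ← Finset.sum_neg_distrib]
          exact Finset.sum_congr rfl fun i _ => by split_ifs <;> simp
      simp only [thRaw_cons, h2, h3]
      abel
    · rw [vecCons_comp_swap_succ, thRaw_cons, thRaw_cons]
      rw [thRaw_anti c p _ (fun p q i b a => ?_), hf]
      · split_ifs <;> simp <;> abel
      · rw [← vecCons_comp_swap_succ, hf]

/-- Removal of an index of the second group. -/
def D (c : Fin n) : Fock n →ₗ[ℝ] Fock n where
  toFun f := ⟨fun p q b a => f.1 p (q + 1) b (Matrix.vecCons c a), by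
    obtain ⟨f, h, h', N, hN⟩ := f
    refine ⟨fun p q i b a => h _ _ _ _ _, fun p q i b a => ?_, N, fun p q hpq => ?_⟩
    · change f _ _ _ (Matrix.vecCons c (a ∘ _)) = f _ _ _ _
      rw [← vecCons_comp_swap_succ, h']
    · funext b a; simp [hN p (q + 1) (by omega)]⟩
  map_add' _ _ := rfl
  map_smul' _ _ := rfl

/-- Removal of an index of the first group. -/
def d (c : Fin n) : Fock n →ₗ[ℝ] Fock n where
  toFun f := ⟨fun p q b a => f.1 (p + 1) q (Matrix.vecCons c b) a, by
    obtain ⟨f, h, h', N, hN⟩ := f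
    refine ⟨fun p q i b a => ?_, fun p q i b a => h' _ _ _ _ _, N, fun p q hpq => ?_⟩
    · change f _ _ (Matrix.vecCons c (b ∘ _)) _ = -f _ _ _ _
      rw [← vecCons_comp_swap_succ, h]
    · funext b a; simp [hN (p + 1) q (by omega)]⟩
  map_add' _ _ := rfl
  map_smul' _ _ := rfl

/-- Insertion of an index in the second group. -/
def u (c : Fin n) : Fock n →ₗ[ℝ] Fock n where
  toFun f := ⟨uRaw c f.1, by
    obtain ⟨f, h, h', N, hN⟩ := f
    refine ⟨fun p q i b a => ?_, fun p q i b a => uRaw_symm c q f h' p i b a, N + 1,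
      uRaw_bound hN c⟩
    cases q with
    | zero => simp [uRaw]
    | succ q =>
      simp only [uRaw, h, ← Finset.sum_neg_distrib]
      exact Finset.sum_congr rfl fun i _ => by split_ifs <;> simp⟩
  map_add' f g := Subtype.ext (uRaw_add c f.1 g.1)
  map_smul' r f := Subtype.ext (uRaw_smul c r f.1)

/-- Alternating insertion of an index in the first group. -/
def th (c : Fin n) : Fock n →ₗ[ℝ] Fock n where
  toFun f := ⟨thRaw c f.1, by
    obtain ⟨f, h, h', N, hN⟩ := f
    refine ⟨fun p q i b a => thRaw_anti c p f h q i b a, fun p q i b a => ?_, N + 1,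
      thRaw_bound hN c⟩
    cases p with
    | zero => simp [thRaw]
    | succ p => simp only [thRaw, h']⟩
  map_add' f g := Subtype.ext (thRaw_add c f.1 g.1)
  map_smul' r f := Subtype.ext (thRaw_smul c r f.1)

/-- The componentwise action of an operator on scalars. -/
def mapS (L : Sm n →ₗ[ℝ] Sm n) : Fock n →ₗ[ℝ] Fock n where
  toFun f := ⟨fun p q b a => L (f.1 p q b a), by
    obtain ⟨f, h, h', N, hN⟩ := f
    refine ⟨fun p q i b a => by simp only [h, map_neg], fun p q i b a => by simp only [h'],
      N, fun p q hpq => by funext b a; simp [hN p q hpq]⟩⟩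
  map_add' f g := Subtype.ext (by funext p q b a; exact map_add L _ _)
  map_smul' c f := Subtype.ext (by funext p q b a; exact map_smul L _ _)

/-- Partial derivatives of all components. -/
def del (c : Fin n) : Fock n →ₗ[ℝ] Fock n := mapS (pdS c)

@[simp] lemma D_val (c : Fin n) (f : Fock n) (p q b a) :
    (D c f).1 p q b a = f.1 p (q + 1) b (Matrix.vecCons c a) := rfl
@[simp] lemma d_val (c : Fin n) (f : Fock n) (p q b a) :
    (d c f).1 p q b a = f.1 (p + 1) q (Matrix.vecCons c b) a := rfl
@[simp] lemma mapS_val (L : Sm n →ₗ[ℝ] Sm n) (f : Fock n) (p q b a) :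
    (mapS L f).1 p q b a = L (f.1 p q b a) := rfl
@[simp] lemma u_zero (c : Fin n) (f : Fock n) (p b a) : (u c f).1 p 0 b a = 0 := rfl
@[simp] lemma th_zero (c : Fin n) (f : Fock n) (q b a) : (th c f).1 0 q b a = 0 := rfl
lemma u_succ (c : Fin n) (f : Fock n) (p q b a) : (u c f).1 p (q + 1) b a
    = ∑ i : Fin (q + 1), if a i = c then f.1 p q b (a ∘ i.succAbove) else 0 := rfl
lemma th_succ (c : Fin n) (f : Fock n) (p q b a) : (th c f).1 (p + 1) q b a
    = ∑ i : Fin (p + 1), if b i = c then (-1 : ℝ) ^ (i : ℕ) • f.1 p q (b ∘ i.succAbove) a else 0 :=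
  rfl

/-! ### Canonical commutation relations -/

/-- The Kronecker delta. -/
def kd (c e : Fin n) : ℝ := if c = e then 1 else 0

lemma D_u (c e : Fin n) (f : Fock n) : D c (u e f) = u e (D c f) + kd c e • f := by
  ext1 p q b a
  rw [D_val]
  change uRaw e f.1 p (q + 1) b _ = uRaw e _ p q b a + _
  rw [uRaw_cons, add_comm]
  congr 1
  simp only [kd, Fock.smul_val]
  split_ifs <;> simp

lemma d_th (c e : Fin n) (f : Fock n) : d c (th e f) = kd c e • f - th e (d c f) := by
  ext1 p q b a
  rw [d_val]
  change thRaw e f.1 (p + 1) q _ a = _ - thRaw e _ p q b a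
  rw [thRaw_cons]
  congr 1
  simp only [kd, Fock.smul_val]
  split_ifs <;> simp

lemma D_D (c e : Fin n) (f : Fock n) : D c (D e f) = D e (D c f) := by
  ext1 p q b a; exact fock_symm f _ _ _ _

lemma d_d (c e : Fin n) (f : Fock n) : d c (d e f) = -d e (d c f) := by
  ext1 p q b a; exact fock_anti f _ _ _ _

/-- The two groups of indices are independent slots, so bosonic and fermionic operators commute and
no sign arises between them. -/
lemma d_D (c e : Fin n) (f : Fock n) : d c (D e f) = D e (d c f) := rfl

lemma d_u (c e : Fin n) (f : Fock n) : d c (u e f) = u e (d c f) := by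
  ext1 p q b a; cases q <;> rfl

lemma D_th (c e : Fin n) (f : Fock n) : D c (th e f) = th e (D c f) := by
  ext1 p q b a; cases p <;> rfl

lemma mapS_D (L : Sm n →ₗ[ℝ] Sm n) (e : Fin n) (f : Fock n) : mapS L (D e f) = D e (mapS L f) :=
  rfl

lemma mapS_d (L : Sm n →ₗ[ℝ] Sm n) (e : Fin n) (f : Fock n) : mapS L (d e f) = d e (mapS L f) :=
  rfl

lemma mapS_u (L : Sm n →ₗ[ℝ] Sm n) (e : Fin n) (f : Fock n) : mapS L (u e f) = u e (mapS L f) := by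
  ext1 p q b a
  cases q with
  | zero => simp
  | succ q => simp [u_succ, apply_ite L]

lemma mapS_th (L : Sm n →ₗ[ℝ] Sm n) (e : Fin n) (f : Fock n) :
    mapS L (th e f) = th e (mapS L f) := by
  ext1 p q b a
  cases p with
  | zero => simp
  | succ p => simp [th_succ, apply_ite L]

lemma del_del (c e : Fin n) (f : Fock n) : del c (del e f) = del e (del c f) := by
  ext1 p q b a; exact pdS_comm _ _ _

lemma del_D (c e : Fin n) (f : Fock n) : del c (D e f) = D e (del c f) := rfl
lemma del_d (c e : Fin n) (f : Fock n) : del c (d e f) = d e (del c f) := rfl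
lemma del_u (c e : Fin n) (f : Fock n) : del c (u e f) = u e (del c f) := mapS_u _ _ _
lemma del_th (c e : Fin n) (f : Fock n) : del c (th e f) = th e (del c f) := mapS_th _ _ _

/-- Relations among creation operators alone are proved by removing an index: after applying every
`D x` (or `d x`), the mixed relations reduce the claim to one index fewer. -/
lemma ext_D_aux {f g : Fock n} {p q : ℕ} (h : ∀ x b a, (D x f).1 p q b a = (D x g).1 p q b a)
    (b a) : f.1 p (q + 1) b a = g.1 p (q + 1) b a := by
  obtain ⟨x, a, rfl⟩ := exists_cons a
  exact h x b a

lemma ext_d_aux {f g : Fock n} {p q : ℕ} (h : ∀ x b a, (d x f).1 p q b a = (d x g).1 p q b a)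
    (b a) : f.1 (p + 1) q b a = g.1 (p + 1) q b a := by
  obtain ⟨x, b, rfl⟩ := exists_cons b
  exact h x b a

lemma u_u (c e : Fin n) (f : Fock n) : u c (u e f) = u e (u c f) := by
  ext1 p q b a
  induction q generalizing f b with
  | zero => rfl
  | succ q ih =>
    refine ext_D_aux (fun x b a => ?_) b a
    simp only [D_u, map_add, map_smul, Fock.add_val, Fock.smul_val, ih]
    abel

lemma th_th (c e : Fin n) (f : Fock n) : th c (th e f) = -th e (th c f) := by
  ext1 p q b a
  induction p generalizing f a with
  | zero => exact neg_zero.symm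
  | succ p ih =>
    refine ext_d_aux (fun x b a => ?_) b a
    simp only [d_th, map_sub, map_neg, map_smul, Fock.sub_val, Fock.smul_val, Fock.neg_val, ih]
    abel

lemma u_th (c e : Fin n) (f : Fock n) : u c (th e f) = th e (u c f) := by
  ext1 p q b a
  induction q generalizing f b with
  | zero => cases p <;> simp [th_succ]
  | succ q ih =>
    refine ext_D_aux (fun x b a => ?_) b a
    simp only [D_u, D_th, map_add, map_smul, Fock.add_val, Fock.smul_val, ih]

end

end SpinDuality

namespace SpinDuality

noncomputable section

variable {n : ℕ}

/-! ### Quadratic operators -/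

lemma eta_mul_self (c : Fin n) : eta c * eta c = 1 := by
  unfold eta; split_ifs <;> norm_num

/-- Trace in the second group of indices. -/
def opA : Fock n →ₗ[ℝ] Fock n := ∑ c, eta c • (D c ∘ₗ D c)
/-- Mixed trace. -/
def opM : Fock n →ₗ[ℝ] Fock n := ∑ c, eta c • (d c ∘ₗ D c)
/-- Multiplication by the metric in the second group of indices. -/
def opA' : Fock n →ₗ[ℝ] Fock n := ∑ c, eta c • (u c ∘ₗ u c)
/-- Mixed multiplication by the metric. -/
def opM' : Fock n →ₗ[ℝ] Fock n := ∑ c, eta c • (th c ∘ₗ u c)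
/-- Divergence on the first group. -/
def opDb : Fock n →ₗ[ℝ] Fock n := ∑ c, eta c • (d c ∘ₗ del c)
/-- Divergence on the second group. -/
def opDa : Fock n →ₗ[ℝ] Fock n := ∑ c, eta c • (D c ∘ₗ del c)
/-- Antisymmetrized gradient. -/
def opGb : Fock n →ₗ[ℝ] Fock n := ∑ c, (th c ∘ₗ del c)
/-- Symmetrized gradient. -/
def opGa : Fock n →ₗ[ℝ] Fock n := ∑ c, (u c ∘ₗ del c)
/-- Symmetrization of an index of the first group with the second group. -/
def opS : Fock n →ₗ[ℝ] Fock n := ∑ c, (u c ∘ₗ d c)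
/-- Antisymmetrization of an index of the second group with the first group. -/
def opR : Fock n →ₗ[ℝ] Fock n := ∑ c, (th c ∘ₗ D c)
/-- Number of indices in the first group. -/
def opP : Fock n →ₗ[ℝ] Fock n := ∑ c, (th c ∘ₗ d c)
/-- Number of indices in the second group. -/
def opQ : Fock n →ₗ[ℝ] Fock n := ∑ c, (u c ∘ₗ D c)
/-- The wave operator. -/
def box : Fock n →ₗ[ℝ] Fock n := ∑ c, eta c • (del c ∘ₗ del c)

section
variable (f : Fock n)
lemma opA_apply : opA f = ∑ c, eta c • D c (D c f) := by simp [opA]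
lemma opM_apply : opM f = ∑ c, eta c • d c (D c f) := by simp [opM]
lemma opA'_apply : opA' f = ∑ c, eta c • u c (u c f) := by simp [opA']
lemma opM'_apply : opM' f = ∑ c, eta c • th c (u c f) := by simp [opM']
lemma opDb_apply : opDb f = ∑ c, eta c • d c (del c f) := by simp [opDb]
lemma opDa_apply : opDa f = ∑ c, eta c • D c (del c f) := by simp [opDa]
lemma opGb_apply : opGb f = ∑ c, th c (del c f) := by simp [opGb]
lemma opGa_apply : opGa f = ∑ c, u c (del c f) := by simp [opGa]
lemma opS_apply : opS f = ∑ c, u c (d c f) := by simp [opS]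
lemma opR_apply : opR f = ∑ c, th c (D c f) := by simp [opR]
lemma opP_apply : opP f = ∑ c, th c (d c f) := by simp [opP]
lemma opQ_apply : opQ f = ∑ c, u c (D c f) := by simp [opQ]
lemma box_apply : box f = ∑ c, eta c • del c (del c f) := by simp [box]
end

lemma sum_kd_smul (c : Fin n) (F : Fin n → Fock n) : ∑ e, kd c e • F e = F c := by
  simp [kd, ite_smul]

lemma sum_kd_smul' (c : Fin n) (F : Fin n → Fock n) : ∑ e, kd e c • F e = F c := by
  simp [kd, ite_smul]

lemma sum_eta_kd_smul' (c : Fin n) (F : Fin n → Fock n) :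
    ∑ e, eta e • kd e c • F e = eta c • F c := by
  simp [kd, ite_smul]

/-! ### Commutators of the quadratic operators with the elementary ones. -/

section elementary

variable (c : Fin n) (f : Fock n)

lemma D_S : D c (opS f) = opS (D c f) + d c f := by
  simp only [opS_apply, map_sum, D_u, ← d_D, Finset.sum_add_distrib, sum_kd_smul]
lemma D_R : D c (opR f) = opR (D c f) := by
  simp only [opR_apply, map_sum, D_th, D_D c]
lemma D_A : D c (opA f) = opA (D c f) := by
  simp only [opA_apply, map_sum, map_smul, D_D c]
lemma D_M : D c (opM f) = opM (D c f) := by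
  simp only [opM_apply, map_sum, map_smul, ← d_D, D_D c]
lemma D_Db : D c (opDb f) = opDb (D c f) := by
  simp only [opDb_apply, map_sum, map_smul, ← d_D, del_D]
lemma D_Q : D c (opQ f) = opQ (D c f) + D c f := by
  simp only [opQ_apply, map_sum, D_u, D_D c, Finset.sum_add_distrib, sum_kd_smul]
lemma D_P : D c (opP f) = opP (D c f) := by
  simp only [opP_apply, map_sum, D_th, d_D]

lemma d_S : d c (opS f) = -opS (d c f) := by
  simp only [opS_apply, map_sum, d_u, d_d c, map_neg, Finset.sum_neg_distrib]
lemma d_R : d c (opR f) = D c f - opR (d c f) := by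
  simp only [opR_apply, map_sum, d_th, Finset.sum_sub_distrib, sum_kd_smul, d_D]
lemma d_A : d c (opA f) = opA (d c f) := by
  simp only [opA_apply, map_sum, map_smul, d_D]
lemma d_M : d c (opM f) = -opM (d c f) := by
  simp only [opM_apply, map_sum, map_smul, d_d c, d_D, map_neg, smul_neg,
    Finset.sum_neg_distrib]
lemma d_Db : d c (opDb f) = -opDb (d c f) := by
  simp only [opDb_apply, map_sum, map_smul, d_d c, del_d, smul_neg, Finset.sum_neg_distrib]
lemma d_P : d c (opP f) = opP (d c f) + d c f := by
  simp only [opP_apply, map_sum, d_th, d_d c, map_neg, sub_neg_eq_add, Finset.sum_add_distrib,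
    sum_kd_smul]
  abel
lemma d_Q : d c (opQ f) = opQ (d c f) := by
  simp only [opQ_apply, map_sum, d_u, d_D]

lemma A_u : opA (u c f) = u c (opA f) + (2 * eta c) • D c f := by
  simp only [opA_apply, map_sum, map_smul, D_u, map_add, smul_add, Finset.sum_add_distrib,
    sum_eta_kd_smul', mul_smul, two_smul]
  abel
lemma M_u : opM (u c f) = u c (opM f) + eta c • d c f := by
  simp only [opM_apply, map_sum, map_smul, D_u, d_u, map_add, smul_add, Finset.sum_add_distrib,
    sum_eta_kd_smul']
lemma R_u : opR (u c f) = u c (opR f) + th c f := by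
  simp only [opR_apply, map_sum, D_u, map_add, map_smul, Finset.sum_add_distrib, sum_kd_smul', u_th]
lemma S_u : opS (u c f) = u c (opS f) := by
  simp only [opS_apply, map_sum, d_u, u_u c]
lemma Da_u : opDa (u c f) = u c (opDa f) + eta c • del c f := by
  simp only [opDa_apply, map_sum, map_smul, D_u, del_u, map_add, smul_add, Finset.sum_add_distrib,
    sum_eta_kd_smul']
lemma Db_u : opDb (u c f) = u c (opDb f) := by
  simp only [opDb_apply, map_sum, map_smul, d_u, del_u]
lemma Ga_u : opGa (u c f) = u c (opGa f) := by
  simp only [opGa_apply, map_sum, del_u, u_u c]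
lemma Gb_u : opGb (u c f) = u c (opGb f) := by
  simp only [opGb_apply, map_sum, del_u, u_th]
lemma M'_u : opM' (u c f) = u c (opM' f) := by
  simp only [opM'_apply, map_sum, map_smul, u_th, u_u c]

lemma A_th : opA (th c f) = th c (opA f) := by
  simp only [opA_apply, map_sum, map_smul, D_th]
lemma M_th : opM (th c f) = eta c • D c f - th c (opM f) := by
  simp only [opM_apply, map_sum, map_smul, D_th, d_th, smul_sub, Finset.sum_sub_distrib,
    sum_eta_kd_smul']
lemma R_th : opR (th c f) = -th c (opR f) := by
  simp only [opR_apply, map_sum, D_th, th_th c, Finset.sum_neg_distrib, neg_neg]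
lemma S_th : opS (th c f) = u c f - th c (opS f) := by
  simp only [opS_apply, map_sum, d_th, map_sub, map_smul, Finset.sum_sub_distrib, sum_kd_smul',
    u_th]
lemma Da_th : opDa (th c f) = th c (opDa f) := by
  simp only [opDa_apply, map_sum, map_smul, D_th, del_th]
lemma Db_th : opDb (th c f) = eta c • del c f - th c (opDb f) := by
  simp only [opDb_apply, map_sum, map_smul, d_th, del_th, smul_sub, Finset.sum_sub_distrib,
    sum_eta_kd_smul']
lemma Ga_th : opGa (th c f) = th c (opGa f) := by
  simp only [opGa_apply, map_sum, del_th, u_th]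
lemma Gb_th : opGb (th c f) = -th c (opGb f) := by
  simp only [opGb_apply, map_sum, del_th, th_th c, Finset.sum_neg_distrib, neg_neg]
lemma A'_th : opA' (th c f) = th c (opA' f) := by
  simp only [opA'_apply, map_sum, map_smul, u_th]
lemma M'_th : opM' (th c f) = -th c (opM' f) := by
  simp only [opM'_apply, map_sum, map_smul, u_th, th_th c, Finset.sum_neg_distrib, smul_neg,
    neg_neg]

lemma del_S : opS (del c f) = del c (opS f) := by
  simp only [opS_apply, map_sum, del_u, del_d]
lemma del_R : opR (del c f) = del c (opR f) := by
  simp only [opR_apply, map_sum, del_th, del_D]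
lemma del_A : opA (del c f) = del c (opA f) := by
  simp only [opA_apply, map_sum, map_smul, del_D]
lemma del_M : opM (del c f) = del c (opM f) := by
  simp only [opM_apply, map_sum, map_smul, del_D, del_d]
lemma del_A' : opA' (del c f) = del c (opA' f) := by
  simp only [opA'_apply, map_sum, map_smul, del_u]
lemma del_M' : opM' (del c f) = del c (opM' f) := by
  simp only [opM'_apply, map_sum, map_smul, del_u, del_th]
lemma del_Ga : opGa (del c f) = del c (opGa f) := by
  simp only [opGa_apply, map_sum, del_u, del_del c]
lemma del_Gb : opGb (del c f) = del c (opGb f) := by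
  simp only [opGb_apply, map_sum, del_th, del_del c]
lemma del_Da : opDa (del c f) = del c (opDa f) := by
  simp only [opDa_apply, map_sum, map_smul, del_D, del_del c]
lemma del_Db : opDb (del c f) = del c (opDb f) := by
  simp only [opDb_apply, map_sum, map_smul, del_d, del_del c]
lemma del_P : opP (del c f) = del c (opP f) := by
  simp only [opP_apply, map_sum, del_th, del_d]
lemma del_Q : opQ (del c f) = del c (opQ f) := by
  simp only [opQ_apply, map_sum, del_u, del_D]
lemma P_u : opP (u c f) = u c (opP f) := by
  simp only [opP_apply, map_sum, d_u, u_th]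
lemma P_th : opP (th c f) = th c (opP f) + th c f := by
  have h (x : Fin n) : th c (th x (d x f)) = -th x (th c (d x f)) := th_th c x _
  simp only [opP_apply, map_sum, d_th, map_sub, map_smul, h, Finset.sum_sub_distrib,
    Finset.sum_neg_distrib, sum_kd_smul']
  abel
lemma Q_u : opQ (u c f) = u c (opQ f) + u c f := by
  simp only [opQ_apply, map_sum, D_u, map_add, map_smul, u_u c, Finset.sum_add_distrib,
    sum_kd_smul']
lemma Q_th : opQ (th c f) = th c (opQ f) := by
  simp only [opQ_apply, map_sum, D_th, u_th]

/-- An operator applied to a sum such as `opA f` or `opM f` has to be moved inwards past `D` and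
`d`, so the preceding relations are also needed solved for this order. -/
lemma S_D : opS (D c f) = D c (opS f) - d c f := by rw [D_S, add_sub_cancel_right]
lemma S_d : opS (d c f) = -d c (opS f) := by rw [d_S, neg_neg]
lemma R_D : opR (D c f) = D c (opR f) := (D_R c f).symm
lemma R_d : opR (d c f) = D c f - d c (opR f) := by rw [d_R]; abel
lemma A_D : opA (D c f) = D c (opA f) := (D_A c f).symm
lemma A_d : opA (d c f) = d c (opA f) := (d_A c f).symm
lemma M_D : opM (D c f) = D c (opM f) := (D_M c f).symm
lemma M_d : opM (d c f) = -d c (opM f) := by rw [d_M, neg_neg]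
lemma Db_D : opDb (D c f) = D c (opDb f) := (D_Db c f).symm
lemma Db_d : opDb (d c f) = -d c (opDb f) := by rw [d_Db, neg_neg]
lemma P_d : opP (d c f) = d c (opP f) - d c f := by rw [d_P, add_sub_cancel_right]
lemma P_D : opP (D c f) = D c (opP f) := (D_P c f).symm
lemma Q_d : opQ (d c f) = d c (opQ f) := (d_Q c f).symm
lemma Q_D : opQ (D c f) = D c (opQ f) - D c f := by rw [D_Q, add_sub_cancel_right]

end elementary

/-! ### Commutators of the quadratic operators with one another. -/

section composite

variable (f : Fock n)

lemma sum_eta_eta_smul (F : Fin n → Fock n) : ∑ c, eta c • eta c • F c = ∑ c, F c := by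
  simp only [smul_smul, eta_mul_self, one_smul]

lemma sum_const_smul (f : Fock n) : ∑ _c : Fin n, f = (n : ℝ) • f := by
  simp [← Nat.cast_smul_eq_nsmul ℝ]

lemma S_A : opS (opA f) = opA (opS f) - (2 : ℝ) • opM f := by
  simp only [opA_apply, opM_apply, map_sum, map_smul, S_D, map_sub, smul_sub,
    Finset.sum_sub_distrib, two_smul, ← d_D]
  abel
lemma A_S : opA (opS f) = opS (opA f) + (2 : ℝ) • opM f := by rw [S_A]; abel
lemma A_R : opA (opR f) = opR (opA f) := by
  simp only [opR_apply, map_sum, A_th, A_D]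
lemma A_M : opA (opM f) = opM (opA f) := by
  simp only [opM_apply, map_sum, map_smul, A_d, A_D]
lemma A_M' : opA (opM' f) = opM' (opA f) + (2 : ℝ) • opR f := by
  simp only [opM'_apply, opR_apply, map_sum, map_smul, A_th, A_u, map_add, smul_add,
    Finset.sum_add_distrib, mul_smul, two_smul, sum_eta_eta_smul]
lemma A_A' : opA (opA' f) = opA' (opA f) + (4 : ℝ) • opQ f + (2 * n : ℝ) • f := by
  simp only [opA'_apply, opQ_apply, map_sum, map_smul, A_u, map_add, smul_add, D_u,
    Finset.sum_add_distrib, mul_smul, two_smul, sum_eta_eta_smul]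
  simp only [kd, if_true, one_smul, sum_const_smul]
  module
lemma A_Ga : opA (opGa f) = opGa (opA f) + (2 : ℝ) • opDa f := by
  simp only [opGa_apply, opDa_apply, map_sum, A_u, del_A, Finset.sum_add_distrib, mul_smul,
    Finset.smul_sum]
lemma A_Gb : opA (opGb f) = opGb (opA f) := by
  simp only [opGb_apply, map_sum, A_th, del_A]
lemma A_Da : opA (opDa f) = opDa (opA f) := by
  simp only [opDa_apply, map_sum, map_smul, A_D, del_A]
lemma A_Db : opA (opDb f) = opDb (opA f) := by
  simp only [opDb_apply, map_sum, map_smul, A_d, del_A]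

lemma eq_zero_of_eq_neg {x : Fock n} (h : x = -x) : x = 0 := by
  have h2 : (2 : ℝ) • x = 0 := by rw [two_smul]; nth_rewrite 1 [h]; abel
  simpa using h2

/-- The two factors `d` anticommute and the two factors `D` commute, so exchanging the summation
indices changes the sign. The same parity argument gives nilpotency of `opS`, `opR`, `opDb` and
`opGb`. -/
lemma M_M : opM (opM f) = 0 := by
  apply eq_zero_of_eq_neg
  conv_lhs => rw [opM_apply]
  conv_rhs => rw [opM_apply f]
  simp only [map_sum, map_smul, M_d, M_D, smul_neg, Finset.sum_neg_distrib, neg_neg]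
lemma M_S : opM (opS f) = -opS (opM f) := by
  have h (c : Fin n) : d c (d c f) = 0 := eq_zero_of_eq_neg (d_d c c f)
  simp only [opS_apply, map_sum, M_u, M_d, map_neg, h, smul_zero, add_zero,
    Finset.sum_neg_distrib]
lemma M_R : opM (opR f) = opA f - opR (opM f) := by
  simp only [opR_apply, opA_apply, map_sum, M_th, M_D, Finset.sum_sub_distrib]
-- The anticommutator of mixed trace and mixed metric is the number `n + q - p`. Dividing by it
-- yields the projection that removes mixed traces; see `xPart`.
lemma M_M' : opM (opM' f) = (n : ℝ) • f + opQ f - opP f - opM' (opM f) := by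
  simp only [opM'_apply, opQ_apply, opP_apply, map_sum, map_smul, M_th, M_u, map_add, smul_add,
    D_u, Finset.sum_add_distrib, Finset.sum_sub_distrib, smul_sub, sum_eta_eta_smul]
  simp only [kd, if_true, one_smul, sum_const_smul]
  abel
lemma M_A' : opM (opA' f) = opA' (opM f) + (2 : ℝ) • opS f := by
  simp only [opA'_apply, opS_apply, map_sum, map_smul, M_u, map_add, smul_add, d_u,
    Finset.sum_add_distrib, two_smul, sum_eta_eta_smul]
  abel
lemma M_Ga : opM (opGa f) = opGa (opM f) + opDb f := by
  simp only [opGa_apply, opDb_apply, map_sum, M_u, del_M, Finset.sum_add_distrib]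
lemma M_Gb : opM (opGb f) = opDa f - opGb (opM f) := by
  simp only [opGb_apply, opDa_apply, map_sum, M_th, del_M, Finset.sum_sub_distrib]
lemma M_Da : opM (opDa f) = opDa (opM f) := by
  simp only [opDa_apply, map_sum, map_smul, M_D, del_M]
lemma M_Db : opM (opDb f) = -opDb (opM f) := by
  simp only [opDb_apply, map_sum, map_smul, M_d, del_M, smul_neg, Finset.sum_neg_distrib]

lemma S_S : opS (opS f) = 0 := by
  apply eq_zero_of_eq_neg
  conv_lhs => rw [opS_apply]
  simp only [d_S, map_neg, ← S_u, Finset.sum_neg_distrib, ← map_sum, ← opS_apply]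
-- The anticommutator of the two nilpotent operators is the total number of indices. Hence a field
-- annihilated by one of them is, up to that number, in the image of that same operator; this takes
-- the place of Young projectors throughout.
lemma S_R : opS (opR f) = opP f + opQ f - opR (opS f) := by
  simp only [opR_apply, opQ_apply, opP_apply, map_sum, S_th, S_D, map_sub,
    Finset.sum_sub_distrib]
  abel
lemma S_A' : opS (opA' f) = opA' (opS f) := by
  simp only [opA'_apply, map_sum, map_smul, S_u]
lemma S_M' : opS (opM' f) = opA' f - opM' (opS f) := by
  simp only [opM'_apply, opA'_apply, map_sum, map_smul, S_u, S_th, smul_sub,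
    Finset.sum_sub_distrib]
lemma S_Ga : opS (opGa f) = opGa (opS f) := by
  simp only [opGa_apply, map_sum, S_u, del_S]
lemma S_Gb : opS (opGb f) = opGa f - opGb (opS f) := by
  simp only [opGb_apply, opGa_apply, map_sum, S_th, del_S, Finset.sum_sub_distrib]
lemma S_Da : opS (opDa f) = opDa (opS f) - opDb f := by
  simp only [opDa_apply, opDb_apply, map_sum, map_smul, S_D, del_S, smul_sub,
    Finset.sum_sub_distrib]
lemma S_Db : opS (opDb f) = -opDb (opS f) := by
  simp only [opDb_apply, map_sum, map_smul, S_d, del_S, smul_neg, Finset.sum_neg_distrib]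

lemma R_R : opR (opR f) = 0 := by
  apply eq_zero_of_eq_neg
  have h (c : Fin n) : th c (D c (opR f)) = -opR (th c (D c f)) := by
    rw [D_R, R_th, neg_neg]
  conv_lhs => rw [opR_apply]
  simp only [h, Finset.sum_neg_distrib, ← map_sum, ← opR_apply]
lemma R_A' : opR (opA' f) = opA' (opR f) + (2 : ℝ) • opM' f := by
  simp only [opA'_apply, opM'_apply, map_sum, map_smul, R_u, map_add, smul_add, u_th,
    Finset.sum_add_distrib, two_smul]
  abel
lemma R_M' : opR (opM' f) = -opM' (opR f) := by
  simp only [opM'_apply, map_sum, map_smul, R_th, R_u, map_add, neg_add, smul_add, smul_neg,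
    Finset.sum_add_distrib, Finset.sum_neg_distrib]
  have h (c : Fin n) : th c (th c f) = 0 := eq_zero_of_eq_neg (th_th c c f)
  simp [h]
lemma R_Ga : opR (opGa f) = opGa (opR f) + opGb f := by
  simp only [opGa_apply, opGb_apply, map_sum, R_u, del_R, Finset.sum_add_distrib]
lemma R_Gb : opR (opGb f) = -opGb (opR f) := by
  simp only [opGb_apply, map_sum, R_th, del_R, Finset.sum_neg_distrib]
lemma R_Da : opR (opDa f) = opDa (opR f) := by
  simp only [opDa_apply, map_sum, map_smul, R_D, del_R]
lemma R_Db : opR (opDb f) = opDa f - opDb (opR f) := by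
  simp only [opDb_apply, opDa_apply, map_sum, map_smul, R_d, del_R, smul_sub,
    Finset.sum_sub_distrib]

lemma Db_Db : opDb (opDb f) = 0 := by
  apply eq_zero_of_eq_neg
  conv_lhs => rw [opDb_apply]
  conv_rhs => rw [opDb_apply f]
  simp only [map_sum, map_smul, Db_d, del_Db, smul_neg, Finset.sum_neg_distrib, neg_neg]
lemma Db_Gb : opDb (opGb f) = box f - opGb (opDb f) := by
  simp only [opGb_apply, box_apply, map_sum, Db_th, del_Db, Finset.sum_sub_distrib]
lemma Db_M' : opDb (opM' f) = opGa f - opM' (opDb f) := by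
  simp only [opM'_apply, opGa_apply, map_sum, map_smul, Db_th, Db_u, del_u, smul_sub,
    Finset.sum_sub_distrib, sum_eta_eta_smul]
lemma Db_Ga : opDb (opGa f) = opGa (opDb f) := by
  simp only [opGa_apply, map_sum, Db_u, del_Db]
lemma Db_Da : opDb (opDa f) = opDa (opDb f) := by
  simp only [opDa_apply, map_sum, map_smul, Db_D, del_Db]
lemma Da_Ga : opDa (opGa f) = opGa (opDa f) + box f := by
  simp only [opGa_apply, box_apply, map_sum, Da_u, del_Da, Finset.sum_add_distrib]
lemma Da_Gb : opDa (opGb f) = opGb (opDa f) := by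
  simp only [opGb_apply, map_sum, Da_th, del_Da]
lemma Gb_Gb : opGb (opGb f) = 0 := by
  apply eq_zero_of_eq_neg
  conv_lhs => rw [opGb_apply]
  conv_rhs => rw [opGb_apply f]
  simp only [map_sum, Gb_th, del_Gb, Finset.sum_neg_distrib, neg_neg]

lemma box_S : opS (box f) = box (opS f) := by
  simp only [box_apply, map_sum, map_smul, del_S]
lemma box_R : opR (box f) = box (opR f) := by
  simp only [box_apply, map_sum, map_smul, del_R]
lemma box_A : opA (box f) = box (opA f) := by
  simp only [box_apply, map_sum, map_smul, del_A]
lemma box_M : opM (box f) = box (opM f) := by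
  simp only [box_apply, map_sum, map_smul, del_M]

lemma P_A : opP (opA f) = opA (opP f) := by
  simp only [opA_apply, map_sum, map_smul, P_D]
lemma Q_A : opQ (opA f) = opA (opQ f) - (2 : ℝ) • opA f := by
  simp only [opA_apply, map_sum, map_smul, Q_D, map_sub, smul_sub, Finset.sum_sub_distrib, two_smul]
  abel
lemma P_M : opP (opM f) = opM (opP f) - opM f := by
  simp only [opM_apply, map_sum, map_smul, P_d, P_D, smul_sub, Finset.sum_sub_distrib]
lemma Q_M : opQ (opM f) = opM (opQ f) - opM f := by
  simp only [opM_apply, map_sum, map_smul, Q_d, Q_D, map_sub, smul_sub, Finset.sum_sub_distrib]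
lemma P_S : opP (opS f) = opS (opP f) - opS f := by
  simp only [opS_apply, map_sum, P_u, P_d, map_sub, Finset.sum_sub_distrib]
lemma Q_S : opQ (opS f) = opS (opQ f) + opS f := by
  simp only [opS_apply, map_sum, Q_u, Q_d, Finset.sum_add_distrib]
lemma P_R : opP (opR f) = opR (opP f) + opR f := by
  simp only [opR_apply, map_sum, P_th, P_D, Finset.sum_add_distrib]
lemma Q_R : opQ (opR f) = opR (opQ f) - opR f := by
  simp only [opR_apply, map_sum, Q_th, Q_D, map_sub, Finset.sum_sub_distrib]
lemma P_Db : opP (opDb f) = opDb (opP f) - opDb f := by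
  simp only [opDb_apply, map_sum, map_smul, P_d, del_P, smul_sub, Finset.sum_sub_distrib]
lemma Q_Db : opQ (opDb f) = opDb (opQ f) := by
  simp only [opDb_apply, map_sum, map_smul, Q_d, del_Q]
lemma P_Da : opP (opDa f) = opDa (opP f) := by
  simp only [opDa_apply, map_sum, map_smul, P_D, del_P]
lemma Q_Da : opQ (opDa f) = opDa (opQ f) - opDa f := by
  simp only [opDa_apply, map_sum, map_smul, Q_D, del_Q, smul_sub, Finset.sum_sub_distrib]
lemma P_Gb : opP (opGb f) = opGb (opP f) + opGb f := by
  simp only [opGb_apply, map_sum, P_th, del_P, Finset.sum_add_distrib]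
lemma Q_Gb : opQ (opGb f) = opGb (opQ f) := by
  simp only [opGb_apply, map_sum, Q_th, del_Q]
lemma P_M' : opP (opM' f) = opM' (opP f) + opM' f := by
  simp only [opM'_apply, map_sum, map_smul, P_th, P_u, smul_add, Finset.sum_add_distrib]
lemma Q_M' : opQ (opM' f) = opM' (opQ f) + opM' f := by
  simp only [opM'_apply, map_sum, map_smul, Q_th, Q_u, map_add, smul_add, Finset.sum_add_distrib]
lemma P_A' : opP (opA' f) = opA' (opP f) := by
  simp only [opA'_apply, map_sum, map_smul, P_u]
lemma Q_A' : opQ (opA' f) = opA' (opQ f) + (2 : ℝ) • opA' f := by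
  simp only [opA'_apply, map_sum, map_smul, Q_u, map_add, smul_add, Finset.sum_add_distrib, two_smul]
  abel

end composite

/-! ### Homogeneous families -/

/-- Families concentrated in bidegree `(p, q)`. -/
def Homog (p q : ℝ) (f : Fock n) : Prop := opP f = p • f ∧ opQ f = q • f

section homog
variable {p q : ℝ} {f g : Fock n}

lemma Homog.add (hf : Homog p q f) (hg : Homog p q g) : Homog p q (f + g) := by
  constructor
  · rw [map_add, hf.1, hg.1, smul_add]
  · rw [map_add, hf.2, hg.2, smul_add]
lemma Homog.smul (c : ℝ) (hf : Homog p q f) : Homog p q (c • f) := by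
  constructor
  · rw [map_smul, hf.1, smul_comm]
  · rw [map_smul, hf.2, smul_comm]
lemma Homog.neg (hf : Homog p q f) : Homog p q (-f) := by
  constructor
  · rw [map_neg, hf.1, smul_neg]
  · rw [map_neg, hf.2, smul_neg]
lemma Homog.sub (hf : Homog p q f) (hg : Homog p q g) : Homog p q (f - g) := by
  rw [sub_eq_add_neg]; exact hf.add hg.neg
lemma Homog.A (hf : Homog p q f) : Homog p (q - 2) (opA f) := by
  constructor
  · rw [P_A, hf.1, map_smul]
  · rw [Q_A, hf.2, map_smul]; module
lemma Homog.M (hf : Homog p q f) : Homog (p - 1) (q - 1) (opM f) := by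
  constructor
  · rw [P_M, hf.1, map_smul]; module
  · rw [Q_M, hf.2, map_smul]; module
lemma Homog.S (hf : Homog p q f) : Homog (p - 1) (q + 1) (opS f) := by
  constructor
  · rw [P_S, hf.1, map_smul]; module
  · rw [Q_S, hf.2, map_smul]; module
lemma Homog.R (hf : Homog p q f) : Homog (p + 1) (q - 1) (opR f) := by
  constructor
  · rw [P_R, hf.1, map_smul]; module
  · rw [Q_R, hf.2, map_smul]; module
lemma Homog.Db (hf : Homog p q f) : Homog (p - 1) q (opDb f) := by
  constructor
  · rw [P_Db, hf.1, map_smul]; module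
  · rw [Q_Db, hf.2, map_smul]
lemma Homog.Da (hf : Homog p q f) : Homog p (q - 1) (opDa f) := by
  constructor
  · rw [P_Da, hf.1, map_smul]
  · rw [Q_Da, hf.2, map_smul]; module
lemma Homog.Gb (hf : Homog p q f) : Homog (p + 1) q (opGb f) := by
  constructor
  · rw [P_Gb, hf.1, map_smul]; module
  · rw [Q_Gb, hf.2, map_smul]
lemma Homog.M' (hf : Homog p q f) : Homog (p + 1) (q + 1) (opM' f) := by
  constructor
  · rw [P_M', hf.1, map_smul]; module
  · rw [Q_M', hf.2, map_smul]; module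
lemma Homog.A' (hf : Homog p q f) : Homog p (q + 2) (opA' f) := by
  constructor
  · rw [P_A', hf.1, map_smul]
  · rw [Q_A', hf.2, map_smul]; module
lemma Homog.d (hf : Homog p q f) (c : Fin n) : Homog (p - 1) q (d c f) := by
  constructor
  · rw [P_d, hf.1, map_smul]; module
  · rw [Q_d, hf.2, map_smul]
lemma Homog.D (hf : Homog p q f) (c : Fin n) : Homog p (q - 1) (D c f) := by
  constructor
  · rw [P_D, hf.1, map_smul]
  · rw [Q_D, hf.2, map_smul]; module
lemma Homog.th (hf : Homog p q f) (c : Fin n) : Homog (p + 1) q (th c f) := by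
  constructor
  · rw [P_th, hf.1, map_smul]; module
  · rw [Q_th, hf.2, map_smul]
lemma Homog.u (hf : Homog p q f) (c : Fin n) : Homog p (q + 1) (u c f) := by
  constructor
  · rw [P_u, hf.1, map_smul]
  · rw [Q_u, hf.2, map_smul]; module
lemma Homog.del (hf : Homog p q f) (c : Fin n) : Homog p q (del c f) := by
  constructor
  · rw [del_P, hf.1, map_smul]
  · rw [del_Q, hf.2, map_smul]

lemma opP_val (f : Fock n) (p q b a) : (opP f).1 p q b a = (p : ℝ) • f.1 p q b a := by
  induction p generalizing f with
  | zero => simp [opP_apply]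
  | succ p ih =>
    obtain ⟨x, b, rfl⟩ := exists_cons b
    rw [← d_val, d_P, Fock.add_val, ih, d_val]
    push_cast
    module

lemma opQ_val (f : Fock n) (p q b a) : (opQ f).1 p q b a = (q : ℝ) • f.1 p q b a := by
  induction q generalizing f with
  | zero => simp [opQ_apply]
  | succ q ih =>
    obtain ⟨x, a, rfl⟩ := exists_cons a
    rw [← D_val, D_Q, Fock.add_val, ih, D_val]
    push_cast
    module

lemma Homog.val_eq_zero (hf : Homog p q f) {p' q' : ℕ} (h : (p' : ℝ) ≠ p ∨ (q' : ℝ) ≠ q) (b a) :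
    f.1 p' q' b a = 0 := by
  rcases h with h | h
  · have := congrArg (fun g : Fock n => g.1 p' q' b a) hf.1
    simp only [opP_val, Fock.smul_val] at this
    rw [← sub_eq_zero, ← sub_smul, smul_eq_zero, sub_eq_zero] at this
    exact this.resolve_left h
  · have := congrArg (fun g : Fock n => g.1 p' q' b a) hf.2
    simp only [opQ_val, Fock.smul_val] at this
    rw [← sub_eq_zero, ← sub_smul, smul_eq_zero, sub_eq_zero] at this
    exact this.resolve_left h

lemma homog_iff {p q : ℕ} : Homog (p : ℝ) (q : ℝ) f ↔
    ∀ p' q', p' ≠ p ∨ q' ≠ q → ∀ b a, f.1 p' q' b a = 0 := by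
  refine ⟨fun h p' q' hpq b a => h.val_eq_zero (by exact_mod_cast hpq) b a, fun h => ⟨?_, ?_⟩⟩
  · ext1 p' q' b a
    rw [opP_val, Fock.smul_val]
    by_cases hp : p' = p
    · subst hp; rfl
    · rw [h p' q' (Or.inl hp), smul_zero, smul_zero]
  · ext1 p' q' b a
    rw [opQ_val, Fock.smul_val]
    by_cases hq : q' = q
    · subst hq; rfl
    · rw [h p' q' (Or.inr hq), smul_zero, smul_zero]

lemma Homog.eq_of_val {p q : ℕ} (hf : Homog p q f) (hg : Homog p q g)
    (h : ∀ b a, f.1 p q b a = g.1 p q b a) : f = g := by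
  ext1 p' q' b a
  by_cases hpq : p' ≠ p ∨ q' ≠ q
  · rw [homog_iff.1 hf _ _ hpq, homog_iff.1 hg _ _ hpq]
  · push Not at hpq
    obtain ⟨rfl, rfl⟩ := hpq
    exact h b a

/-- Real degrees pay off here: lowering operators produce degrees such as `q - 2` without case
distinctions, and a degree that has become negative means that the field vanishes. -/
lemma Homog.eq_zero (hf : Homog p q f) (h : p < 0 ∨ q < 0) : f = 0 := by
  ext1 p' q' b a
  refine hf.val_eq_zero ?_ b a
  have h1 : (0 : ℝ) ≤ p' := Nat.cast_nonneg _
  have h2 : (0 : ℝ) ≤ q' := Nat.cast_nonneg _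
  rcases h with h | h
  · exact Or.inl (by linarith)
  · exact Or.inr (by linarith)

end homog

end

end SpinDuality

namespace SpinDuality

noncomputable section

variable {n : ℕ}

/-! ### Sums over permutations -/

lemma perm_sign_of_swap {k : ℕ} (G : (Fin (k + 1) → Fin n) → ℝ)
    (h : ∀ (i : Fin k) b, G (b ∘ Equiv.swap i.castSucc i.succ) = -G b)
    (σ : Equiv.Perm (Fin (k + 1))) (b) : G (b ∘ σ) = ((Equiv.Perm.sign σ : ℤ) : ℝ) * G b := by
  have hσ : σ ∈ Submonoid.closure (Set.range fun i : Fin k => Equiv.swap i.castSucc i.succ) := by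
    rw [Equiv.Perm.mclosure_swap_castSucc_succ]; trivial
  induction hσ using Submonoid.closure_induction generalizing b with
  | mem x hx =>
    obtain ⟨i, rfl⟩ := hx
    rw [h, Equiv.Perm.sign_swap (by simp [Fin.ext_iff])]
    simp
  | one => simp
  | mul x y _ _ hx hy =>
    have : b ∘ (x * y : Equiv.Perm _) = (b ∘ x) ∘ y := rfl
    rw [this, hy, hx, Equiv.Perm.sign_mul]
    push_cast
    ring

lemma perm_of_swap {k : ℕ} (G : (Fin (k + 1) → Fin n) → ℝ)
    (h : ∀ (i : Fin k) b, G (b ∘ Equiv.swap i.castSucc i.succ) = G b)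
    (σ : Equiv.Perm (Fin (k + 1))) (b) : G (b ∘ σ) = G b := by
  have hσ : σ ∈ Submonoid.closure (Set.range fun i : Fin k => Equiv.swap i.castSucc i.succ) := by
    rw [Equiv.Perm.mclosure_swap_castSucc_succ]; trivial
  induction hσ using Submonoid.closure_induction generalizing b with
  | mem x hx =>
    obtain ⟨i, rfl⟩ := hx
    rw [h]
  | one => simp
  | mul x y _ _ hx hy =>
    have : b ∘ (x * y : Equiv.Perm _) = (b ∘ x) ∘ y := rfl
    rw [this, hy, hx]

lemma comp_decomposeFin_symm {k : ℕ} (b : Fin (k + 1) → Fin n) (i : Fin (k + 1))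
    (τ : Equiv.Perm (Fin k)) :
    b ∘ Equiv.Perm.decomposeFin.symm (i, τ)
      = Matrix.vecCons (b i) ((fun j => b (Equiv.swap 0 i j.succ)) ∘ τ) := by
  funext j
  refine Fin.cases ?_ (fun j => ?_) j <;> simp

/-- Laplace expansion along the first slot. Permutations are sorted by the index they put first; as
`G` already alternates in the remaining slots, the `k!` permutations of these contribute equally. -/
lemma sum_perm_sign {k : ℕ} (G : (Fin (k + 1) → Fin n) → ℝ) (g : Fin n → (Fin k → Fin n) → ℝ)
    (hG : ∀ c b, G (Matrix.vecCons c b) = g c b)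
    (hg : ∀ c b (τ : Equiv.Perm (Fin k)), g c (b ∘ τ) = ((Equiv.Perm.sign τ : ℤ) : ℝ) * g c b)
    (b : Fin (k + 1) → Fin n) :
    ∑ σ : Equiv.Perm (Fin (k + 1)), ((Equiv.Perm.sign σ : ℤ) : ℝ) * G (b ∘ σ)
      = k.factorial * ∑ i : Fin (k + 1), (-1 : ℝ) ^ (i : ℕ) * g (b i) (b ∘ i.succAbove) := by
  rw [← Equiv.sum_comp Equiv.Perm.decomposeFin.symm, Fintype.sum_prod_type, Finset.mul_sum]
  refine Finset.sum_congr rfl fun i hi => ?_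
  clear hi
  have key (τ : Equiv.Perm (Fin k)) :
      ((Equiv.Perm.sign (Equiv.Perm.decomposeFin.symm (i, τ)) : ℤ) : ℝ)
        * G (b ∘ Equiv.Perm.decomposeFin.symm (i, τ))
      = (-1 : ℝ) ^ (i : ℕ) * g (b i) (b ∘ i.succAbove) := by
    have hs : ((Equiv.Perm.sign τ : ℤ) : ℝ) * ((Equiv.Perm.sign τ : ℤ) : ℝ) = 1 := by
      rcases Int.units_eq_one_or (Equiv.Perm.sign τ) with h | h <;> simp [h]
    rw [comp_decomposeFin_symm, hG, hg, Equiv.Perm.decomposeFin.symm_sign]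
    revert i
    refine Fin.cases ?_ fun i => ?_
    · have : (fun j : Fin k => b (Equiv.swap 0 0 j.succ)) = b ∘ (0 : Fin (k + 1)).succAbove := by
        funext j; simp
      rw [this]
      simp only [if_true, Fin.val_zero, pow_zero, one_mul, ← mul_assoc]
      rw [hs, one_mul]
    -- The transposition of `0` and `i + 1` leaves the remaining indices out of order; the cycle
    -- `i.cycleRange` reorders them with sign `(-1)^i`, and the transposition itself contributes the
    -- last factor of `(-1)^(i+1)`.
    · have : (fun j : Fin k => b (Equiv.swap 0 i.succ j.succ))
          = (b ∘ i.succ.succAbove) ∘ i.cycleRange := by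
        funext j
        simp [Fin.succAbove_cycleRange]
      rw [this, hg, Fin.sign_cycleRange, if_neg (Fin.succ_ne_zero i)]
      push_cast
      rw [Fin.val_succ, pow_succ]
      linear_combination (-(-1) ^ (i : ℕ) * g (b i.succ) (b ∘ i.succ.succAbove)) * hs
  simp only [key, Finset.sum_const, Finset.card_univ, Fintype.card_perm, Fintype.card_fin,
    nsmul_eq_mul]

lemma sum_perm {k : ℕ} (G : (Fin (k + 1) → Fin n) → ℝ) (g : Fin n → (Fin k → Fin n) → ℝ)
    (hG : ∀ c b, G (Matrix.vecCons c b) = g c b)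
    (hg : ∀ c b (τ : Equiv.Perm (Fin k)), g c (b ∘ τ) = g c b)
    (b : Fin (k + 1) → Fin n) :
    ∑ σ : Equiv.Perm (Fin (k + 1)), G (b ∘ σ)
      = k.factorial * ∑ i : Fin (k + 1), g (b i) (b ∘ i.succAbove) := by
  rw [← Equiv.sum_comp Equiv.Perm.decomposeFin.symm, Fintype.sum_prod_type, Finset.mul_sum]
  refine Finset.sum_congr rfl fun i hi => ?_
  clear hi
  have key (τ : Equiv.Perm (Fin k)) : G (b ∘ Equiv.Perm.decomposeFin.symm (i, τ))
      = g (b i) (b ∘ i.succAbove) := by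
    rw [comp_decomposeFin_symm, hG, hg]
    revert i
    refine Fin.cases ?_ fun i => ?_
    · congr 1
    · have : (fun j : Fin k => b (Equiv.swap 0 i.succ j.succ))
          = (b ∘ i.succ.succAbove) ∘ i.cycleRange := by
        funext j
        simp [Fin.succAbove_cycleRange]
      rw [this, hg]
  simp only [key, Finset.sum_const, Finset.card_univ, Fintype.card_perm, Fintype.card_fin,
    nsmul_eq_mul]

/-! ### Evaluation of families in a fixed bidegree -/

/-- The member of bidegree `(p, q)` of a family. -/
def ev (p q : ℕ) (f : Fock n) : Ten n p q := fun b a => (f.1 p q b a).1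

lemma ev_add (p q : ℕ) (f g : Fock n) : ev p q (f + g) = ev p q f + ev p q g := rfl
lemma ev_sub (p q : ℕ) (f g : Fock n) : ev p q (f - g) = ev p q f - ev p q g := rfl
lemma ev_neg (p q : ℕ) (f : Fock n) : ev p q (-f) = -ev p q f := rfl
lemma ev_smul (p q : ℕ) (c : ℝ) (f : Fock n) : ev p q (c • f) = c • ev p q f := rfl
lemma ev_zero (p q : ℕ) : ev p q (0 : Fock n) = 0 := rfl
lemma ev_sum {ι : Type*} (p q : ℕ) (s : Finset ι) (f : ι → Fock n) (b a x) :
    ev p q (∑ i ∈ s, f i) b a x = ∑ i ∈ s, ev p q (f i) b a x := by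
  simp [ev]

lemma isSmooth_ev (p q : ℕ) (f : Fock n) : IsSmooth (ev p q f) := fun b a => (f.1 p q b a).2

lemma ev_perm_right (p q : ℕ) (f : Fock n) (τ : Equiv.Perm (Fin q)) (b a x) :
    ev p q f b (a ∘ τ) x = ev p q f b a x := by
  cases q with
  | zero => rw [Subsingleton.elim (a ∘ τ) a]
  | succ q =>
    refine perm_of_swap (fun a => ev p (q + 1) f b a x) (fun i b' => ?_) τ a
    exact congrArg (fun h : Sm n => h.1 x) (f.2.2.1 p q i b b')

lemma ev_perm_left (p q : ℕ) (f : Fock n) (σ : Equiv.Perm (Fin p)) (b a x) :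
    ev p q f (b ∘ σ) a x = ((Equiv.Perm.sign σ : ℤ) : ℝ) * ev p q f b a x := by
  cases p with
  | zero => rw [Subsingleton.elim (b ∘ σ) b, Subsingleton.elim σ 1]; simp
  | succ p =>
    refine perm_sign_of_swap (fun b => ev (p + 1) q f b a x) (fun i b' => ?_) σ b
    exact congrArg (fun h : Sm n => h.1 x) (f.2.1 p q i b' a)

lemma isBiSym_ev (p q : ℕ) (f : Fock n) : IsBiSym (ev p q f) := fun σ τ b a x => by
  rw [ev_perm_right, ev_perm_left]

/-- The tensor becomes the only non-zero member of a family. This is the entrance to the operator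
calculus; `ev_inj` leads back to tensors. -/
lemma exists_ev {p q : ℕ} {T : Ten n p q} (hs : IsSmooth T) (hb : IsBiSym T) :
    ∃ f : Fock n, Homog p q f ∧ ev p q f = T := by
  let F : Fam n := fun p' q' b a =>
    if h : p' = p ∧ q' = q then
      ⟨T (b ∘ Fin.cast h.1.symm) (a ∘ Fin.cast h.2.symm), hs _ _⟩ else 0
  have hF : F ∈ fockSubmodule n := by
    refine ⟨fun p' q' i b a => ?_, fun p' q' i b a => ?_, p + q + 1, fun p' q' h => ?_⟩
    · by_cases h : p' + 1 = p ∧ q' = q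
      · obtain ⟨rfl, rfl⟩ := h
        simp only [F, and_self, dif_pos]
        apply Sm.ext
        intro x
        have := hb (Equiv.swap i.castSucc i.succ) 1 b a x
        rw [Equiv.Perm.sign_swap (by simp [Fin.ext_iff])] at this
        have h0 (b' : Fin (p' + 1) → Fin n) : (F (p' + 1) q' b' a).1 = T b' a := by simp [F]
        rw [Sm.coe_neg, h0, h0]
        simpa using this
      · have h0 (b' : Fin (p' + 1) → Fin n) : F (p' + 1) q' b' a = 0 := dif_neg h
        rw [h0, h0, neg_zero]
    · by_cases h : p' = p ∧ q' + 1 = q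
      · obtain ⟨rfl, rfl⟩ := h
        simp only [F, and_self, dif_pos]
        apply Sm.ext
        intro x
        have := hb 1 (Equiv.swap i.castSucc i.succ) b a x
        simpa using this
      · have h0 (a' : Fin (q' + 1) → Fin n) : F p' (q' + 1) b a' = 0 := dif_neg h
        rw [h0, h0]
    · funext b a
      exact dif_neg (by omega)
  refine ⟨⟨F, hF⟩, homog_iff.2 fun p' q' h b a => dif_neg (by tauto), ?_⟩
  funext b a
  simp [ev, F]

lemma ev_inj {p q : ℕ} {f g : Fock n} (hf : Homog p q f) (hg : Homog p q g) :
    ev p q f = ev p q g ↔ f = g := by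
  refine ⟨fun h => hf.eq_of_val hg fun b a => Sm.ext fun x => ?_, fun h => h ▸ rfl⟩
  exact congrFun (congrFun (congrFun h b) a) x

lemma ev_eq_zero {p q : ℕ} {f : Fock n} (hf : Homog p q f) : ev p q f = 0 ↔ f = 0 := by
  rw [← ev_zero, ev_inj hf]
  constructor <;> simp

/-! ### Contractions and derivatives -/

section
variable {p q : ℕ} {f : Fock n}

lemma trA_ev (hf : Homog p q f) : trA (ev p q f) = ev p (q - 1 - 1) (opA f) := by
  match q with
  | 0 => rw [hf.A.eq_zero (Or.inr (by norm_num)), ev_zero]; rfl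
  | 1 => rw [hf.A.eq_zero (Or.inr (by norm_num)), ev_zero]; rfl
  | q + 2 =>
    funext b a x
    rw [opA_apply, ev_sum]
    rfl

lemma trM_ev (hf : Homog p q f) : trM (ev p q f) = ev (p - 1) (q - 1) (opM f) := by
  match p, q with
  | 0, _ => rw [hf.M.eq_zero (Or.inl (by norm_num)), ev_zero]; rfl
  | _ + 1, 0 => rw [hf.M.eq_zero (Or.inr (by norm_num)), ev_zero]; rfl
  | p + 1, q + 1 =>
    funext b a x
    rw [opM_apply, ev_sum]
    rfl

lemma divB_ev (hf : Homog p q f) : divB (ev p q f) = ev (p - 1) q (opDb f) := by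
  match p with
  | 0 => rw [hf.Db.eq_zero (Or.inl (by norm_num)), ev_zero]; rfl
  | p + 1 =>
    funext b a x
    rw [opDb_apply, ev_sum]
    rfl

lemma divA_ev (hf : Homog p q f) : divA (ev p q f) = ev p (q - 1) (opDa f) := by
  match q with
  | 0 => rw [hf.Da.eq_zero (Or.inr (by norm_num)), ev_zero]; rfl
  | q + 1 =>
    funext b a x
    rw [opDa_apply, ev_sum]
    rfl

lemma pd_ev (c : Fin n) (f : Fock n) (p q : ℕ) :
    (fun b a => pd c (ev p q f b a)) = ev p q (del c f) := rfl

/-! ### Symmetrizations -/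

/-- All slots but one are already antisymmetric, so the average over `(p+1)!` permutations is an
average over the `p + 1` positions of the remaining index, and `th` is the sum over these positions.
-/
lemma asym_of {G : Ten n (p + 1) q} (g : Fin n → Fock n)
    (hG : ∀ c b a x, G (Matrix.vecCons c b) a x = ev p q (g c) b a x) :
    asym G = (1 / ((p : ℝ) + 1)) • ev (p + 1) q (∑ c, th c (g c)) := by
  funext b a x
  have h := sum_perm_sign (fun b => G b a x) (fun c b => ev p q (g c) b a x) (fun c b => hG c b a x)
    (fun c b τ => ev_perm_left p q (g c) τ b a x) b
  rw [asym, h, Pi.smul_apply, Pi.smul_apply, Pi.smul_apply, ev_sum, Nat.factorial_succ]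
  have : ∑ c, ev (p + 1) q (th c (g c)) b a x
      = ∑ i : Fin (p + 1), (-1 : ℝ) ^ (i : ℕ) * ev p q (g (b i)) (b ∘ i.succAbove) a x := by
    simp only [ev, th_succ, Sm.coe_sum]
    rw [Finset.sum_comm]
    refine Finset.sum_congr rfl fun i _ => ?_
    rw [Finset.sum_eq_single (b i) (fun c _ hc => by rw [if_neg hc.symm]; rfl) (by simp)]
    simp
  rw [this, smul_eq_mul]
  push_cast
  have := Nat.factorial_ne_zero p
  field_simp

lemma sym_of (G : Ten n p (q + 1)) (b : Fin p → Fin n) (x : Fin n → ℝ)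
    (g : Fin n → (Fin q → Fin n) → ℝ)
    (hG : ∀ c a, G b (Matrix.vecCons c a) x = g c a)
    (hg : ∀ c a (τ : Equiv.Perm (Fin q)), g c (a ∘ τ) = g c a) (a) :
    sym G b a x = (1 / ((q : ℝ) + 1)) * ∑ i : Fin (q + 1), g (a i) (a ∘ i.succAbove) := by
  have h := sum_perm (fun a => G b a x) g (fun c a => hG c a) hg a
  rw [sym, h, Nat.factorial_succ]
  push_cast
  have := Nat.factorial_ne_zero q
  field_simp

lemma sym_of_ev {G : Ten n p (q + 1)} (g : Fin n → Fock n)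
    (hG : ∀ c b a x, G b (Matrix.vecCons c a) x = ev p q (g c) b a x) :
    sym G = (1 / ((q : ℝ) + 1)) • ev p (q + 1) (∑ c, u c (g c)) := by
  funext b a x
  rw [sym_of G b x (fun c a => ev p q (g c) b a x) (fun c a => hG c b a x)
    (fun c a τ => ev_perm_right p q (g c) τ b a x), Pi.smul_apply, Pi.smul_apply, Pi.smul_apply,
    ev_sum, smul_eq_mul]
  congr 1
  simp only [ev, u_succ, Sm.coe_sum]
  rw [Finset.sum_comm]
  refine Finset.sum_congr rfl fun i _ => ?_
  rw [Finset.sum_eq_single (a i) (fun c _ hc => by rw [if_neg hc.symm]; rfl) (by simp)]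
  simp

lemma asym_ev (p q : ℕ) (f : Fock n) : asym (ev p q f) = ev p q f := by
  funext b a x
  have h (σ : Equiv.Perm (Fin p)) : ((Equiv.Perm.sign σ : ℤ) : ℝ) * ev p q f (b ∘ σ) a x
      = ev p q f b a x := by
    rw [ev_perm_left]
    rcases Int.units_eq_one_or (Equiv.Perm.sign σ) with h | h <;> simp [h]
  have := Nat.factorial_ne_zero p
  simp only [asym, h, Finset.sum_const, Finset.card_univ, Fintype.card_perm, Fintype.card_fin,
    nsmul_eq_mul]
  field_simp

lemma sym_ev (p q : ℕ) (f : Fock n) : sym (ev p q f) = ev p q f := by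
  funext b a x
  have := Nat.factorial_ne_zero q
  simp only [sym, ev_perm_right, Finset.sum_const, Finset.card_univ, Fintype.card_perm,
    Fintype.card_fin, nsmul_eq_mul]
  field_simp

lemma asym_add (S T : Ten n p q) : asym (S + T) = asym S + asym T := by
  funext b a x
  simp only [asym, Pi.add_apply, mul_add, Finset.sum_add_distrib]

lemma asym_smul (c : ℝ) (T : Ten n p q) : asym (c • T) = c • asym T := by
  funext b a x
  simp only [asym, Pi.smul_apply, smul_eq_mul, Finset.mul_sum]
  exact Finset.sum_congr rfl fun i _ => by ring

lemma asym_neg (T : Ten n p q) : asym (-T) = -asym T := by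
  rw [← neg_one_smul ℝ, asym_smul, neg_one_smul]

lemma asym_sub (S T : Ten n p q) : asym (S - T) = asym S - asym T := by
  rw [sub_eq_add_neg, asym_add, asym_neg, ← sub_eq_add_neg]

lemma sym_add (S T : Ten n p q) : sym (S + T) = sym S + sym T := by
  funext b a x
  simp only [sym, Pi.add_apply, mul_add, Finset.sum_add_distrib]

lemma sym_smul (c : ℝ) (T : Ten n p q) : sym (c • T) = c • sym T := by
  funext b a x
  simp only [sym, Pi.smul_apply, smul_eq_mul, Finset.mul_sum]
  exact Finset.sum_congr rfl fun i _ => by ring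

lemma sym_neg (T : Ten n p q) : sym (-T) = -sym T := by
  rw [← neg_one_smul ℝ, sym_smul, neg_one_smul]

lemma sym_sub (S T : Ten n p q) : sym (S - T) = sym S - sym T := by
  rw [sub_eq_add_neg, sym_add, sym_neg, ← sub_eq_add_neg]

lemma asym_grad_ev (p q : ℕ) (f : Fock n) :
    asym (grad (p := p + 1) (ev p q f)) = (1 / ((p : ℝ) + 1)) • ev (p + 1) q (opGb f) := by
  rw [opGb_apply]
  exact asym_of (fun c => del c f) fun c b a x => rfl

lemma symPart_ev (q : ℕ) (f : Fock n) :
    symPart (q + 1) (ev 1 q f) = (1 / ((q : ℝ) + 1)) • ev 0 (q + 1) (opS f) := by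
  rw [opS_apply]
  refine sym_of_ev (p := 0) (q := q) (G := fun _ a => ev 1 q f ![a 0] (Matrix.vecTail a))
    (fun c => d c f) fun c b a x => ?_
  change ev 1 q f ![c] a x = ev 1 q f (Matrix.vecCons c b) a x
  rw [Subsingleton.elim b ![]]

lemma asym_sym_etaMix_ev (p q : ℕ) (f : Fock n) :
    asym (sym (etaMix (p := p + 1) (q := q + 1) (ev p q f)))
      = (1 / (((p : ℝ) + 1) * ((q : ℝ) + 1))) • ev (p + 1) (q + 1) (opM' f) := by
  have h : sym (etaMix (p := p + 1) (q := q + 1) (ev p q f)) = (1 / ((q : ℝ) + 1)) •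
      fun b a x => ev p (q + 1) (eta (b 0) • u (b 0) f) (Matrix.vecTail b) a x := by
    funext b a x
    rw [sym_of _ b x (fun c a => (if b 0 = c then eta (b 0) else 0) * ev p q f (Matrix.vecTail b) a x)
      (fun c a => rfl) (fun c a τ => by rw [ev_perm_right])]
    simp only [Pi.smul_apply, smul_eq_mul]
    congr 1
    simp only [ev, Fock.smul_val, u_succ, Sm.coe_smul, Sm.coe_sum, Finset.mul_sum]
    refine Finset.sum_congr rfl fun i _ => ?_
    by_cases hi : b 0 = a i
    · simp [hi]
    · simp [hi, Ne.symm hi]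
  rw [h, asym_smul, asym_of (p := p) (fun c => eta c • u c f) (fun c b a x => rfl), smul_smul,
    opM'_apply]
  simp only [map_smul]
  congr 1
  field_simp

/-- Exchanging one index of each group is the normal-ordered product `∑ th c (u e (D c (d e f)))`.
It differs from `opR (opS f)` by the contraction in which the index just moved is moved back, and
this is `opP f`. -/
lemma asym_sym_swap_ev (p q : ℕ) (f : Fock n) :
    asym (sym (swap (ev (p + 1) (q + 1) f)))
      = (1 / (((p : ℝ) + 1) * ((q : ℝ) + 1))) • ev (p + 1) (q + 1) (opR (opS f) - opP f) := by
  have h : sym (swap (ev (p + 1) (q + 1) f)) = (1 / ((q : ℝ) + 1)) •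
      fun b a x => ev p (q + 1) (D (b 0) (opS f) - d (b 0) f) (Matrix.vecTail b) a x := by
    funext b a x
    obtain ⟨e, b, rfl⟩ := exists_cons b
    rw [sym_of _ _ x (fun c a => ev (p + 1) (q + 1) f (Matrix.vecCons c b) (Matrix.vecCons e a) x)
      (fun c a => rfl) (fun c a τ => ev_perm_right p q (D e (d c f)) τ b a x)]
    simp only [Pi.smul_apply, smul_eq_mul]
    congr 1
    have : D e (opS f) - d e f = ∑ c, u c (D e (d c f)) := by
      rw [D_S, opS_apply, add_sub_cancel_right]
      simp only [d_D]
    change _ = ev p (q + 1) (D e (opS f) - d e f) b a x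
    rw [this, ev_sum]
    simp only [ev, u_succ, Sm.coe_sum]
    rw [Finset.sum_comm]
    refine Finset.sum_congr rfl fun i _ => ?_
    rw [Finset.sum_eq_single (a i) (fun c _ hc => by rw [if_neg hc.symm]; rfl) (by simp)]
    simp
  have h' : opR (opS f) - opP f = ∑ c, th c (D c (opS f) - d c f) := by
    simp only [opR_apply (opS f), opP_apply, map_sub, Finset.sum_sub_distrib]
  rw [h, asym_smul, asym_of (p := p) (fun c => D c (opS f) - d c f) (fun c b a x => rfl), smul_smul,
    h']
  congr 1
  field_simp

lemma snoc_eq_comp {k : ℕ} (b : Fin k → Fin n) (c : Fin n) :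
    (Fin.snoc (α := fun _ => Fin n) b c) = Matrix.vecCons c b ∘ (finRotate (k + 1)) := by
  funext j
  refine Fin.lastCases ?_ (fun j => ?_) j
  · simp
  · simp

lemma asym_comp_perm (G : Ten n p q) (σ : Equiv.Perm (Fin p)) :
    asym (fun b a x => G (b ∘ σ) a x) = ((Equiv.Perm.sign σ : ℤ) : ℝ) • asym G := by
  funext b a x
  simp only [asym, Pi.smul_apply, smul_eq_mul]
  have h := Equiv.sum_comp (Equiv.mulRight σ)
    (fun τ : Equiv.Perm (Fin p) => (((Equiv.Perm.sign τ : ℤ) : ℝ) * G (b ∘ τ) a x : ℝ))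
  rw [← h, mul_left_comm]
  congr 1
  rw [Finset.mul_sum]
  refine Finset.sum_congr rfl fun τ _ => ?_
  have hs : ((Equiv.Perm.sign σ : ℤ) : ℝ) * ((Equiv.Perm.sign σ : ℤ) : ℝ) = 1 := by
    rcases Int.units_eq_one_or (Equiv.Perm.sign σ) with h | h <;> simp [h]
  have : b ∘ (τ * σ : Equiv.Perm (Fin p)) = (b ∘ τ) ∘ σ := rfl
  rw [Equiv.coe_mulRight, Equiv.Perm.sign_mul, this]
  push_cast
  linear_combination (-((Equiv.Perm.sign τ : ℤ) : ℝ) * G ((b ∘ τ) ∘ σ) a x) * hs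

/-- `pull` appends the index at the end of the first group, whereas `th` produces it at the front.
The rotation relating the two has sign `(-1)^p`. -/
lemma asym_pull_ev (p q : ℕ) (f : Fock n) : asym (pull (ev p (q + 1) f))
    = ((-1 : ℝ) ^ p / ((p : ℝ) + 1)) • ev (p + 1) q (opR f) := by
  let G : Ten n (p + 1) q := fun b a => ev p (q + 1) f (Matrix.vecTail b) (Matrix.vecCons (b 0) a)
  have h : pull (ev p (q + 1) f) = fun b a x => G (b ∘ (finRotate (p + 1)).symm) a x := by
    funext b a x
    have h1 (i : Fin p) : (finRotate (p + 1)).symm i.succ = i.castSucc := by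
      rw [Equiv.symm_apply_eq]; simp
    have h2 : (finRotate (p + 1)).symm 0 = Fin.last p := by
      rw [Equiv.symm_apply_eq]; simp
    have h3 : Matrix.vecTail (b ∘ (finRotate (p + 1)).symm) = fun i => b i.castSucc := by
      funext i
      exact congrArg b (h1 i)
    change _ = ev p (q + 1) f (Matrix.vecTail (b ∘ _))
      (Matrix.vecCons (b ((finRotate (p + 1)).symm 0)) a) x
    rw [h2, h3]
    rfl
  have h4 : ((Equiv.Perm.sign (finRotate (p + 1)).symm : ℤ) : ℝ) = (-1) ^ p := by
    rw [Equiv.Perm.sign_symm, sign_finRotate]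
    simp
  rw [h, asym_comp_perm G, asym_of (fun c => D c f) (fun c b a x => rfl), ← opR_apply, smul_smul, h4]
  congr 1
  ring

lemma sym_unpull_ev (p q : ℕ) (f : Fock n) : sym (unpull (q := q + 1) (ev (p + 1) q f))
    = ((-1 : ℝ) ^ p / ((q : ℝ) + 1)) • ev p (q + 1) (opS f) := by
  have : sym (unpull (q := q + 1) (ev (p + 1) q f))
      = (1 / ((q : ℝ) + 1)) • ev p (q + 1) (∑ c, u c ((-1 : ℝ) ^ p • d c f)) := by
    refine sym_of_ev _ fun c b a x => ?_
    change ev (p + 1) q f (Fin.snoc (α := fun _ => Fin n) b c) a x = _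
    rw [snoc_eq_comp, ev_perm_left, sign_finRotate]
    simp [ev]
  rw [this]
  simp only [map_smul, ← Finset.smul_sum, ← opS_apply]
  rw [ev_smul, smul_smul]
  congr 1
  ring

lemma sym_comp_perm (G : Ten n p q) (τ : Equiv.Perm (Fin q)) :
    sym (fun b a x => G b (a ∘ τ) x) = sym G := by
  funext b a x
  simp only [sym]
  rw [← Equiv.sum_comp (Equiv.mulRight τ) fun σ => G b (a ∘ σ) x]
  rfl

/-- A permutation of the indices of `V` extends to one that fixes the slot of the metric, so an
inner symmetrization is absorbed by the outer one. -/
lemma sym_etaMix_sym (V : Ten n p q) : sym (etaMix (p := p + 1) (q := q + 1) (sym V))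
    = sym (etaMix (p := p + 1) (q := q + 1) V) := by
  have key (τ : Equiv.Perm (Fin q)) :
      sym (etaMix (p := p + 1) (q := q + 1) fun b a x => V b (a ∘ τ) x)
      = sym (etaMix (p := p + 1) (q := q + 1) V) := by
    rw [← sym_comp_perm (etaMix (p := p + 1) (q := q + 1) V)
      (Equiv.Perm.decomposeFin.symm (0, τ))]
    refine congrArg sym ?_
    funext b a x
    have h : a ∘ Equiv.Perm.decomposeFin.symm (0, τ)
        = Matrix.vecCons (a 0) (Matrix.vecTail a ∘ τ) := by
      rw [comp_decomposeFin_symm]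
      congr 1
    rw [h]
    rfl
  have h1 : etaMix (p := p + 1) (q := q + 1) (sym V) = (1 / (q.factorial : ℝ)) •
      ∑ τ : Equiv.Perm (Fin q), etaMix (p := p + 1) (q := q + 1) fun b a x => V b (a ∘ τ) x := by
    funext b a x
    simp only [Pi.smul_apply, Finset.sum_apply]
    simp only [etaMix, smul_eq_mul, ← Finset.mul_sum]
    exact mul_left_comm _ _ _
  have h2 {ι : Type} (s : Finset ι) (F : ι → Ten n (p + 1) (q + 1)) :
      sym (∑ i ∈ s, F i) = ∑ i ∈ s, sym (F i) := by
    induction s using Finset.cons_induction with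
    | empty => funext b a x; simp [sym]
    | cons i s hi ih => rw [Finset.sum_cons, Finset.sum_cons, sym_add, ih]
  have := Nat.factorial_ne_zero q
  rw [h1, sym_smul, h2]
  simp only [key, Finset.sum_const, Finset.card_univ, Fintype.card_perm, Fintype.card_fin]
  rw [← Nat.cast_smul_eq_nsmul ℝ, smul_smul, one_div_mul_cancel (by exact_mod_cast this), one_smul]

end

end

end SpinDuality

namespace SpinDuality

noncomputable section

variable {n : ℕ}

/-! ### The invariant pairing -/

/-- Contribution of the bidegree `(p, q)` to the pairing. -/
def pairTerm (f g : Fock n) (x : Fin n → ℝ) (p q : ℕ) : ℝ :=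
  (1 / ((p.factorial : ℝ) * q.factorial)) * contr (ev p q f) (ev p q g) x

/-- The invariant pairing of families of tensors, as a function on `ℝⁿ`. -/
def pair (f g : Fock n) : (Fin n → ℝ) → ℝ := fun x => ∑' p, ∑' q, pairTerm f g x p q

lemma exists_bound (f : Fock n) : ∃ N, ∀ p q, N ≤ p ∨ N ≤ q → ∀ b a, f.1 p q b a = 0 := by
  obtain ⟨N, hN⟩ := f.2.2.2
  exact ⟨N, fun p q h b a => by rw [hN p q h]; rfl⟩

lemma pairTerm_eq_zero {f : Fock n} {p q : ℕ} (h : ∀ b a, f.1 p q b a = 0) (g : Fock n) (x) :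
    pairTerm f g x p q = 0 := by
  simp [pairTerm, contr, ev, h]

lemma pair_eq {f : Fock n} {N : ℕ} (hN : ∀ p q, N ≤ p ∨ N ≤ q → ∀ b a, f.1 p q b a = 0)
    (g : Fock n) (x) :
    pair f g x = ∑ p ∈ Finset.range N, ∑ q ∈ Finset.range N, pairTerm f g x p q := by
  have h (p : ℕ) : ∑' q, pairTerm f g x p q = ∑ q ∈ Finset.range N, pairTerm f g x p q :=
    tsum_eq_sum fun q hq =>
      pairTerm_eq_zero (hN p q (Or.inr (by simpa using hq))) g x
  simp only [pair, h]
  exact tsum_eq_sum fun p hp => Finset.sum_eq_zero fun q _ =>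
    pairTerm_eq_zero (hN p q (Or.inl (by simpa using hp))) g x

lemma pairTerm_comm (f g : Fock n) (x p q) : pairTerm f g x p q = pairTerm g f x p q := by
  simp only [pairTerm, contr]
  congr 1
  exact Finset.sum_congr rfl fun b _ => Finset.sum_congr rfl fun a _ => by ring

lemma pair_comm (f g : Fock n) (x) : pair f g x = pair g f x := by
  simp only [pair, pairTerm_comm f g]

lemma pairTerm_add (f g h : Fock n) (x p q) :
    pairTerm f (g + h) x p q = pairTerm f g x p q + pairTerm f h x p q := by
  simp only [pairTerm, contr, ← mul_add, ← Finset.sum_add_distrib]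
  congr 1

lemma pairTerm_smul (c : ℝ) (f g : Fock n) (x p q) :
    pairTerm f (c • g) x p q = c * pairTerm f g x p q := by
  simp only [pairTerm, contr]
  rw [mul_left_comm c]
  congr 1
  simp only [Finset.mul_sum]
  exact Finset.sum_congr rfl fun b _ => Finset.sum_congr rfl fun a _ => by
    simp only [ev_smul, Pi.smul_apply, smul_eq_mul]; ring

lemma pair_add_right (f g h : Fock n) (x) : pair f (g + h) x = pair f g x + pair f h x := by
  obtain ⟨N, hN⟩ := exists_bound f
  simp only [pair_eq hN, pairTerm_add, Finset.sum_add_distrib]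

lemma pair_smul_right (c : ℝ) (f g : Fock n) (x) : pair f (c • g) x = c * pair f g x := by
  obtain ⟨N, hN⟩ := exists_bound f
  simp only [pair_eq hN, pairTerm_smul, Finset.mul_sum]

lemma pair_add_left (f g h : Fock n) (x) : pair (f + g) h x = pair f h x + pair g h x := by
  rw [pair_comm, pair_add_right, pair_comm h f, pair_comm h g]

lemma pair_smul_left (c : ℝ) (f g : Fock n) (x) : pair (c • f) g x = c * pair f g x := by
  rw [pair_comm, pair_smul_right, pair_comm]

lemma pair_neg_right (f g : Fock n) (x) : pair f (-g) x = -pair f g x := by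
  rw [← neg_one_smul ℝ g, pair_smul_right]; ring

lemma pair_neg_left (f g : Fock n) (x) : pair (-f) g x = -pair f g x := by
  rw [pair_comm, pair_neg_right, pair_comm]

lemma pair_sub_right (f g h : Fock n) (x) : pair f (g - h) x = pair f g x - pair f h x := by
  rw [sub_eq_add_neg, pair_add_right, pair_neg_right, ← sub_eq_add_neg]

lemma pair_sub_left (f g h : Fock n) (x) : pair (f - g) h x = pair f h x - pair g h x := by
  rw [sub_eq_add_neg, pair_add_left, pair_neg_left, ← sub_eq_add_neg]

lemma pair_zero_right (f : Fock n) (x) : pair f 0 x = 0 := by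
  rw [← zero_smul ℝ (0 : Fock n), pair_smul_right, zero_mul]

lemma pair_zero_left (f : Fock n) (x) : pair 0 f x = 0 := by
  rw [pair_comm, pair_zero_right]

lemma pair_sum_right {ι : Type*} (s : Finset ι) (f : Fock n) (g : ι → Fock n) (x) :
    pair f (∑ i ∈ s, g i) x = ∑ i ∈ s, pair f (g i) x := by
  induction s using Finset.cons_induction with
  | empty => simp [pair_zero_right]
  | cons i s hi ih => rw [Finset.sum_cons, Finset.sum_cons, pair_add_right, ih]

lemma pair_sum_left {ι : Type*} (s : Finset ι) (f : ι → Fock n) (g : Fock n) (x) :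
    pair (∑ i ∈ s, f i) g x = ∑ i ∈ s, pair (f i) g x := by
  rw [pair_comm, pair_sum_right]
  exact Finset.sum_congr rfl fun i _ => pair_comm _ _ _

lemma prod_eta_cons {k : ℕ} (c : Fin n) (a : Fin k → Fin n) :
    ∏ j, eta (Matrix.vecCons c a j) = eta c * ∏ j, eta (a j) := by
  rw [Fin.prod_univ_succ]; simp

lemma sum_insertNth {k : ℕ} (i : Fin (k + 1)) (c : Fin n) (F : (Fin (k + 1) → Fin n) → ℝ) :
    ∑ a : Fin (k + 1) → Fin n, (if a i = c then F a else 0)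
      = ∑ a : Fin k → Fin n, F (i.insertNth c a) := by
  rw [← Equiv.sum_comp (Fin.insertNthEquiv (fun _ => Fin n) i), Fintype.sum_prod_type,
    Finset.sum_eq_single c]
  · simp
    rfl
  · intro e _ he
    simp [he]
  · simp

/-- The `q + 1` positions of the inserted index contribute equally. This factor is what the weight
`1/(p! q!)` in `pairTerm` compensates, so that `u c` becomes adjoint to `eta c • D c`. -/
lemma contr_u (c : Fin n) (f g : Fock n) (p q : ℕ) (x) :
    contr (ev p (q + 1) (u c f)) (ev p (q + 1) g) x
      = ((q : ℝ) + 1) * (eta c * contr (ev p q f) (ev p q (D c g)) x) := by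
  simp only [contr, Finset.mul_sum]
  refine Finset.sum_congr rfl fun b _ => ?_
  have key (i : Fin (q + 1)) :
      ∑ a : Fin (q + 1) → Fin n, (if a i = c then (∏ j, eta (b j)) * (∏ j, eta (a j))
        * ev p q f b (a ∘ i.succAbove) x * ev p (q + 1) g b a x else 0)
      = ∑ a : Fin q → Fin n, eta c * ((∏ j, eta (b j)) * (∏ j, eta (a j))
        * ev p q f b a x * ev p q (D c g) b a x) := by
    rw [sum_insertNth]
    refine Finset.sum_congr rfl fun a _ => ?_
    have h1 : (i.insertNth c a : Fin (q + 1) → Fin n) ∘ i.succAbove = a := by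
      funext j; simp
    have h2 : ev p (q + 1) g b (i.insertNth c a : Fin (q + 1) → Fin n) x
        = ev p q (D c g) b a x := by
      rw [← Fin.cons_comp_cycleRange, ev_perm_right]
      rfl
    rw [h1, h2, Fin.prod_univ_succAbove _ i]
    simp only [Fin.insertNth_apply_same, Fin.insertNth_apply_succAbove]
    ring
  calc _ = ∑ a : Fin (q + 1) → Fin n, ∑ i : Fin (q + 1), (if a i = c then
        (∏ j, eta (b j)) * (∏ j, eta (a j))
        * ev p q f b (a ∘ i.succAbove) x * ev p (q + 1) g b a x else 0) := by
        refine Finset.sum_congr rfl fun a _ => ?_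
        simp only [ev, u_succ, Sm.coe_sum, Finset.mul_sum, Finset.sum_mul]
        refine Finset.sum_congr rfl fun i _ => ?_
        split_ifs <;> simp
    _ = _ := by
        rw [Finset.sum_comm]
        simp only [key, Finset.sum_const, Finset.card_univ, Fintype.card_fin, nsmul_eq_mul,
          Finset.mul_sum]
        push_cast
        rfl

lemma contr_th (c : Fin n) (f g : Fock n) (p q : ℕ) (x) :
    contr (ev (p + 1) q (th c f)) (ev (p + 1) q g) x
      = ((p : ℝ) + 1) * (eta c * contr (ev p q f) (ev p q (d c g)) x) := by
  have hcomm (k l : ℕ) (F : (Fin k → Fin n) → (Fin l → Fin n) → ℝ) :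
      ∑ b, ∑ a, F b a = ∑ a, ∑ b, F b a := Finset.sum_comm
  simp only [contr]
  rw [hcomm (p + 1) q, hcomm p q]
  simp only [Finset.mul_sum]
  refine Finset.sum_congr rfl fun a _ => ?_
  have key (i : Fin (p + 1)) :
      ∑ b : Fin (p + 1) → Fin n, (if b i = c then (∏ j, eta (b j)) * (∏ j, eta (a j))
        * ((-1) ^ (i : ℕ) * ev p q f (b ∘ i.succAbove) a x) * ev (p + 1) q g b a x else 0)
      = ∑ b : Fin p → Fin n, eta c * ((∏ j, eta (b j)) * (∏ j, eta (a j))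
        * ev p q f b a x * ev p q (d c g) b a x) := by
    rw [sum_insertNth]
    refine Finset.sum_congr rfl fun b _ => ?_
    have h1 : (i.insertNth c b : Fin (p + 1) → Fin n) ∘ i.succAbove = b := by
      funext j; simp
    have h2 : ev (p + 1) q g (i.insertNth c b : Fin (p + 1) → Fin n) a x
        = (-1) ^ (i : ℕ) * ev p q (d c g) b a x := by
      rw [← Fin.cons_comp_cycleRange, ev_perm_left, Fin.sign_cycleRange]
      simp
      rfl
    have h3 : (-1 : ℝ) ^ (i : ℕ) * (-1) ^ (i : ℕ) = 1 := by
      rw [← mul_pow]; simp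
    rw [h1, h2, Fin.prod_univ_succAbove _ i]
    simp only [Fin.insertNth_apply_same, Fin.insertNth_apply_succAbove]
    linear_combination (eta c * (∏ j, eta (b j)) * (∏ j, eta (a j))
        * ev p q f b a x * ev p q (d c g) b a x) * h3
  calc _ = ∑ b : Fin (p + 1) → Fin n, ∑ i : Fin (p + 1), (if b i = c then
        (∏ j, eta (b j)) * (∏ j, eta (a j))
        * ((-1) ^ (i : ℕ) * ev p q f (b ∘ i.succAbove) a x) * ev (p + 1) q g b a x else 0) := by
        refine Finset.sum_congr rfl fun b _ => ?_
        simp only [ev, th_succ, Sm.coe_sum, Finset.mul_sum, Finset.sum_mul]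
        refine Finset.sum_congr rfl fun i _ => ?_
        split_ifs <;> simp
    _ = _ := by
        rw [Finset.sum_comm]
        simp only [key, Finset.sum_const, Finset.card_univ, Fintype.card_fin, nsmul_eq_mul,
          Finset.mul_sum]
        push_cast
        rfl

lemma pair_u_left (c : Fin n) (f g : Fock n) (x) : pair (u c f) g x = eta c * pair f (D c g) x := by
  obtain ⟨N, hN⟩ := exists_bound f
  have hN' (p q) (h : N + 1 ≤ p ∨ N + 1 ≤ q) (b a) : (u c f).1 p q b a = 0 := by
    cases q with
    | zero => rfl
    | succ q => simp [u_succ, hN p q (by omega)]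
  have hN'' (p q) (h : N + 1 ≤ p ∨ N + 1 ≤ q) (b a) : f.1 p q b a = 0 := hN p q (by omega) b a
  rw [pair_eq hN', pair_eq hN'', Finset.mul_sum]
  refine Finset.sum_congr rfl fun p _ => ?_
  -- Insertion raises the degree by one: the sums match after a shift, since `u c f` has no term of
  -- degree `0` and `f` none of degree `N`.
  rw [Finset.sum_range_succ', Finset.sum_range_succ, pairTerm_eq_zero (fun b a => u_zero c f p b a),
    pairTerm_eq_zero (hN p N (by omega)), add_zero, add_zero, Finset.mul_sum]
  refine Finset.sum_congr rfl fun q _ => ?_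
  rw [pairTerm, contr_u, pairTerm, Nat.factorial_succ]
  push_cast
  have := Nat.factorial_ne_zero p
  have := Nat.factorial_ne_zero q
  field_simp

lemma pair_th_left (c : Fin n) (f g : Fock n) (x) :
    pair (th c f) g x = eta c * pair f (d c g) x := by
  obtain ⟨N, hN⟩ := exists_bound f
  have hN' (p q) (h : N + 1 ≤ p ∨ N + 1 ≤ q) (b a) : (th c f).1 p q b a = 0 := by
    cases p with
    | zero => rfl
    | succ p => simp [th_succ, hN p q (by omega)]
  have hN'' (p q) (h : N + 1 ≤ p ∨ N + 1 ≤ q) (b a) : f.1 p q b a = 0 := hN p q (by omega) b a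
  have h0 : ∑ q ∈ Finset.range (N + 1), pairTerm (th c f) g x 0 q = 0 :=
    Finset.sum_eq_zero fun q _ => pairTerm_eq_zero (fun b a => th_zero c f q b a) _ _
  have h1 : ∑ q ∈ Finset.range (N + 1), pairTerm f (d c g) x N q = 0 :=
    Finset.sum_eq_zero fun q _ => pairTerm_eq_zero (hN N q (by omega)) _ _
  rw [pair_eq hN', pair_eq hN'', Finset.sum_range_succ' (fun p => ∑ q ∈ Finset.range (N + 1), _), h0,
    Finset.sum_range_succ (fun p => ∑ q ∈ Finset.range (N + 1), pairTerm f (d c g) x p q) N, h1,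
    add_zero, add_zero, Finset.mul_sum]
  refine Finset.sum_congr rfl fun p _ => ?_
  rw [Finset.mul_sum]
  refine Finset.sum_congr rfl fun q _ => ?_
  rw [pairTerm, contr_th, pairTerm, Nat.factorial_succ]
  push_cast
  have := Nat.factorial_ne_zero p
  have := Nat.factorial_ne_zero q
  field_simp

lemma pair_D_left (c : Fin n) (f g : Fock n) (x) : pair (D c f) g x = eta c * pair f (u c g) x := by
  rw [pair_comm f, pair_u_left, ← mul_assoc, eta_mul_self, one_mul, pair_comm]

lemma pair_d_left (c : Fin n) (f g : Fock n) (x) :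
    pair (d c f) g x = eta c * pair f (th c g) x := by
  rw [pair_comm f, pair_th_left, ← mul_assoc, eta_mul_self, one_mul, pair_comm]

/-- Each adjunction of an elementary operator yields a factor `eta c`; the two factors cancel, so
the adjoint of `∑ u c d c` is `∑ th c D c` without metric. -/
lemma pair_S_left (f g : Fock n) (x) : pair (opS f) g x = pair f (opR g) x := by
  rw [opS_apply, opR_apply, pair_sum_left, pair_sum_right]
  refine Finset.sum_congr rfl fun c _ => ?_
  rw [pair_u_left, pair_d_left, ← mul_assoc, eta_mul_self, one_mul]

lemma pair_R_left (f g : Fock n) (x) : pair (opR f) g x = pair f (opS g) x := by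
  rw [pair_comm, ← pair_S_left, pair_comm]

lemma pair_M_left (f g : Fock n) (x) : pair (opM f) g x = pair f (opM' g) x := by
  rw [opM_apply, opM'_apply, pair_sum_left, pair_sum_right]
  refine Finset.sum_congr rfl fun c _ => ?_
  rw [pair_smul_left, pair_smul_right, pair_d_left, pair_D_left, u_th, ← mul_assoc (eta c) (eta c),
    eta_mul_self, one_mul]

lemma pair_M'_left (f g : Fock n) (x) : pair (opM' f) g x = pair f (opM g) x := by
  rw [pair_comm, ← pair_M_left, pair_comm]

lemma pair_A_left (f g : Fock n) (x) : pair (opA f) g x = pair f (opA' g) x := by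
  rw [opA_apply, opA'_apply, pair_sum_left, pair_sum_right]
  refine Finset.sum_congr rfl fun c _ => ?_
  rw [pair_smul_left, pair_smul_right, pair_D_left, pair_D_left, ← mul_assoc (eta c) (eta c),
    eta_mul_self, one_mul]

lemma contr_ev {p q : ℕ} {f : Fock n} (hf : Homog p q f) (g : Fock n) (x) :
    contr (ev p q f) (ev p q g) x = (p.factorial * q.factorial : ℝ) * pair f g x := by
  obtain ⟨N, hN⟩ := exists_bound f
  have hN' (p' q') (h : max N (p + q + 1) ≤ p' ∨ max N (p + q + 1) ≤ q') (b a) :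
      f.1 p' q' b a = 0 := hN p' q' (by omega) b a
  rw [pair_eq hN', Finset.sum_eq_single p, Finset.sum_eq_single q, pairTerm]
  · have := Nat.factorial_ne_zero p
    have := Nat.factorial_ne_zero q
    field_simp
  · intro q' _ hq'
    exact pairTerm_eq_zero (homog_iff.1 hf _ _ (Or.inr hq')) _ _
  · intro h
    simp only [Finset.mem_range] at h
    omega
  · intro p' _ hp'
    exact Finset.sum_eq_zero fun q' _ =>
      pairTerm_eq_zero (homog_iff.1 hf _ _ (Or.inl hp')) _ _
  · intro h
    simp only [Finset.mem_range] at h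
    omega

/-- Pairing of gradients, `∂_μ f ∂^μ g`. -/
def pairGrad (f g : Fock n) : (Fin n → ℝ) → ℝ :=
  fun x => ∑ c, eta c * pair (del c f) (del c g) x

lemma kin_ev {p q : ℕ} {f : Fock n} (hf : Homog p q f) (x) :
    kin (ev p q f) x = (p.factorial * q.factorial : ℝ) * pairGrad f f x := by
  simp only [kin, pairGrad, pd_ev, contr_ev (hf.del _), Finset.mul_sum]
  exact Finset.sum_congr rfl fun c _ => by ring

/-! ### Compactly supported families and the integrated pairing -/

/-- Compactly supported smooth functions. -/
def csSm (n : ℕ) : Submodule ℝ (Sm n) where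
  carrier := {f | HasCompactSupport f.1}
  add_mem' hf hg := HasCompactSupport.add hf hg
  zero_mem' := HasCompactSupport.zero
  smul_mem' c _ hf := HasCompactSupport.smul_left (f := fun _ => c) hf

/-- Compactly supported families. -/
def cs (n : ℕ) : Submodule ℝ (Fock n) where
  carrier := {f | ∀ p q b a, f.1 p q b a ∈ csSm n}
  add_mem' hf hg p q b a := (csSm n).add_mem (hf p q b a) (hg p q b a)
  zero_mem' _ _ _ _ := (csSm n).zero_mem
  smul_mem' c _ hf p q b a := (csSm n).smul_mem c (hf p q b a)

lemma isCompactlySupported_ev {p q : ℕ} {f : Fock n} (hf : f ∈ cs n) :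
    IsCompactlySupported (ev p q f) := fun b a => hf p q b a

lemma mem_cs_of_ev {p q : ℕ} {f : Fock n} (hf : Homog p q f)
    (h : IsCompactlySupported (ev p q f)) : f ∈ cs n := by
  intro p' q' b a
  by_cases hpq : p' ≠ p ∨ q' ≠ q
  · rw [homog_iff.1 hf _ _ hpq]; exact (csSm n).zero_mem
  · push Not at hpq
    obtain ⟨rfl, rfl⟩ := hpq
    exact h b a

section
variable {f g : Fock n} (hf : f ∈ cs n)
include hf

lemma cs_D (c : Fin n) : D c f ∈ cs n := fun _ _ _ _ => hf _ _ _ _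
lemma cs_d (c : Fin n) : d c f ∈ cs n := fun _ _ _ _ => hf _ _ _ _
lemma cs_u (c : Fin n) : u c f ∈ cs n := fun p q b a => by
  cases q with
  | zero => exact (csSm n).zero_mem
  | succ q =>
    rw [u_succ]
    refine (csSm n).sum_mem fun i _ => ?_
    split_ifs
    exacts [hf _ _ _ _, (csSm n).zero_mem]
lemma cs_th (c : Fin n) : th c f ∈ cs n := fun p q b a => by
  cases p with
  | zero => exact (csSm n).zero_mem
  | succ p =>
    rw [th_succ]
    refine (csSm n).sum_mem fun i _ => ?_
    split_ifs
    exacts [(csSm n).smul_mem _ (hf _ _ _ _), (csSm n).zero_mem]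
lemma cs_del (c : Fin n) : del c f ∈ cs n := fun p q b a =>
  HasCompactSupport.fderiv_apply (𝕜 := ℝ) (hf p q b a) _

lemma cs_A : opA f ∈ cs n := by
  rw [opA_apply]
  exact Submodule.sum_mem _ fun c _ => Submodule.smul_mem _ _ (cs_D (cs_D hf c) c)
lemma cs_M : opM f ∈ cs n := by
  rw [opM_apply]
  exact Submodule.sum_mem _ fun c _ => Submodule.smul_mem _ _ (cs_d (cs_D hf c) c)
lemma cs_A' : opA' f ∈ cs n := by
  rw [opA'_apply]
  exact Submodule.sum_mem _ fun c _ => Submodule.smul_mem _ _ (cs_u (cs_u hf c) c)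
lemma cs_M' : opM' f ∈ cs n := by
  rw [opM'_apply]
  exact Submodule.sum_mem _ fun c _ => Submodule.smul_mem _ _ (cs_th (cs_u hf c) c)
lemma cs_S : opS f ∈ cs n := by
  rw [opS_apply]
  exact Submodule.sum_mem _ fun c _ => cs_u (cs_d hf c) c
lemma cs_R : opR f ∈ cs n := by
  rw [opR_apply]
  exact Submodule.sum_mem _ fun c _ => cs_th (cs_D hf c) c
lemma cs_Da : opDa f ∈ cs n := by
  rw [opDa_apply]
  exact Submodule.sum_mem _ fun c _ => Submodule.smul_mem _ _ (cs_D (cs_del hf c) c)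
lemma cs_Db : opDb f ∈ cs n := by
  rw [opDb_apply]
  exact Submodule.sum_mem _ fun c _ => Submodule.smul_mem _ _ (cs_d (cs_del hf c) c)
lemma cs_Ga : opGa f ∈ cs n := by
  rw [opGa_apply]
  exact Submodule.sum_mem _ fun c _ => cs_u (cs_del hf c) c
lemma cs_Gb : opGb f ∈ cs n := by
  rw [opGb_apply]
  exact Submodule.sum_mem _ fun c _ => cs_th (cs_del hf c) c
lemma cs_box : box f ∈ cs n := by
  rw [box_apply]
  exact Submodule.sum_mem _ fun c _ => Submodule.smul_mem _ _ (cs_del (cs_del hf c) c)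

end

/-- The integrated pairing. -/
def ip (f g : Fock n) : ℝ := ∫ x, pair f g x

lemma integrable_mul (f : Sm n) {g : Sm n} (hg : g ∈ csSm n) :
    MeasureTheory.Integrable fun x => f.1 x * g.1 x :=
  (f.smooth.continuous.mul g.smooth.continuous).integrable_of_hasCompactSupport
    (HasCompactSupport.mul_left hg)

lemma contr_ev_eq (f g : Fock n) (p q : ℕ) (x) : contr (ev p q f) (ev p q g) x
    = ∑ b, ∑ a, ((∏ i, eta (b i)) * (∏ j, eta (a j))) * ((f.1 p q b a).1 x * (g.1 p q b a).1 x) := by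
  simp only [contr]
  exact Finset.sum_congr rfl fun b _ => Finset.sum_congr rfl fun a _ => by simp only [ev]; ring

lemma integrable_pair (f : Fock n) {g : Fock n} (hg : g ∈ cs n) :
    MeasureTheory.Integrable (pair f g) := by
  obtain ⟨N, hN⟩ := exists_bound f
  rw [show pair f g = _ from funext (pair_eq hN g)]
  refine MeasureTheory.integrable_finsetSum _ fun p _ =>
    MeasureTheory.integrable_finsetSum _ fun q _ => ?_
  simp only [pairTerm, contr_ev_eq]
  refine MeasureTheory.Integrable.const_mul ?_ _
  refine MeasureTheory.integrable_finsetSum _ fun b _ =>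
    MeasureTheory.integrable_finsetSum _ fun a _ => ?_
  exact (integrable_mul _ (hg p q b a)).const_mul _

/-- Reduces the integrated pairing to integrals of products of single components, in which one can
integrate by parts. -/
lemma ip_eq {f : Fock n} {N : ℕ} (hN : ∀ p q, N ≤ p ∨ N ≤ q → ∀ b a, f.1 p q b a = 0)
    {g : Fock n} (hg : g ∈ cs n) : ip f g = ∑ p ∈ Finset.range N, ∑ q ∈ Finset.range N,
      (1 / ((p.factorial : ℝ) * q.factorial)) * ∑ b, ∑ a,
        ((∏ i, eta (b i)) * (∏ j, eta (a j))) * ∫ x, (f.1 p q b a).1 x * (g.1 p q b a).1 x := by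
  have hi (p q b a) : MeasureTheory.Integrable
      fun x => ((∏ i, eta (b i)) * (∏ j, eta (a j))) * ((f.1 p q b a).1 x * (g.1 p q b a).1 x) :=
    (integrable_mul _ (hg p q b a)).const_mul _
  have hi2 (p q b) : MeasureTheory.Integrable fun x => ∑ a,
      ((∏ i, eta (b i)) * (∏ j, eta (a j))) * ((f.1 p q b a).1 x * (g.1 p q b a).1 x) :=
    MeasureTheory.integrable_finsetSum _ fun a _ => hi p q b a
  have hi3 (p q) : MeasureTheory.Integrable fun x => (1 / ((p.factorial : ℝ) * q.factorial))
      * ∑ b, ∑ a,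
      ((∏ i, eta (b i)) * (∏ j, eta (a j))) * ((f.1 p q b a).1 x * (g.1 p q b a).1 x) :=
    (MeasureTheory.integrable_finsetSum _ fun b _ => hi2 p q b).const_mul _
  simp only [ip, pair_eq hN, pairTerm, contr_ev_eq]
  rw [MeasureTheory.integral_finsetSum _ fun p _ =>
    MeasureTheory.integrable_finsetSum _ fun q _ => hi3 p q]
  refine Finset.sum_congr rfl fun p _ => ?_
  rw [MeasureTheory.integral_finsetSum _ fun q _ => hi3 p q]
  refine Finset.sum_congr rfl fun q _ => ?_
  rw [MeasureTheory.integral_const_mul,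
    MeasureTheory.integral_finsetSum _ fun b _ => hi2 p q b]
  congr 1
  refine Finset.sum_congr rfl fun b _ => ?_
  rw [MeasureTheory.integral_finsetSum _ fun a _ => hi p q b a]
  exact Finset.sum_congr rfl fun a _ => MeasureTheory.integral_const_mul _ _

lemma ip_comm (f g : Fock n) : ip f g = ip g f := by
  simp only [ip, pair_comm f g]

/-- Only the second entry needs compact support, as for a variation around an arbitrary smooth
field; the product is then integrable. -/
lemma ip_add_left (f f' : Fock n) {g : Fock n} (hg : g ∈ cs n) :
    ip (f + f') g = ip f g + ip f' g := by
  simp only [ip, pair_add_left]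
  exact MeasureTheory.integral_add (integrable_pair f hg) (integrable_pair f' hg)

lemma ip_smul_left (c : ℝ) (f g : Fock n) : ip (c • f) g = c * ip f g := by
  simp only [ip, pair_smul_left]
  exact MeasureTheory.integral_const_mul _ _

lemma ip_smul_right (c : ℝ) (f g : Fock n) : ip f (c • g) = c * ip f g := by
  rw [ip_comm, ip_smul_left, ip_comm]

lemma ip_neg_left (f g : Fock n) : ip (-f) g = -ip f g := by
  rw [← neg_one_smul ℝ f, ip_smul_left]; ring

lemma ip_neg_right (f g : Fock n) : ip f (-g) = -ip f g := by
  rw [ip_comm, ip_neg_left, ip_comm]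

lemma ip_sub_left (f f' : Fock n) {g : Fock n} (hg : g ∈ cs n) :
    ip (f - f') g = ip f g - ip f' g := by
  rw [sub_eq_add_neg, ip_add_left _ _ hg, ip_neg_left, ← sub_eq_add_neg]

lemma ip_add_right (f : Fock n) {g g' : Fock n} (hg : g ∈ cs n) (hg' : g' ∈ cs n) :
    ip f (g + g') = ip f g + ip f g' := by
  simp only [ip, pair_add_right]
  exact MeasureTheory.integral_add (integrable_pair f hg) (integrable_pair f hg')

lemma ip_sub_right (f : Fock n) {g g' : Fock n} (hg : g ∈ cs n) (hg' : g' ∈ cs n) :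
    ip f (g - g') = ip f g - ip f g' := by
  rw [sub_eq_add_neg, ip_add_right _ hg ((cs n).neg_mem hg'), ip_neg_right, ← sub_eq_add_neg]

lemma ip_zero_left (g : Fock n) : ip 0 g = 0 := by
  rw [← zero_smul ℝ (0 : Fock n), ip_smul_left, zero_mul]

lemma ip_zero_right (g : Fock n) : ip g 0 = 0 := by
  rw [ip_comm, ip_zero_left]

lemma ip_sum_left {ι : Type*} (s : Finset ι) (f : ι → Fock n) {g : Fock n} (hg : g ∈ cs n) :
    ip (∑ i ∈ s, f i) g = ∑ i ∈ s, ip (f i) g := by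
  induction s using Finset.cons_induction with
  | empty => simp [ip_zero_left]
  | cons i s hi ih => rw [Finset.sum_cons, Finset.sum_cons, ip_add_left _ _ hg, ih]

lemma ip_sum_right {ι : Type*} (s : Finset ι) (f : Fock n) {g : ι → Fock n}
    (hg : ∀ i, g i ∈ cs n) : ip f (∑ i ∈ s, g i) = ∑ i ∈ s, ip f (g i) := by
  induction s using Finset.cons_induction with
  | empty => simp [ip_zero_right]
  | cons i s hi ih =>
    rw [Finset.sum_cons, Finset.sum_cons,
      ip_add_right _ (hg i) (Submodule.sum_mem _ fun i _ => hg i), ih]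

lemma ip_S_left (f g : Fock n) : ip (opS f) g = ip f (opR g) := by
  simp only [ip, pair_S_left]
lemma ip_R_left (f g : Fock n) : ip (opR f) g = ip f (opS g) := by
  simp only [ip, pair_R_left]
lemma ip_A_left (f g : Fock n) : ip (opA f) g = ip f (opA' g) := by
  simp only [ip, pair_A_left]
lemma ip_th_left (c : Fin n) (f g : Fock n) : ip (th c f) g = eta c * ip f (d c g) := by
  simp only [ip, pair_th_left]
  exact MeasureTheory.integral_const_mul _ _
lemma ip_D_left (c : Fin n) (f g : Fock n) : ip (D c f) g = eta c * ip f (u c g) := by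
  simp only [ip, pair_D_left]
  exact MeasureTheory.integral_const_mul _ _
lemma ip_d_left (c : Fin n) (f g : Fock n) : ip (d c f) g = eta c * ip f (th c g) := by
  simp only [ip, pair_d_left]
  exact MeasureTheory.integral_const_mul _ _

lemma integral_pdS_mul (c : Fin n) (f : Sm n) {g : Sm n} (hg : g ∈ csSm n) :
    ∫ x, (pdS c f).1 x * g.1 x = -∫ x, f.1 x * (pdS c g).1 x := by
  have hg' : pdS c g ∈ csSm n := HasCompactSupport.fderiv_apply (𝕜 := ℝ) hg _
  have h := integral_mul_fderiv_eq_neg_fderiv_mul_of_integrable (𝕜 := ℝ) (f := f.1) (g := g.1)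
    (v := Pi.single c 1) (μ := MeasureTheory.volume) (integrable_mul (pdS c f) hg)
    (integrable_mul f hg') (integrable_mul f hg) 
    (fun x _ => f.differentiable x) (fun x _ => g.differentiable x)
  rw [eq_neg_iff_add_eq_zero, add_comm, ← eq_neg_iff_add_eq_zero]
  exact h

lemma ip_del_left (c : Fin n) (f : Fock n) {g : Fock n} (hg : g ∈ cs n) :
    ip (del c f) g = -ip f (del c g) := by
  obtain ⟨N, hN⟩ := exists_bound f
  have hN' (p q) (h : N ≤ p ∨ N ≤ q) (b a) : (del c f).1 p q b a = 0 := by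
    rw [del, mapS_val, hN p q h, map_zero]
  rw [ip_eq hN' hg, ip_eq hN (cs_del hg c)]
  simp only [← Finset.sum_neg_distrib, ← mul_neg]
  refine Finset.sum_congr rfl fun p _ => Finset.sum_congr rfl fun q _ => ?_
  congr 1
  refine Finset.sum_congr rfl fun b _ => Finset.sum_congr rfl fun a _ => ?_
  congr 1
  exact integral_pdS_mul c _ (hg p q b a)

lemma ip_Da_left (f : Fock n) {g : Fock n} (hg : g ∈ cs n) : ip (opDa f) g = -ip f (opGa g) := by
  rw [opDa_apply, opGa_apply, ip_sum_left _ _ hg, ip_sum_right _ _ fun c => cs_u (cs_del hg c) c,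
    ← Finset.sum_neg_distrib]
  refine Finset.sum_congr rfl fun c _ => ?_
  rw [ip_smul_left, ip_D_left, ip_del_left c _ (cs_u hg c), ← mul_assoc, eta_mul_self, one_mul,
    del_u]

lemma ip_Db_left (f : Fock n) {g : Fock n} (hg : g ∈ cs n) : ip (opDb f) g = -ip f (opGb g) := by
  rw [opDb_apply, opGb_apply, ip_sum_left _ _ hg, ip_sum_right _ _ fun c => cs_th (cs_del hg c) c,
    ← Finset.sum_neg_distrib]
  refine Finset.sum_congr rfl fun c _ => ?_
  rw [ip_smul_left, ip_d_left, ip_del_left c _ (cs_th hg c), ← mul_assoc, eta_mul_self, one_mul,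
    del_th]

lemma ip_Gb_left (f : Fock n) {g : Fock n} (hg : g ∈ cs n) : ip (opGb f) g = -ip f (opDb g) := by
  have h (c : Fin n) : eta c • d c (del c g) ∈ cs n :=
    Submodule.smul_mem _ _ (cs_d (cs_del hg c) c)
  rw [opDb_apply, opGb_apply, ip_sum_left _ _ hg, ip_sum_right _ _ h, ← Finset.sum_neg_distrib]
  refine Finset.sum_congr rfl fun c _ => ?_
  rw [ip_smul_right, ip_th_left, ip_del_left c _ (cs_d hg c), mul_neg, del_d]

lemma integrable_pairGrad (f : Fock n) {g : Fock n} (hg : g ∈ cs n) :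
    MeasureTheory.Integrable (pairGrad f g) :=
  MeasureTheory.integrable_finsetSum _ fun c _ => (integrable_pair _ (cs_del hg c)).const_mul _

lemma integral_pairGrad (f : Fock n) {g : Fock n} (hg : g ∈ cs n) :
    ∫ x, pairGrad f g x = -ip f (box g) := by
  have h (c : Fin n) : eta c • del c (del c g) ∈ cs n :=
    Submodule.smul_mem _ _ (cs_del (cs_del hg c) c)
  simp only [pairGrad]
  rw [MeasureTheory.integral_finsetSum _ fun c _ =>
    (integrable_pair _ (cs_del hg c)).const_mul _, box_apply, ip_sum_right _ _ h,
    ← Finset.sum_neg_distrib]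
  refine Finset.sum_congr rfl fun c _ => ?_
  rw [MeasureTheory.integral_const_mul, ip_smul_right, ← mul_neg, ← ip_del_left c _ (cs_del hg c)]
  rfl

end

end SpinDuality

namespace SpinDuality

noncomputable section

variable {n : ℕ}

/-! ### The Levi-Civita symbol -/

lemma leviCivita_comp (f : Fin n → Fin n) (σ : Equiv.Perm (Fin n)) :
    leviCivita (f ∘ σ) = ((Equiv.Perm.sign σ : ℤ) : ℝ) * leviCivita f := by
  rw [leviCivita, leviCivita, ← Matrix.det_permute]
  rfl

lemma epsilon_of_perm {k p k' p' : ℕ} {b : Fin k → Fin n} {c : Fin p → Fin n}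
    {b' : Fin k' → Fin n} {c' : Fin p' → Fin n} (hkp : k' + p' = k + p)
    (σ : Equiv.Perm (Fin (k + p)))
    (h : Fin.append b' c' ∘ Fin.cast hkp.symm = Fin.append b c ∘ σ) :
    epsilon b' c' = ((Equiv.Perm.sign σ : ℤ) : ℝ) * epsilon b c := by
  by_cases hn : n = k + p
  · subst hn
    rw [epsilon, dif_pos hkp.symm, epsilon, dif_pos rfl]
    have : (fun i => Fin.append b' c' (Fin.cast hkp.symm i)) = Fin.append b c ∘ σ := h
    rw [this, leviCivita_comp]
    rfl
  · rw [epsilon, dif_neg (by omega), epsilon, dif_neg hn, mul_zero]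

lemma epsilon_perm {k p : ℕ} (b : Fin k → Fin n) (c : Fin p → Fin n) (σ : Equiv.Perm (Fin k))
    (τ : Equiv.Perm (Fin p)) : epsilon (b ∘ σ) (c ∘ τ)
      = ((Equiv.Perm.sign σ : ℤ) : ℝ) * ((Equiv.Perm.sign τ : ℤ) : ℝ) * epsilon b c := by
  rw [epsilon_of_perm rfl (finSumFinEquiv.permCongr (Equiv.sumCongr σ τ)) (b := b) (c := c)]
  · congr 1
    rw [Equiv.Perm.sign_permCongr]
    have := Equiv.Perm.sign_sumCongr σ τ
    rw [show Equiv.Perm.sign (Equiv.sumCongr σ τ : Equiv.Perm (Fin k ⊕ Fin p))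
      = Equiv.Perm.sign σ * Equiv.Perm.sign τ from this]
    push_cast
    rfl
  · funext i
    obtain ⟨i, rfl⟩ := finSumFinEquiv.surjective i
    rcases i with i | i <;> simp

lemma epsilon_perm_left {k p : ℕ} (b : Fin k → Fin n) (c : Fin p → Fin n)
    (σ : Equiv.Perm (Fin k)) :
    epsilon (b ∘ σ) c = ((Equiv.Perm.sign σ : ℤ) : ℝ) * epsilon b c := by
  simpa using epsilon_perm b c σ 1

lemma epsilon_perm_right {k p : ℕ} (b : Fin k → Fin n) (c : Fin p → Fin n)
    (τ : Equiv.Perm (Fin p)) :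
    epsilon b (c ∘ τ) = ((Equiv.Perm.sign τ : ℤ) : ℝ) * epsilon b c := by
  simpa using epsilon_perm b c 1 τ

lemma epsilon_cons {k p : ℕ} (b : Fin k → Fin n) (e : Fin n) (c : Fin p → Fin n) :
    epsilon b (Matrix.vecCons e c) = (-1) ^ k * epsilon (Matrix.vecCons e b) c := by
  have h1 : epsilon (Fin.snoc (α := fun _ => Fin n) b e) c = epsilon b (Matrix.vecCons e c) := by
    rw [epsilon_of_perm (b := b) (c := Matrix.vecCons e c) (by omega) 1, Equiv.Perm.sign_one]
    · simp
    · rw [Fin.append_left_snoc]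
      rfl
  rw [← h1, snoc_eq_comp, epsilon_perm_left, sign_finRotate]
  simp

lemma epsilon_insertNth {k p : ℕ} (b : Fin k → Fin n) (e : Fin n) (c : Fin p → Fin n)
    (i : Fin (p + 1)) : epsilon b (i.insertNth e c : Fin (p + 1) → Fin n)
      = (-1) ^ (i : ℕ) * epsilon b (Matrix.vecCons e c) := by
  rw [← Fin.cons_comp_cycleRange, epsilon_perm_right, Fin.sign_cycleRange]
  simp
  rfl

lemma epsilon_eq_zero {k p : ℕ} (h : n ≠ k + p) (b : Fin k → Fin n) (c : Fin p → Fin n) :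
    epsilon b c = 0 := by
  rw [epsilon, dif_neg h]

lemma leviCivita_eq_zero {f : Fin n → Fin n} (h : ¬ Function.Injective f) : leviCivita f = 0 := by
  rw [Function.Injective] at h
  push Not at h
  obtain ⟨i, j, hij, hne⟩ := h
  refine Matrix.det_zero_of_row_eq hne ?_
  funext k
  simp [hij]

lemma leviCivita_id : leviCivita (id : Fin n → Fin n) = 1 := by
  have : (Matrix.of fun i j => if (id i : Fin n) = j then (1 : ℝ) else 0) = 1 := by
    ext i j
    simp [Matrix.one_apply]
  rw [leviCivita, this, Matrix.det_one]

lemma prod_eta (hn : 0 < n) : ∏ i : Fin n, eta i = -1 := by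
  obtain ⟨m, rfl⟩ := Nat.exists_eq_succ_of_ne_zero hn.ne'
  rw [Fin.prod_univ_succ]
  simp [eta]

/-- Only permutations contribute, and each contributes the determinant `-1` of the metric. This is
the origin of the sign in `star_star` and `pair_star`. -/
lemma sum_leviCivita_sq (hn : 0 < n) :
    ∑ f : Fin n → Fin n, (∏ i, eta (f i)) * leviCivita f ^ 2 = -(n.factorial : ℝ) := by
  have h := Fintype.sum_of_injective (fun σ : Equiv.Perm (Fin n) => (σ : Fin n → Fin n))
    (fun σ τ h => DFunLike.coe_injective h) (fun _ => (-1 : ℝ))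
    (fun f => (∏ i, eta (f i)) * leviCivita f ^ 2) ?_ ?_
  · rw [← h]
    simp [Finset.card_univ, Fintype.card_perm]
  · intro f hf
    rw [leviCivita_eq_zero]
    · simp
    · intro hinj
      exact hf ⟨Equiv.ofBijective f (Finite.injective_iff_bijective.1 hinj), rfl⟩
  · intro σ
    have : leviCivita (σ : Fin n → Fin n) = ((Equiv.Perm.sign σ : ℤ) : ℝ) * leviCivita id :=
      leviCivita_comp id σ
    change -1 = (∏ i, eta (σ i)) * leviCivita (σ : Fin n → Fin n) ^ 2
    rw [this, leviCivita_id, Equiv.prod_comp σ eta, prod_eta hn]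
    rcases Int.units_eq_one_or (Equiv.Perm.sign σ) with h | h <;> simp [h]

/-! ### The Hodge operator -/

/-- Sign convention of the Hodge operator. -/
def hsgn (n : ℕ) : ℕ → ℝ
  | 0 => 1
  | p + 1 => hsgn n p * (-1) ^ (n - p - 1)

/-- The recursion defining `hsgn` is chosen to cancel the sign of moving an index of `epsilon`
across its first group, so that `star_th` holds without a sign. -/
lemma hsgn_sq (n p : ℕ) : hsgn n p * hsgn n p = 1 := by
  induction p with
  | zero => simp [hsgn]
  | succ p ih =>
    have h3 : (-1 : ℝ) ^ (n - p - 1) * (-1) ^ (n - p - 1) = 1 := by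
      rw [← mul_pow]; simp
    simp only [hsgn]
    linear_combination ih + hsgn n p * hsgn n p * h3

/-- The underlying map of the Hodge operator. -/
def starRaw (f : Fam n) : Fam n := fun k q b a =>
  -- For `k > n` the truncated difference `n - k` is `0`, but then `epsilon` vanishes because `n ≠ k
  -- + 0`.
  (hsgn n (n - k) / ((n - k).factorial : ℝ)) •
    ∑ c : Fin (n - k) → Fin n, ((∏ i, eta (c i)) * epsilon b c) • f (n - k) q c a

/-- The Hodge operator, dualizing the first group of indices. -/
def star : Fock n →ₗ[ℝ] Fock n where
  toFun f := ⟨starRaw f.1, by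
    obtain ⟨f, h, h', N, hN⟩ := f
    refine ⟨fun k q i b a => ?_, fun k q i b a => ?_, max N (n + 1), fun k q hkq => ?_⟩
    · simp only [starRaw]
      rw [← smul_neg, ← Finset.sum_neg_distrib]
      congr 1
      refine Finset.sum_congr rfl fun c _ => ?_
      rw [epsilon_perm_left, Equiv.Perm.sign_swap (by simp [Fin.ext_iff])]
      simp
    · simp only [starRaw]
      congr 1
      exact Finset.sum_congr rfl fun c _ => by rw [h']
    · funext b a
      simp only [starRaw]
      rcases hkq with hk | hq
      · have he : ∀ c : Fin (n - k) → Fin n, epsilon b c = 0 :=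
          fun c => epsilon_eq_zero (by omega) b c
        simp [he]
      · simp [hN (n - k) q (by omega)]⟩
  map_add' f g := Subtype.ext (by
    funext k q b a
    change starRaw _ k q b a = starRaw _ k q b a + starRaw _ k q b a
    simp only [starRaw, ← smul_add, ← Finset.sum_add_distrib]
    rfl)
  map_smul' r f := Subtype.ext (by
    funext k q b a
    change starRaw _ k q b a = r • starRaw _ k q b a
    simp only [starRaw, smul_comm r, Finset.smul_sum]
    rfl)

lemma star_val {k p : ℕ} (h : n = k + p) (f : Fock n) (q : ℕ) (b : Fin k → Fin n)
    (a : Fin q → Fin n) : (star f).1 k q b a = (hsgn n p / (p.factorial : ℝ)) •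
      ∑ c : Fin p → Fin n, ((∏ i, eta (c i)) * epsilon b c) • f.1 p q c a := by
  obtain rfl : p = n - k := by omega
  rfl

lemma val_eq_zero_of_lt (f : Fock n) {k : ℕ} (hk : n < k) (q : ℕ) (b : Fin k → Fin n)
    (a : Fin q → Fin n) : f.1 k q b a = 0 := by
  have hb : ¬ Function.Injective b := fun h => by
    have := Fintype.card_le_of_injective b h
    simp at this
    omega
  rw [Function.Injective] at hb
  push Not at hb
  obtain ⟨i, j, hij, hne⟩ := hb
  ext x
  have h := ev_perm_left k q f (Equiv.swap i j) b a x
  have h2 : b ∘ Equiv.swap i j = b := by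
    funext l
    by_cases h1 : l = i
    · subst h1; simp [hij]
    · by_cases h2 : l = j
      · subst h2; simp [hij]
      · simp [Equiv.swap_apply_of_ne_of_ne h1 h2]
  rw [h2, Equiv.Perm.sign_swap hne] at h
  simp only [ev] at h
  push_cast at h
  rw [Sm.coe_zero]
  linarith

lemma ev_star {k p : ℕ} (h : n = k + p) (f : Fock n) (q : ℕ) :
    ev k q (star f) = (hsgn n p / (p.factorial : ℝ)) • epsDual (ev p q f) := by
  funext b a x
  simp only [ev, star_val h, epsDual, Sm.coe_smul, Sm.coe_sum, Pi.smul_apply, smul_eq_mul]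

lemma star_D (e : Fin n) (f : Fock n) : star (D e f) = D e (star f) := rfl

lemma star_mapS (L : Sm n →ₗ[ℝ] Sm n) (f : Fock n) : star (mapS L f) = mapS L (star f) := by
  ext1 k q b a
  change starRaw _ _ _ _ _ = L (starRaw _ _ _ _ _)
  simp only [starRaw, map_smul, map_sum]
  rfl

lemma star_del (e : Fin n) (f : Fock n) : star (del e f) = del e (star f) := star_mapS _ _

lemma star_u (e : Fin n) (f : Fock n) : star (u e f) = u e (star f) := by
  ext1 k q b a
  cases q with
  | zero =>
    change starRaw _ _ _ _ _ = 0
    simp [starRaw]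
  | succ q =>
    by_cases hk : n < k
    · rw [val_eq_zero_of_lt _ hk, val_eq_zero_of_lt _ hk]
    · obtain ⟨p, hp⟩ : ∃ p, n = k + p := ⟨n - k, by omega⟩
      rw [star_val hp, u_succ]
      simp only [star_val hp, u_succ, Finset.smul_sum]
      rw [Finset.sum_comm]
      refine Finset.sum_congr rfl fun i _ => ?_
      split_ifs <;> simp

/-- Contracting with `epsilon` turns a created index into a free one that is read off: creation
becomes annihilation. All relations of `star` with the quadratic operators follow from this and
`star_d`. -/
lemma star_th (e : Fin n) (f : Fock n) : star (th e f) = eta e • d e (star f) := by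
  ext1 m q b a
  by_cases hm : n ≤ m
  · rw [Fock.smul_val, d_val, val_eq_zero_of_lt (star f) (by omega)]
    by_cases hm' : n = m
    · rw [star_val (p := 0) hm']
      simp
    · rw [val_eq_zero_of_lt _ (by omega)]
      simp
  · obtain ⟨p, hp⟩ : ∃ p, n = m + (p + 1) := ⟨n - m - 1, by omega⟩
    ext x
    rw [star_val hp, Fock.smul_val, d_val, star_val (k := m + 1) (p := p) (by omega)]
    simp only [Sm.coe_smul, Sm.coe_sum]
    have h1 : ∀ c : Fin (p + 1) → Fin n, (∏ i, eta (c i)) * epsilon b c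
        * ((th e f).1 (p + 1) q c a).1 x = ∑ i : Fin (p + 1), if c i = e then
          (∏ i, eta (c i)) * epsilon b c * ((-1) ^ (i : ℕ) * (f.1 p q (c ∘ i.succAbove) a).1 x)
          else 0 := by
      intro c
      rw [th_succ, Sm.coe_sum, Finset.mul_sum]
      refine Finset.sum_congr rfl fun i _ => ?_
      split_ifs <;> simp
    have h2 (i : Fin (p + 1)) : ∑ c : Fin (p + 1) → Fin n, (if c i = e then
          (∏ i, eta (c i)) * epsilon b c * ((-1) ^ (i : ℕ) * (f.1 p q (c ∘ i.succAbove) a).1 x)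
          else 0) = ∑ c : Fin p → Fin n, ((-1) ^ m * eta e) * ((∏ i, eta (c i))
            * epsilon (Matrix.vecCons e b) c * (f.1 p q c a).1 x) := by
      rw [sum_insertNth]
      refine Finset.sum_congr rfl fun c _ => ?_
      have h1 : (i.insertNth e c : Fin (p + 1) → Fin n) ∘ i.succAbove = c := by
        funext j; simp
      have h3 : (-1 : ℝ) ^ (i : ℕ) * (-1) ^ (i : ℕ) = 1 := by
        rw [← mul_pow]; simp
      rw [h1, Fin.prod_univ_succAbove _ i, epsilon_insertNth, epsilon_cons]
      simp only [Fin.insertNth_apply_same, Fin.insertNth_apply_succAbove]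
      linear_combination (eta e * (∏ j, eta (c j)) * (-1) ^ m
        * epsilon (Matrix.vecCons e b) c * (f.1 p q c a).1 x) * h3
    simp only [h1]
    rw [Finset.sum_comm]
    simp only [h2, ← Finset.mul_sum, Finset.sum_const, Finset.card_univ, Fintype.card_fin,
      nsmul_eq_mul, hsgn, Nat.factorial_succ]
    have h3 : (-1 : ℝ) ^ m * (-1) ^ m = 1 := by
      rw [← mul_pow]; simp
    have h4 : n - p - 1 = m := by omega
    have := Nat.factorial_ne_zero p
    rw [h4]
    push_cast
    field_simp
    linear_combination (hsgn n p * eta e * ∑ c : Fin p → Fin n, (∏ i, eta (c i))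
            * epsilon (Matrix.vecCons e b) c * (f.1 p q c a).1 x) * h3

/-- Component of degree `N` in the first group of indices. -/
def projB (N : ℕ) (f : Fock n) : Fock n :=
  ⟨fun p q b a => if p = N then f.1 p q b a else 0, by
    obtain ⟨f, h, h', M, hM⟩ := f
    refine ⟨fun p q i b a => ?_, fun p q i b a => ?_, M, fun p q hpq => ?_⟩
    · dsimp only
      split_ifs
      exacts [h p q i b a, neg_zero.symm]
    · dsimp only
      split_ifs
      exacts [h' p q i b a, rfl]
    · funext b a
      simp [hM p q hpq]⟩

lemma projB_val (N : ℕ) (f : Fock n) (p q b a) :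
    (projB N f).1 p q b a = if p = N then f.1 p q b a else 0 := rfl

/-- In degree `p > 0` the operator `∑ th c d c` is multiplication by `p`, so every family is built
by the `th c` from families without indices in the first group. Statements that are linear and
compatible with `th` need checking only on these fermionic vacua. -/
lemma fock_induction {Pr : Fock n → Prop} (h0 : ∀ f, (∀ c, d c f = 0) → Pr f)
    (hth : ∀ c f, Pr f → Pr (th c f)) (hadd : ∀ f g, Pr f → Pr g → Pr (f + g))
    (hsmul : ∀ (r : ℝ) f, Pr f → Pr (r • f)) (f : Fock n) : Pr f := by
  have hzero : Pr 0 := h0 0 fun c => map_zero _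
  have hsum (s : Finset (Fin n)) (F : Fin n → Fock n) (h : ∀ c, Pr (F c)) :
      Pr (∑ c ∈ s, F c) := by
    induction s using Finset.cons_induction with
    | empty => simpa using hzero
    | cons i s hi ih => rw [Finset.sum_cons]; exact hadd _ _ (h i) ih
  have key : ∀ N (f : Fock n), (∀ p, N < p → ∀ q b a, f.1 p q b a = 0) → Pr f := by
    intro N
    induction N with
    | zero =>
      intro f hf
      refine h0 f fun c => ?_
      ext1 p q b a
      rw [d_val, hf _ (by omega)]; rfl
    | succ N ih =>
      intro f hf
      -- The component of top degree `N + 1` is split off and written through `th`; both the fields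
      -- under `th` and the rest have degree at most `N`.
      have h1 : f = (1 / ((N : ℝ) + 1)) • ∑ c, th c (d c (projB (N + 1) f))
          + (f - projB (N + 1) f) := by
        have : opP (projB (N + 1) f) = ((N : ℝ) + 1) • projB (N + 1) f := by
          ext1 p q b a
          rw [opP_val, Fock.smul_val, projB_val]
          split_ifs with h
          · subst h; push_cast; rfl
          · simp
        rw [← opP_apply, this, smul_smul, one_div, inv_mul_cancel₀ (by positivity), one_smul]
        abel
      rw [h1]
      refine hadd _ _ (hsmul _ _ (hsum _ _ fun c => hth _ _ (ih _ fun p hp q b a => ?_)))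
        (ih _ fun p hp q b a => ?_)
      · rw [d_val, projB_val]
        split_ifs
        · omega
        · rfl
      · rw [Fock.sub_val, projB_val]
        split_ifs with h
        · simp
        · rw [hf _ (by omega), sub_zero]
  obtain ⟨N, hN⟩ := exists_bound f
  exact key N f fun p hp q b a => hN p q (Or.inl hp.le) b a

lemma val_succ_of_d_eq_zero {f : Fock n} (h : ∀ c, d c f = 0) (p q) (b : Fin (p + 1) → Fin n) (a) :
    f.1 (p + 1) q b a = 0 := by
  obtain ⟨x, b, rfl⟩ := exists_cons b
  rw [← d_val, h]; rfl

lemma star_val_of_d_eq_zero {f : Fock n} (h : ∀ c, d c f = 0) {k : ℕ} (hk : k ≠ n) (q)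
    (b : Fin k → Fin n) (a) : (star f).1 k q b a = 0 := by
  by_cases hk' : n < k
  · exact val_eq_zero_of_lt _ hk' _ _ _
  · obtain ⟨p, hp⟩ : ∃ p, n = k + (p + 1) := ⟨n - k - 1, by omega⟩
    rw [star_val hp]
    simp [val_succ_of_d_eq_zero h]

lemma th_star_of_d_eq_zero {f : Fock n} (h : ∀ c, d c f = 0) (e : Fin n) : th e (star f) = 0 := by
  ext1 p q b a
  cases p with
  | zero => rfl
  | succ p =>
    by_cases hp : p = n
    · exact val_eq_zero_of_lt _ (by omega) _ _ _
    · rw [th_succ]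
      simp [star_val_of_d_eq_zero h hp]

/-- Induction from the vacuum. On a vacuum both sides vanish, since its dual has all `n` indices and
admits no further one; the step combines `star_th` with the anticommutation relations. -/
lemma star_d (e : Fin n) (f : Fock n) : star (d e f) = eta e • th e (star f) := by
  induction f using fock_induction with
  | h0 f h => rw [h, map_zero, th_star_of_d_eq_zero h, smul_zero]
  | hth c f ih =>
    have hk : kd e c • star f = (eta e * eta c) • kd c e • star f := by
      rw [smul_smul]
      congr 1
      by_cases h : e = c
      · subst h; rw [eta_mul_self, one_mul]
      · simp [kd, h, Ne.symm h]
    rw [d_th, map_sub, map_smul, star_th, ih, star_th, map_smul, map_smul, hk,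
      show d c (th e (star f)) = kd c e • star f - th e (d c (star f)) from d_th _ _ _]
    module
  | hadd f g hf hg => rw [map_add, map_add, hf, hg, map_add, map_add, smul_add]
  | hsmul r f hf => rw [map_smul, map_smul, hf, map_smul, map_smul, smul_comm]


lemma star_val_self {f : Fock n} (q : ℕ) (b : Fin n → Fin n) (a : Fin q → Fin n) :
    (star f).1 n q b a = leviCivita b • f.1 0 q ![] a := by
  rw [star_val (p := 0) (by omega)]
  ext x
  have h (c : Fin 0 → Fin n) : epsilon b c = leviCivita b := by
    rw [epsilon, dif_pos (by omega)]
    congr 1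
    funext i
    rw [Fin.append_right_nil _ _ rfl]
    rfl
  simp only [h, Sm.coe_smul, Sm.coe_sum, hsgn]
  rw [Fintype.sum_unique]
  simp
  left
  congr 1

/-- By `star_th` and `star_d` the double dual commutes with `th`, so the constant is determined on
vacua, where it is the square of the Levi-Civita symbol. -/
lemma star_star (hn : 0 < n) (f : Fock n) : star (star f) = (-hsgn n n) • f := by
  induction f using fock_induction with
  | h0 f h =>
    ext1 k q b a
    cases k with
    | succ k =>
      rw [Fock.smul_val, val_succ_of_d_eq_zero h]
      by_cases hk : n < k + 1
      · rw [val_eq_zero_of_lt _ hk]; simp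
      · rw [star_val (p := n - (k + 1)) (by omega)]
        simp [star_val_of_d_eq_zero h (show n - (k + 1) ≠ n by omega)]
    | zero =>
      rw [star_val (p := n) (by omega)]
      have h (c : Fin n → Fin n) : epsilon b c = leviCivita c := by
        rw [epsilon, dif_pos (by omega)]
        congr 1
        funext i
        rw [Fin.append_left_nil _ _ rfl]
        rfl
      obtain rfl : b = ![] := Subsingleton.elim _ _
      simp only [h, star_val_self, smul_smul]
      rw [← Finset.sum_smul, Fock.smul_val, smul_smul]
      congr 1
      have h2 := sum_leviCivita_sq hn
      simp only [pow_two, ← mul_assoc] at h2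
      have := Nat.factorial_ne_zero n
      rw [h2]
      field_simp
  | hth c f ih =>
    rw [star_th, map_smul, star_d, smul_smul, eta_mul_self, one_smul, ih, map_smul]
  | hadd f g hf hg => rw [map_add, map_add, hf, hg, smul_add]
  | hsmul r f hf => rw [map_smul, map_smul, hf, smul_comm]

/-- The relations with `th` and `d` are compatible with the adjunctions, so the claim reduces to two
vacua, where the sum of squares of the Levi-Civita symbol gives `-1`. -/
lemma pair_star (hn : 0 < n) (f g : Fock n) (x) : pair (star f) (star g) x = -pair f g x := by
  induction f using fock_induction generalizing g with
  | h0 f h =>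
    induction g using fock_induction with
    | h0 g h' =>
      obtain ⟨N, hN⟩ := exists_bound f
      obtain ⟨N', hN'⟩ := exists_bound (star f)
      set m := max (n + 1) (max N N') with hm
      rw [pair_eq (f := f) (N := m) (fun p q h => hN p q (by omega)),
        pair_eq (f := star f) (N := m) (fun p q h => hN' p q (by omega)),
        Finset.sum_eq_single (f := fun p => ∑ q ∈ Finset.range m,
          pairTerm (star f) (star g) x p q) n,
        Finset.sum_eq_single (f := fun p => ∑ q ∈ Finset.range m, pairTerm f g x p q) 0,
        ← Finset.sum_neg_distrib]
      · refine Finset.sum_congr rfl fun q _ => ?_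
        simp only [pairTerm, contr, ev, star_val_self]
        rw [Fintype.sum_unique (ι := Fin 0 → Fin n)]
        have h2 := sum_leviCivita_sq hn
        have h3 : ∀ b : Fin n → Fin n, ∑ a : Fin q → Fin n,
          (∏ i, eta (b i)) * (∏ j, eta (a j)) * (leviCivita b • f.1 0 q ![] a).1 x
            * (leviCivita b • g.1 0 q ![] a).1 x = (∏ i, eta (b i)) * leviCivita b ^ 2 *
            ∑ a : Fin q → Fin n, (∏ j, eta (a j)) * (f.1 0 q ![] a).1 x * (g.1 0 q ![] a).1 x := by
          intro b
          rw [Finset.mul_sum]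
          refine Finset.sum_congr rfl fun a _ => ?_
          simp only [Sm.coe_smul]
          ring
        simp only [h3]
        rw [← Finset.sum_mul, h2]
        have h4 : ∀ a : Fin q → Fin n, (∏ i : Fin 0, eta ((default : Fin 0 → Fin n) i)) *
            (∏ j, eta (a j)) * (f.1 0 q default a).1 x * (g.1 0 q default a).1 x
            = (∏ j, eta (a j)) * (f.1 0 q ![] a).1 x * (g.1 0 q ![] a).1 x := by
          intro a
          rw [show (default : Fin 0 → Fin n) = ![] from Subsingleton.elim _ _]
          simp
        simp only [h4]
        have := Nat.factorial_ne_zero n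
        have := Nat.factorial_ne_zero q
        simp only [Nat.factorial_zero]
        push_cast
        field_simp
      · intro p _ hp
        obtain ⟨p, rfl⟩ := Nat.exists_eq_succ_of_ne_zero hp
        exact Finset.sum_eq_zero fun q _ => pairTerm_eq_zero (val_succ_of_d_eq_zero h p q) _ _
      · intro h
        simp [hm] at h
      · intro p _ hp
        exact Finset.sum_eq_zero fun q _ => pairTerm_eq_zero (star_val_of_d_eq_zero h hp q) _ _
      · intro h
        simp only [Finset.mem_range] at h
        omega
    | hth c g ih =>
      rw [star_th, pair_smul_right, pair_comm, pair_d_left, pair_comm (star g),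
        th_star_of_d_eq_zero h, pair_zero_left, pair_comm f, pair_th_left, h, pair_zero_right]
      simp
    | hadd g g' hg hg' => rw [map_add, pair_add_right, pair_add_right, hg, hg']; ring
    | hsmul r g hg => rw [map_smul, pair_smul_right, pair_smul_right, hg]; ring
  | hth c f ih =>
    rw [star_th, pair_smul_left, pair_d_left, ← mul_assoc, eta_mul_self, one_mul, pair_th_left,
      ← mul_neg, ← ih, star_d, pair_smul_right, ← mul_assoc, eta_mul_self, one_mul]
  | hadd f f' hf hf' => rw [map_add, pair_add_left, pair_add_left, hf, hf']; ring
  | hsmul r f hf => rw [map_smul, pair_smul_left, pair_smul_left, hf]; ring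

lemma ip_star (hn : 0 < n) (f g : Fock n) : ip (star f) (star g) = -ip f g := by
  simp only [ip, pair_star hn]
  exact MeasureTheory.integral_neg _

variable (f : Fock n)

/-- The dictionary of the duality: mixed trace and Young antisymmetrization are exchanged, likewise
divergence and gradient on the first group, while operators on the second group are untouched. -/
lemma star_R : star (opR f) = opM (star f) := by
  simp only [opR_apply, opM_apply, map_sum, star_th, star_D]
lemma star_M : star (opM f) = opR (star f) := by
  simp only [opR_apply, opM_apply, map_sum, map_smul, star_d, star_D, smul_smul, eta_mul_self,
    one_smul]
lemma star_M' : star (opM' f) = opS (star f) := by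
  simp only [opS_apply, opM'_apply, map_sum, map_smul, star_th, star_u, smul_smul, eta_mul_self,
    one_smul, d_u]
lemma star_A : star (opA f) = opA (star f) := by
  simp only [opA_apply, map_sum, map_smul, star_D]
lemma star_Da : star (opDa f) = opDa (star f) := by
  simp only [opDa_apply, map_sum, map_smul, star_D, star_del]
lemma star_Db : star (opDb f) = opGb (star f) := by
  simp only [opDb_apply, opGb_apply, map_sum, map_smul, star_d, star_del, smul_smul, eta_mul_self,
    one_smul]
lemma star_Gb : star (opGb f) = opDb (star f) := by
  simp only [opDb_apply, opGb_apply, map_sum, star_th, star_del]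
lemma star_box : star (box f) = box (star f) := by
  simp only [box_apply, map_sum, map_smul, star_del]

lemma star_P : star (opP f) = (n : ℝ) • star f - opP (star f) := by
  simp only [opP_apply, map_sum, star_th, star_d, map_smul, smul_smul, eta_mul_self, one_smul, d_th]
  rw [Finset.sum_sub_distrib]
  congr 1
  simp only [kd, if_true, one_smul, sum_const_smul]

lemma star_Q : star (opQ f) = opQ (star f) := by
  simp only [opQ_apply, map_sum, star_u, star_D]

variable {f}

lemma Homog.star {p q : ℝ} (hf : Homog p q f) : Homog (n - p) q (star f) := by
  constructor
  · have h := star_P f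
    rw [hf.1, map_smul] at h
    rw [sub_smul, h, sub_sub_cancel]
  · rw [← star_Q, hf.2, map_smul]

lemma cs_star (hf : f ∈ cs n) : star f ∈ cs n := fun _ _ _ _ =>
  (csSm n).smul_mem _ ((csSm n).sum_mem fun _ _ => (csSm n).smul_mem _ (hf _ _ _ _))

lemma star_eq_zero (hn : 0 < n) : star f = 0 ↔ f = 0 := by
  refine ⟨fun h => ?_, fun h => by rw [h, map_zero]⟩
  have h2 := star_star hn f
  rw [h, map_zero] at h2
  have h3 := hsgn_sq n n
  rcases smul_eq_zero.1 h2.symm with h | h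
  · have : hsgn n n = 0 := by linarith
    rw [this] at h3
    norm_num at h3
  · exact h

end

end SpinDuality
set_option linter.unusedSectionVars false

namespace SpinDuality

noncomputable section

open MeasureTheory Set

variable {n : ℕ}

/-! ### Integration along a coordinate direction -/

section line
variable {F : Type} [NormedAddCommGroup F] [NormedSpace ℝ F]

/-- The integral of `f` along the lines in the direction `i`. -/
def lineInt (S : Set ℝ) (i : Fin n) (f : (Fin n → ℝ) → F) (x : Fin n → ℝ) : F :=
  ∫ t in S, f (x - t • Pi.single i 1)

lemma exists_line_bound {f : (Fin n → ℝ) → F} (hf : HasCompactSupport f) (i : Fin n)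
    (x : Fin n → ℝ) : ∃ T : ℝ, ∀ y ∈ Metric.ball x 1, ∀ t, T < |t| →
      f (y - t • Pi.single i 1) = 0 := by
  obtain ⟨R, hR⟩ := hf.isBounded.subset_closedBall 0
  refine ⟨R + ‖x‖ + 1, fun y hy t ht => ?_⟩
  by_contra h
  have h1 := hR (subset_tsupport f (show y - t • Pi.single i 1 ∈ Function.support f from h))
  rw [mem_closedBall_zero_iff] at h1
  have h2 : ‖y‖ < ‖x‖ + 1 := by
    have := norm_sub_norm_le y x
    rw [mem_ball_iff_norm] at hy
    linarith
  have h3 : ‖t • (Pi.single i 1 : Fin n → ℝ)‖ = |t| := by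
    rw [norm_smul, Pi.norm_single]; simp
  have h4 := norm_sub_norm_le (t • (Pi.single i 1 : Fin n → ℝ)) y
  rw [norm_sub_rev, h3] at h4
  linarith

lemma hasCompactSupport_line {f : (Fin n → ℝ) → F} (hf : HasCompactSupport f) (i : Fin n)
    (x : Fin n → ℝ) : HasCompactSupport fun t : ℝ => f (x - t • Pi.single i 1) := by
  obtain ⟨T, hT⟩ := exists_line_bound hf i x
  refine HasCompactSupport.of_support_subset_isCompact (isCompact_Icc (a := -T) (b := T))
    fun t ht => ?_
  by_contra h
  refine ht (hT x (Metric.mem_ball_self one_pos) t ?_)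
  rw [mem_Icc, ← abs_le] at h
  exact not_le.1 h

lemma integrable_line {f : (Fin n → ℝ) → F} (hc : Continuous f) (hf : HasCompactSupport f)
    (S : Set ℝ) (i : Fin n) (x : Fin n → ℝ) :
    Integrable (fun t : ℝ => f (x - t • Pi.single i 1)) (volume.restrict S) :=
  (Continuous.integrable_of_hasCompactSupport (by fun_prop) (hasCompactSupport_line hf i x)).restrict

/-- Differentiation under the integral. Lines through the unit ball around `x` meet the support in a
bounded range of the parameter, so the supremum of the derivative times an indicator function
dominates. -/
lemma hasFDerivAt_lineInt {f : (Fin n → ℝ) → F} (hf : ContDiff ℝ 1 f)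
    (hs : HasCompactSupport f) (S : Set ℝ) (i : Fin n) (x : Fin n → ℝ) :
    HasFDerivAt (lineInt S i f) (lineInt S i (fderiv ℝ f) x) x := by
  have hf' : Continuous (fderiv ℝ f) := hf.continuous_fderiv one_ne_zero
  have hs' : HasCompactSupport (fderiv ℝ f) := hs.fderiv (𝕜 := ℝ)
  obtain ⟨T, hT⟩ := exists_line_bound hs' i x
  obtain ⟨C, hC⟩ := hs'.exists_bound_of_continuous hf'
  have hC0 : 0 ≤ C := (norm_nonneg _).trans (hC 0)
  refine hasFDerivAt_integral_of_dominated_of_fderiv_le (𝕜 := ℝ)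
    (F := fun y t => f (y - t • Pi.single i 1))
    (F' := fun y t => fderiv ℝ f (y - t • Pi.single i 1)) (bound := (Icc (-T) T).indicator fun _ => C)
    (Metric.ball_mem_nhds x one_pos) ?_ ?_ ?_ ?_ ?_ ?_
  · exact Filter.Eventually.of_forall fun y =>
      (integrable_line hf.continuous hs S i y).aestronglyMeasurable
  · exact integrable_line hf.continuous hs S i x
  · exact (integrable_line hf' hs' S i x).aestronglyMeasurable
  · refine Filter.Eventually.of_forall fun t y hy => ?_
    by_cases ht : t ∈ Icc (-T) T
    · rw [indicator_of_mem ht]; exact hC _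
    · rw [hT y hy t, norm_zero]
      · exact indicator_nonneg (fun _ _ => hC0) _
      · rw [mem_Icc, ← abs_le] at ht
        exact not_le.1 ht
  · refine Integrable.restrict ?_
    rw [integrable_indicator_iff measurableSet_Icc]
    exact integrableOn_const (by simp)
  · refine Filter.Eventually.of_forall fun t y _ => ?_
    have h1 : HasFDerivAt f (fderiv ℝ f (y - t • Pi.single i 1)) (y - t • Pi.single i 1) :=
      (hf.differentiable one_ne_zero _).hasFDerivAt
    exact h1.comp y ((hasFDerivAt_id y).sub_const _)

end line

/-- The target space varies in the induction, because the derivative takes values in a space of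
linear maps. -/
lemma contDiff_lineInt_nat (m : ℕ) : ∀ {F : Type} [NormedAddCommGroup F] [NormedSpace ℝ F]
    {f : (Fin n → ℝ) → F} (_ : ContDiff ℝ ∞ f) (_ : HasCompactSupport f) (S : Set ℝ) (i : Fin n),
    ContDiff ℝ m (lineInt S i f) := by
  induction m with
  | zero =>
    intro F _ _ f hf hs S i
    have h (x) := hasFDerivAt_lineInt (hf.of_le (by norm_cast)) hs S i x
    exact contDiff_zero.2 (continuous_iff_continuousAt.2 fun x => (h x).continuousAt)
  | succ m ih =>
    intro F _ _ f hf hs S i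
    have h (x) := hasFDerivAt_lineInt (hf.of_le (by norm_cast)) hs S i x
    rw [show ((m + 1 : ℕ) : WithTop ℕ∞) = (m : WithTop ℕ∞) + 1 from rfl, contDiff_succ_iff_fderiv]
    refine ⟨fun x => (h x).differentiableAt, by simp, ?_⟩
    rw [show fderiv ℝ (lineInt S i f) = lineInt S i (fderiv ℝ f) from funext fun x => (h x).fderiv]
    exact ih (hf.fderiv_right (m := ∞) (by norm_cast)) (hs.fderiv (𝕜 := ℝ)) S i

lemma contDiff_lineInt {f : (Fin n → ℝ) → ℝ} (hf : ContDiff ℝ ∞ f) (hs : HasCompactSupport f)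
    (S : Set ℝ) (i : Fin n) : ContDiff ℝ ∞ (lineInt S i f) :=
  contDiff_infty.2 fun m => contDiff_lineInt_nat m hf hs S i

lemma pd_lineInt {f : (Fin n → ℝ) → ℝ} (hf : ContDiff ℝ ∞ f) (hs : HasCompactSupport f)
    (S : Set ℝ) (i j : Fin n) : pd j (lineInt S i f) = lineInt S i (pd j f) := by
  funext x
  have hf1 : ContDiff ℝ 1 f := hf.of_le (by norm_cast)
  rw [pd, (hasFDerivAt_lineInt hf1 hs S i x).fderiv, lineInt,
    ContinuousLinearMap.integral_apply (integrable_line (hf1.continuous_fderiv one_ne_zero)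
      (hs.fderiv (𝕜 := ℝ)) S i x)]
  rfl

lemma hasDerivAt_line {f : (Fin n → ℝ) → ℝ} (hf : ContDiff ℝ ∞ f) (i : Fin n) (x : Fin n → ℝ)
    (t : ℝ) : HasDerivAt (fun t : ℝ => f (x - t • Pi.single i 1))
      (-pd i f (x - t • Pi.single i 1)) t := by
  have h1 : HasFDerivAt f (fderiv ℝ f (x - t • Pi.single i 1)) (x - t • Pi.single i 1) :=
    (hf.differentiable (by simp) _).hasFDerivAt
  have h2 : HasDerivAt (fun t : ℝ => x - t • (Pi.single i 1 : Fin n → ℝ))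
      (-((1 : ℝ) • Pi.single i 1)) t := ((hasDerivAt_id t).smul_const _).const_sub x
  have h := h1.comp_hasDerivAt t h2
  rw [map_neg, one_smul] at h
  exact h

lemma lineInt_Ioi_pd {f : (Fin n → ℝ) → ℝ} (hf : ContDiff ℝ ∞ f) (hs : HasCompactSupport f)
    (i : Fin n) : lineInt (Ioi 0) i (pd i f) = f := by
  funext x
  have h1 : ContDiff ℝ 1 fun t : ℝ => f (x - t • Pi.single i 1) :=
    (hf.of_le (by norm_cast)).comp (by fun_prop)
  have h := HasCompactSupport.integral_Ioi_deriv_eq h1 (hasCompactSupport_line hs i x) 0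
  simp only [(hasDerivAt_line hf i x _).deriv, integral_neg, zero_smul, sub_zero, neg_inj] at h
  exact h

lemma lineInt_univ_pd {f : (Fin n → ℝ) → ℝ} (hf : ContDiff ℝ ∞ f) (hs : HasCompactSupport f)
    (i : Fin n) : lineInt univ i (pd i f) = 0 := by
  funext x
  have h := integral_eq_zero_of_hasDerivAt_of_integrable (hasDerivAt_line hf i x)
    (by
      have := integrable_line (contDiff_pd i hf).continuous
        (HasCompactSupport.fderiv_apply (𝕜 := ℝ) hs _) univ i x
      rw [Measure.restrict_univ] at this
      exact this.neg)
    (by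
      have := integrable_line hf.continuous hs univ i x
      rw [Measure.restrict_univ] at this
      exact this)
  rw [integral_neg, neg_eq_zero] at h
  rw [lineInt, Measure.restrict_univ]
  exact h

/-! ### Primitives in one direction, for arbitrary smooth functions and with compact support. -/

/-- Integral from the hyperplane `x_i = 0`. -/
def segInt (i : Fin n) (f : (Fin n → ℝ) → ℝ) (x : Fin n → ℝ) : ℝ :=
  ∫ t in (0 : ℝ)..x i, f (Function.update x i t)

/-- Projection to the hyperplane `x_i = 0`. -/
def hyp (i : Fin n) : (Fin n → ℝ) →L[ℝ] (Fin n → ℝ) :=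
  ContinuousLinearMap.pi fun j => if j = i then 0 else ContinuousLinearMap.proj j

lemma hyp_apply (i : Fin n) (x : Fin n → ℝ) : hyp i x = Function.update x i 0 := by
  funext j
  by_cases h : j = i
  · subst h; simp [hyp]
  · simp [hyp, h]

lemma sub_smul_single (i : Fin n) (x : Fin n → ℝ) (t : ℝ) :
    x - t • Pi.single i 1 = Function.update x i (x i - t) := by
  funext j
  by_cases h : j = i
  · subst h; simp
  · simp [h]

lemma lineInt_Ioi_eq (i : Fin n) (f : (Fin n → ℝ) → ℝ) (x : Fin n → ℝ) :
    lineInt (Ioi 0) i f x = ∫ t in Iic (x i), f (Function.update x i t) := by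
  simp only [lineInt, sub_smul_single]
  rw [← integral_indicator measurableSet_Ioi, integral_Iic_eq_integral_Iio,
    ← integral_indicator measurableSet_Iio, ← integral_sub_left_eq_self _ volume (x i)]
  congr 1
  funext t
  by_cases h : t < x i
  · rw [indicator_of_mem (by simpa using h), indicator_of_mem (by simpa using h), sub_sub_cancel]
  · rw [indicator_of_notMem (by simpa using h), indicator_of_notMem (by simpa using h)]

/-- For compact support the primitive from the hyperplane is a difference of primitives from `-∞`,
and so inherits smoothness and the rule for derivatives from `lineInt`. -/
lemma segInt_eq {f : (Fin n → ℝ) → ℝ} (hf : ContDiff ℝ ∞ f) (hs : HasCompactSupport f)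
    (i : Fin n) : segInt i f = lineInt (Ioi 0) i f - lineInt (Ioi 0) i f ∘ hyp i := by
  funext x
  have hi : Integrable fun t : ℝ => f (Function.update x i t) := by
    have h := integrable_line hf.continuous hs univ i x
    rw [Measure.restrict_univ] at h
    simp only [sub_smul_single] at h
    simpa using (h.comp_sub_left (x i))
  rw [Pi.sub_apply, Function.comp_apply, lineInt_Ioi_eq, lineInt_Ioi_eq, hyp_apply, segInt]
  simp only [Function.update_self, Function.update_idem]
  exact (intervalIntegral.integral_Iic_sub_Iic hi.integrableOn hi.integrableOn).symm

/-- On a ball the primitive depends only on the values in that ball. Hence an arbitrary smooth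
function may be cut off far away, and local statements reduce to compact support. -/
lemma segInt_congr {f g : (Fin n → ℝ) → ℝ} {r : ℝ} (h : ∀ x, ‖x‖ ≤ r → f x = g x) (i : Fin n)
    {x : Fin n → ℝ} (hx : ‖x‖ ≤ r) : segInt i f x = segInt i g x := by
  have hr : 0 ≤ r := (norm_nonneg _).trans hx
  refine intervalIntegral.integral_congr fun t ht => h _ ?_
  rw [pi_norm_le_iff_of_nonneg hr] at hx ⊢
  intro j
  by_cases hj : j = i
  · subst hj
    rw [Function.update_self]
    refine le_trans ?_ (hx j)
    have := abs_sub_left_of_mem_uIcc ht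
    simpa using this
  · rw [Function.update_of_ne hj]; exact hx j

/-- A cutoff equal to one on a large ball. -/
lemma exists_cutoff (n : ℕ) (r : ℝ) : ∃ χ : (Fin n → ℝ) → ℝ, ContDiff ℝ ∞ χ ∧ HasCompactSupport χ ∧
    (∀ x, ‖x‖ ≤ r → χ x = 1) ∧ ∀ x, 0 ≤ χ x := by
  let b : ContDiffBump (0 : Fin n → ℝ) := ⟨|r| + 1, |r| + 2, by positivity, by linarith⟩
  refine ⟨b, b.contDiff, b.hasCompactSupport, fun x hx => b.one_of_mem_closedBall ?_, fun x => b.nonneg⟩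
  rw [mem_closedBall_zero_iff]
  exact hx.trans ((le_abs_self r).trans (by simp [b]))

lemma exists_local_cs {f : (Fin n → ℝ) → ℝ} (hf : ContDiff ℝ ∞ f) (r : ℝ) :
    ∃ g : (Fin n → ℝ) → ℝ, ContDiff ℝ ∞ g ∧ HasCompactSupport g ∧ ∀ x, ‖x‖ ≤ r → f x = g x := by
  obtain ⟨χ, h1, h2, h3, -⟩ := exists_cutoff n r
  exact ⟨fun x => χ x * f x, h1.mul hf, h2.mul_right, fun x hx => by simp [h3 x hx]⟩

lemma eventually_eq_of_ball {f g : (Fin n → ℝ) → ℝ} {r : ℝ} (h : ∀ x, ‖x‖ ≤ r → f x = g x)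
    {x : Fin n → ℝ} (hx : ‖x‖ < r) : f =ᶠ[nhds x] g := by
  have : ∀ᶠ y in nhds x, ‖y‖ < r := continuous_norm.continuousAt.eventually (gt_mem_nhds hx)
  exact this.mono fun y hy => h y hy.le

lemma pd_congr {f g : (Fin n → ℝ) → ℝ} {x : Fin n → ℝ} (h : f =ᶠ[nhds x] g) (j : Fin n) :
    pd j f x = pd j g x := by
  rw [pd, pd, h.fderiv_eq]

lemma contDiff_segInt {f : (Fin n → ℝ) → ℝ} (hf : ContDiff ℝ ∞ f) (i : Fin n) :
    ContDiff ℝ ∞ (segInt i f) := by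
  refine contDiff_iff_contDiffAt.2 fun x => ?_
  obtain ⟨g, hg, hgs, hfg⟩ := exists_local_cs hf (‖x‖ + 1)
  have h : segInt i f =ᶠ[nhds x] segInt i g :=
    eventually_eq_of_ball (fun y hy => segInt_congr hfg i hy) (lt_add_one _)
  refine ContDiffAt.congr_of_eventuallyEq ?_ h
  rw [segInt_eq hg hgs]
  have := contDiff_lineInt hg hgs (Ioi 0) i
  exact (this.sub (this.comp (hyp i).contDiff)).contDiffAt

lemma pd_segInt_cs {f : (Fin n → ℝ) → ℝ} (hf : ContDiff ℝ ∞ f) (hs : HasCompactSupport f)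
    (i j : Fin n) (x) : pd j (segInt i f) x = lineInt (Ioi 0) i (pd j f) x
      - if j = i then 0 else lineInt (Ioi 0) i (pd j f) (hyp i x) := by
  have h := contDiff_lineInt hf hs (Ioi 0) i
  have hd : Differentiable ℝ (lineInt (Ioi 0) i f) := h.differentiable (by simp)
  have h2 : HasFDerivAt (lineInt (Ioi 0) i f ∘ hyp i)
      ((fderiv ℝ (lineInt (Ioi 0) i f) (hyp i x)).comp (hyp i)) x :=
    (hd _).hasFDerivAt.comp x (hyp i).hasFDerivAt
  rw [segInt_eq hf hs, pd, fderiv_sub (hd x) h2.differentiableAt, h2.fderiv]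
  rw [_root_.sub_apply, ContinuousLinearMap.comp_apply, hyp_apply i (Pi.single j 1)]
  rw [← pd_lineInt hf hs]
  congr 1
  split_ifs with hj
  · subst hj
    rw [show Function.update (Pi.single j (1 : ℝ) : Fin n → ℝ) j 0 = 0 by
      funext k; by_cases h : k = j
      · subst h; simp
      · simp [h], map_zero]
  · rw [show Function.update (Pi.single j (1 : ℝ) : Fin n → ℝ) i 0 = Pi.single j 1 by
      rw [Function.update_eq_self_iff]; simp [Pi.single_apply, Ne.symm hj]]
    rfl

lemma pd_segInt_self {f : (Fin n → ℝ) → ℝ} (hf : ContDiff ℝ ∞ f) (i : Fin n) :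
    pd i (segInt i f) = f := by
  funext x
  obtain ⟨g, hg, hgs, hfg⟩ := exists_local_cs hf (‖x‖ + 1)
  have h : segInt i f =ᶠ[nhds x] segInt i g :=
    eventually_eq_of_ball (fun y hy => segInt_congr hfg i hy) (lt_add_one _)
  rw [pd_congr h, pd_segInt_cs hg hgs, if_pos rfl, sub_zero, lineInt_Ioi_pd hg hgs]
  exact (hfg x (lt_add_one _).le).symm

lemma pd_segInt_of_ne {f : (Fin n → ℝ) → ℝ} (hf : ContDiff ℝ ∞ f) {i j : Fin n} (hj : j ≠ i) :
    pd j (segInt i f) = segInt i (pd j f) := by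
  funext x
  obtain ⟨g, hg, hgs, hfg⟩ := exists_local_cs hf (‖x‖ + 1)
  have h : segInt i f =ᶠ[nhds x] segInt i g :=
    eventually_eq_of_ball (fun y hy => segInt_congr hfg i hy) (lt_add_one _)
  have h2 : ∀ y, ‖y‖ ≤ ‖x‖ → pd j f y = pd j g y := fun y hy =>
    pd_congr (eventually_eq_of_ball hfg (by linarith)) j
  rw [pd_congr h, pd_segInt_cs hg hgs, if_neg hj, segInt_congr h2 i le_rfl,
    segInt_eq (contDiff_pd j hg) (HasCompactSupport.fderiv_apply (𝕜 := ℝ) hgs _)]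
  rfl

/-- Primitive in the direction `i` vanishing on the hyperplane `x_i = 0`. -/
def primS (i : Fin n) : Sm n →ₗ[ℝ] Sm n where
  toFun f := ⟨segInt i f.1, contDiff_segInt f.2 i⟩
  map_add' f g := by
    ext x
    refine intervalIntegral.integral_add ?_ ?_
    · exact (f.smooth.continuous.comp (by fun_prop)).intervalIntegrable _ _
    · exact (g.smooth.continuous.comp (by fun_prop)).intervalIntegrable _ _
  map_smul' c f := by
    ext x
    exact intervalIntegral.integral_const_mul c _

lemma pdS_primS_self (i : Fin n) (f : Sm n) : pdS i (primS i f) = f :=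
  Subtype.ext (pd_segInt_self f.2 i)

lemma pdS_primS_of_ne {i j : Fin n} (hj : j ≠ i) (f : Sm n) :
    pdS j (primS i f) = primS i (pdS j f) :=
  Subtype.ext (pd_segInt_of_ne f.2 hj)

/-- Compactly supported inverse of the derivative in the direction `i`. -/
def csInt (i : Fin n) (f : (Fin n → ℝ) → ℝ) (x : Fin n → ℝ) : ℝ :=
  lineInt (Ioi 0) i f x - Real.smoothTransition (x i) * lineInt univ i f x

lemma contDiff_csInt {f : (Fin n → ℝ) → ℝ} (hf : ContDiff ℝ ∞ f) (hs : HasCompactSupport f)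
    (i : Fin n) : ContDiff ℝ ∞ (csInt i f) :=
  (contDiff_lineInt hf hs _ i).sub
    ((Real.smoothTransition.contDiff.comp (contDiff_apply ℝ ℝ i)).mul (contDiff_lineInt hf hs _ i))

/-- Beyond the support the primitive from `-∞` equals the integral over the whole line, which is
subtracted there. As the whole-line integral of a derivative vanishes, `csInt i` is a left inverse
of `pd i` (`csInt_pd_self`), whereas `segInt i` is a right inverse. -/
lemma hasCompactSupport_csInt {f : (Fin n → ℝ) → ℝ} (hs : HasCompactSupport f) (i : Fin n) :
    HasCompactSupport (csInt i f) := by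
  obtain ⟨R, hR⟩ := hs.isBounded.subset_closedBall 0
  have h0 : ∀ x : Fin n → ℝ, (∃ j, R < |x j|) → f x = 0 := by
    rintro x ⟨j, hj⟩
    by_contra h
    have h1 := hR (subset_tsupport f (show x ∈ Function.support f from h))
    rw [mem_closedBall_zero_iff] at h1
    have := (norm_le_pi_norm x j).trans h1
    rw [Real.norm_eq_abs] at this
    linarith
  -- The added `1` covers the interval in which `Real.smoothTransition` passes from `0` to `1`.
  refine HasCompactSupport.of_support_subset_isCompact (isCompact_closedBall 0 (|R| + 1))
    fun x hx => ?_
  by_contra h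
  apply hx
  rw [mem_closedBall_zero_iff, pi_norm_le_iff_of_nonneg (by positivity)] at h
  push Not at h
  obtain ⟨j, hj⟩ := h
  rw [Real.norm_eq_abs] at hj
  have hRR := le_abs_self R
  by_cases hji : j = i
  · subst hji
    rcases lt_abs.1 hj with hj | hj
    · have h1 : lineInt (Ioi 0) j f x = lineInt univ j f x := by
        rw [lineInt, lineInt]
        refine (setIntegral_eq_of_subset_of_forall_sdiff_eq_zero MeasurableSet.univ (subset_univ _)
          fun t ht => h0 _ ⟨j, ?_⟩).symm
        simp only [mem_sdiff, mem_univ, mem_Ioi, not_lt, true_and] at ht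
        simp only [Pi.sub_apply, Pi.smul_apply, Pi.single_eq_same, smul_eq_mul, mul_one]
        rw [lt_abs]
        left; linarith
      have h2 : Real.smoothTransition (x j) = 1 :=
        Real.smoothTransition.one_of_one_le (by have := abs_nonneg R; linarith)
      rw [csInt, h1, h2]; ring
    · have h1 : lineInt (Ioi 0) j f x = 0 := by
        rw [lineInt]
        refine setIntegral_eq_zero_of_forall_eq_zero fun t ht => h0 _ ⟨j, ?_⟩
        simp only [mem_Ioi] at ht
        simp only [Pi.sub_apply, Pi.smul_apply, Pi.single_eq_same, smul_eq_mul, mul_one]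
        rw [lt_abs]
        right; linarith
      have h2 : Real.smoothTransition (x j) = 0 :=
        Real.smoothTransition.zero_of_nonpos (by have := abs_nonneg R; linarith)
      rw [csInt, h1, h2]; ring
  · have h1 (S : Set ℝ) : lineInt S i f x = 0 := by
      rw [lineInt]
      refine setIntegral_eq_zero_of_forall_eq_zero fun t ht => h0 _ ⟨j, ?_⟩
      simp only [Pi.sub_apply, Pi.smul_apply, smul_eq_mul]
      rw [Pi.single_eq_of_ne hji]
      simp only [mul_zero, sub_zero]
      linarith
    rw [csInt, h1, h1]; ring

lemma csInt_pd_self {f : (Fin n → ℝ) → ℝ} (hf : ContDiff ℝ ∞ f) (hs : HasCompactSupport f)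
    (i : Fin n) : csInt i (pd i f) = f := by
  funext x
  rw [csInt, lineInt_Ioi_pd hf hs, lineInt_univ_pd hf hs]
  simp

lemma pd_csInt_of_ne {f : (Fin n → ℝ) → ℝ} (hf : ContDiff ℝ ∞ f) (hs : HasCompactSupport f)
    {i j : Fin n} (hj : j ≠ i) : pd j (csInt i f) = csInt i (pd j f) := by
  funext x
  have hd (S : Set ℝ) : DifferentiableAt ℝ (lineInt S i f) x :=
    (contDiff_lineInt hf hs S i).differentiable (by simp) x
  have hσ : HasFDerivAt (fun x : Fin n → ℝ => Real.smoothTransition (x i))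
      (deriv Real.smoothTransition (x i) • (ContinuousLinearMap.proj i : (Fin n → ℝ) →L[ℝ] ℝ)) x :=
    HasDerivAt.comp_hasFDerivAt x
      ((Real.smoothTransition.contDiff (n := 1)).differentiable one_ne_zero _).hasDerivAt
      (ContinuousLinearMap.proj i : (Fin n → ℝ) →L[ℝ] ℝ).hasFDerivAt
  have h := ((hd (Ioi 0)).hasFDerivAt.sub (hσ.mul (hd univ).hasFDerivAt)).fderiv
  have h' : fderiv ℝ (csInt i f) x = _ := h
  rw [pd, h', csInt, ← pd_lineInt hf hs, ← pd_lineInt hf hs]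
  simp [pd, Pi.single_apply, Ne.symm hj]

lemma csInt_add {f g : (Fin n → ℝ) → ℝ} (hf : ContDiff ℝ ∞ f) (hs : HasCompactSupport f)
    (hg : ContDiff ℝ ∞ g) (hgs : HasCompactSupport g) (i : Fin n) :
    csInt i (f + g) = csInt i f + csInt i g := by
  funext x
  have h (S : Set ℝ) : lineInt S i (f + g) x = lineInt S i f x + lineInt S i g x :=
    integral_add (integrable_line hf.continuous hs S i x) (integrable_line hg.continuous hgs S i x)
  simp only [csInt, h, Pi.add_apply]
  ring

lemma csInt_smul (c : ℝ) (f : (Fin n → ℝ) → ℝ) (i : Fin n) :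
    csInt i (c • f) = c • csInt i f := by
  funext x
  have h (S : Set ℝ) : lineInt S i (c • f) x = c * lineInt S i f x :=
    integral_const_mul _ _
  simp only [csInt, h, Pi.smul_apply, smul_eq_mul]
  ring

/-- `mapS` requires a linear map on all smooth functions. Any linear extension will do, since it is
evaluated on compactly supported functions only. -/
lemma exists_csPrim (i : Fin n) : ∃ J : Sm n →ₗ[ℝ] Sm n, ∀ f ∈ csSm n, (J f).1 = csInt i f.1 := by
  let J0 : csSm n →ₗ[ℝ] Sm n :=
    { toFun := fun f => ⟨csInt i f.1.1, contDiff_csInt f.1.2 f.2 i⟩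
      map_add' := fun f g => Subtype.ext (csInt_add f.1.2 f.2 g.1.2 g.2 i)
      map_smul' := fun c f => Subtype.ext (csInt_smul c f.1.1 i) }
  obtain ⟨J, hJ⟩ := J0.exists_extend
  refine ⟨J, fun f hf => ?_⟩
  have := LinearMap.congr_fun hJ ⟨f, hf⟩
  exact congrArg Subtype.val this

/-! ### The Poincaré lemma for divergences -/

section
variable {p q : ℕ} {Y : Fock n}

lemma sum_d_th (f : Fock n) : ∑ c, d c (th c f) = (n : ℝ) • f - opP f := by
  simp only [d_th, Finset.sum_sub_distrib, opP_apply]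
  simp only [kd, if_true, one_smul, sum_const_smul]

/-- If `J` commutes with every derivative except the `i`-th, only one term of the divergence feels
the failure to commute. -/
lemma Db_mapS (J : Sm n →ₗ[ℝ] Sm n) (i : Fin n) (f : Fock n)
    (h : ∀ j, j ≠ i → del j (mapS J f) = mapS J (del j f)) :
    opDb (mapS J f) = mapS J (opDb f) + eta i • d i (del i (mapS J f) - mapS J (del i f)) := by
  simp only [opDb_apply, map_sum, map_smul, mapS_d]
  rw [← sub_eq_iff_eq_add', ← Finset.sum_sub_distrib, Finset.sum_eq_single i]
  · rw [← smul_sub, ← map_sub]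
  · intro j _ hj
    rw [h j hj, sub_self]
  · simp

lemma A_mapS (J : Sm n →ₗ[ℝ] Sm n) (f : Fock n) : opA (mapS J f) = mapS J (opA f) := by
  simp only [opA_apply, map_sum, map_smul, mapS_D]

lemma Homog.mapS {p q : ℝ} {f : Fock n} (hf : Homog p q f) (J : Sm n →ₗ[ℝ] Sm n) :
    Homog p q (mapS J f) := by
  constructor
  · rw [← map_smul, ← hf.1]
    simp only [opP_apply, map_sum, mapS_d, mapS_th]
  · rw [← map_smul, ← hf.2]
    simp only [opQ_apply, map_sum, mapS_D, mapS_u]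

/-- One coordinate at a time. With a primitive `Z` of `Y'` in the direction `i`, subtracting the
divergence of `eta i • th i Z` leaves `th i (d i W)`, which is annihilated by `th i` and still by
the `th k` treated before. A remainder annihilated by every `th i` vanishes, because `∑ d c th c` is
the number `n - p`, non-zero for `p < n`. Tracelessness is preserved because operators on scalars
commute with traces. -/
theorem exists_opDb_eq (hY : Homog (p : ℝ) (q : ℝ) Y) (hA : opA Y = 0) (hp : p < n)
    (h : opDb Y = 0) : ∃ X : Fock n, Homog ((p : ℝ) + 1) q X ∧ opA X = 0 ∧ opDb X = Y := by
  have key (s : Finset (Fin n)) : ∃ X Y' : Fock n, Homog ((p : ℝ) + 1) q X ∧ opA X = 0 ∧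
      Homog (p : ℝ) (q : ℝ) Y' ∧ opA Y' = 0 ∧ opDb Y' = 0 ∧ Y = opDb X + Y' ∧
      ∀ i ∈ s, th i Y' = 0 := by
    induction s using Finset.cons_induction with
    | empty =>
      refine ⟨0, Y, ?_, map_zero _, hY, hA, h, by simp, by simp⟩
      constructor <;> simp
    | cons i s hi ih =>
      obtain ⟨X, Y', hX, hXA, hY', hYA, hdY, hXY, hth⟩ := ih
      have e1 : del i (mapS (primS i) Y') = Y' := by
        ext1 p q b a; exact pdS_primS_self _ _
      have e2 : ∀ j, j ≠ i → del j (mapS (primS i) Y') = mapS (primS i) (del j Y') := by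
        intro j hj; ext1 p q b a; exact pdS_primS_of_ne hj _
      set Z := mapS (primS i) Y' with hZ
      set W := Y' - mapS (primS i) (del i Y') with hW
      have e3 : opDb Z = eta i • d i W := by
        rw [hZ, Db_mapS _ i _ e2, hdY, map_zero, zero_add, e1]
      have e4 : opDb (eta i • th i Z) = Y' - th i (d i W) := by
        rw [map_smul, Db_th, e3, smul_sub, map_smul, smul_smul, smul_smul, eta_mul_self, one_smul,
          one_smul, e1]
      have hW' : Homog (p : ℝ) q W := hY'.sub ((hY'.del i).mapS _)
      refine ⟨X + eta i • th i Z, th i (d i W), hX.add (((hY'.mapS _).th i).smul _), ?_, ?_, ?_, ?_,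
        ?_, ?_⟩
      · rw [map_add, map_smul, hXA, A_th, hZ, A_mapS, hYA, map_zero, map_zero, smul_zero, add_zero]
      · simpa using (hW'.d i).th i
      · rw [A_th, A_d, hW, map_sub, A_mapS, del_A, hYA]
        simp
      · have : th i (d i W) = Y' - opDb (eta i • th i Z) := by rw [e4]; abel
        rw [this, map_sub, hdY, Db_Db, sub_zero]
      · rw [hXY, map_add, e4]; abel
      · intro k hk
        by_cases hki : k = i
        · subst hki; exact eq_zero_of_eq_neg (th_th k k _)
        · have hk' : k ∈ s := (Finset.mem_cons.1 hk).resolve_left hki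
          have h1 : th k (d i W) = -d i (th k W) := by
            rw [d_th]; simp [kd, Ne.symm hki]
          have h2 : th k W = 0 := by
            rw [hW, map_sub, ← mapS_th, ← del_th, hth k hk']; simp
          rw [th_th, h1, h2]; simp
  obtain ⟨X, Y', hX, hXA, hY', -, -, hXY, hth⟩ := key Finset.univ
  have h0 := sum_d_th Y'
  simp only [hth _ (Finset.mem_univ _), map_zero, Finset.sum_const_zero] at h0
  rw [hY'.1, ← sub_smul, eq_comm, smul_eq_zero] at h0
  have hne : (n : ℝ) - p ≠ 0 := by
    rw [sub_ne_zero]; exact_mod_cast hp.ne'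
  refine ⟨X, hX, hXA, ?_⟩
  rw [hXY, h0.resolve_left hne, add_zero]

/-- As before, but the compactly supported primitive inverts the derivative from the left, so the
remainder is `d i (th i W)`. Now it is `∑ th c d c = p` that forces the final remainder to vanish,
whence the condition `0 < p`. -/
theorem exists_opDb_eq_cs (hY : Homog (p : ℝ) (q : ℝ) Y) (hA : opA Y = 0) (hp : 0 < p)
    (hc : Y ∈ cs n) (h : opDb Y = 0) :
    ∃ X : Fock n, Homog ((p : ℝ) + 1) q X ∧ opA X = 0 ∧ X ∈ cs n ∧ opDb X = Y := by
  choose J hJ using exists_csPrim (n := n)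
  have hJc (i : Fin n) {f : Fock n} (hf : f ∈ cs n) : mapS (J i) f ∈ cs n := by
    intro p q b a
    change HasCompactSupport (J i _).1
    rw [hJ i _ (hf p q b a)]
    exact hasCompactSupport_csInt (hf p q b a) i
  have key (s : Finset (Fin n)) : ∃ X Y' : Fock n, Homog ((p : ℝ) + 1) q X ∧ opA X = 0 ∧ X ∈ cs n ∧
      Homog (p : ℝ) (q : ℝ) Y' ∧ opA Y' = 0 ∧ Y' ∈ cs n ∧ opDb Y' = 0 ∧ Y = opDb X + Y' ∧
      ∀ i ∈ s, d i Y' = 0 := by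
    induction s using Finset.cons_induction with
    | empty =>
      refine ⟨0, Y, ?_, map_zero _, (cs n).zero_mem, hY, hA, hc, h, by simp, by simp⟩
      constructor <;> simp
    | cons i s hi ih =>
      obtain ⟨X, Y', hX, hXA, hXc, hY', hYA, hYc, hdY, hXY, hd⟩ := ih
      have e1 : mapS (J i) (del i Y') = Y' := by
        ext1 p q b a
        refine Subtype.ext ?_
        change (J i (pdS i (Y'.1 p q b a))).1 = _
        rw [hJ i (pdS i (Y'.1 p q b a)) (cs_del hYc i p q b a)]
        exact csInt_pd_self (Y'.1 p q b a).2 (hYc p q b a) i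
      have e2 : ∀ j, j ≠ i → del j (mapS (J i) Y') = mapS (J i) (del j Y') := by
        intro j hj; ext1 p q b a
        refine Subtype.ext ?_
        change pd j (J i (Y'.1 p q b a)).1 = (J i (pdS j (Y'.1 p q b a))).1
        rw [hJ i _ (hYc p q b a), hJ i (pdS j (Y'.1 p q b a)) (cs_del hYc j p q b a)]
        exact pd_csInt_of_ne (Y'.1 p q b a).2 (hYc p q b a) hj
      set Z := mapS (J i) Y' with hZ
      set W := Y' - del i Z with hW
      have hZc : Z ∈ cs n := hJc i hYc
      have e3 : opDb Z = -(eta i • d i W) := by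
        rw [hZ, Db_mapS _ i _ e2, hdY, map_zero, zero_add, e1, ← smul_neg, ← map_neg, neg_sub]
      have e4 : opDb (eta i • th i Z) = Y' - d i (th i W) := by
        rw [map_smul, Db_th, e3, smul_sub, map_neg, map_smul, smul_neg, smul_smul, smul_smul,
          eta_mul_self, one_smul, one_smul, d_th]
        simp only [kd, if_true, one_smul]
        rw [hW]; abel
      have hZh : Homog (p : ℝ) q Z := hY'.mapS _
      have hW' : Homog (p : ℝ) q W := hY'.sub (hZh.del i)
      have hWc : W ∈ cs n := (cs n).sub_mem hYc (cs_del hZc i)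
      refine ⟨X + eta i • th i Z, d i (th i W), hX.add ((hZh.th i).smul _), ?_,
        (cs n).add_mem hXc ((cs n).smul_mem _ (cs_th hZc i)), ?_, ?_, cs_d (cs_th hWc i) i, ?_,
        ?_, ?_⟩
      · rw [map_add, map_smul, hXA, A_th, hZ, A_mapS, hYA, map_zero, map_zero, smul_zero, add_zero]
      · simpa using (hW'.th i).d i
      · rw [A_d, A_th, hW, map_sub, del_A, hZ, A_mapS, hYA]
        simp
      · have : d i (th i W) = Y' - opDb (eta i • th i Z) := by rw [e4]; abel
        rw [this, map_sub, hdY, Db_Db, sub_zero]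
      · rw [hXY, map_add, e4]; abel
      · intro k hk
        by_cases hki : k = i
        · subst hki; exact eq_zero_of_eq_neg (d_d k k _)
        · have hk' : k ∈ s := (Finset.mem_cons.1 hk).resolve_left hki
          have h1 : d k (th i W) = -th i (d k W) := by
            rw [d_th]; simp [kd, hki]
          have h2 : d k W = 0 := by
            rw [hW, map_sub, ← del_d, hZ, ← mapS_d, hd k hk']; simp
          rw [d_d, h1, h2]; simp
  obtain ⟨X, Y', hX, hXA, hXc, hY', -, -, -, hXY, hd⟩ := key Finset.univ
  have h0 := opP_apply Y'
  simp only [hd _ (Finset.mem_univ _), map_zero, Finset.sum_const_zero] at h0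
  rw [hY'.1, smul_eq_zero] at h0
  have hne : (p : ℝ) ≠ 0 := by exact_mod_cast hp.ne'
  refine ⟨X, hX, hXA, hXc, ?_⟩
  rw [hXY, h0.resolve_left hne, add_zero]

end

end

end SpinDuality

namespace SpinDuality

noncomputable section

variable {n : ℕ}

/-! ### Normal ordering -/

lemma Da_M' (f : Fock n) : opDa (opM' f) = opM' (opDa f) + opGb f := by
  simp only [opM'_apply, opGb_apply, map_sum, map_smul, Da_th, Da_u, map_add, del_u, smul_add,
    Finset.sum_add_distrib, sum_eta_eta_smul]
lemma Da_A' (f : Fock n) : opDa (opA' f) = opA' (opDa f) + (2 : ℝ) • opGa f := by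
  simp only [opA'_apply, opGa_apply, map_sum, map_smul, Da_u, map_add, del_u, smul_add,
    Finset.sum_add_distrib, sum_eta_eta_smul, two_smul]
  abel
lemma Db_A' (f : Fock n) : opDb (opA' f) = opA' (opDb f) := by
  simp only [opA'_apply, map_sum, map_smul, Db_u]
lemma Ga_M' (f : Fock n) : opGa (opM' f) = opM' (opGa f) := by
  simp only [opM'_apply, map_sum, map_smul, Ga_th, Ga_u]
lemma Ga_A' (f : Fock n) : opGa (opA' f) = opA' (opGa f) := by
  simp only [opA'_apply, map_sum, map_smul, Ga_u]
lemma Gb_M' (f : Fock n) : opGb (opM' f) = -opM' (opGb f) := by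
  simp only [opM'_apply, map_sum, map_smul, Gb_th, Gb_u, map_neg, smul_neg, Finset.sum_neg_distrib]
lemma Gb_A' (f : Fock n) : opGb (opA' f) = opA' (opGb f) := by
  simp only [opA'_apply, map_sum, map_smul, Gb_u]
lemma Gb_Ga (f : Fock n) : opGb (opGa f) = opGa (opGb f) := by
  simp only [opGa_apply, map_sum, Gb_u, del_Gb]
lemma M'_A' (f : Fock n) : opM' (opA' f) = opA' (opM' f) := by
  simp only [opA'_apply, map_sum, map_smul, M'_u]

/-- Normal ordering of the algebraic operators. -/
lemma alg (f : Fock n) :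
    opA (opS f) = opS (opA f) + (2 : ℝ) • opM f ∧ opA (opR f) = opR (opA f) ∧
    opA (opM f) = opM (opA f) ∧ opA (opM' f) = opM' (opA f) + (2 : ℝ) • opR f ∧
    opA (opA' f) = opA' (opA f) + (4 : ℝ) • opQ f + (2 * n : ℝ) • f ∧
    opM (opM f) = 0 ∧ opM (opS f) = -opS (opM f) ∧ opM (opR f) = opA f - opR (opM f) ∧
    opM (opM' f) = (n : ℝ) • f + opQ f - opP f - opM' (opM f) ∧
    opM (opA' f) = opA' (opM f) + (2 : ℝ) • opS f ∧
    opS (opS f) = 0 ∧ opS (opR f) = opP f + opQ f - opR (opS f) ∧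
    opS (opA' f) = opA' (opS f) ∧ opS (opM' f) = opA' f - opM' (opS f) ∧ opR (opR f) = 0 ∧
    opR (opA' f) = opA' (opR f) + (2 : ℝ) • opM' f ∧ opR (opM' f) = -opM' (opR f) ∧
    opM' (opA' f) = opA' (opM' f) :=
  ⟨A_S f, A_R f, A_M f, A_M' f, A_A' f, M_M f, M_S f, M_R f, M_M' f, M_A' f, S_S f, S_R f, S_A' f,
    S_M' f, R_R f, R_A' f, R_M' f, M'_A' f⟩

/-- Commutation of the counting operators with the algebraic operators. -/
lemma algN (f : Fock n) :
    opP (opA f) = opA (opP f) ∧ opQ (opA f) = opA (opQ f) - (2 : ℝ) • opA f ∧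
    opP (opM f) = opM (opP f) - opM f ∧ opQ (opM f) = opM (opQ f) - opM f ∧
    opP (opS f) = opS (opP f) - opS f ∧ opQ (opS f) = opS (opQ f) + opS f ∧
    opP (opR f) = opR (opP f) + opR f ∧ opQ (opR f) = opR (opQ f) - opR f ∧
    opP (opM' f) = opM' (opP f) + opM' f ∧ opQ (opM' f) = opM' (opQ f) + opM' f ∧
    opP (opA' f) = opA' (opP f) ∧ opQ (opA' f) = opA' (opQ f) + (2 : ℝ) • opA' f :=
  ⟨P_A f, Q_A f, P_M f, Q_M f, P_S f, Q_S f, P_R f, Q_R f, P_M' f, Q_M' f, P_A' f, Q_A' f⟩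

/-- Normal ordering of the differential operators. -/
lemma algD (f : Fock n) :
    opA (opGa f) = opGa (opA f) + (2 : ℝ) • opDa f ∧ opA (opGb f) = opGb (opA f) ∧
    opA (opDa f) = opDa (opA f) ∧ opA (opDb f) = opDb (opA f) ∧
    opM (opGa f) = opGa (opM f) + opDb f ∧ opM (opGb f) = opDa f - opGb (opM f) ∧
    opM (opDa f) = opDa (opM f) ∧ opM (opDb f) = -opDb (opM f) ∧
    opS (opGa f) = opGa (opS f) ∧ opS (opGb f) = opGa f - opGb (opS f) ∧
    opS (opDa f) = opDa (opS f) - opDb f ∧ opS (opDb f) = -opDb (opS f) ∧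
    opR (opGa f) = opGa (opR f) + opGb f ∧ opR (opGb f) = -opGb (opR f) ∧
    opR (opDa f) = opDa (opR f) ∧ opR (opDb f) = opDa f - opDb (opR f) ∧
    opDb (opDb f) = 0 ∧ opDb (opGb f) = box f - opGb (opDb f) ∧
    opDb (opM' f) = opGa f - opM' (opDb f) ∧ opDb (opGa f) = opGa (opDb f) ∧
    opDb (opDa f) = opDa (opDb f) ∧ opDa (opGa f) = opGa (opDa f) + box f ∧
    opDa (opGb f) = opGb (opDa f) ∧ opGb (opGb f) = 0 ∧
    opDa (opM' f) = opM' (opDa f) + opGb f ∧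
    opDa (opA' f) = opA' (opDa f) + (2 : ℝ) • opGa f ∧ opDb (opA' f) = opA' (opDb f) ∧
    opGa (opM' f) = opM' (opGa f) ∧ opGa (opA' f) = opA' (opGa f) ∧
    opGb (opM' f) = -opM' (opGb f) ∧ opGb (opA' f) = opA' (opGb f) ∧
    opGb (opGa f) = opGa (opGb f) :=
  ⟨A_Ga f, A_Gb f, A_Da f, A_Db f, M_Ga f, M_Gb f, M_Da f, M_Db f, S_Ga f, S_Gb f, S_Da f, S_Db f,
    R_Ga f, R_Gb f, R_Da f, R_Db f, Db_Db f, Db_Gb f, Db_M' f, Db_Ga f, Db_Da f, Da_Ga f, Da_Gb f,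
    Gb_Gb f, Da_M' f, Da_A' f, Db_A' f, Ga_M' f, Ga_A' f, Gb_M' f, Gb_A' f, Gb_Ga f⟩

/-! ### The map from `B` to `Y` and its inverse -/

/-- The map `B ↦ Y`. -/
def yF (Q : ℝ) (B : Fock n) : Fock n :=
  (1 / (2 * Q)) • (B - opR (opS B) + opM' (opR (opS (opM B)) + opM B))

/-- The inverse map `Y ↦ B`. -/
def xF (Q : ℝ) (Y : Fock n) : Fock n :=
  (2 * Q) • (Y - (1 / (Q + 1)) • opR (opS Y)
    - (1 / (n + Q - 3)) • (opM' (opM Y) - (1 / (Q + 1)) • opR (opS (opM' (opM Y)))))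

section
variable {Q : ℝ} {f g : Fock n}

lemma Homog.yF (h : Homog 2 Q f) : Homog 2 Q (yF Q f) := by
  have h1 : Homog 2 Q (opR (opS f)) := by simpa using h.S.R
  have h2 := h.M
  have h3 : Homog (2 - 1) (Q - 1) (opR (opS (opM f))) := by simpa using h2.S.R
  have h4 : Homog 2 Q (opM' (opR (opS (opM f)) + opM f)) := by simpa using (h3.add h2).M'
  exact ((h.sub h1).add h4).smul _

lemma Homog.xF (h : Homog 2 Q f) : Homog 2 Q (xF Q f) := by
  have h1 : Homog 2 Q (opR (opS f)) := by simpa using h.S.R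
  have h2 : Homog 2 Q (opM' (opM f)) := by simpa using h.M.M'
  have h3 : Homog 2 Q (opR (opS (opM' (opM f)))) := by simpa using h2.S.R
  exact ((h.sub (h1.smul _)).sub ((h2.sub (h3.smul _)).smul _)).smul _

lemma A_yF (hA : opA f = 0) : opA (yF Q f) = 0 := by
  -- The rules `alg` and `algN` order every word as `opA'`, `opM'`, `opR`, `opS`, `opM`, `opA` from
  -- left to right. Trace conditions then act directly on `f`, and only scalar coefficients remain
  -- to be compared.
  simp only [yF, map_smul, map_add, map_sub, map_neg, alg, algN, hA, map_zero, smul_zero]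
  module

lemma A_xF (h : Homog 2 Q f) (hA : opA f = 0) (hQ : 0 < Q) (hn : (4 : ℝ) ≤ n) : opA (xF Q f) = 0 := by
  have h2 : Q + 1 ≠ 0 := by positivity
  have h3 : (n : ℝ) + Q - 3 ≠ 0 := by linarith
  simp only [xF, map_smul, map_add, map_sub, map_neg, alg, algN, hA, h.1, h.2, map_zero, smul_zero]
  match_scalars
  field_simp
  ring

/-- On bidegree `(2, Q)` the operator `opR ∘ opS` squares to `Q + 2` times itself, so `1 - opR opS`
has the inverse `1 - opR opS/(Q+1)`. The map `xF` is `2Q` times this inverse composed with `1 - opM'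
opM/(n+Q-3)`, which undoes the trace terms. -/
lemma xF_yF (h : Homog 2 Q f) (hA : opA f = 0) (hQ : 0 < Q) (hn : (4 : ℝ) ≤ n) :
    xF Q (yF Q f) = f := by
  have h1 : Q ≠ 0 := hQ.ne'
  have h2 : Q + 1 ≠ 0 := by positivity
  have h3 : (n : ℝ) + Q - 3 ≠ 0 := by linarith
  simp only [xF, yF, map_smul, map_add, map_sub, map_neg, alg, algN, hA, h.1, h.2, map_zero, smul_zero]
  match_scalars <;> field_simp <;> ring

lemma yF_xF (h : Homog 2 Q f) (hA : opA f = 0) (hQ : 0 < Q) (hn : (4 : ℝ) ≤ n) :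
    yF Q (xF Q f) = f := by
  have h1 : Q ≠ 0 := hQ.ne'
  have h2 : Q + 1 ≠ 0 := by positivity
  have h3 : (n : ℝ) + Q - 3 ≠ 0 := by linarith
  simp only [xF, yF, map_smul, map_add, map_sub, map_neg, alg, algN, hA, h.1, h.2, map_zero, smul_zero]
  match_scalars <;> field_simp <;> ring

end

end

end SpinDuality

namespace SpinDuality

noncomputable section

variable {n p q : ℕ}

/-! ### Contractions with fields of definite symmetry -/

lemma contr_comm (S T : Ten n p q) : contr S T = contr T S := by
  funext x
  simp only [contr]
  exact Finset.sum_congr rfl fun b _ => Finset.sum_congr rfl fun a _ => by ring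

lemma contr_add_left (S S' T : Ten n p q) : contr (S + S') T = contr S T + contr S' T := by
  funext x
  simp only [contr, Pi.add_apply, ← Finset.sum_add_distrib]
  exact Finset.sum_congr rfl fun b _ => Finset.sum_congr rfl fun a _ => by ring

lemma contr_smul_left (c : ℝ) (S T : Ten n p q) : contr (c • S) T = c • contr S T := by
  funext x
  simp only [contr, Pi.smul_apply, smul_eq_mul, Finset.mul_sum]
  exact Finset.sum_congr rfl fun b _ => Finset.sum_congr rfl fun a _ => by ring

lemma contr_smul_right (c : ℝ) (S T : Ten n p q) : contr S (c • T) = c • contr S T := by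
  rw [contr_comm, contr_smul_left, contr_comm]

lemma contr_sum_left {ι : Type*} (s : Finset ι) (S : ι → Ten n p q) (T : Ten n p q) (x) :
    contr (∑ i ∈ s, S i) T x = ∑ i ∈ s, contr (S i) T x := by
  induction s using Finset.cons_induction with
  | empty => simp [contr]
  | cons i s hi ih =>
    rw [Finset.sum_cons, Finset.sum_cons, contr_add_left, Pi.add_apply, ih]

lemma contr_perm_left (X : Ten n p q) (f : Fock n) (σ : Equiv.Perm (Fin p)) (x) :
    contr (fun b a x => ((Equiv.Perm.sign σ : ℤ) : ℝ) * X (b ∘ σ) a x) (ev p q f) x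
      = contr X (ev p q f) x := by
  simp only [contr]
  rw [← Equiv.sum_comp (Equiv.arrowCongr σ.symm (Equiv.refl (Fin n)))
    (fun b => ∑ a : Fin q → Fin n, (∏ i, eta (b i)) * (∏ j, eta (a j)) * X b a x * ev p q f b a x)]
  refine Finset.sum_congr rfl fun b _ => Finset.sum_congr rfl fun a _ => ?_
  have h : (Equiv.arrowCongr σ.symm (Equiv.refl (Fin n))) b = b ∘ σ := rfl
  rw [h, ev_perm_left, show ∏ i, eta ((b ∘ σ) i) = ∏ i, eta (b i) from
    Equiv.prod_comp σ fun i => eta (b i)]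
  ring

lemma contr_perm_right (X : Ten n p q) (f : Fock n) (τ : Equiv.Perm (Fin q)) (x) :
    contr (fun b a x => X b (a ∘ τ) x) (ev p q f) x = contr X (ev p q f) x := by
  simp only [contr]
  refine Finset.sum_congr rfl fun b _ => ?_
  rw [← Equiv.sum_comp (Equiv.arrowCongr τ.symm (Equiv.refl (Fin n)))
    (fun a => (∏ i, eta (b i)) * (∏ j, eta (a j)) * X b a x * ev p q f b a x)]
  refine Finset.sum_congr rfl fun a _ => ?_
  have h : (Equiv.arrowCongr τ.symm (Equiv.refl (Fin n))) a = a ∘ τ := rfl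
  rw [h, ev_perm_right, show ∏ i, eta ((a ∘ τ) i) = ∏ i, eta (a i) from
    Equiv.prod_comp τ fun i => eta (a i)]

/-- Antisymmetrization is an orthogonal projection. It may thus be inserted in front of the factors
without definite symmetry, such as `swap B`, that occur in the Lagrangians. -/
lemma contr_asym (X : Ten n p q) (f : Fock n) :
    contr (asym X) (ev p q f) = contr X (ev p q f) := by
  funext x
  have h : asym X = (1 / (p.factorial : ℝ)) • ∑ σ : Equiv.Perm (Fin p),
      (fun b a x => ((Equiv.Perm.sign σ : ℤ) : ℝ) * X (b ∘ σ) a x : Ten n p q) := by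
    funext b a x
    simp only [asym, Pi.smul_apply, Finset.sum_apply, smul_eq_mul]
  rw [h, contr_smul_left, Pi.smul_apply, contr_sum_left]
  simp only [contr_perm_left, Finset.sum_const, Finset.card_univ, Fintype.card_perm,
    Fintype.card_fin, nsmul_eq_mul, smul_eq_mul]
  have := Nat.factorial_ne_zero p
  field_simp

lemma contr_sym (X : Ten n p q) (f : Fock n) :
    contr (sym X) (ev p q f) = contr X (ev p q f) := by
  funext x
  have h : sym X = (1 / (q.factorial : ℝ)) • ∑ τ : Equiv.Perm (Fin q),
      (fun b a x => X b (a ∘ τ) x : Ten n p q) := by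
    funext b a x
    simp only [sym, Pi.smul_apply, Finset.sum_apply, smul_eq_mul]
  rw [h, contr_smul_left, Pi.smul_apply, contr_sum_left]
  simp only [contr_perm_right, Finset.sum_const, Finset.card_univ, Fintype.card_perm,
    Fintype.card_fin, nsmul_eq_mul, smul_eq_mul]
  have := Nat.factorial_ne_zero q
  field_simp

lemma asym_one (T : Ten n 1 q) : asym T = T := by
  funext b a x
  simp only [asym]
  rw [Fintype.sum_unique]
  simp

/-! ### The Lagrangians in terms of the operators -/

section
variable {f e : Fock n}

/-- The factor `q` keeps spin two (`q = 0`) in the statement: there `swap` is zero, and so is `opR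
(opS f) - f`. -/
lemma sym_swap_ev_one (hf : Homog ((1 : ℕ) : ℝ) (q : ℝ) f) :
    (q : ℝ) • sym (swap (ev 1 q f)) = ev 1 q (opR (opS f) - f) := by
  cases q with
  | zero =>
    have h1 : opR f = 0 := hf.R.eq_zero (Or.inr (by norm_num))
    have h2 := S_R f
    rw [hf.1, hf.2, h1, map_zero] at h2
    have h3 : opR (opS f) = f := by
      rw [← sub_eq_zero, ← neg_eq_zero, neg_sub, h2]; push_cast; module
    rw [h3, sub_self, ev_zero]
    simp
  | succ q =>
    have h := asym_sym_swap_ev 0 q f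
    rw [asym_one] at h
    rw [h, hf.1, smul_smul]
    have : (q : ℝ) + 1 ≠ 0 := by positivity
    push_cast
    rw [zero_add, one_mul, mul_one_div_cancel this, one_smul, one_smul]

/-- The coefficient `s - 2` is `q`, exactly the factor that `sym_swap_ev_one` needs; the two trace
terms of `Y` thus merge into one operator expression valid for all spins. -/
lemma sym_trace_comb (hf : Homog 2 ((q : ℝ) + 1) f) :
    sym ((2 : ℝ) • ev 1 q (opM f) + (((q + 2 : ℕ) : ℝ) - 2) • swap (ev 1 q (opM f)))
      = ev 1 q (opR (opS (opM f)) + opM f) := by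
  have hM : Homog ((1 : ℕ) : ℝ) (q : ℝ) (opM f) := by
    have := hf.M
    norm_num at this
    simpa using this
  have h2 : (((q + 2 : ℕ) : ℝ) - 2) = q := by push_cast; ring
  rw [sym_add, sym_smul, sym_smul, sym_ev, h2, sym_swap_ev_one hM]
  rw [← ev_smul, ← ev_add]
  congr 1
  module

lemma yOfB_ev (hf : Homog 2 ((q : ℝ) + 1) f) :
    yOfB (q + 2) (ev 2 (q + 1) f : Ten n 2 (q + 2 - 1)) = ev 2 (q + 1) (yF ((q : ℝ) + 1) f) := by
  have h1 := sym_trace_comb hf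
  have hQ : (q : ℝ) + 1 ≠ 0 := by positivity
  have h2 := asym_sym_swap_ev 1 q f
  have h3 := asym_sym_etaMix_ev 1 q (opR (opS (opM f)) + opM f)
  rw [← h1, sym_etaMix_sym] at h3
  have hs : ((q + 2 : ℕ) : ℝ) - 1 = (q : ℝ) + 1 := by push_cast; ring
  have hM : trM (ev 2 (q + 1) f) = ev 1 q (opM f) := trM_ev (by push_cast; exact hf)
  have key : yOfB (q + 2) (ev 2 (q + 1) f : Ten n 2 (q + 2 - 1)) =
    asym (sym (-swap (ev 2 (q + 1) f) - (1 / (2 * ((q : ℝ) + 1))) • ev 2 (q + 1) f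
    + etaMix (p := 1 + 1) (q := q + 1) ((2 : ℝ) • ev 1 q (opM f)
      + (((q + 2 : ℕ) : ℝ) - 2) • swap (ev 1 q (opM f))))) := by
    rw [← hs]
    exact congrArg (fun W : Ten n 1 q => asym (sym (-swap (ev 2 (q + 1) f)
      - (1 / (2 * (((q + 2 : ℕ) : ℝ) - 1))) • ev 2 (q + 1) f
      + etaMix (p := 1 + 1) (q := q + 1) ((2 : ℝ) • W + (((q + 2 : ℕ) : ℝ) - 2) • swap W)))) hM
  rw [key, sym_add, asym_add, h3, sym_sub, asym_sub, sym_neg, asym_neg, h2, sym_smul, asym_smul,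
    sym_ev, asym_ev, ← ev_smul, ← ev_smul, ← ev_smul, ← ev_neg, ← ev_sub, ← ev_add, yF, hf.1]
  congr 1
  push_cast
  match_scalars <;> field_simp <;> ring

lemma contr_trace_comb (hf : Homog 2 ((q : ℝ) + 1) f) (g : Fock n) (x) :
    contr ((2 : ℝ) • ev 1 q (opM f) + (((q + 2 : ℕ) : ℝ) - 2) • swap (ev 1 q (opM f)))
      (ev 1 q g) x = q.factorial * pair (opR (opS (opM f)) + opM f) g x := by
  have hM : Homog ((1 : ℕ) : ℝ) (q : ℝ) (opR (opS (opM f)) + opM f) := by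
    have h := hf.M
    norm_num at h
    have h2 := h.S.R
    norm_num at h2
    simpa using h2.add h
  rw [← contr_sym, sym_trace_comb hf, contr_ev hM]
  simp

lemma contr_swap_ev (hf : Homog 2 ((q : ℝ) + 1) f) (g : Fock n) (x) :
    contr (swap (ev 2 (q + 1) f)) (ev 2 (q + 1) g) x
      = q.factorial * pair (opR (opS f) - (2 : ℝ) • f) g x := by
  have h1 : Homog ((2 : ℕ) : ℝ) ((q + 1 : ℕ) : ℝ) (opR (opS f) - (2 : ℝ) • f) := by
    have h2 := hf.S.R
    norm_num at h2
    push_cast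
    exact h2.sub (hf.smul _)
  have hQ : (q : ℝ) + 1 ≠ 0 := by positivity
  rw [← contr_sym, ← contr_asym, asym_sym_swap_ev 1 q f, hf.1, contr_smul_left, Pi.smul_apply,
    contr_ev h1, Nat.factorial_succ q]
  push_cast
  simp
  field_simp
  ring

/-- The parent Lagrangian as a function on families. -/
def parentF (q : ℕ) (e Y : Fock n) (x : Fin n → ℝ) : ℝ :=
  ((q + 1).factorial : ℝ) * (2 * pair Y (opGb e) x - pair Y (xF ((q : ℝ) + 1) Y) x)

/-- Moving the mixed trace off `K` by adjunction collects both contractions into `4⟨yF B, K⟩`, and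
`K` is `Gb e / 2 - B / 4`. -/
lemma vasiliev_ev (he : Homog 1 ((q : ℝ) + 1) e) (hf : Homog 2 ((q : ℝ) + 1) f) (x) :
    vasilievLagrangian (q + 2) (ev 1 (q + 1) e : Ten n 1 (q + 2 - 1))
      (ev 2 (q + 1) f : Ten n 2 (q + 2 - 1)) x
    = ((q + 1).factorial : ℝ) * (2 * pair (yF ((q : ℝ) + 1) f) (opGb e) x
      - pair (yF ((q : ℝ) + 1) f) f x) := by
  have hs : ((q + 2 : ℕ) : ℝ) - 1 = (q : ℝ) + 1 := by push_cast; ring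
  have hQ : (q : ℝ) + 1 ≠ 0 := by positivity
  set K : Fock n := (1 / 2 : ℝ) • opGb e - (1 / 4 : ℝ) • f with hK
  have hKh : Homog 2 ((q : ℝ) + 1) K := by
    have := he.Gb
    norm_num at this
    exact (this.smul _).sub (hf.smul _)
  have hK' : asym (grad (p := 2) (ev 1 (q + 1) e)) - (1 / 4 : ℝ) • ev 2 (q + 1) f
      = ev 2 (q + 1) K := by
    rw [asym_grad_ev 1 (q + 1) e, hK, ev_sub, ev_smul, ev_smul]
    norm_num
  have key : vasilievLagrangian (q + 2) (ev 1 (q + 1) e : Ten n 1 (q + 2 - 1))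
      (ev 2 (q + 1) f : Ten n 2 (q + 2 - 1)) x = (-2) *
      (contr (swap (ev 2 (q + 1) f) + (1 / (2 * ((q : ℝ) + 1))) • ev 2 (q + 1) f) (ev 2 (q + 1) K) x
    - contr ((2 : ℝ) • ev 1 q (opM f)
      + (((q + 2 : ℕ) : ℝ) - 2) • swap (ev 1 q (opM f))) (ev 1 q (opM K)) x) := by
    rw [← hs]
    have h1 : trM (ev 2 (q + 1) K) = ev 1 q (opM K) := trM_ev (by push_cast; exact hKh)
    have h2 : trM (ev 2 (q + 1) f) = ev 1 q (opM f) := trM_ev (by push_cast; exact hf)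
    rw [← hK'] at h1 ⊢
    exact congrArg₂ (fun W W' : Ten n 1 q => (-2) *
      (contr (swap (ev 2 (q + 1) f) + (1 / (2 * (((q + 2 : ℕ) : ℝ) - 1))) • ev 2 (q + 1) f)
        (asym (grad (p := 2) (ev 1 (q + 1) e)) - (1 / 4 : ℝ) • ev 2 (q + 1) f) x
    - contr ((2 : ℝ) • W + (((q + 2 : ℕ) : ℝ) - 2) • swap W) W' x)) h2 h1
  have hf' : Homog ((2 : ℕ) : ℝ) ((q + 1 : ℕ) : ℝ) f := by push_cast; exact hf
  rw [key, contr_trace_comb hf, contr_add_left, contr_smul_left, Pi.add_apply, Pi.smul_apply,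
    contr_ev hf', contr_swap_ev hf, ← pair_M'_left]
  have h2 : pair (yF ((q : ℝ) + 1) f) K x = 1 / 2 * pair (yF ((q : ℝ) + 1) f) (opGb e) x
      - 1 / 4 * pair (yF ((q : ℝ) + 1) f) f x := by
    rw [hK, pair_sub_right, pair_smul_right, pair_smul_right]
  have h3 : 2 * pair (yF ((q : ℝ) + 1) f) (opGb e) x - pair (yF ((q : ℝ) + 1) f) f x
     = 4 * pair (yF ((q : ℝ) + 1) f) K x := by rw [h2]; ring
  rw [h3, yF]
  simp only [pair_smul_left, pair_add_left, pair_sub_left, map_add, Nat.factorial_succ]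
  simp
  field_simp
  ring

/-- Tracelessness of `f` removes the image of `opA'` that arises when `opS` passes `opM'`. The
result is manifestly symmetric in `f` and `g`, which is the source of `pair_xF_symm`. -/
lemma pair_xF {Q : ℝ} (hA : opA f = 0) (g : Fock n) (x) :
    pair f (xF Q g) x = (2 * Q) * (pair f g x - (1 / (Q + 1)) * pair (opS f) (opS g) x
      - (1 / (n + Q - 3)) * (pair (opM f) (opM g) x - (1 / (Q + 1))
        * (2 * pair (opM f) (opM g) x + pair (opS (opM f)) (opS (opM g)) x))) := by
  have e6 : pair f (opM' (opR (opS (opM g)))) x = pair (opS (opM f)) (opS (opM g)) x := by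
    rw [← pair_M_left, ← pair_S_left]
  have e7 : pair f (opM' (opM g)) x = pair (opM f) (opM g) x := by
    rw [← pair_M_left]
  have e8 : pair f (opR (opA' (opM g))) x = 2 * pair (opM f) (opM g) x := by
    rw [R_A', pair_add_right, pair_smul_right, e7, ← pair_A_left, hA, pair_zero_left, zero_add]
  rw [xF]
  simp only [pair_smul_right, pair_sub_right, S_M', R_M', map_sub, sub_neg_eq_add,
    pair_add_right, e6, e7, e8, ← pair_S_left f (opS g)]

lemma pair_xF_symm {Q : ℝ} {g : Fock n} (hA : opA f = 0) (hA' : opA g = 0) (x) :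
    pair f (xF Q g) x = pair g (xF Q f) x := by
  rw [pair_xF hA, pair_xF hA', pair_comm f g, pair_comm (opS f), pair_comm (opM f),
    pair_comm (opS (opM f))]

/-- The quadratic part of the parent Lagrangian is `-⟨Y, xF Y⟩` up to the factorial: it arises by
substituting `B = xF Y` in `⟨yF B, B⟩`, and the expansion `pair_xF` reproduces its coefficients. -/
lemma parent_ev (e : Fock n) (hf : Homog 2 ((q : ℝ) + 1) f) (hA : opA f = 0)
    (hn : (4 : ℝ) ≤ n) (x) :
    parentLagrangian (q + 2) (ev 1 (q + 1) e : Ten n 1 (q + 2 - 1))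
      (ev 2 (q + 1) f : Ten n 2 (q + 2 - 1)) x = parentF q e f x := by
  have hs : ((q + 2 : ℕ) : ℝ) = (q : ℝ) + 2 := by push_cast; ring
  have hQ : (q : ℝ) + 1 ≠ 0 := by positivity
  have hQ2 : (q : ℝ) + 2 ≠ 0 := by positivity
  have hN : (n : ℝ) + q - 2 ≠ 0 := by
    have : (0 : ℝ) ≤ q := Nat.cast_nonneg q
    linarith
  have hM : Homog ((1 : ℕ) : ℝ) (q : ℝ) (opM f) := by
    have := hf.M
    norm_num at this
    simpa using this
  have hf' : Homog ((2 : ℕ) : ℝ) ((q + 1 : ℕ) : ℝ) f := by push_cast; exact hf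
  have h1 : trM (ev 2 (q + 1) f) = ev 1 q (opM f) := trM_ev hf'
  have h2 : (q : ℝ) * contr (ev 1 q (opM f)) (swap (ev 1 q (opM f))) x
      = q.factorial * (pair (opR (opS (opM f))) (opM f) x - pair (opM f) (opM f) x) := by
    have h := sym_swap_ev_one hM
    have hM2 : Homog ((1 : ℕ) : ℝ) (q : ℝ) (opR (opS (opM f)) - opM f) := by
      have h2 := hM.S.R
      norm_num at h2
      rw [Nat.cast_one]
      exact h2.sub (by simpa using hM)
    rw [contr_comm, ← contr_sym]
    have h3 := contr_ev hM2 (opM f) x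
    rw [← h, contr_smul_left, Pi.smul_apply, smul_eq_mul] at h3
    refine h3.trans ?_
    rw [pair_sub_left]; simp
  have key : parentLagrangian (q + 2) (ev 1 (q + 1) e : Ten n 1 (q + 2 - 1))
      (ev 2 (q + 1) f : Ten n 2 (q + 2 - 1)) x = (-2) *
      (-contr (ev 2 (q + 1) f) (asym (grad (p := 2) (ev 1 (q + 1) e))) x
      + ((((q : ℝ) + 1)) ^ 2 / (q + 2)) * (-contr (ev 2 (q + 1) f) (swap (ev 2 (q + 1) f)) x
    + ((q : ℝ) / (2 * (q + 1))) * contr (ev 2 (q + 1) f) (ev 2 (q + 1) f) x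
    + (1 / ((n : ℝ) + q - 2)) * (-(((q : ℝ) - 1) * contr (ev 1 q (opM f))
       (ev 1 q (opM f)) x)
      + (q : ℝ) * contr (ev 1 q (opM f)) (swap (ev 1 q (opM f))) x))) := by
    have e1 : (q : ℝ) + 1 = ((q + 2 : ℕ) : ℝ) - 1 := by push_cast; ring
    have e2 : (q : ℝ) + 2 = ((q + 2 : ℕ) : ℝ) := by push_cast; ring
    have e3 : (q : ℝ) = ((q + 2 : ℕ) : ℝ) - 2 := by push_cast; ring
    have e4 : (n : ℝ) + q - 2 = (n : ℝ) + ((q + 2 : ℕ) : ℝ) - 4 := by push_cast; ring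
    have e5 : (q : ℝ) - 1 = ((q + 2 : ℕ) : ℝ) - 3 := by push_cast; ring
    rw [e4, e5, e1, e2, e3]
    exact congrArg (fun W : Ten n 1 q => (-2) *
      (-contr (ev 2 (q + 1) f) (asym (grad (p := 2) (ev 1 (q + 1) e))) x
      + (((((q + 2 : ℕ) : ℝ) - 1)) ^ 2 / ((q + 2 : ℕ) : ℝ)) *
      (-contr (ev 2 (q + 1) f) (swap (ev 2 (q + 1) f)) x
    + ((((q + 2 : ℕ) : ℝ) - 2) / (2 * (((q + 2 : ℕ) : ℝ) - 1)))
      * contr (ev 2 (q + 1) f) (ev 2 (q + 1) f) x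
    + (1 / ((n : ℝ) + ((q + 2 : ℕ) : ℝ) - 4)) * (-((((q + 2 : ℕ) : ℝ) - 3) * contr W W x)
      + (((q + 2 : ℕ) : ℝ) - 2) * contr W (swap W) x)))) h1
  rw [key, asym_grad_ev 1 (q + 1) e, contr_smul_right, Pi.smul_apply, contr_ev hf', contr_comm,
    contr_swap_ev hf, contr_ev hf', contr_ev hM, h2]
  have e1 : pair (opR (opS f)) f x = pair (opS f) (opS f) x := pair_R_left _ _ _
  have e2 : pair (opR (opS (opM f))) (opM f) x = pair (opS (opM f)) (opS (opM f)) x :=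
    pair_R_left _ _ _
  rw [parentF, pair_xF hA, pair_sub_left, pair_smul_left, e1, e2,
    show (q : ℝ) + 1 + 1 = q + 2 by ring, show (n : ℝ) + (q + 1) - 3 = n + q - 2 by ring]
  simp only [Nat.factorial_succ]
  simp
  field_simp
  ring

end

end

end SpinDuality

namespace SpinDuality

noncomputable section

variable {n p q : ℕ}

/-! ### Tensor classes and families -/

lemma trA_ev_eq_zero {f : Fock n} (hf : Homog (p : ℝ) (q : ℝ) f) :
    trA (ev p q f) = 0 ↔ opA f = 0 := by
  rw [trA_ev hf]
  match q with
  | 0 =>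
    have := hf.A.eq_zero (Or.inr (by norm_num))
    simp [this, ev_zero]
  | 1 =>
    have := hf.A.eq_zero (Or.inr (by norm_num))
    simp [this, ev_zero]
  | q + 2 =>
    refine ev_eq_zero (p := p) (q := q) ?_
    have := hf.A
    push_cast at this
    simpa using this

lemma trM_ev_eq_zero {f : Fock n} (hf : Homog (p : ℝ) (q : ℝ) f) :
    trM (ev p q f) = 0 ↔ opM f = 0 := by
  rw [trM_ev hf]
  match p, q with
  | 0, _ =>
    have := hf.M.eq_zero (Or.inl (by norm_num))
    simp [this, ev_zero]
  | _ + 1, 0 =>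
    have := hf.M.eq_zero (Or.inr (by norm_num))
    simp [this, ev_zero]
  | p + 1, q + 1 =>
    refine ev_eq_zero (p := p) (q := q) ?_
    have := hf.M
    push_cast at this
    simpa using this

lemma divB_ev_eq_zero {f : Fock n} (hf : Homog ((p + 1 : ℕ) : ℝ) (q : ℝ) f) :
    divB (ev (p + 1) q f) = 0 ↔ opDb f = 0 := by
  rw [divB_ev hf]
  refine ev_eq_zero (p := p) (q := q) ?_
  have := hf.Db
  push_cast at this
  simpa using this

lemma isTracelessForm_ev {f : Fock n} (hf : Homog (p : ℝ) (q : ℝ) f) (hA : opA f = 0) :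
    IsTracelessForm (ev p q f) :=
  ⟨isSmooth_ev _ _ _, isBiSym_ev _ _ _, (trA_ev_eq_zero hf).2 hA⟩

lemma IsTracelessForm.exists_ev {F : Ten n p q} (h : IsTracelessForm F) :
    ∃ f : Fock n, Homog (p : ℝ) (q : ℝ) f ∧ opA f = 0 ∧ ev p q f = F := by
  obtain ⟨f, hf, rfl⟩ := SpinDuality.exists_ev h.1 h.2.1
  exact ⟨f, hf, (trA_ev_eq_zero hf).1 h.2.2, rfl⟩

lemma isVariation_ev {f : Fock n} (hf : Homog (p : ℝ) (q : ℝ) f) (hA : opA f = 0)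
    (hc : f ∈ cs n) : IsVariation (ev p q f) :=
  ⟨isTracelessForm_ev hf hA, isCompactlySupported_ev hc⟩

lemma IsVariation.exists_ev {F : Ten n p q} (h : IsVariation F) :
    ∃ f : Fock n, Homog (p : ℝ) (q : ℝ) f ∧ opA f = 0 ∧ f ∈ cs n ∧ ev p q f = F := by
  obtain ⟨f, hf, hA, rfl⟩ := h.1.exists_ev
  exact ⟨f, hf, hA, mem_cs_of_ev hf h.2, rfl⟩

lemma isHook_ev {f : Fock n} (hf : Homog 1 ((q : ℝ) + 1) f) :
    IsHook (q + 2) (ev 1 (q + 1) f : Ten n 1 (q + 2 - 1)) ↔ opS f = 0 ∧ opA f = 0 := by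
  have hf' : Homog ((1 : ℕ) : ℝ) ((q + 1 : ℕ) : ℝ) f := by push_cast; exact hf
  have h1 : symPart (q + 2) (ev 1 (q + 1) f : Ten n 1 (q + 2 - 1)) = 0 ↔ opS f = 0 := by
    have h := symPart_ev (q + 1) f
    have hS : Homog ((0 : ℕ) : ℝ) ((q + 1 + 1 : ℕ) : ℝ) (opS f) := by
      have := hf'.S
      push_cast at this ⊢
      simpa using this
    have hne : (1 / (((q + 1 : ℕ) : ℝ) + 1)) ≠ 0 := by positivity
    rw [← ev_eq_zero hS]
    constructor
    · intro h0
      have h2 := h.symm.trans h0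
      rwa [smul_eq_zero_iff_right hne] at h2
    · intro h0
      exact h.trans (by rw [h0, smul_zero])
  constructor
  · rintro ⟨-, hS, -, hA⟩
    exact ⟨h1.1 hS, (trA_ev_eq_zero hf').1 hA⟩
  · rintro ⟨hS, hA⟩
    -- The mixed trace condition is automatic, since the commutator of `opA` with `opS` is `2 opM`.
    have hM : opM f = 0 := by
      have h := A_S f
      rw [hS, hA, map_zero, map_zero, zero_add] at h
      simpa using h.symm
    exact ⟨isBiSym_ev _ _ _, h1.2 hS, (trM_ev_eq_zero hf').2 hM, (trA_ev_eq_zero hf').2 hA⟩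

/-! ### Generalized spin connections -/

/-- A connection with given `B`. -/
def omegaF (Q : ℝ) (B : Fock n) (μ : Fin n) : Fock n :=
  -- The terms of the first line built from `d μ B` and `D μ (opS B)` already antisymmetrize to `B`
  -- and satisfy the hook condition. The other terms cancel under antisymmetrization in `μ`; `a` and
  -- `a2` are chosen so that they preserve the hook condition and remove the trace.
  let a : ℝ := -1 / (2 * Q * (n + Q - 2))
  let a2 : ℝ := -a * (4 * Q - 8 + 2 * n) / (2 * n - 4)
  let W := opM B
  let V := opS (opM B)
  (1 / 2 : ℝ) • d μ B - (1 / (2 * Q)) • (opR (opS (d μ B)) - D μ (opS B))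
    - ((Q - 2) * a * eta μ) • u μ W + (a2 * eta μ) • u μ (opR V)
    + (((Q - 2) * a - Q * a2) * eta μ) • th μ V
    + a • opA' (D μ W) + a • opA' (opR (d μ W)) + (4 * a / (2 * n - 4)) • opA' (opR (D μ V))
    - ((Q - 2) * a) • opM' (d μ W) + a2 • opM' (D μ V)

/-! ### The connection attached to `B`: hook condition, tracelessness and antisymmetrization. -/

section omega
variable {Q : ℝ} {f : Fock n} (h : Homog 2 Q f)
include h

lemma omegaF_homog (μ : Fin n) : Homog 1 Q (omegaF Q f μ) := by
  have hd : Homog 1 Q (d μ f) := by have := h.d μ; norm_num at this; exact this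
  have hSd : Homog 1 Q (opR (opS (d μ f))) := by have := hd.S.R; norm_num at this; exact this
  have hDS : Homog 1 Q (D μ (opS f)) := by have := h.S.D μ; norm_num at this; exact this
  have hW : Homog 1 (Q - 1) (opM f) := by have := h.M; norm_num at this; exact this
  have hV : Homog 0 Q (opS (opM f)) := by have := hW.S; norm_num at this; exact this
  have t1 : Homog 1 Q (u μ (opM f)) := by have := hW.u μ; norm_num at this; exact this
  have t2 : Homog 1 Q (u μ (opR (opS (opM f)))) := by
    have := hV.R.u μ; norm_num at this; exact this
  have t3 : Homog 1 Q (th μ (opS (opM f))) := by have := hV.th μ; norm_num at this; exact this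
  have t4 : Homog 1 Q (opA' (D μ (opM f))) := by
    have := (hW.D μ).A'; ring_nf at this; exact this
  have t5 : Homog 1 Q (opA' (opR (d μ (opM f)))) := by
    have := (hW.d μ).R.A'; ring_nf at this; exact this
  have t6 : Homog 1 Q (opA' (opR (D μ (opS (opM f))))) := by
    have := (hV.D μ).R.A'; ring_nf at this; exact this
  have t7 : Homog 1 Q (opM' (d μ (opM f))) := by
    have := (hW.d μ).M'; ring_nf at this; exact this
  have t8 : Homog 1 Q (opM' (D μ (opS (opM f)))) := by
    have := (hV.D μ).M'; ring_nf at this; exact this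
  exact ((((((((((hd.smul _).sub ((hSd.sub hDS).smul _)).sub (t1.smul _)).add (t2.smul _)).add
    (t3.smul _)).add (t4.smul _)).add (t5.smul _)).add (t6.smul _)).sub (t7.smul _)).add
    (t8.smul _))

lemma S_omegaF (hQ : 0 < Q) (hn : (4 : ℝ) ≤ n) (μ : Fin n) : opS (omegaF Q f μ) = 0 := by
  have h1 : Q ≠ 0 := hQ.ne'
  have h2 : (n : ℝ) + Q - 2 ≠ 0 := by linarith
  have h3 : (2 : ℝ) * n - 4 ≠ 0 := by linarith
  have h4 : d μ (opS (opM f)) = 0 := (h.M.S.d μ).eq_zero (Or.inl (by norm_num))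
  simp only [omegaF, map_smul, map_add, map_sub, map_neg, alg, algN, S_d, S_D, S_u, S_th, P_d, Q_d,
    P_D, Q_D, h.1, h.2, h4, map_zero, smul_zero]
  match_scalars <;> field_simp <;> ring

lemma A_omegaF (hA : opA f = 0) (hQ : 0 < Q) (hn : (4 : ℝ) ≤ n) (μ : Fin n) :
    opA (omegaF Q f μ) = 0 := by
  have h1 : Q ≠ 0 := hQ.ne'
  have h2 : (n : ℝ) + Q - 2 ≠ 0 := by linarith
  have h3 : (2 : ℝ) * n - 4 ≠ 0 := by linarith
  simp only [omegaF, map_smul, map_add, map_sub, map_neg, alg, algN, A_d, A_D, A_u, A_th, P_d, Q_d,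
    P_D, Q_D, S_d, M_d, R_d, R_D, M_D, hA, h.1, h.2, map_zero, smul_zero, smul_add, smul_smul]
  have h4 : eta μ ^ 2 = 1 := by rw [sq, eta_mul_self]
  match_scalars <;> field_simp <;> ring_nf <;> simp only [h4] <;> ring

lemma sum_th_omegaF : ∑ μ, th μ (omegaF Q f μ) = f := by
  have s0 : ∑ μ, th μ (d μ f) = (2 : ℝ) • f := by rw [← opP_apply, h.1]
  have s1 : ∑ μ, th μ (opR (opS (d μ f))) = opR (opS f) := by
    have e (μ : Fin n) : th μ (opR (opS (d μ f))) = opR (opS (th μ (d μ f))) - opR (u μ (d μ f)) := by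
      rw [S_th, map_sub, R_th]; abel
    simp only [e, Finset.sum_sub_distrib, ← map_sum, s0, map_smul]
    rw [← opS_apply, two_smul]; abel
  have s2 (g : Fock n) : ∑ μ, th μ (D μ g) = opR g := (opR_apply g).symm
  have s3 (g : Fock n) (c : ℝ) : ∑ μ, th μ ((c * eta μ) • u μ g) = c • opM' g := by
    rw [opM'_apply, Finset.smul_sum]
    exact Finset.sum_congr rfl fun μ _ => by rw [map_smul, mul_smul]
  have s4 (g : Fock n) (c : ℝ) : ∑ μ, th μ ((c * eta μ) • th μ g) = 0 := by
    refine Finset.sum_eq_zero fun μ _ => ?_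
    rw [map_smul, eq_zero_of_eq_neg (th_th μ μ g), smul_zero]
  have hW : opP (opM f) = opM f := by rw [P_M, h.1, map_smul, two_smul]; abel
  have s5 (g : Fock n) : ∑ μ, th μ (opA' (D μ g)) = opA' (opR g) := by
    rw [← s2, map_sum]; exact Finset.sum_congr rfl fun μ _ => (A'_th μ _).symm
  have s6 : ∑ μ, th μ (opA' (opR (d μ (opM f)))) = -opA' (opR (opM f)) := by
    conv_rhs => rw [← hW, opP_apply]
    rw [map_sum, map_sum, ← Finset.sum_neg_distrib]
    exact Finset.sum_congr rfl fun μ _ => by rw [R_th, map_neg, neg_neg, A'_th]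
  have s7 (g : Fock n) : ∑ μ, th μ (opA' (opR (D μ g))) = 0 := by
    have e (μ : Fin n) : th μ (opA' (opR (D μ g))) = -opA' (opR (th μ (D μ g))) := by
      rw [R_th, map_neg, neg_neg, A'_th]
    simp only [e, Finset.sum_neg_distrib, ← map_sum, s2, R_R, map_zero, neg_zero]
  have s8 : ∑ μ, th μ (opM' (d μ (opM f))) = -opM' (opM f) := by
    conv_rhs => rw [← hW, opP_apply]
    rw [map_sum, ← Finset.sum_neg_distrib]
    exact Finset.sum_congr rfl fun μ _ => by rw [M'_th, neg_neg]
  have s9 (g : Fock n) : ∑ μ, th μ (opM' (D μ g)) = -opM' (opR g) := by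
    rw [← s2, map_sum, ← Finset.sum_neg_distrib]
    exact Finset.sum_congr rfl fun μ _ => by rw [M'_th, neg_neg]
  simp only [omegaF, map_add, map_sub, Finset.sum_add_distrib, Finset.sum_sub_distrib, s3, s4]
  simp only [map_smul, map_sub, ← Finset.smul_sum, Finset.sum_sub_distrib, s0, s1, s2, s5, s6, s7,
    s8, s9]
  module

end omega


/-- The form index `μ` is carried as an external label, so antisymmetrizing over it is `∑ th μ`;
this operation keeps the fields traceless, and `omegaF` provides a right inverse. -/
theorem isTracelessForm_iff_exists_connection (hn : 4 ≤ n) (B : Ten n 2 (q + 2 - 1)) :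
    IsTracelessForm B ↔
      ∃ Ω : Ten n 2 (q + 2 - 1), IsSpinConnection (q + 2) Ω ∧ bOfOmega Ω = B := by
  have hn' : (4 : ℝ) ≤ n := by exact_mod_cast hn
  have hQ : (0 : ℝ) < (q : ℝ) + 1 := by positivity
  constructor
  · intro hB
    obtain ⟨f, hf, hA, rfl⟩ := IsTracelessForm.exists_ev (p := 2) (q := q + 1) hB
    push_cast at hf
    let G : Ten n 2 (q + 1) := fun b a =>
      ev 1 (q + 1) (omegaF ((q : ℝ) + 1) f (b 0)) (Matrix.vecTail b) a
    refine ⟨G, ⟨fun b a => isSmooth_ev _ _ _ _ _, fun μ => ?_⟩, ?_⟩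
    · exact (isHook_ev (omegaF_homog hf μ)).2 ⟨S_omegaF hf hQ hn' μ, A_omegaF hf hA hQ hn' μ⟩
    · have h : asym G = (1 / (((1 : ℕ) : ℝ) + 1)) • ev 2 (q + 1)
          (∑ μ, th μ (omegaF ((q : ℝ) + 1) f μ)) :=
        asym_of (G := G) (p := 1) (omegaF ((q : ℝ) + 1) f) fun c b a x => rfl
      rw [sum_th_omegaF hf] at h
      change (2 : ℝ) • asym G = _
      rw [h, smul_smul]
      norm_num
  · rintro ⟨Ω, ⟨hs, hh⟩, rfl⟩
    have key (μ : Fin n) : ∃ f : Fock n, Homog 1 ((q : ℝ) + 1) f ∧ opA f = 0 ∧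
        ev 1 (q + 1) f = fun b a => Ω (Matrix.vecCons μ b) a := by
      obtain ⟨f, hf, h⟩ := SpinDuality.exists_ev (p := 1) (q := q + 1)
        (T := fun b a => Ω (Matrix.vecCons μ b) a) (fun b a => hs _ _) (hh μ).1
      push_cast at hf
      refine ⟨f, hf, ?_, h⟩
      have h2 := hh μ
      rw [show (fun b a => Ω (Matrix.vecCons μ b) a) = _ from h.symm] at h2
      exact ((isHook_ev hf).1 h2).2
    choose f hf hA he using key
    have h : asym (p := 2) (q := q + 1) Ω = (1 / (((1 : ℕ) : ℝ) + 1)) • ev 2 (q + 1)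
        (∑ μ, th μ (f μ)) :=
      asym_of (G := Ω) (p := 1) (q := q + 1) f fun c b a x => by rw [he c]
    have h2 : bOfOmega Ω = ev 2 (q + 1) (∑ μ, th μ (f μ)) := by
      change (2 : ℝ) • asym (p := 2) (q := q + 1) Ω = _
      rw [h, smul_smul]
      norm_num
    rw [h2]
    refine isTracelessForm_ev (p := 2) (q := q + 1) ?_ ?_
    · constructor
      · rw [map_sum, Finset.smul_sum]
        refine Finset.sum_congr rfl fun μ _ => ?_
        rw [((hf μ).th μ).1]; norm_num
      · rw [map_sum, Finset.smul_sum]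
        refine Finset.sum_congr rfl fun μ _ => ?_
        rw [((hf μ).th μ).2]; push_cast; rfl
    · rw [map_sum]
      exact Finset.sum_eq_zero fun μ _ => by rw [A_th, hA, map_zero]

/-! ### Non-degeneracy of the integrated pairing -/

/-- Multiplication by a smooth function. -/
def mulS (χ : Sm n) : Sm n →ₗ[ℝ] Sm n where
  toFun f := ⟨fun x => χ.1 x * f.1 x, χ.smooth.mul f.smooth⟩
  map_add' f g := by ext x; exact mul_add _ _ _
  map_smul' c f := by ext x; exact mul_left_comm _ _ _

/-- Raising of all indices. -/
def etaF : Fock n →ₗ[ℝ] Fock n where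
  toFun f := ⟨fun _ _ b a => ((∏ i, eta (b i)) * ∏ j, eta (a j)) • f.1 _ _ b a, by
    obtain ⟨h, h', N, hN⟩ := f.2
    refine ⟨fun p q i b a => ?_, fun p q i b a => ?_, N, fun p q hpq => ?_⟩
    · have h2 := h p q i b a
      have h3 := Equiv.prod_comp (Equiv.swap i.castSucc i.succ) fun j => eta (b j)
      change ((∏ j, eta (b (Equiv.swap i.castSucc i.succ j))) * _) • _ = _
      rw [h3]
      exact (congrArg _ h2).trans (smul_neg _ _)
    · have h2 := h' p q i b a
      have h3 := Equiv.prod_comp (Equiv.swap i.castSucc i.succ) fun j => eta (a j)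
      change (_ * (∏ j, eta (a (Equiv.swap i.castSucc i.succ j)))) • _ = _
      rw [h3]
      exact congrArg _ h2
    · funext b a
      simp [hN p q hpq]⟩
  map_add' f g := Subtype.ext (by funext p q b a; exact smul_add _ _ _)
  map_smul' c f := Subtype.ext (by funext p q b a; exact smul_comm (_ : ℝ) c (f.1 p q b a))

lemma etaF_val (f : Fock n) (p q b a) :
    (etaF f).1 p q b a = ((∏ i, eta (b i)) * ∏ j, eta (a j)) • f.1 p q b a := rfl

lemma D_etaF (c : Fin n) (f : Fock n) : D c (etaF f) = eta c • etaF (D c f) := by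
  ext1 p q b a
  rw [D_val, etaF_val, Fock.smul_val, etaF_val, D_val, prod_eta_cons, smul_smul]
  congr 1
  ring

lemma A_etaF (f : Fock n) : opA (etaF f) = etaF (opA f) := by
  simp only [opA_apply, D_etaF, map_sum, map_smul, smul_smul, eta_mul_self, mul_one]

lemma Homog.etaF {f : Fock n} (hf : Homog (p : ℝ) (q : ℝ) f) :
    Homog (p : ℝ) (q : ℝ) (etaF f) :=
  homog_iff.2 fun p' q' h b a => by rw [etaF_val, homog_iff.1 hf p' q' h, smul_zero]

/-- The pairing is indefinite, so `Z` is tested against itself with all indices raised, times a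
cutoff. The integrand is then a sum of squares, and the test field is still traceless. -/
lemma eq_zero_of_ip {Z : Fock n} (hZ : Homog (p : ℝ) (q : ℝ) Z) (hA : opA Z = 0)
    (h : ∀ δ ∈ cs n, Homog (p : ℝ) (q : ℝ) δ → opA δ = 0 → ip δ Z = 0) : Z = 0 := by
  refine hZ.eq_of_val (g := 0) (by constructor <;> simp) fun b a => ?_
  ext x
  by_contra hx
  obtain ⟨χ, h1, h2, h3, h4⟩ := exists_cutoff n ‖x‖
  let χ' : Sm n := ⟨χ, h1⟩
  let δ := mapS (mulS χ') (etaF Z)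
  have hc : δ ∈ cs n := fun p q b a => HasCompactSupport.mul_right (f := χ) h2
  have hδ : Homog (p : ℝ) (q : ℝ) δ := hZ.etaF.mapS _
  have h0 := h δ hc hδ (by rw [A_mapS, A_etaF, hA, map_zero, map_zero])
  have hp (y) : ((p.factorial : ℝ) * q.factorial) * pair δ Z y
      = χ y * ∑ b, ∑ a, (ev p q Z b a y) ^ 2 := by
    rw [← contr_ev hδ]
    simp only [contr, Finset.mul_sum]
    refine Finset.sum_congr rfl fun b _ => Finset.sum_congr rfl fun a _ => ?_
    have e1 : ev p q δ b a y = χ y * (((∏ i, eta (b i)) * ∏ j, eta (a j)) * ev p q Z b a y) := rfl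
    have e2 : ((∏ i, eta (b i)) * ∏ j, eta (a j)) * ((∏ i, eta (b i)) * ∏ j, eta (a j))
        = (1 : ℝ) := by
      rw [mul_mul_mul_comm, ← Finset.prod_mul_distrib, ← Finset.prod_mul_distrib]
      simp only [eta_mul_self, Finset.prod_const_one, mul_one]
    rw [e1]
    linear_combination χ y * (ev p q Z b a y) ^ 2 * e2
  have hcont : Continuous fun y => χ y * ∑ b, ∑ a, (ev p q Z b a y) ^ 2 := by
    refine h1.continuous.mul (continuous_finsetSum _ fun b _ => continuous_finsetSum _ fun a _ =>
      ((Z.1 p q b a).smooth.continuous).pow 2)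
  have hpos : 0 < ∫ y, χ y * ∑ b, ∑ a, (ev p q Z b a y) ^ 2 := by
    refine Continuous.integral_pos_of_hasCompactSupport_nonneg_nonzero (x := x) hcont h2.mul_right
      (fun y => mul_nonneg (h4 y) (Finset.sum_nonneg fun b _ => Finset.sum_nonneg fun a _ =>
        sq_nonneg _)) ?_
    rw [h3 x le_rfl, one_mul]
    refine (lt_of_lt_of_le ?_ (Finset.single_le_sum (fun b _ => Finset.sum_nonneg fun a _ =>
      sq_nonneg _) (Finset.mem_univ b))).ne'
    refine lt_of_lt_of_le ?_ (Finset.single_le_sum (fun a _ => sq_nonneg _) (Finset.mem_univ a))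
    exact sq_pos_of_ne_zero hx
  simp only [← hp] at hpos
  rw [MeasureTheory.integral_const_mul] at hpos
  change 0 < _ * ip δ Z at hpos
  rw [h0, mul_zero] at hpos
  exact lt_irrefl _ hpos

end

end SpinDuality

namespace SpinDuality

noncomputable section

variable {n q : ℕ}

/-! ### Variations of the parent action -/

section
variable {Q : ℝ} (f g : Fock n)

lemma xF_add : xF Q (f + g) = xF Q f + xF Q g := by
  simp only [xF, map_add]
  module

lemma xF_smul (c : ℝ) : xF Q (c • f) = c • xF Q f := by
  simp only [xF, map_smul]
  module

lemma yF_add : yF Q (f + g) = yF Q f + yF Q g := by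
  simp only [yF, map_add]
  module

lemma yF_smul (c : ℝ) : yF Q (c • f) = c • yF Q f := by
  simp only [yF, map_smul, map_add]
  module

variable {f}

lemma cs_xF (h : f ∈ cs n) : xF Q f ∈ cs n := by
  have h1 := cs_R (cs_S h)
  have h2 := cs_M' (cs_M h)
  exact Submodule.smul_mem _ _ (sub_mem (sub_mem h (Submodule.smul_mem _ _ h1))
    (Submodule.smul_mem _ _ (sub_mem h2 (Submodule.smul_mem _ _ (cs_R (cs_S h2))))))

lemma cs_yF (h : f ∈ cs n) : yF Q f ∈ cs n := by
  have h1 := cs_R (cs_S h)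
  have h2 := cs_M h
  exact Submodule.smul_mem _ _ (add_mem (sub_mem h h1) (cs_M' (add_mem (cs_R (cs_S h2)) h2)))

end

lemma ip_xF_symm {Q : ℝ} {f g : Fock n} (hA : opA f = 0) (hA' : opA g = 0) :
    ip f (xF Q g) = ip g (xF Q f) :=
  MeasureTheory.integral_congr_ae (Filter.Eventually.of_forall (pair_xF_symm hA hA'))

/-- An exact expansion, as the Lagrangian is quadratic. The symmetry of `xF` on traceless fields
merges the two cross terms, and every remaining term has a compactly supported factor. -/
lemma integral_parentF (e : Fock n) {Y δe δY : Fock n} (hA : opA Y = 0) (hA' : opA δY = 0)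
    (hc : δe ∈ cs n) (hc' : δY ∈ cs n) :
    ∫ x, (parentF q (e + δe) (Y + δY) x - parentF q e Y x)
      = ((q + 1).factorial : ℝ) * (2 * ip Y (opGb δe) + 2 * ip (opGb (e + δe)) δY
        - 2 * ip (xF ((q : ℝ) + 1) Y) δY - ip (xF ((q : ℝ) + 1) δY) δY) := by
  set Z := (2 : ℝ) • opGb (e + δe) - (2 : ℝ) • xF ((q : ℝ) + 1) Y - xF ((q : ℝ) + 1) δY with hZ
  have h (x) : parentF q (e + δe) (Y + δY) x - parentF q e Y x
      = ((q + 1).factorial : ℝ) * (2 * pair Y (opGb δe) x + pair Z δY x) := by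
    have h1 := pair_xF_symm (Q := (q : ℝ) + 1) hA hA' x
    simp only [parentF, hZ, xF_add, map_add, pair_add_left, pair_add_right, pair_sub_right,
      pair_smul_right, pair_comm _ δY, smul_add] at h1 ⊢
    rw [h1]
    ring
  simp only [h]
  rw [MeasureTheory.integral_const_mul, MeasureTheory.integral_add
    ((integrable_pair _ (cs_Gb hc)).const_mul _) (integrable_pair _ hc'),
    MeasureTheory.integral_const_mul]
  change _ * (2 * ip Y (opGb δe) + ip Z δY) = _
  rw [hZ, ip_sub_left _ _ hc', ip_sub_left _ _ hc', ip_smul_left, ip_smul_left]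
  ring

lemma hasDerivAt_quadratic_iff (a b : ℝ) :
    HasDerivAt (fun t : ℝ => a * t + b * t ^ 2) 0 0 ↔ a = 0 := by
  have h : HasDerivAt (fun t : ℝ => a * t + b * t ^ 2) (a * 1 + b * ((2 : ℕ) * 0 ^ (2 - 1) * 1)) 0 :=
    ((hasDerivAt_id' 0).const_mul a).add (((hasDerivAt_id' (0 : ℝ)).pow 2).const_mul b)
  norm_num at h
  exact ⟨fun h' => h.unique h', fun h' => by rwa [h'] at h ⊢⟩

lemma isTracelessForm_yOfB (B : Ten n 2 (q + 2 - 1)) (hB0 : IsTracelessForm B) :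
    IsTracelessForm (yOfB (q + 2) B) := by
  obtain ⟨f, hf, hA, rfl⟩ := IsTracelessForm.exists_ev (p := 2) (q := q + 1) hB0
  push_cast at hf
  rw [yOfB_ev hf]
  exact isTracelessForm_ev (p := 2) (q := q + 1) (by push_cast; exact hf.yF) (A_yF hA)

/-! ### The bijection between `B` and `Y`, and the field equations of the parent action. -/

section
variable (hn : (4 : ℝ) ≤ n)
include hn

lemma existsUnique_yOfB (Y : Ten n 2 (q + 2 - 1)) (hY0 : IsTracelessForm Y) :
    ∃! B : Ten n 2 (q + 2 - 1), IsTracelessForm B ∧ yOfB (q + 2) B = Y := by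
  obtain ⟨y, hy, hA, rfl⟩ := IsTracelessForm.exists_ev (p := 2) (q := q + 1) hY0
  push_cast at hy
  have hQ : (0 : ℝ) < (q : ℝ) + 1 := by positivity
  refine ⟨ev 2 (q + 1) (xF ((q : ℝ) + 1) y), ⟨isTracelessForm_ev (p := 2) (q := q + 1)
    (by push_cast; exact hy.xF) (A_xF hy hA hQ hn), ?_⟩, ?_⟩
  · rw [yOfB_ev hy.xF, yF_xF hy hA hQ hn]
  · rintro B ⟨hB0, h⟩
    obtain ⟨f, hf, hA', rfl⟩ := IsTracelessForm.exists_ev (p := 2) (q := q + 1) hB0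
    push_cast at hf
    rw [yOfB_ev hf] at h
    have h2 := (ev_inj (p := 2) (q := q + 1) (by push_cast; exact hf.yF)
      (by push_cast; exact hy)).1 h
    rw [← h2, xF_yF hf hA' hQ hn]

lemma vasilievLagrangian_eq_parentLagrangian (e : Ten n 1 (q + 2 - 1)) (B : Ten n 2 (q + 2 - 1))
    (he0 : IsTracelessForm e) (hB0 : IsTracelessForm B) :
    vasilievLagrangian (q + 2) e B = parentLagrangian (q + 2) e (yOfB (q + 2) B) := by
  obtain ⟨e, he, -, rfl⟩ := IsTracelessForm.exists_ev (p := 1) (q := q + 1) he0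
  obtain ⟨f, hf, hA, rfl⟩ := IsTracelessForm.exists_ev (p := 2) (q := q + 1) hB0
  push_cast at he hf
  have hQ : (0 : ℝ) < (q : ℝ) + 1 := by positivity
  funext x
  rw [vasiliev_ev he hf, yOfB_ev hf, parent_ev e hf.yF (A_yF hA) hn, parentF, xF_yF hf hA hQ hn]

/-- The term linear in the variation is a multiple of `⟨δ, Gb e - xF Y⟩`. Non-degeneracy on
traceless fields gives `xF Y = Gb e`, which `yF` solves uniquely. -/
lemma parentLagrangian_stationary_iff (e : Ten n 1 (q + 2 - 1)) (Y : Ten n 2 (q + 2 - 1))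
    (he0 : IsTracelessForm e) (hY0 : IsTracelessForm Y) :
    IsStationaryPoint (parentLagrangian (q + 2) e) IsVariation Y ↔
      Y = yOfB (q + 2) ((2 : ℝ) • asym (grad e)) := by
  obtain ⟨e, he, hAe, rfl⟩ := IsTracelessForm.exists_ev (p := 1) (q := q + 1) he0
  obtain ⟨y, hy, hA, rfl⟩ := IsTracelessForm.exists_ev (p := 2) (q := q + 1) hY0
  push_cast at he hy
  have hQ : (0 : ℝ) < (q : ℝ) + 1 := by positivity
  have hG : Homog 2 ((q : ℝ) + 1) (opGb e) := by have := he.Gb; norm_num at this; exact this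
  have h1 : (2 : ℝ) • asym (grad (ev 1 (q + 1) e : Ten n 1 (q + 2 - 1)))
      = (ev 2 (q + 1) (opGb e) : Ten n 2 (q + 2 - 1)) := by
    have h := asym_grad_ev 1 (q + 1) e
    refine (congrArg (fun W : Ten n 2 (q + 1) => (2 : ℝ) • W) h).trans ?_
    simp only [smul_smul]
    norm_num
  have hd (δ : Fock n) (hδ : Homog 2 ((q : ℝ) + 1) δ) (hA' : opA δ = 0) (hc : δ ∈ cs n) :
      HasDerivAt (fun t : ℝ => actionDiff (parentLagrangian (q + 2)
        (ev 1 (q + 1) e : Ten n 1 (q + 2 - 1))) (ev 2 (q + 1) y : Ten n 2 (q + 2 - 1))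
        (t • (ev 2 (q + 1) δ : Ten n 2 (q + 2 - 1)))) 0 0
      ↔ ip δ (opGb e - xF ((q : ℝ) + 1) y) = 0 := by
    have h2 (t : ℝ) : actionDiff (parentLagrangian (q + 2)
        (ev 1 (q + 1) e : Ten n 1 (q + 2 - 1))) (ev 2 (q + 1) y : Ten n 2 (q + 2 - 1))
        (t • (ev 2 (q + 1) δ : Ten n 2 (q + 2 - 1)))
        = (((q + 1).factorial : ℝ) * 2 * ip δ (opGb e - xF ((q : ℝ) + 1) y)) * t
          + (-((q + 1).factorial : ℝ) * ip (xF ((q : ℝ) + 1) δ) δ) * t ^ 2 := by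
      have h3 := integral_parentF (q := q) e (δe := 0) hA
        (show opA (t • δ) = 0 by rw [map_smul, hA', smul_zero])
        (Submodule.zero_mem _) (Submodule.smul_mem _ t hc)
      simp only [add_zero] at h3
      have h4 : ∀ x, parentLagrangian (q + 2) (ev 1 (q + 1) e : Ten n 1 (q + 2 - 1))
          ((ev 2 (q + 1) y : Ten n 2 (q + 2 - 1)) + t • (ev 2 (q + 1) δ : Ten n 2 (q + 2 - 1))) x
          = parentF q e (y + t • δ) x := fun x =>
        parent_ev e (hy.add (hδ.smul t)) (by rw [map_add, map_smul, hA, hA', smul_zero, add_zero])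
          hn x
      simp only [actionDiff, h4, parent_ev e hy hA hn]
      rw [h3, map_zero, ip_zero_right, xF_smul, ip_smul_left, ip_smul_right, ip_smul_right,
        ip_smul_right, ip_comm δ, ip_sub_left _ _ hc]
      ring
    simp only [h2]
    rw [hasDerivAt_quadratic_iff]
    have : ((q + 1).factorial : ℝ) ≠ 0 := by positivity
    simp [this]
  rw [h1, yOfB_ev hG, ev_inj (p := 2) (q := q + 1) (by push_cast; exact hy)
    (by push_cast; exact hG.yF)]
  constructor
  · intro h
    have h0 : opGb e - xF ((q : ℝ) + 1) y = 0 := by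
      refine eq_zero_of_ip (p := 2) (q := q + 1) (by push_cast; exact hG.sub hy.xF)
        (by rw [map_sub, A_Gb, hAe, map_zero, A_xF hy hA hQ hn, sub_zero]) fun δ hc hδ hA' => ?_
      have hv := isVariation_ev (p := 2) (q := q + 1) hδ hA' hc
      push_cast at hδ
      exact (hd δ hδ hA' hc).1 (h _ hv)
    rw [sub_eq_zero.1 h0, yF_xF hy hA hQ hn]
  · intro h δ hδ0
    obtain ⟨δ, hδ, hA', hc, rfl⟩ := IsVariation.exists_ev (p := 2) (q := q + 1) hδ0
    push_cast at hδ
    refine (hd δ hδ hA' hc).2 ?_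
    rw [h, xF_yF hG (by rw [A_Gb, hAe, map_zero]) hQ hn, sub_self, ip_zero_right]

/-- The action is affine in `e`; integration by parts turns its coefficient into the divergence of
`Y`, which is again traceless, so traceless variations detect it. -/
lemma parentLagrangian_stationary_vielbein_iff (e : Ten n 1 (q + 2 - 1)) (Y : Ten n 2 (q + 2 - 1))
    (he0 : IsTracelessForm e) (hY0 : IsTracelessForm Y) :
    IsStationaryPoint (fun e : Ten n 1 (q + 2 - 1) => parentLagrangian (q + 2) e Y) IsVariation e ↔
      divB Y = 0 := by
  obtain ⟨e, he, hAe, rfl⟩ := IsTracelessForm.exists_ev (p := 1) (q := q + 1) he0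
  obtain ⟨y, hy, hA, rfl⟩ := IsTracelessForm.exists_ev (p := 2) (q := q + 1) hY0
  rw [show divB (ev 2 (q + 1) y : Ten n 2 (q + 2 - 1)) = 0 ↔ opDb y = 0 from divB_ev_eq_zero hy]
  push_cast at he hy
  have hd (δ : Fock n) (hc : δ ∈ cs n) :
      HasDerivAt (fun t : ℝ => actionDiff (fun e : Ten n 1 (q + 2 - 1) => parentLagrangian (q + 2)
        e (ev 2 (q + 1) y : Ten n 2 (q + 2 - 1))) (ev 1 (q + 1) e : Ten n 1 (q + 2 - 1))
        (t • (ev 1 (q + 1) δ : Ten n 1 (q + 2 - 1)))) 0 0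
      ↔ ip δ (opDb y) = 0 := by
    have h2 (t : ℝ) : actionDiff (fun e : Ten n 1 (q + 2 - 1) => parentLagrangian (q + 2)
        e (ev 2 (q + 1) y : Ten n 2 (q + 2 - 1))) (ev 1 (q + 1) e : Ten n 1 (q + 2 - 1))
        (t • (ev 1 (q + 1) δ : Ten n 1 (q + 2 - 1)))
        = (-((q + 1).factorial : ℝ) * 2 * ip δ (opDb y)) * t + 0 * t ^ 2 := by
      have h3 := integral_parentF (q := q) e hA (map_zero _)
        (Submodule.smul_mem _ t hc) (Submodule.zero_mem _)
      have h4 : ∀ x, parentLagrangian (q + 2) ((ev 1 (q + 1) e : Ten n 1 (q + 2 - 1))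
          + t • (ev 1 (q + 1) δ : Ten n 1 (q + 2 - 1))) (ev 2 (q + 1) y : Ten n 2 (q + 2 - 1)) x
          = parentF q (e + t • δ) y x := fun x => parent_ev (e + t • δ) hy hA hn x
      simp only [add_zero] at h3
      simp only [actionDiff, h4, parent_ev e hy hA hn]
      rw [h3, map_smul, ip_smul_right, ip_zero_right, ip_zero_right, ip_zero_right, ip_comm y,
        ip_comm δ, ip_Db_left _ hc, ip_comm y]
      ring
    simp only [h2]
    rw [hasDerivAt_quadratic_iff]
    have : ((q + 1).factorial : ℝ) ≠ 0 := by positivity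
    simp [this]
  have hD : Homog 1 ((q : ℝ) + 1) (opDb y) := by have := hy.Db; norm_num at this; exact this
  constructor
  · intro h
    refine eq_zero_of_ip (p := 1) (q := q + 1) (by push_cast; exact hD)
      (by rw [A_Db, hA, map_zero]) fun δ hc hδ hA' => ?_
    exact (hd δ hc).1 (h _ (isVariation_ev (p := 1) (q := q + 1) hδ hA' hc))
  · intro h δ hδ0
    obtain ⟨δ, hδ, hA', hc, rfl⟩ := IsVariation.exists_ev (p := 1) (q := q + 1) hδ0
    exact (hd δ hc).2 (by rw [h, ip_zero_right])

end

/-! ### Gauge invariance of the parent action -/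

lemma asym_sym_comm {p : ℕ} (T : Ten n p q) : asym (sym T) = sym (asym T) := by
  funext b a x
  simp only [asym, sym, Finset.mul_sum]
  rw [Finset.sum_comm]
  refine Finset.sum_congr rfl fun σ _ => Finset.sum_congr rfl fun τ _ => ?_
  ring

/-- The antisymmetric counterpart of `sym_etaMix_sym`; the sign of a permutation fixing the slot of
the metric is that of the inner permutation. -/
lemma asym_etaMix_asym {p : ℕ} (V : Ten n p q) :
    asym (etaMix (p := p + 1) (q := q + 1) (asym V))
    = asym (etaMix (p := p + 1) (q := q + 1) V) := by
  have key (σ : Equiv.Perm (Fin p)) :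
      asym (etaMix (p := p + 1) (q := q + 1) fun b a x => V (b ∘ σ) a x)
      = ((Equiv.Perm.sign σ : ℤ) : ℝ) • asym (etaMix (p := p + 1) (q := q + 1) V) := by
    have hs : Equiv.Perm.sign (Equiv.Perm.decomposeFin.symm (0, σ)) = Equiv.Perm.sign σ := by
      simp
    rw [← hs, ← asym_comp_perm (etaMix (p := p + 1) (q := q + 1) V)]
    refine congrArg asym ?_
    funext b a x
    have h : b ∘ Equiv.Perm.decomposeFin.symm (0, σ)
        = Matrix.vecCons (b 0) (Matrix.vecTail b ∘ σ) := by
      rw [comp_decomposeFin_symm]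
      congr 1
    rw [h]
    rfl
  have h1 : etaMix (p := p + 1) (q := q + 1) (asym V) = (1 / (p.factorial : ℝ)) •
      ∑ σ : Equiv.Perm (Fin p), ((Equiv.Perm.sign σ : ℤ) : ℝ) •
        etaMix (p := p + 1) (q := q + 1) fun b a x => V (b ∘ σ) a x := by
    funext b a x
    simp only [Pi.smul_apply, Finset.sum_apply]
    simp only [etaMix, asym, smul_eq_mul, Finset.mul_sum]
    refine Finset.sum_congr rfl fun σ _ => ?_
    change _ * ((1 / (p.factorial : ℝ)) * (_ * _)) = (1 / (p.factorial : ℝ)) * (_ * (_ * _))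
    ring
  have h2 {ι : Type} (s : Finset ι) (F : ι → Ten n (p + 1) (q + 1)) :
      asym (∑ i ∈ s, F i) = ∑ i ∈ s, asym (F i) := by
    induction s using Finset.cons_induction with
    | empty => funext b a x; simp [asym]
    | cons i s hi ih => rw [Finset.sum_cons, Finset.sum_cons, asym_add, ih]
  have h3 (σ : Equiv.Perm (Fin p)) :
      ((Equiv.Perm.sign σ : ℤ) : ℝ) * ((Equiv.Perm.sign σ : ℤ) : ℝ) = 1 := by
    rcases Int.units_eq_one_or (Equiv.Perm.sign σ) with h | h <;> simp [h]
  have := Nat.factorial_ne_zero p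
  rw [h1, asym_smul, h2]
  simp only [asym_smul, key, smul_smul, h3, one_smul, Finset.sum_const, Finset.card_univ,
    Fintype.card_perm, Fintype.card_fin]
  rw [← Nat.cast_smul_eq_nsmul ℝ, smul_smul, one_div_mul_cancel (by exact_mod_cast this), one_smul]

/-- The factor `-1/2` comes from bringing the second index of `α` to the front of its pair, and
`1/(3(q+1))` from the unit-weight symmetrization over three and `q + 1` slots. -/
lemma shift_ev (f : Fock n) : shift (q + 2) (ev 1 (q + 1) f : Ten n 1 (q + 2 - 1))
    = (ev 3 (q + 1) (-(1 / (6 * ((q : ℝ) + 1))) • opM' (opR f)) : Ten n 3 (q + 2 - 1)) := by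
  change asym (sym (etaMix (p := 2 + 1) (q := q + 1) (pull (ev 1 (q + 1) f)))) = _
  rw [asym_sym_comm, ← asym_etaMix_asym, asym_pull_ev 1 q f, ← asym_sym_comm, ← ev_smul]
  rw [asym_sym_etaMix_ev 2 q, map_smul, ev_smul, smul_smul, ev_smul]
  congr 1
  push_cast
  field_simp
  norm_num

/-- Shifts of the potential act on `Y` as the transformations with parameter `α`. -/
lemma Db_shift {Q : ℝ} (hQ : 0 < Q) {α : Fock n} (hS : opS α = 0)
    (hA : opA α = 0) :
    opDb (-(1 / (2 * Q)) • opM' (opR α)) = yF Q (opGb α) := by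
  have hM : opM α = 0 := by
    have h := A_S α
    rw [hS, hA, map_zero, map_zero, zero_add] at h
    simpa using h.symm
  simp only [yF, map_smul, map_add, map_sub, map_neg, alg, algD, algN, hS, hM,
    map_zero, smul_zero]
  match_scalars <;> field_simp <;> ring

/-- The gauge invariance of the parent action. -/
lemma actionDiff_parentLagrangian_gauge (hn : (4 : ℝ) ≤ n) (e : Ten n 1 (q + 2 - 1))
    (Y : Ten n 2 (q + 2 - 1)) (ξ : Ten n 0 (q + 2 - 1)) (α : Ten n 1 (q + 2 - 1))
    (he0 : IsTracelessForm e) (hY0 : IsTracelessForm Y) (hξ0 : IsVariation ξ) (hα0 : IsVariation α)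
    (hH : IsHook (q + 2) α) :
    actionDiff (fun F : Ten n 1 (q + 2 - 1) × Ten n 2 (q + 2 - 1) =>
      parentLagrangian (q + 2) F.1 F.2)
      (e, Y) (grad ξ + α, (3 : ℝ) • divB (shift (q + 2) α)) = 0 := by
  obtain ⟨e, he, hAe, rfl⟩ := IsTracelessForm.exists_ev (p := 1) (q := q + 1) he0
  obtain ⟨y, hy, hA, rfl⟩ := IsTracelessForm.exists_ev (p := 2) (q := q + 1) hY0
  obtain ⟨ξ, hξ, hAξ, hcξ, rfl⟩ := IsVariation.exists_ev (p := 0) (q := q + 1) hξ0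
  obtain ⟨α, hα, hAα, hcα, rfl⟩ := IsVariation.exists_ev (p := 1) (q := q + 1) hα0
  push_cast at he hy hξ hα
  have hQ : (0 : ℝ) < (q : ℝ) + 1 := by positivity
  have hS := ((isHook_ev hα).1 hH).1
  have hGα : Homog 2 ((q : ℝ) + 1) (opGb α) := by have := hα.Gb; norm_num at this; exact this
  have hAG : opA (opGb α) = 0 := by rw [A_Gb, hAα, map_zero]
  have h1 : grad (ev 0 (q + 1) ξ : Ten n 0 (q + 2 - 1))
      = (ev 1 (q + 1) (opGb ξ) : Ten n 1 (q + 2 - 1)) := by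
    have h := asym_grad_ev 0 (q + 1) ξ
    rw [asym_one] at h
    refine h.trans ?_
    simp
  have hMR : Homog ((3 : ℕ) : ℝ) ((q + 1 : ℕ) : ℝ) (-(1 / (6 * ((q : ℝ) + 1))) • opM' (opR α)) := by
    have := (hα.R.M').smul (-(1 / (6 * ((q : ℝ) + 1))))
    push_cast
    norm_num at this ⊢
    exact this
  have h2 : (3 : ℝ) • divB (shift (q + 2) (ev 1 (q + 1) α : Ten n 1 (q + 2 - 1)))
      = (ev 2 (q + 1) (yF ((q : ℝ) + 1) (opGb α)) : Ten n 2 (q + 2 - 1)) := by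
    rw [shift_ev]
    have h := divB_ev hMR
    refine (congrArg (fun W : Ten n 2 (q + 1) => (3 : ℝ) • W) h).trans ?_
    change ev 2 (q + 1) ((3 : ℝ) • _) = _
    congr 1
    rw [← Db_shift hQ hS hAα, ← map_smul, smul_smul]
    congr 2
    field_simp
    norm_num
  have hYD := (Db_shift hQ hS hAα).symm
  have hcY : yF ((q : ℝ) + 1) (opGb α) ∈ cs n := cs_yF (cs_Gb hcα)
  have hAY := A_yF (Q := (q : ℝ) + 1) hAG
  have hce : opGb ξ + α ∈ cs n := add_mem (cs_Gb hcξ) hcα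
  rw [h1, h2]
  have h3 := integral_parentF (q := q) e hA hAY hce hcY
  have h4 : ∀ x, parentLagrangian (q + 2) ((ev 1 (q + 1) e : Ten n 1 (q + 2 - 1))
      + (ev 1 (q + 1) (opGb ξ) + ev 1 (q + 1) α))
      ((ev 2 (q + 1) y : Ten n 2 (q + 2 - 1)) + ev 2 (q + 1) (yF ((q : ℝ) + 1) (opGb α))) x
      = parentF q (e + (opGb ξ + α)) (y + yF ((q : ℝ) + 1) (opGb α)) x := fun x =>
    parent_ev (e + (opGb ξ + α)) (hy.add hGα.yF) (by rw [map_add, hA, hAY, add_zero]) hn x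
  have h5 : ∀ x, parentLagrangian (q + 2) (ev 1 (q + 1) e : Ten n 1 (q + 2 - 1))
      (ev 2 (q + 1) y : Ten n 2 (q + 2 - 1)) x = parentF q e y x := fun x =>
    parent_ev e hy hA hn x
  -- The variation of `Y` is a divergence and is therefore orthogonal to every gradient.
  have h6 (f : Fock n) : ip (opGb f) (yF ((q : ℝ) + 1) (opGb α)) = 0 := by
    rw [ip_Gb_left _ hcY, hYD, Db_Db, ip_zero_right, neg_zero]
  refine (MeasureTheory.integral_congr_ae (Filter.Eventually.of_forall fun x =>
    congrArg₂ (· - ·) (h4 x) (h5 x))).trans ?_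
  -- What is left cancels: `xF` is symmetric and sends the variation of `Y` back to `Gb α`, so its
  -- cross term with `Y` is `⟨Y, Gb α⟩`.
  rw [h3, xF_yF hGα hAG hQ hn, h6, h6, ip_comm (xF _ y), ip_xF_symm hAY hA, xF_yF hGα hAG hQ hn,
    map_add, Gb_Gb, zero_add]
  ring

end

end SpinDuality

namespace SpinDuality

noncomputable section

variable {n q : ℕ}

/-! ### Polarization of quadratic actions -/

/-- The action with Lagrangian `L` is quadratic, with polarization `B`. -/
def Polar (L : Fock n → (Fin n → ℝ) → ℝ) (B : Fock n → Fock n → ℝ) : Prop :=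
  ∀ f, ∀ g ∈ cs n, MeasureTheory.Integrable (fun x => L (f + g) x - L f x) ∧
    ∫ x, (L (f + g) x - L f x) = 2 * B f g + B g g

section
variable {L L' : Fock n → (Fin n → ℝ) → ℝ} {B B' : Fock n → Fock n → ℝ}

lemma Polar.add (h : Polar L B) (h' : Polar L' B') :
    Polar (fun f x => L f x + L' f x) (fun f g => B f g + B' f g) := by
  intro f g hg
  have e : (fun x => L (f + g) x + L' (f + g) x - (L f x + L' f x))
      = fun x => (L (f + g) x - L f x) + (L' (f + g) x - L' f x) := by funext x; ring
  simp only [e]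
  refine ⟨(h f g hg).1.add (h' f g hg).1, ?_⟩
  rw [MeasureTheory.integral_add (h f g hg).1 (h' f g hg).1, (h f g hg).2, (h' f g hg).2]
  ring

lemma Polar.smul (c : ℝ) (h : Polar L B) :
    Polar (fun f x => c * L f x) (fun f g => c * B f g) := by
  intro f g hg
  simp only [← mul_sub]
  refine ⟨(h f g hg).1.const_mul c, ?_⟩
  rw [MeasureTheory.integral_const_mul, (h f g hg).2]
  ring

lemma Polar.sub (h : Polar L B) (h' : Polar L' B') :
    Polar (fun f x => L f x - L' f x) (fun f g => B f g - B' f g) := by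
  have := h.add (h'.smul (-1))
  simpa only [neg_one_mul, ← sub_eq_add_neg] using this

/-- The Lagrangian at `f` need not be integrable; in the difference every term contains the
compactly supported `g`. -/
lemma polar_pair (X X' : Fock n →ₗ[ℝ] Fock n) (hX : ∀ g ∈ cs n, X g ∈ cs n)
    (hX' : ∀ g ∈ cs n, X' g ∈ cs n) :
    Polar (fun f => pair (X f) (X' f))
      (fun f g => 1 / 2 * (ip (X f) (X' g) + ip (X' f) (X g))) := by
  intro f g hg
  have e (x) : pair (X (f + g)) (X' (f + g)) x - pair (X f) (X' f) x
      = pair (X f) (X' g) x + (pair (X' f) (X g) x + pair (X g) (X' g) x) := by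
    simp only [map_add, pair_add_left, pair_add_right, pair_comm (X g) (X' f)]
    ring
  have i1 := integrable_pair (X f) (hX' g hg)
  have i2 := integrable_pair (X' f) (hX g hg)
  have i3 := integrable_pair (X g) (hX' g hg)
  simp only [e]
  have i4 : MeasureTheory.Integrable fun x => pair (X' f) (X g) x + pair (X g) (X' g) x := i2.add i3
  refine ⟨i1.add i4, ?_⟩
  rw [MeasureTheory.integral_add i1 i4, MeasureTheory.integral_add i2 i3]
  change ip (X f) (X' g) + (ip (X' f) (X g) + ip (X g) (X' g)) = _
  rw [ip_comm (X' g) (X g)]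
  ring

lemma polar_pairGrad (X : Fock n →ₗ[ℝ] Fock n) (hX : ∀ g ∈ cs n, X g ∈ cs n) :
    Polar (fun f => pairGrad (X f) (X f)) (fun f g => -ip (X f) (box (X g))) := by
  intro f g hg
  have e (x) : pairGrad (X (f + g)) (X (f + g)) x - pairGrad (X f) (X f) x
      = 2 * pairGrad (X f) (X g) x + pairGrad (X g) (X g) x := by
    simp only [pairGrad, map_add, pair_add_left, pair_add_right, Finset.mul_sum,
      ← Finset.sum_add_distrib, ← Finset.sum_sub_distrib]
    refine Finset.sum_congr rfl fun c _ => ?_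
    rw [pair_comm (del c (X g)) (del c (X f))]
    ring
  have i1 := integrable_pairGrad (X f) (hX g hg)
  have i2 := integrable_pairGrad (X g) (hX g hg)
  simp only [e]
  refine ⟨(i1.const_mul 2).add i2, ?_⟩
  rw [MeasureTheory.integral_add (i1.const_mul 2) i2, MeasureTheory.integral_const_mul,
    integral_pairGrad _ (hX g hg), integral_pairGrad _ (hX g hg)]

end

/-! ### Contractions of fields of lowered degree -/

lemma Homog.congr {p q p' q' : ℝ} {f : Fock n} (h : Homog p q f) (hp : p = p') (hq : q = q') :
    Homog p' q' f := hp ▸ hq ▸ h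

section
variable {p : ℕ} {f : Fock n}

/-- Multiplication by `q` hides the case `q = 0`, where the truncated `q - 1` is not the true degree
but the field vanishes. The prefactors `s - 2` in the Lagrangians supply exactly this factor. -/
lemma mul_contr_ev_right (hf : Homog (p : ℝ) ((q : ℝ) - 1) f) (g : Fock n) (x) :
    (q : ℝ) * contr (ev p (q - 1) f) (ev p (q - 1) g) x
      = (p.factorial * q.factorial : ℝ) * pair f g x := by
  cases q with
  | zero =>
    rw [hf.eq_zero (Or.inr (by norm_num)), pair_zero_left]
    simp
  | succ q =>
    have h := contr_ev (p := p) (q := q) (hf.congr rfl (by push_cast; ring)) g x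
    rw [Nat.factorial_succ]
    refine (congrArg _ h).trans ?_
    push_cast
    ring

lemma mul_contr_ev_left (hf : Homog ((p : ℝ) - 1) (q : ℝ) f) (g : Fock n) (x) :
    (p : ℝ) * contr (ev (p - 1) q f) (ev (p - 1) q g) x
      = (p.factorial * q.factorial : ℝ) * pair f g x := by
  cases p with
  | zero =>
    rw [hf.eq_zero (Or.inl (by norm_num)), pair_zero_left]
    simp
  | succ p =>
    have h := contr_ev (p := p) (q := q) (hf.congr (by push_cast; ring) rfl) g x
    rw [Nat.factorial_succ]
    refine (congrArg _ h).trans ?_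
    push_cast
    ring

/-- The same for two lowered degrees: the factor `q (q - 1)` vanishes for both `q = 0` and `q = 1`.
-/
lemma mul_contr_ev_right_two (hf : Homog (p : ℝ) ((q : ℝ) - 2) f) (g : Fock n) (x) :
    (q : ℝ) * (q - 1) * contr (ev p (q - 1 - 1) f) (ev p (q - 1 - 1) g) x
      = (p.factorial * q.factorial : ℝ) * pair f g x := by
  cases q with
  | zero =>
    rw [hf.eq_zero (Or.inr (by norm_num)), pair_zero_left]
    simp
  | succ q =>
    have h := mul_contr_ev_right (p := p) (q := q) (hf.congr rfl (by push_cast; ring)) g x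
    have h2 : ((q + 1 : ℕ) : ℝ) * ((q + 1 : ℕ) - 1) = ((q : ℝ) + 1) * q := by push_cast; ring
    rw [h2, mul_assoc, Nat.factorial_succ]
    refine (congrArg _ h).trans ?_
    push_cast
    ring

lemma mul_kin_ev_right (hf : Homog (p : ℝ) ((q : ℝ) - 1) f) (x) :
    (q : ℝ) * kin (ev p (q - 1) f) x = (p.factorial * q.factorial : ℝ) * pairGrad f f x := by
  simp only [kin, pairGrad, pd_ev, Finset.mul_sum]
  refine Finset.sum_congr rfl fun c _ => ?_
  rw [mul_left_comm, mul_contr_ev_right (hf.del c)]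
  ring

/-- With truncated subtraction the degree is correct also for `q ≤ 1`, because the trace is then
zero and zero is homogeneous of every degree. -/
lemma homog_A_ev (hf : Homog (p : ℝ) (q : ℝ) f) :
    Homog (p : ℝ) ((q - 1 - 1 : ℕ) : ℝ) (opA f) := by
  match q with
  | 0 => rw [hf.A.eq_zero (Or.inr (by norm_num))]; constructor <;> simp
  | 1 => rw [hf.A.eq_zero (Or.inr (by norm_num))]; constructor <;> simp
  | q + 2 => exact hf.A.congr rfl (by push_cast [Nat.add_sub_cancel]; simp)

lemma trA_trA_ev_eq_zero (hf : Homog (p : ℝ) (q : ℝ) f) :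
    trA (trA (ev p q f)) = 0 ↔ opA (opA f) = 0 := by
  rw [trA_ev hf, trA_ev_eq_zero (homog_A_ev hf)]

lemma homog_M_ev (hf : Homog (p : ℝ) (q : ℝ) f) :
    Homog ((p - 1 : ℕ) : ℝ) ((q - 1 : ℕ) : ℝ) (opM f) := by
  match p, q with
  | 0, _ => rw [hf.M.eq_zero (Or.inl (by norm_num))]; constructor <;> simp
  | _ + 1, 0 => rw [hf.M.eq_zero (Or.inr (by norm_num))]; constructor <;> simp
  | p + 1, q + 1 => exact hf.M.congr (by push_cast; simp) (by push_cast; simp)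

lemma trA_trM_ev_eq_zero (hf : Homog (p : ℝ) (q : ℝ) f) :
    trA (trM (ev p q f)) = 0 ↔ opA (opM f) = 0 := by
  rw [trM_ev hf, trA_ev_eq_zero (homog_M_ev hf)]

lemma isFronsdalField_ev (hf : Homog 0 (q : ℝ) f) :
    IsFronsdalField (ev 0 q f) ↔ opA (opA f) = 0 := by
  have hf' : Homog ((0 : ℕ) : ℝ) (q : ℝ) f := hf.congr (by simp) rfl
  rw [← trA_trA_ev_eq_zero hf']
  exact ⟨fun h => h.2.2, fun h => ⟨isSmooth_ev _ _ _, isBiSym_ev _ _ _, h⟩⟩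

end

/-! ### The Fronsdal field -/

lemma symPart_ev' (f : Fock n) : symPart (q + 2) (ev 1 (q + 1) f : Ten n 1 (q + 2 - 1))
    = ev 0 (q + 2) ((1 / ((q : ℝ) + 2)) • opS f) := by
  have h := symPart_ev (q + 1) f
  refine h.trans ?_
  rw [ev_smul]
  congr 1
  push_cast
  ring

/-- A traceless form with prescribed symmetric part. -/
def vielbeinF (s : ℝ) (h : Fock n) : Fock n :=
  -- Up to the factor `s`, `opR h` already has symmetric part `h`. The bracket is annihilated by
  -- `opS`, and its coefficient is the one that cancels the trace of `opR h`.
  opR h + (1 / (2 * (n + s - 4))) • ((s - 2) • opM' (opA h) - opA' (opR (opA h)))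

/-- Transfers a polarization to tensors. The predicate `C` records the degree and constraints under
which the Lagrangian is known to translate. -/
lemma Polar.actionDiff_ev {p : ℕ} {L : Fock n → (Fin n → ℝ) → ℝ} {B : Fock n → Fock n → ℝ}
    (h : Polar L B) {T : Ten n p q → (Fin n → ℝ) → ℝ} {C : Fock n → Prop}
    (hT : ∀ f, C f → T (ev p q f) = L f) {f g : Fock n} (hf : C f) (hfg : C (f + g))
    (hg : g ∈ cs n) : actionDiff T (ev p q f) (ev p q g) = 2 * B f g + B g g := by
  rw [← (h f g hg).2, ← hT f hf, ← hT _ hfg]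
  rfl

/-- The Fronsdal Lagrangian as a function on families. -/
def fronsdalF (s : ℕ) (h : Fock n) (x : Fin n → ℝ) : ℝ :=
  (s.factorial : ℝ) * (-1 / 2 * pairGrad h h x + 1 / 2 * pair (opDa h) (opDa h) x
    + 1 / 2 * pair (opDa (opDa h)) (opA h) x + 1 / 4 * pairGrad (opA h) (opA h) x
    + 1 / 8 * pair (opDa (opA h)) (opDa (opA h)) x)

/-- Each trace or divergence lowers the factorial produced by `contr_ev`; the coefficients in `s`
compensate this, so pure numbers remain. -/
lemma fronsdal_ev {h : Fock n} (hh : Homog 0 ((q : ℝ) + 2) h) (x) :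
    fronsdalLagrangian (ev 0 (q + 2) h) x = fronsdalF (q + 2) h x := by
  have h0 : Homog ((0 : ℕ) : ℝ) ((q + 2 : ℕ) : ℝ) h := hh.congr (by simp) (by push_cast; ring)
  have hA : Homog ((0 : ℕ) : ℝ) (q : ℝ) (opA h) := h0.A.congr rfl (by push_cast; ring)
  have hD : Homog ((0 : ℕ) : ℝ) ((q + 1 : ℕ) : ℝ) (opDa h) := h0.Da.congr rfl (by push_cast; ring)
  have hDD : Homog ((0 : ℕ) : ℝ) (q : ℝ) (opDa (opDa h)) := hD.Da.congr rfl (by push_cast; ring)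
  have e1 : divA (ev 0 (q + 2) h) = ev 0 (q + 1) (opDa h) := divA_ev h0
  have e2 : divA (ev 0 (q + 1) (opDa h)) = ev 0 q (opDa (opDa h)) := divA_ev hD
  have e3 : trA (ev 0 (q + 2) h) = ev 0 q (opA h) := trA_ev h0
  have e4 : divA (ev 0 q (opA h)) = ev 0 (q - 1) (opDa (opA h)) := divA_ev hA
  have key : fronsdalLagrangian (ev 0 (q + 2) h) x = -1 / 2 * kin (ev 0 (q + 2) h) x
      + ((q + 2 : ℕ) : ℝ) / 2 * contr (ev 0 (q + 1) (opDa h)) (ev 0 (q + 1) (opDa h)) x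
      + ((q + 2 : ℕ) : ℝ) * ((q + 2 : ℕ) - 1) / 2
        * contr (ev 0 q (opDa (opDa h))) (ev 0 q (opA h)) x
      + ((q + 2 : ℕ) : ℝ) * ((q + 2 : ℕ) - 1) / 4 * kin (ev 0 q (opA h)) x
      + ((q + 2 : ℕ) : ℝ) * ((q + 2 : ℕ) - 1) * ((q + 2 : ℕ) - 2) / 8
        * contr (ev 0 (q - 1) (opDa (opA h))) (ev 0 (q - 1) (opDa (opA h))) x := by
    rw [← e4, ← e2, ← e3, ← e1]
    rfl
  have h5 := mul_contr_ev_right (p := 0) (hA.Da) (opDa (opA h)) x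
  rw [key, kin_ev h0, contr_ev hD, contr_ev hDD, kin_ev hA, fronsdalF]
  simp only [Nat.factorial_succ, Nat.factorial_zero] at h5 ⊢
  push_cast at h5 ⊢
  linear_combination (((q : ℝ) + 2) * (q + 1) / 8) * h5

/-- The polarization of the Fronsdal action. -/
def fronsdalB (h k : Fock n) : ℝ :=
  1 / 2 * ip h (box k) + 1 / 2 * ip (opDa h) (opDa k)
    + 1 / 4 * (ip (opDa (opDa h)) (opA k) + ip (opA h) (opDa (opDa k)))
    - 1 / 4 * ip (opA h) (box (opA k)) + 1 / 8 * ip (opDa (opA h)) (opDa (opA k))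

lemma polar_fronsdalF (s : ℕ) : Polar (fronsdalF (n := n) s)
    (fun f g => (s.factorial : ℝ) * fronsdalB f g) := by
  have h1 := polar_pairGrad (n := n) LinearMap.id fun g hg => hg
  have h2 := polar_pair (n := n) opDa opDa (fun g hg => cs_Da hg) fun g hg => cs_Da hg
  have h3 := polar_pair (n := n) (opDa ∘ₗ opDa) opA (fun g hg => cs_Da (cs_Da hg))
    fun g hg => cs_A hg
  have h4 := polar_pairGrad (n := n) opA fun g hg => cs_A hg
  have h5 := polar_pair (n := n) (opDa ∘ₗ opA) (opDa ∘ₗ opA) (fun g hg => cs_Da (cs_A hg))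
    fun g hg => cs_Da (cs_A hg)
  have h := ((((h1.smul (-1 / 2)).add (h2.smul (1 / 2))).add (h3.smul (1 / 2))).add
    (h4.smul (1 / 4))).add (h5.smul (1 / 8))
  refine (congrArg (Polar _) ?_).mpr (h.smul (s.factorial : ℝ))
  funext f g
  simp only [fronsdalB, LinearMap.coe_comp, Function.comp_apply, LinearMap.id_coe, id_eq]
  ring_nf

lemma box_A' (f : Fock n) : opA' (box f) = box (opA' f) := by
  simp only [box_apply, map_sum, map_smul, del_A']
lemma box_M' (f : Fock n) : opM' (box f) = box (opM' f) := by
  simp only [box_apply, map_sum, map_smul, del_M']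
lemma box_Da (f : Fock n) : opDa (box f) = box (opDa f) := by
  simp only [box_apply, map_sum, map_smul, del_Da]
lemma box_Db (f : Fock n) : opDb (box f) = box (opDb f) := by
  simp only [box_apply, map_sum, map_smul, del_Db]
lemma box_Ga (f : Fock n) : opGa (box f) = box (opGa f) := by
  simp only [box_apply, map_sum, map_smul, del_Ga]
lemma box_Gb (f : Fock n) : opGb (box f) = box (opGb f) := by
  simp only [box_apply, map_sum, map_smul, del_Gb]

/-- The d'Alembertian commutes with all operators. -/
lemma algB (f : Fock n) : opA (box f) = box (opA f) ∧ opM (box f) = box (opM f) ∧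
    opS (box f) = box (opS f) ∧ opR (box f) = box (opR f) ∧ opA' (box f) = box (opA' f) ∧
    opM' (box f) = box (opM' f) ∧ opDa (box f) = box (opDa f) ∧ opDb (box f) = box (opDb f) ∧
    opGa (box f) = box (opGa f) ∧ opGb (box f) = box (opGb f) :=
  ⟨box_A f, box_M f, box_S f, box_R f, box_A' f, box_M' f, box_Da f, box_Db f, box_Ga f, box_Gb f⟩

/-- The second-order operator of the eliminated action is the one of the Fronsdal action, up to
terms proportional to the metric. -/
lemma Db_yF_Gb {Q : ℝ} (hQ : 0 < Q) {f : Fock n} (hf : Homog 1 Q f) (hA : opA f = 0) :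
    -(Q • opDb (yF Q (opGb f)))
      = (1 / 2 : ℝ) • opR (box (opS f)) - (1 / 2 : ℝ) • opR (opGa (opDa (opS f)))
        + (1 / 4 : ℝ) • (opR (opGa (opGa (opA (opS f)))) + opR (opA' (opDa (opDa (opS f)))))
        - (1 / 4 : ℝ) • opR (opA' (box (opA (opS f))))
        - (1 / 8 : ℝ) • opR (opA' (opGa (opDa (opA (opS f)))))
        - opA' ((1 / 4 : ℝ) • opR (opDa (opDa (opS f))) - (1 / 2 : ℝ) • opR (box (opM f))
          - (1 / 4 : ℝ) • opR (opGa (opDa (opM f)))) := by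
  have h1 : Q ≠ 0 := hQ.ne'
  -- A vielbein has one index in its first group, so removing two from it gives zero.
  have h2 : opS (opM f) = 0 := hf.M.S.eq_zero (Or.inl (by norm_num))
  have h3 : opDb (opS f) = 0 := hf.S.Db.eq_zero (Or.inl (by norm_num))
  have h4 : opDb (opM f) = 0 := hf.M.Db.eq_zero (Or.inl (by norm_num))
  have h5 : opDb (opR (opS f)) = opDa (opS f) := by
    have h := R_Db (opS f)
    rw [h3, map_zero] at h
    exact (sub_eq_zero.1 h.symm).symm
  have h6 : opDb (opR (opM f)) = opDa (opM f) := by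
    have h := R_Db (opM f)
    rw [h4, map_zero] at h
    exact (sub_eq_zero.1 h.symm).symm
  simp only [yF, map_smul, map_add, map_sub, map_neg, alg, algD, algN, algB, hA, hf.1, hf.2,
    map_zero, smul_zero, h2, h3, h4, h5, h6]
  match_scalars <;> field_simp <;> ring

end

end SpinDuality

/-! ### The eliminated action is the Fronsdal action. -/

namespace SpinDuality

noncomputable section

variable {n q : ℕ}

/-- Adjunction moves `opS` off `f`, so the Fronsdal form becomes `⟨f, R (…) S g⟩`. By `Db_yF_Gb`
this is the eliminated operator up to the image of `opA'`, which is orthogonal to the traceless `f`.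
-/
lemma fronsdalB_S (f : Fock n) {g : Fock n} (hg : g ∈ cs n) (hA : opA f = 0) {Q : ℝ} (hQ : 0 < Q)
    (h : Homog 1 Q g) (hA' : opA g = 0) :
    fronsdalB (opS f) (opS g) = Q * ip (opGb f) (yF Q (opGb g)) := by
  have hS := cs_S hg
  have hDS := cs_Da hS
  have hAS := cs_A hS
  have c1 := cs_R (cs_box hS)
  have c2 := cs_R (cs_Ga hDS)
  have c3 := cs_R (cs_Ga (cs_Ga hAS))
  have c4 := cs_R (cs_A' (cs_Da hDS))
  have c5 := cs_R (cs_A' (cs_box hAS))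
  have c6 := cs_R (cs_A' (cs_Ga (cs_Da hAS)))
  have c7 := add_mem c3 c4
  have cM := cs_M hg
  have key := congrArg (ip f) (Db_yF_Gb hQ h hA')
  have e7 : ip f (opA' ((1 / 4 : ℝ) • opR (opDa (opDa (opS g))) - (1 / 2 : ℝ) • opR (box (opM g))
      - (1 / 4 : ℝ) • opR (opGa (opDa (opM g))))) = 0 := by
    rw [← ip_A_left, hA, ip_zero_left]
  have c8 : opA' ((1 / 4 : ℝ) • opR (opDa (opDa (opS g))) - (1 / 2 : ℝ) • opR (box (opM g))
      - (1 / 4 : ℝ) • opR (opGa (opDa (opM g)))) ∈ cs n :=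
    cs_A' (sub_mem (sub_mem (Submodule.smul_mem _ _ (cs_R (cs_Da hDS)))
      (Submodule.smul_mem _ _ (cs_R (cs_box cM)))) (Submodule.smul_mem _ _
        (cs_R (cs_Ga (cs_Da cM)))))
  have s1 (c : ℝ) {x : Fock n} (hx : x ∈ cs n) : c • x ∈ cs n := Submodule.smul_mem _ _ hx
  rw [ip_sub_right _ (sub_mem (sub_mem (add_mem (sub_mem (s1 _ c1) (s1 _ c2)) (s1 _ c7)) (s1 _ c5))
      (s1 _ c6)) c8, ip_sub_right _ (sub_mem (add_mem (sub_mem (s1 _ c1) (s1 _ c2)) (s1 _ c7))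
      (s1 _ c5)) (s1 _ c6), ip_sub_right _ (add_mem (sub_mem (s1 _ c1) (s1 _ c2)) (s1 _ c7))
      (s1 _ c5), ip_add_right _ (sub_mem (s1 _ c1) (s1 _ c2)) (s1 _ c7),
    ip_sub_right _ (s1 _ c1) (s1 _ c2), e7, ip_neg_right, ip_smul_right, ip_smul_right,
    ip_smul_right, ip_smul_right, ip_smul_right, ip_smul_right, ip_add_right _ c3 c4] at key
  rw [fronsdalB, ip_Gb_left _ (cs_yF (cs_Gb hg)), mul_neg, key, ip_S_left,
    ip_Da_left _ hDS, ip_S_left, ip_Da_left _ hAS, ip_Da_left _ (cs_Ga hAS), ip_S_left,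
    ip_A_left, ip_S_left, ip_A_left, ip_S_left, ip_Da_left _ (cs_Da hAS), ip_A_left, ip_S_left]
  ring

lemma pair_yF_left {Q : ℝ} (f g : Fock n) (x) : pair (yF Q f) g x = pair f (yF Q g) x := by
  simp only [yF, pair_smul_left, pair_smul_right, pair_add_left, pair_add_right, pair_sub_left,
    pair_sub_right, map_add, pair_R_left, pair_S_left, pair_M'_left, pair_M_left]

lemma ip_yF_left {Q : ℝ} (f g : Fock n) : ip (yF Q f) g = ip f (yF Q g) :=
  MeasureTheory.integral_congr_ae (Filter.Eventually.of_forall (pair_yF_left f g))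

variable (hn : (4 : ℝ) ≤ n)

lemma isFronsdalField_symPart (e : Ten n 1 (q + 2 - 1)) (he0 : IsTracelessForm e) :
    IsFronsdalField (symPart (q + 2) e) := by
  obtain ⟨e, he, hA, rfl⟩ := IsTracelessForm.exists_ev (p := 1) (q := q + 1) he0
  rw [symPart_ev', isFronsdalField_ev
    ((he.S.smul _).congr (by simp) (by push_cast; ring)), map_smul, map_smul, A_S, hA, map_zero,
    zero_add, map_smul, A_M, hA]
  simp

lemma symPart_eq_iff (e e' : Ten n 1 (q + 2 - 1)) (he0 : IsTracelessForm e)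
    (he0' : IsTracelessForm e') :
    symPart (q + 2) e = symPart (q + 2) e' ↔ IsHook (q + 2) (e - e') := by
  obtain ⟨e, he, hA, rfl⟩ := IsTracelessForm.exists_ev (p := 1) (q := q + 1) he0
  obtain ⟨e', he', hA', rfl⟩ := IsTracelessForm.exists_ev (p := 1) (q := q + 1) he0'
  have h0 : ((0 : ℕ) : ℝ) = ((1 : ℕ) : ℝ) - 1 := by norm_num
  have hq : ((q + 1 : ℕ) : ℝ) + 1 = ((q + 2 : ℕ) : ℝ) := by push_cast; ring
  have h1 : IsHook (q + 2) ((ev 1 (q + 1) e : Ten n 1 (q + 2 - 1)) - ev 1 (q + 1) e') ↔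
      opS (e - e') = 0 ∧ opA (e - e') = 0 :=
    isHook_ev ((he.sub he').congr (by simp) (by push_cast; ring))
  have hne : (1 / ((q : ℝ) + 2)) ≠ 0 := by positivity
  rw [h1, symPart_ev', symPart_ev', ev_inj ((he.S.smul _).congr h0.symm hq)
    ((he'.S.smul _).congr h0.symm hq), map_sub, map_sub, hA, hA', sub_zero, sub_eq_zero,
    (smul_right_injective _ hne).eq_iff]
  simp

include hn

lemma exists_symPart_eq (h : Ten n 0 (q + 2)) (hh : IsFronsdalField h) :
    ∃ e : Ten n 1 (q + 2 - 1), IsTracelessForm e ∧ symPart (q + 2) e = h ∧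
      (IsCompactlySupported h → IsCompactlySupported e) := by
  obtain ⟨h, hh', rfl⟩ := SpinDuality.exists_ev hh.1 hh.2.1
  have hAA := (trA_trA_ev_eq_zero hh').1 hh.2.2
  have hA := homog_A_ev hh'
  have hq0 : (0 : ℝ) ≤ q := Nat.cast_nonneg q
  have hs : (q : ℝ) + 2 ≠ 0 := by positivity
  have hN : (n : ℝ) + ((q : ℝ) + 2) - 4 ≠ 0 := by linarith
  have hA2 : Homog 0 (q : ℝ) (opA h) := hh'.A.congr (by simp) (by push_cast; ring)
  have hh2 : Homog 0 ((q : ℝ) + 2) h := hh'.congr (by simp) (by push_cast; ring)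
  have hM : opM (opA h) = 0 := hA2.M.eq_zero (Or.inl (by norm_num))
  have hM' : opM h = 0 := hh2.M.eq_zero (Or.inl (by norm_num))
  have hS : opS (opA h) = 0 := hA2.S.eq_zero (Or.inl (by norm_num))
  have hS' : opS h = 0 := hh2.S.eq_zero (Or.inl (by norm_num))
  -- Double tracelessness of `h` enters here: it makes the correction term free of mixed traces.
  have hMR : opM (opR (opA h)) = 0 := by rw [M_R, hAA, hM, map_zero, sub_zero]
  set e := vielbeinF ((q : ℝ) + 2) h with he
  have hE : Homog ((1 : ℕ) : ℝ) ((q + 1 : ℕ) : ℝ) e := by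
    have h1 : Homog ((1 : ℕ) : ℝ) ((q + 1 : ℕ) : ℝ) (opR h) :=
      hh2.R.congr (by simp) (by push_cast; ring)
    have h2 : Homog ((1 : ℕ) : ℝ) ((q + 1 : ℕ) : ℝ) (opM' (opA h)) :=
      hA2.M'.congr (by simp) (by push_cast; ring)
    have h3 : Homog ((1 : ℕ) : ℝ) ((q + 1 : ℕ) : ℝ) (opA' (opR (opA h))) :=
      hA2.R.A'.congr (by simp) (by push_cast; ring)
    exact h1.add (((h2.smul _).sub h3).smul _)
  refine ⟨ev 1 (q + 1) e, isTracelessForm_ev (p := 1) (q := q + 1) hE ?_, ?_, fun hc => ?_⟩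
  · simp only [he, vielbeinF, map_smul, map_add, map_sub, map_neg, alg, algN, hAA, hM, hM', hS, hS', hA2.1,
      hA2.2, hh2.1, hh2.2, hMR, map_zero, smul_zero]
    match_scalars <;> field_simp <;> ring
  · rw [symPart_ev']
    congr 1
    simp only [he, vielbeinF, map_smul, map_add, map_sub, map_neg, alg, algN, hAA, hM, hM', hS, hS', hA2.1,
      hA2.2, hh2.1, hh2.2, hMR, map_zero, smul_zero]
    match_scalars <;> field_simp <;> ring
  · have hc' := mem_cs_of_ev hh' hc
    have hcA := cs_A hc'
    exact isCompactlySupported_ev (p := 1) (q := q + 1) (add_mem (cs_R hc')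
      (Submodule.smul_mem _ _ (sub_mem (Submodule.smul_mem _ _ (cs_M' hcA)) (cs_A' (cs_R hcA)))))

/-- At the solution the two terms of the parent Lagrangian combine to `(s-1)! ⟨Gb e, yF (Gb e)⟩`.
With `h = opS e / s` the Fronsdal side carries `s! / s²` and the factor `s - 1` of `fronsdalB_S`;
their quotient is the constant `s / (s-1)`. -/
lemma actionDiff_eliminated (e δe : Ten n 1 (q + 2 - 1)) (he0 : IsTracelessForm e)
    (hδ0 : IsVariation δe) :
    actionDiff (fun e : Ten n 1 (q + 2 - 1) =>
        parentLagrangian (q + 2) e (yOfB (q + 2) ((2 : ℝ) • asym (grad e)))) e δe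
      = (((q + 2 : ℕ) : ℝ) / ((q + 2 : ℕ) - 1)) *
        actionDiff fronsdalLagrangian (symPart (q + 2) e) (symPart (q + 2) δe) := by
  obtain ⟨e, he, hA, rfl⟩ := IsTracelessForm.exists_ev (p := 1) (q := q + 1) he0
  obtain ⟨δ, hδ, hA', hc, rfl⟩ := IsVariation.exists_ev (p := 1) (q := q + 1) hδ0
  push_cast at he hδ
  have hQ : (0 : ℝ) < (q : ℝ) + 1 := by positivity
  have hs : ((q + 2 : ℕ) : ℝ) - 1 = (q : ℝ) + 1 := by push_cast; ring
  have hT (f : Fock n) (hf : Homog 1 ((q : ℝ) + 1) f ∧ opA f = 0) :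
      parentLagrangian (q + 2) (ev 1 (q + 1) f : Ten n 1 (q + 2 - 1)) (yOfB (q + 2)
        ((2 : ℝ) • asym (grad (ev 1 (q + 1) f : Ten n 1 (q + 2 - 1)))))
      = fun x => ((q + 1).factorial : ℝ) * pair (opGb f) (yF ((q : ℝ) + 1) (opGb f)) x := by
    have hG : Homog 2 ((q : ℝ) + 1) (opGb f) := hf.1.Gb.congr (by norm_num) rfl
    have hAG : opA (opGb f) = 0 := by rw [A_Gb, hf.2, map_zero]
    have h1 : (2 : ℝ) • asym (grad (ev 1 (q + 1) f : Ten n 1 (q + 2 - 1)))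
        = (ev 2 (q + 1) (opGb f) : Ten n 2 (q + 2 - 1)) := by
      have h := asym_grad_ev 1 (q + 1) f
      refine (congrArg (fun W : Ten n 2 (q + 1) => (2 : ℝ) • W) h).trans ?_
      simp only [smul_smul]
      norm_num
    funext x
    rw [h1, yOfB_ev hG, parent_ev f hG.yF (A_yF hAG) hn, parentF, xF_yF hG hAG hQ hn,
      pair_comm (yF _ _)]
    ring
  have hp := (polar_pair (n := n) opGb (⟨⟨yF ((q : ℝ) + 1), fun f g => yF_add f g⟩,
    fun c f => yF_smul f c⟩ ∘ₗ opGb) (fun g hg => cs_Gb hg) fun g hg => cs_yF (cs_Gb hg)).smul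
    ((q + 1).factorial : ℝ)
  have h1 := hp.actionDiff_ev (p := 1) (q := q + 1) (C := fun f => Homog 1 ((q : ℝ) + 1) f ∧ opA f = 0)
    (T := fun e : Ten n 1 (q + 1) => parentLagrangian (q + 2) (e : Ten n 1 (q + 2 - 1))
      (yOfB (q + 2) ((2 : ℝ) • asym (grad (e : Ten n 1 (q + 2 - 1)))))) hT (f := e) (g := δ) ⟨he, hA⟩
      ⟨he.add hδ, by rw [map_add, hA, hA', add_zero]⟩ hc
  have h2 := (polar_fronsdalF (n := n) (q + 2)).actionDiff_ev (p := 0) (q := q + 2)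
    (T := fronsdalLagrangian) (C := Homog 0 ((q : ℝ) + 2)) (fun f hf => funext (fronsdal_ev hf))
    (f := (1 / ((q : ℝ) + 2)) • opS e) (g := (1 / ((q : ℝ) + 2)) • opS δ)
    ((he.S.smul _).congr (by norm_num) (by ring))
    ((he.S.smul _).add (hδ.S.smul _) |>.congr (by norm_num) (by ring))
    (Submodule.smul_mem _ _ (cs_S hc))
  have h4 (f g : Fock n) (c : ℝ) : fronsdalB (c • f) (c • g) = c ^ 2 * fronsdalB f g := by
    simp only [fronsdalB, map_smul, ip_smul_left, ip_smul_right]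
    ring
  have hq2 : (q : ℝ) + 2 ≠ 0 := by positivity
  rw [symPart_ev', symPart_ev', hs]
  refine h1.trans ?_
  rw [h2, h4, h4, fronsdalB_S e hc hA hQ hδ hA', fronsdalB_S δ hc hA' hQ hδ hA']
  simp only [LinearMap.coe_comp, Function.comp_apply, LinearMap.coe_mk, AddHom.coe_mk]
  rw [ip_yF_left, ip_yF_left, Nat.factorial_succ (q + 1)]
  push_cast
  field_simp
  ring

end

end SpinDuality

namespace SpinDuality

noncomputable section

/-! ### Solution of the constraints -/

section
variable {n q p : ℕ}

lemma divB_eq_zero_iff (hp : p + 1 < n) (Y : Ten n (p + 1) q) (hY : IsTracelessForm Y) :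
    divB Y = 0 ↔ ∃ P : Ten n (p + 2) q, IsTracelessForm P ∧ divB P = Y := by
  obtain ⟨y, hy, hA, rfl⟩ := hY.exists_ev
  rw [divB_ev_eq_zero hy]
  constructor
  · intro h
    obtain ⟨X, hX, hAX, rfl⟩ := exists_opDb_eq hy hA hp h
    have hX' : Homog ((p + 2 : ℕ) : ℝ) (q : ℝ) X := hX.congr (by push_cast; ring) rfl
    exact ⟨ev (p + 2) q X, isTracelessForm_ev hX' hAX, divB_ev hX'⟩
  · rintro ⟨P, hP, h⟩
    obtain ⟨X, hX, hAX, rfl⟩ := hP.exists_ev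
    have h2 := (divB_ev hX).symm.trans h
    have h3 := (ev_inj (p := p + 1) (q := q) (hX.Db.congr (by push_cast; ring) rfl) hy).1 h2
    rw [← h3, Db_Db]

lemma exists_divB_eq_of_compact (Y : Ten n (p + 1) q) (hY : IsTracelessForm Y)
    (hc : IsCompactlySupported Y) (h : divB Y = 0) :
    ∃ P : Ten n (p + 2) q, IsVariation P ∧ divB P = Y := by
  obtain ⟨y, hy, hA, rfl⟩ := hY.exists_ev
  obtain ⟨X, hX, hAX, hcX, rfl⟩ := exists_opDb_eq_cs hy hA (Nat.succ_pos p) (mem_cs_of_ev hy hc)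
    ((divB_ev_eq_zero hy).1 h)
  have hX' : Homog ((p + 2 : ℕ) : ℝ) (q : ℝ) X := hX.congr (by push_cast; ring) rfl
  exact ⟨ev (p + 2) q X, isVariation_ev hX' hAX hcX, divB_ev hX'⟩

end

/-! ### The dual field -/

variable {m q : ℕ}

lemma hsgn_mul_hsgn (m : ℕ) : hsgn (m + 4) (m + 4) = -hsgn (m + 4) (m + 1) := by
  simp only [hsgn, show m + 4 - (m + 2) - 1 = 1 by omega, show m + 4 - (m + 1) - 1 = 2 by omega,
    show m + 4 - (m + 3) - 1 = 0 by omega]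
  ring

lemma hsgn_four (m : ℕ) : hsgn (m + 4) 4 = 1 := by
  simp only [hsgn, show m + 4 - 0 - 1 = m + 3 by omega, show m + 4 - 1 - 1 = m + 2 by omega,
    show m + 4 - (1 + 1) - 1 = m + 1 by omega, show m + 4 - (2 + 1) - 1 = m by omega,
    zero_add, show m + 4 - (1 + 1 + 1) - 1 = m by omega]
  have : ((-1 : ℝ) ^ m) ^ 2 = 1 := by rw [← pow_mul, mul_comm, pow_mul]; norm_num
  simp only [pow_succ]
  linear_combination (((-1 : ℝ) ^ m) ^ 2 + 1) * this

/-- The sign agrees with the one relating `epsDual T` to `star t` in `eps_ev`, so `T` is the dual of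
`X` without further sign. -/
lemma star_star_dual (f : Fock (m + 4)) : star (star f) = hsgn (m + 4) (m + 1) • f := by
  rw [star_star (by omega), hsgn_mul_hsgn, neg_neg]

/-- The component of a potential which is free of mixed traces. -/
def xPart (q : ℕ) (f : Fock (m + 4)) : Fock (m + 4) :=
  f - (1 / ((m : ℝ) + q + 2)) • opM' (opM f)

/-- The dual field of a potential. -/
def dualF (q : ℕ) (f : Fock (m + 4)) : Fock (m + 4) := star (xPart q f)

lemma xPart_sub (f g : Fock (m + 4)) : xPart q (f - g) = xPart q f - xPart q g := by
  simp only [xPart, map_sub]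
  module

section
variable {f g t z : Fock (m + 4)}

/-- The number is `n + q - 2` with `n = m + 4`. It explains the coefficient in `xPart`, which
thereby removes all mixed traces. -/
lemma M_M'_of (hz : Homog 2 (q : ℝ) z) (hM : opM z = 0) :
    opM (opM' z) = ((m : ℝ) + q + 2) • z := by
  rw [M_M', hz.1, hz.2, hM, map_zero, sub_zero]
  push_cast
  module

lemma M_homog (hf : Homog 3 ((q : ℝ) + 1) f) : Homog 2 (q : ℝ) (opM f) :=
  hf.M.congr (by norm_num) (by ring)

lemma xPart_homog (hf : Homog 3 ((q : ℝ) + 1) f) : Homog 3 ((q : ℝ) + 1) (xPart q f) :=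
  hf.sub (((M_homog hf).M'.congr (by norm_num) rfl).smul _)

lemma dualF_homog (hf : Homog 3 ((q : ℝ) + 1) f) :
    Homog ((m : ℝ) + 1) ((q : ℝ) + 1) (dualF q f) :=
  (xPart_homog hf).star.congr (by push_cast; ring) rfl

lemma M_xPart (hf : Homog 3 ((q : ℝ) + 1) f) : opM (xPart q f) = 0 := by
  have h : (m : ℝ) + q + 2 ≠ 0 := by positivity
  rw [xPart, map_sub, map_smul, M_M'_of (M_homog hf) (M_M f), smul_smul, one_div_mul_cancel h,
    one_smul, sub_self]

lemma A_xPart (hA : opA f = 0) :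
    opA (xPart q f) = -((2 / ((m : ℝ) + q + 2)) • opR (opM f)) := by
  rw [xPart, map_sub, map_smul, hA, A_M', A_M, hA, map_zero, map_zero]
  module

lemma xPart_M' (hz : Homog 2 (q : ℝ) z) (hM : opM z = 0) : xPart q (opM' z) = 0 := by
  have h : (m : ℝ) + q + 2 ≠ 0 := by positivity
  rw [xPart, M_M'_of hz hM, map_smul, smul_smul, one_div_mul_cancel h, one_smul, sub_self]

lemma xPart_of_M (hM : opM f = 0) : xPart q f = f := by
  rw [xPart, hM, map_zero, smul_zero, sub_zero]

lemma cs_xPart (hc : f ∈ cs (m + 4)) : xPart q f ∈ cs (m + 4) :=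
  sub_mem hc (Submodule.smul_mem _ _ (cs_M' (cs_M hc)))

lemma isDualField_ev (ht : Homog ((m : ℝ) + 1) ((q : ℝ) + 1) t) :
    IsDualField (q + 2) (ev (m + 1) (q + 1) t : Ten (m + 4) (m + 4 - 3) (q + 2 - 1)) ↔
      opR t = 0 ∧ opA (opA t) = 0 ∧ opA (opM t) = 0 := by
  have ht' : Homog ((m + 1 : ℕ) : ℝ) ((q + 1 : ℕ) : ℝ) t := by push_cast; exact ht
  have h1 : asym (pull (ev (m + 1) (q + 1) t : Ten (m + 4) (m + 4 - 3) (q + 2 - 1))) = 0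
      ↔ opR t = 0 := by
    have h := asym_pull_ev (m + 1) q t
    have hR : Homog ((m + 2 : ℕ) : ℝ) (q : ℝ) (opR t) :=
      ht.R.congr (by push_cast; ring) (by ring)
    have hne : (-1 : ℝ) ^ (m + 1) / (((m + 1 : ℕ) : ℝ) + 1) ≠ 0 :=
      div_ne_zero (pow_ne_zero _ (by norm_num)) (by positivity)
    exact ⟨fun h0 => (ev_eq_zero hR).1 ((smul_eq_zero_iff_right hne).1 (h.symm.trans h0)),
      fun h0 => h.trans (by rw [h0, ev_zero, smul_zero])⟩
  have h2 : trA (trA (ev (m + 1) (q + 1) t : Ten (m + 4) (m + 4 - 3) (q + 2 - 1))) = 0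
      ↔ opA (opA t) = 0 := trA_trA_ev_eq_zero ht'
  have h3 : trA (trM (ev (m + 1) (q + 1) t : Ten (m + 4) (m + 4 - 3) (q + 2 - 1))) = 0
      ↔ opA (opM t) = 0 := trA_trM_ev_eq_zero ht'
  rw [← h1, ← h2, ← h3]
  exact ⟨fun h => h.2.2, fun h => ⟨isSmooth_ev (m + 1) (q + 1) t, isBiSym_ev (m + 1) (q + 1) t, h⟩⟩

lemma IsDualField.exists_ev {T : Ten (m + 4) (m + 4 - 3) (q + 2 - 1)} (h : IsDualField (q + 2) T) :
    ∃ t : Fock (m + 4), Homog ((m : ℝ) + 1) ((q : ℝ) + 1) t ∧ opR t = 0 ∧ opA (opA t) = 0 ∧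
      opA (opM t) = 0 ∧ ev (m + 1) (q + 1) t = T := by
  obtain ⟨t, ht, rfl⟩ := SpinDuality.exists_ev (p := m + 1) (q := q + 1) h.1 h.2.1
  push_cast at ht
  obtain ⟨h1, h2, h3⟩ := (isDualField_ev ht).1 h
  exact ⟨t, ht, h1, h2, h3, rfl⟩

/-- Duality turns the missing mixed trace into the Young condition. The trace of `xPart f` is a
multiple of `opR (opM f)`: its trace vanishes because `f` is traceless, and its `opR` vanishes
because `opR` is nilpotent. These are the two double-trace conditions. -/
lemma isDualField_dualF (hf : Homog 3 ((q : ℝ) + 1) f) (hA : opA f = 0) :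
    opR (dualF q f) = 0 ∧ opA (opA (dualF q f)) = 0 ∧ opA (opM (dualF q f)) = 0 := by
  have h0 : opR (opA f) = 0 := by rw [hA, map_zero]
  refine ⟨?_, ?_, ?_⟩
  · rw [dualF, ← star_M, M_xPart hf, map_zero]
  · rw [dualF, ← star_A, ← star_A, A_xPart hA, map_neg, map_smul, A_R, A_M, hA]
    simp
  · rw [dualF, ← star_R, ← star_A, A_R, A_xPart hA, map_neg, map_smul, R_R]
    simp

/-- Evaluation of the components at a point. -/
def freeze (x : Fin (m + 4) → ℝ) : Sm (m + 4) →ₗ[ℝ] Sm (m + 4) where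
  toFun f := ⟨fun _ => f.1 x, (contDiff_const : ContDiff ℝ ∞ fun _ : Fin (m + 4) → ℝ => f.1 x)⟩
  map_add' _ _ := rfl
  map_smul' _ _ := rfl

lemma M_mapS {n : ℕ} (J : Sm n →ₗ[ℝ] Sm n) (f : Fock n) : opM (mapS J f) = mapS J (opM f) := by
  simp only [opM_apply, map_sum, map_smul, mapS_D, mapS_d]

lemma M'_mapS {n : ℕ} (J : Sm n →ₗ[ℝ] Sm n) (f : Fock n) : opM' (mapS J f) = mapS J (opM' f) := by
  simp only [opM'_apply, map_sum, map_smul, mapS_u, mapS_th]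

/-- A field of the form `η Z`, with a possibly non-smooth `Z` free of mixed traces, has vanishing
trace-free component. -/
lemma xPart_eq_zero_of_etaMix (hf : Homog 3 ((q : ℝ) + 1) f) (Z : Ten (m + 4) 2 q) (hZ : IsBiSym Z)
    (hM : trM Z = 0) (h : ev 3 (q + 1) f = asym (sym (etaMix (p := 2 + 1) (q := q + 1) Z))) :
    xPart q f = 0 := by
  have hX := xPart_homog hf
  refine Homog.eq_of_val (p := 3) (q := q + 1) (g := 0) (hX.congr (by norm_num) (by push_cast; ring))
    (by constructor <;> simp) fun b a => ?_
  ext x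
  -- `Z` need not be smooth. Its value at the point `x`, taken as a constant field, is, and the
  -- identity to be used is purely algebraic.
  obtain ⟨z, hz, hzZ⟩ := SpinDuality.exists_ev (T := fun b a _ => Z b a x) (p := 2) (q := q)
    (fun b a => contDiff_const) fun σ τ b a _ => hZ σ τ b a x
  have hMz : opM z = 0 := by
    rw [← trM_ev_eq_zero hz, hzZ]
    cases q with
    | zero => rfl
    | succ q =>
      funext b a y
      exact congrFun (congrFun (congrFun hM b) a) x
  have h1 : ev 3 (q + 1) (mapS (freeze x) f)
      = ev 3 (q + 1) ((1 / ((((2 : ℕ) : ℝ) + 1) * ((q : ℝ) + 1))) • opM' z) := by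
    rw [ev_smul, ← asym_sym_etaMix_ev 2 q z, hzZ]
    funext b a y
    exact congrFun (congrFun (congrFun h b) a) x
  have hf3 : Homog ((3 : ℕ) : ℝ) ((q + 1 : ℕ) : ℝ) f := hf.congr (by norm_num) (by push_cast; ring)
  have h2 := (ev_inj (hf3.mapS (freeze x))
    ((hz.M'.smul _).congr (by norm_num) (by push_cast; ring))).1 h1
  have h3 : mapS (freeze x) (xPart q f) = xPart q (mapS (freeze x) f) := by
    simp only [xPart, map_sub, map_smul, M_mapS, M'_mapS]
  have h4 : mapS (freeze x) (xPart q f) = 0 := by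
    have h5 := xPart_M' (hz.congr (by norm_num) rfl) hMz
    rw [h3, h2]
    simp only [xPart, map_smul] at h5 ⊢
    rw [smul_comm, ← smul_sub, h5, smul_zero]
  have h5 : ((mapS (freeze x) (xPart q f)).1 3 (q + 1) b a).1 x = 0 := by rw [h4]; rfl
  exact h5

lemma eps_ev (t : Fock (m + 4)) : (1 / ((m + 4 - 3).factorial : ℝ)) •
      (epsDual (ev (m + 1) (q + 1) t : Ten (m + 4) (m + 4 - 3) (q + 2 - 1))
        : Ten (m + 4) 3 (q + 2 - 1))
    = ev 3 (q + 1) (hsgn (m + 4) (m + 1) • star t) := by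
  have h := ev_star (show m + 4 = 3 + (m + 1) by omega) t (q + 1)
  rw [ev_smul, h, smul_smul, ← mul_div_assoc, hsgn_sq]
  rfl

/-- For uniqueness: the metric part of any admissible splitting is annihilated by `xPart`, and
`xPart` fixes the part free of mixed traces. For existence: `f` minus `xPart f` is itself a metric
part. -/
lemma isDualTo_ev (hf : Homog 3 ((q : ℝ) + 1) f) (ht : Homog ((m : ℝ) + 1) ((q : ℝ) + 1) t)
    (hR : opR t = 0) :
    IsDualTo (q + 2) (ev 3 (q + 1) f : Ten (m + 4) 3 (q + 2 - 1))
      (ev (m + 1) (q + 1) t : Ten (m + 4) (m + 4 - 3) (q + 2 - 1)) ↔ t = dualF q f := by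
  have hs : Homog 3 ((q : ℝ) + 1) (hsgn (m + 4) (m + 1) • star t) :=
    (ht.star.smul _).congr (by push_cast; ring) rfl
  have hs3 : Homog ((3 : ℕ) : ℝ) ((q + 1 : ℕ) : ℝ) (hsgn (m + 4) (m + 1) • star t) :=
    hs.congr (by norm_num) (by push_cast; ring)
  have hMs : opM (hsgn (m + 4) (m + 1) • star t) = 0 := by
    rw [map_smul, ← star_R, hR, map_zero, smul_zero]
  constructor
  · rintro ⟨X, Z, -, -, hZ, hMZ, hP, hX⟩
    have h := xPart_eq_zero_of_etaMix (hf.sub hs) Z hZ hMZ (by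
      rw [ev_sub, sub_eq_iff_eq_add, ← eps_ev, ← hX]
      exact hP.trans (add_comm _ _))
    rw [xPart_sub, xPart_of_M hMs, sub_eq_zero] at h
    rw [dualF, h, map_smul, star_star_dual, smul_smul, hsgn_sq, one_smul]
  · rintro rfl
    have h1 : hsgn (m + 4) (m + 1) • star (dualF q f) = xPart q f := by
      rw [dualF, star_star_dual, smul_smul, hsgn_sq, one_smul]
    have hz := M_homog hf
    have hz2 : Homog ((2 : ℕ) : ℝ) (q : ℝ) (opM f) := hz.congr (by norm_num) rfl
    -- The factor `3 (q+1)` undoes the unit weight of the symmetrization over three and `q + 1`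
    -- slots.
    refine ⟨ev 3 (q + 1) (xPart q f), ev 2 q ((3 * ((q : ℝ) + 1) / ((m : ℝ) + q + 2)) • opM f),
      isBiSym_ev 3 (q + 1) _, ?_, isBiSym_ev 2 q _, ?_, ?_, ?_⟩
    · have := (trM_ev_eq_zero hs3).2 hMs
      rw [h1] at this
      exact this
    · exact (trM_ev_eq_zero (hz2.smul _)).2 (by rw [map_smul, M_M, smul_zero])
    · have h := asym_sym_etaMix_ev 2 q ((3 * ((q : ℝ) + 1) / ((m : ℝ) + q + 2)) • opM f)
      refine Eq.trans ?_ (congrArg (fun W : Ten (m + 4) 3 (q + 1) =>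
        ev 3 (q + 1) (xPart q f) + W) h).symm
      change _ = ev 3 (q + 1) (xPart q f) + _
      rw [← ev_smul, ← ev_add, map_smul, smul_smul, xPart]
      congr 1
      have h2 : (1 / ((((2 : ℕ) : ℝ) + 1) * ((q : ℝ) + 1)) * (3 * ((q : ℝ) + 1) / ((m : ℝ) + q + 2)))
          = 1 / ((m : ℝ) + q + 2) := by
        push_cast
        field_simp
        norm_num
      rw [h2, sub_add_cancel]
    · rw [eps_ev, h1]

lemma existsUnique_dual (P : Ten (m + 4) 3 (q + 2 - 1)) (hP : IsTracelessForm P) :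
    ∃! T : Ten (m + 4) (m + 4 - 3) (q + 2 - 1), IsDualField (q + 2) T ∧ IsDualTo (q + 2) P T := by
  obtain ⟨f, hf, hA, rfl⟩ := IsTracelessForm.exists_ev (p := 3) (q := q + 1) hP
  push_cast at hf
  have hd := isDualField_dualF hf hA
  refine ⟨ev (m + 1) (q + 1) (dualF q f), ⟨(isDualField_ev (dualF_homog hf)).2 hd,
    (isDualTo_ev hf (dualF_homog hf) hd.1).2 rfl⟩, ?_⟩
  rintro T ⟨hT, hT'⟩
  obtain ⟨t, ht, hR, -, -, rfl⟩ := hT.exists_ev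
  rw [(isDualTo_ev hf ht hR).1 hT']

/-- A traceless potential of a dual field. -/
def potF (q : ℕ) (t : Fock (m + 4)) : Fock (m + 4) :=
  hsgn (m + 4) (m + 1) •
    (star t - (1 / (2 * ((q : ℝ) + 2))) • opM' (opS (opA (star t))))

/-- Since `opR` annihilates the trace of `x = star t`, one has `R S A x = (q+2) A x`. Applied to
`opM' (opS (opA x))`, `opA` therefore gives `2 (q+2) opA x`, which fixes the coefficient. The
correction has the form `opM' z` with `opM z = 0`, so `xPart` does not see it. -/
lemma potF_spec (ht : Homog ((m : ℝ) + 1) ((q : ℝ) + 1) t) (hR : opR t = 0)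
    (hAA : opA (opA t) = 0) (hAM : opA (opM t) = 0) :
    Homog 3 ((q : ℝ) + 1) (potF q t) ∧ opA (potF q t) = 0 ∧ dualF q (potF q t) = t := by
  set x := star t with hx
  have hX : Homog 3 ((q : ℝ) + 1) x := ht.star.congr (by push_cast; ring) rfl
  have hAX : Homog 3 ((q : ℝ) - 1) (opA x) := hX.A.congr rfl (by ring)
  have h1 : opM x = 0 := by rw [hx, ← star_R, hR, map_zero]
  have h2 : opA (opA x) = 0 := by rw [hx, ← star_A, ← star_A, hAA, map_zero]
  have h3 : opR (opA x) = 0 := by rw [← A_R, hx, ← star_M, ← star_A, hAM, map_zero]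
  have h4 : opM (opA x) = 0 := by rw [← A_M, h1, map_zero]
  have hSA : Homog 2 (q : ℝ) (opS (opA x)) := hAX.S.congr (by norm_num) (by ring)
  have hMS : opM (opS (opA x)) = 0 := by rw [M_S, h4, map_zero, neg_zero]
  have hq : (q : ℝ) + 2 ≠ 0 := by positivity
  have h8 : opR (opS (opA x)) = ((q : ℝ) + 2) • opA x := by
    have h := S_R (opA x)
    rw [h3, map_zero, hAX.1, hAX.2, eq_comm, sub_eq_zero] at h
    rw [← h]
    module
  refine ⟨(hX.sub ((hSA.M'.congr (by norm_num) rfl).smul _)).smul _, ?_, ?_⟩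
  · simp only [potF, ← hx, map_smul, map_sub, alg, algN, h1, h2, h3, h4, h8, add_zero, map_zero, smul_zero, hAX.1,
      hAX.2]
    rw [smul_eq_zero]
    right
    match_scalars
    field_simp
    ring
  · have h5 : xPart q (potF q t) = hsgn (m + 4) (m + 1) • x := by
      have h6 := xPart_M' hSA hMS
      have h7 := xPart_of_M (q := q) h1
      simp only [potF, ← hx]
      generalize opM' (opS (opA x)) = w at *
      simp only [xPart, map_smul, map_sub, h1, map_zero, smul_zero] at h6 ⊢
      calc _ = hsgn (m + 4) (m + 1) • x - (hsgn (m + 4) (m + 1) * (1 / (2 * ((q : ℝ) + 2)))) •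
            (w - (1 / ((m : ℝ) + q + 2)) • opM' (opM w)) := by module
        _ = _ := by rw [h6, smul_zero, sub_zero]
    rw [dualF, h5, map_smul, hx, star_star_dual, smul_smul, hsgn_sq, one_smul]

lemma cs_potF (hc : t ∈ cs (m + 4)) : potF q t ∈ cs (m + 4) := by
  have h := cs_star hc
  exact Submodule.smul_mem _ _ (sub_mem h (Submodule.smul_mem _ _ (cs_M' (cs_S (cs_A h)))))

lemma exists_potential (T : Ten (m + 4) (m + 4 - 3) (q + 2 - 1)) (hT : IsDualField (q + 2) T) :
    ∃ P : Ten (m + 4) 3 (q + 2 - 1), IsTracelessForm P ∧ IsDualTo (q + 2) P T ∧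
      (IsCompactlySupported T → IsCompactlySupported P) := by
  obtain ⟨t, ht, hR, hAA, hAM, rfl⟩ := hT.exists_ev
  obtain ⟨h1, h2, h3⟩ := potF_spec ht hR hAA hAM
  refine ⟨ev 3 (q + 1) (potF q t), isTracelessForm_ev (p := 3) (q := q + 1) (by push_cast; exact h1)
    h2, (isDualTo_ev h1 ht hR).2 h3.symm, fun hc => ?_⟩
  exact isCompactlySupported_ev (p := 3) (q := q + 1) (cs_potF (mem_cs_of_ev (p := m + 1)
    (q := q + 1) (by push_cast; exact ht) hc))

/-- Potentials with vanishing dual field are shifts. -/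
lemma exists_hook (hf : Homog 3 ((q : ℝ) + 1) f) (hA : opA f = 0) (h : xPart q f = 0) :
    ∃ α, Homog 1 ((q : ℝ) + 1) α ∧ opS α = 0 ∧ opA α = 0 ∧ (f ∈ cs (m + 4) → α ∈ cs (m + 4)) ∧
      f = -(1 / (2 * ((q : ℝ) + 1))) • opM' (opR α) := by
  have hq : (q : ℝ) + 1 ≠ 0 := by positivity
  have hq2 : (q : ℝ) + 2 ≠ 0 := by positivity
  have hN : (m : ℝ) + q + 2 ≠ 0 := by positivity
  have hz := M_homog hf
  set z := opM f with hzdef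
  have hfz : f = (1 / ((m : ℝ) + q + 2)) • opM' z := sub_eq_zero.1 h
  have hAz : opA z = 0 := by rw [hzdef, A_M, hA, map_zero]
  have hMz : opM z = 0 := M_M _
  -- Tracelessness of `f` is used through `A M' = M' A + 2 R`: the trace of `opM' z` is `2 opR z`.
  have hRz : opR z = 0 := by
    have h2 := congrArg opA hfz
    rw [hA, map_smul, A_M', hAz, map_zero, zero_add, eq_comm, smul_eq_zero, smul_eq_zero] at h2
    rcases h2 with h2 | h2 | h2
    · exact absurd h2 (one_div_ne_zero hN)
    · norm_num at h2
    · exact h2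
  have hSz : Homog 1 ((q : ℝ) + 1) (opS z) := hz.S.congr (by norm_num) rfl
  -- As `opR z = 0`, `opR (opS z)` is `(q+2) z`; hence `z` is `opR` of a multiple of `opS z`, and
  -- this multiple is the parameter.
  refine ⟨(-(2 * ((q : ℝ) + 1) / (((m : ℝ) + q + 2) * (q + 2)))) • opS z, hSz.smul _, ?_, ?_,
    fun hc => Submodule.smul_mem _ _ (cs_S (cs_M hc)), ?_⟩
  · rw [map_smul, S_S, smul_zero]
  · rw [map_smul, A_S, hAz, hMz]; simp
  · have h3 : opR (opS z) = ((q : ℝ) + 2) • z := by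
      have h4 := S_R z
      rw [hRz, map_zero, hz.1, hz.2, eq_comm, sub_eq_zero] at h4
      rw [← h4]
      module
    rw [map_smul, h3, map_smul, map_smul, smul_smul, smul_smul]
    refine hfz.trans ?_
    congr 1
    field_simp

/-- Equality of the duals means that `xPart` of the difference vanishes, so `exists_hook` applies.
Conversely a shift is `opM'` of a field free of mixed traces. -/
lemma dual_eq_iff (P P' : Ten (m + 4) 3 (q + 2 - 1)) (T T' : Ten (m + 4) (m + 4 - 3) (q + 2 - 1))
    (hP : IsTracelessForm P) (hP' : IsTracelessForm P') (hT : IsDualField (q + 2) T)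
    (hT' : IsDualField (q + 2) T') (hd : IsDualTo (q + 2) P T) (hd' : IsDualTo (q + 2) P' T') :
    T = T' ↔ ∃ α : Ten (m + 4) 1 (q + 2 - 1), IsSmooth α ∧ IsHook (q + 2) α ∧
      P = P' + (3 : ℝ) • shift (q + 2) α := by
  obtain ⟨f, hf, hA, rfl⟩ := IsTracelessForm.exists_ev (p := 3) (q := q + 1) hP
  obtain ⟨g, hg, hA', rfl⟩ := IsTracelessForm.exists_ev (p := 3) (q := q + 1) hP'
  obtain ⟨t, ht, hR, -, -, rfl⟩ := hT.exists_ev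
  obtain ⟨t', ht', hR', -, -, rfl⟩ := hT'.exists_ev
  push_cast at hf hg
  have e1 := (isDualTo_ev hf ht hR).1 hd
  have e2 := (isDualTo_ev hg ht' hR').1 hd'
  have hq : (q : ℝ) + 1 ≠ 0 := by positivity
  have h0 : (ev (m + 1) (q + 1) t : Ten (m + 4) (m + 4 - 3) (q + 2 - 1)) = ev (m + 1) (q + 1) t'
      ↔ xPart q (f - g) = 0 := by
    have h1 : ev (m + 1) (q + 1) t = ev (m + 1) (q + 1) t' ↔ t = t' :=
      ev_inj (by push_cast; exact ht) (by push_cast; exact ht')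
    rw [xPart_sub, ← star_eq_zero (n := m + 4) (by omega), map_sub, sub_eq_zero]
    change _ ↔ dualF q f = dualF q g
    rw [← e1, ← e2]
    exact h1
  have h1 (α : Fock (m + 4)) (hα : Homog 1 ((q : ℝ) + 1) α) (G : Ten (m + 4) 3 (q + 2 - 1))
      (hG : G = ev 3 (q + 1) g) :
      (ev 3 (q + 1) f : Ten (m + 4) 3 (q + 2 - 1)) = G + (3 : ℝ) • shift (q + 2)
        (ev 1 (q + 1) α : Ten (m + 4) 1 (q + 2 - 1)) ↔
      f - g = -(1 / (2 * ((q : ℝ) + 1))) • opM' (opR α) := by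
    have hMR : Homog 3 ((q : ℝ) + 1) (-(1 / (2 * ((q : ℝ) + 1))) • opM' (opR α)) :=
      hα.R.M'.smul _ |>.congr (by norm_num) (by ring)
    have h2 := ev_inj (p := 3) (q := q + 1) (f := f)
      (g := g + -(1 / (2 * ((q : ℝ) + 1))) • opM' (opR α)) (by push_cast; exact hf)
      (by push_cast; exact hg.add hMR)
    rw [sub_eq_iff_eq_add, add_comm (_ • _) g, ← h2, shift_ev, ev_add]
    have h3 : (3 : ℝ) • (ev 3 (q + 1) (-(1 / (6 * ((q : ℝ) + 1))) • opM' (opR α)))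
        = ev 3 (q + 1) (-(1 / (2 * ((q : ℝ) + 1))) • opM' (opR α)) := by
      rw [← ev_smul, smul_smul]
      congr 2
      field_simp
      norm_num
    rw [← h3, hG]
  rw [h0]
  constructor
  · intro h
    obtain ⟨α, hα, hS, hAα, -, h2⟩ := exists_hook (hf.sub hg) (by rw [map_sub, hA, hA', sub_zero]) h
    exact ⟨ev 1 (q + 1) α, isSmooth_ev 1 (q + 1) _, (isHook_ev hα).2 ⟨hS, hAα⟩, (h1 _ hα _ rfl).2 h2⟩
  · rintro ⟨α, hαs, hα, h⟩
    obtain ⟨a, ha, rfl⟩ := SpinDuality.exists_ev (p := 1) (q := q + 1) hαs hα.1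
    push_cast at ha
    obtain ⟨hS, hAa⟩ := (isHook_ev ha).1 hα
    have hMa : opM a = 0 := by
      have h := A_S a
      rw [hS, hAa, map_zero, map_zero, zero_add] at h
      simpa using h.symm
    rw [(h1 a ha _ rfl).1 h]
    have h2 := xPart_M' (q := q) (z := opR a) (ha.R.congr (by norm_num) (by ring))
      (by rw [M_R, hAa, hMa]; simp)
    simp only [xPart, map_smul] at h2 ⊢
    rw [smul_comm, ← smul_sub, h2, smul_zero]

end

end

end SpinDuality

namespace SpinDuality

noncomputable section

variable {m q : ℕ} {f t φ : Fock (m + 4)}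

/-! ### Gauge transformations of the dual field -/

/-- The gauge variation of the dual field. -/
def gaugeF (q : ℕ) (φ : Fock (m + 4)) : Fock (m + 4) :=
  (1 / ((m : ℝ) + 1)) • (opGb φ - (1 / ((m : ℝ) + q + 2)) • opS (opR (opGb φ)))

/-- The composite of `pull`, `asym`, `unpull` and `sym` is `opS opR` divided by `(m+2)(q+1)`, the
two rotation signs cancelling. The prefactor `(s-1)(n-2)/(n+s-4)` thus becomes `1/(m+q+2)`, the
coefficient in `xPart`. -/
lemma dualGauge_ev (φ : Fock (m + 4)) :
    dualGauge (q + 2) (ev m (q + 1) φ : Ten (m + 4) (m + 4 - 4) (q + 2 - 1))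
      = (ev (m + 1) (q + 1) (gaugeF q φ) : Ten (m + 4) (m + 4 - 3) (q + 2 - 1)) := by
  have h1 := asym_grad_ev m (q + 1) φ
  rw [← ev_smul] at h1
  set D := (1 / ((m : ℝ) + 1)) • opGb φ with hD
  have h2 := asym_pull_ev (m + 1) q D
  have h3 := sym_unpull_ev (m + 1) q (opR D)
  have hn : ((m + 4 : ℕ) : ℝ) - 2 = m + 2 := by push_cast; ring
  have hs : ((q + 2 : ℕ) : ℝ) - 1 = q + 1 := by push_cast; ring
  have hN : ((m + 4 : ℕ) : ℝ) + ((q + 2 : ℕ) : ℝ) - 4 = m + q + 2 := by push_cast; ring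
  have key : dualGauge (q + 2) (ev m (q + 1) φ : Ten (m + 4) (m + 4 - 4) (q + 2 - 1))
      = sym (ev (m + 1) (q + 1) D - (((q : ℝ) + 1) * ((m : ℝ) + 2) / ((m : ℝ) + q + 2)) •
        unpull (q := q + 1) (asym (pull (ev (m + 1) (q + 1) D)))) := by
    rw [← h1, ← hn, ← hs, ← hN]
    rfl
  have hu (c : ℝ) (W : Ten (m + 4) (m + 1 + 1) q) :
      unpull (q := q + 1) (c • W) = c • unpull (q := q + 1) W := rfl
  rw [key, h2, hu, sym_sub, sym_ev, sym_smul, sym_smul, h3, smul_smul, smul_smul, ← ev_smul,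
    ← ev_sub, gaugeF, hD]
  congr 1
  have h4 : (-1 : ℝ) ^ (m + 1) * (-1 : ℝ) ^ (m + 1) = 1 := by
    rw [← mul_pow]; norm_num
  simp only [map_smul, smul_sub, smul_smul]
  congr 2
  have h5 : ((m + 1 : ℕ) : ℝ) + 1 = m + 2 := by push_cast; ring
  rw [h5]
  have h6 : (m : ℝ) + 1 ≠ 0 := by positivity
  have h7 : (m : ℝ) + 2 ≠ 0 := by positivity
  have h8 : (m : ℝ) + q + 2 ≠ 0 := by positivity
  have h9 : (q : ℝ) + 1 ≠ 0 := by positivity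
  field_simp
  linear_combination h4

lemma epsDual_four (ψ : Fock (m + 4)) :
    (epsDual (ev 4 (q + 1) ψ : Ten (m + 4) 4 (q + 2 - 1)) : Ten (m + 4) (m + 4 - 4) (q + 2 - 1))
      = ev m (q + 1) ((24 : ℝ) • star ψ) := by
  have h := ev_star (show m + 4 = m + 4 from rfl) ψ (q + 1)
  rw [hsgn_four] at h
  rw [ev_smul, h, smul_smul]
  have : (24 : ℝ) * (1 / ((4).factorial : ℝ)) = 1 := by norm_num [Nat.factorial]
  rw [this, one_smul]

/-- The Hodge operator carries `opDb` to `opGb` and `opM' opM` to `opS opR`: the projection inside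
`dualF` becomes the correction term of the gauge variation. -/
lemma dualF_Db (ψ : Fock (m + 4)) :
    dualF q (opDb ψ) = ((m : ℝ) + 1) • gaugeF q (star ψ) := by
  have h6 : (m : ℝ) + 1 ≠ 0 := by positivity
  rw [dualF, xPart, gaugeF, map_sub, map_smul, star_Db, star_M', star_M, star_Db, smul_smul,
    mul_one_div_cancel h6, one_smul]

lemma star_homog_zero {ψ : Fock (m + 4)} (h : Homog 4 ((q : ℝ) + 1) ψ) :
    Homog (m : ℝ) ((q : ℝ) + 1) (star ψ) := h.star.congr (by push_cast; ring) rfl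

/-- The normalization of the parameter combines `4! = 24` from `epsDual` with `n - 3 = m + 1` from
the unit-weight gradient in `gaugeF`. -/
lemma gauge_of_potential (ψ : Ten (m + 4) 4 (q + 2 - 1)) (hψ : IsTracelessForm ψ) :
    IsTracelessForm (epsDual ψ : Ten (m + 4) (m + 4 - 4) (q + 2 - 1)) ∧
    IsDualTo (q + 2) (divB ψ)
      (dualGauge (q + 2) (((((m + 4 : ℕ) : ℝ) - 3) / 24) • epsDual ψ)) := by
  obtain ⟨ψ, h, hA, rfl⟩ := IsTracelessForm.exists_ev (p := 4) (q := q + 1) hψ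
  push_cast at h
  have hs := star_homog_zero h
  have hAs : opA (star ψ) = 0 := by rw [← star_A, hA, map_zero]
  rw [epsDual_four]
  constructor
  · exact isTracelessForm_ev (p := m) (q := q + 1) (by push_cast; exact hs.smul _)
      (by rw [map_smul, hAs, smul_zero])
  · have h1 : ((((m + 4 : ℕ) : ℝ) - 3) / 24) • (ev m (q + 1) ((24 : ℝ) • star ψ)
        : Ten (m + 4) (m + 4 - 4) (q + 2 - 1)) = ev m (q + 1) (((m : ℝ) + 1) • star ψ) := by
      rw [← ev_smul, smul_smul]
      congr 2
      push_cast
      ring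
    have h2 : gaugeF q (((m : ℝ) + 1) • star ψ) = dualF q (opDb ψ) := by
      rw [dualF_Db]
      simp only [gaugeF, map_smul]
      module
    have h3 : divB (ev 4 (q + 1) ψ : Ten (m + 4) 4 (q + 2 - 1)) = ev 3 (q + 1) (opDb ψ) :=
      divB_ev (p := 4) (q := q + 1) (by push_cast; exact h)
    have hD : Homog 3 ((q : ℝ) + 1) (opDb ψ) := h.Db.congr (by norm_num) rfl
    rw [h1, dualGauge_ev, h2, h3]
    exact (isDualTo_ev hD (dualF_homog hD) (isDualField_dualF hD (by rw [A_Db, hA, map_zero])).1).2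
      rfl

/-- A preimage under the map from four-form potentials to gauge parameters. -/
lemma exists_star_eq (hφ : Homog (m : ℝ) ((q : ℝ) + 1) φ) (hA : opA φ = 0) :
    ∃ ψ : Fock (m + 4), Homog 4 ((q : ℝ) + 1) ψ ∧ opA ψ = 0 ∧ (φ ∈ cs (m + 4) → ψ ∈ cs (m + 4)) ∧
      ((m : ℝ) + 1) • star ψ = φ := by
  have h6 : (m : ℝ) + 1 ≠ 0 := by positivity
  refine ⟨(hsgn (m + 4) (m + 1) / ((m : ℝ) + 1)) • star φ,
    (hφ.star.smul _).congr (by push_cast; ring) rfl, ?_, fun hc => Submodule.smul_mem _ _ (cs_star hc), ?_⟩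
  · rw [map_smul, ← star_A, hA, map_zero, smul_zero]
  · rw [map_smul, star_star_dual, smul_smul, smul_smul, mul_div_cancel₀ _ h6, hsgn_sq,
      one_smul]

lemma exists_potential_of_parameter (φ : Ten (m + 4) (m + 4 - 4) (q + 2 - 1))
    (hφ : IsTracelessForm φ) :
    ∃ ψ : Ten (m + 4) 4 (q + 2 - 1), IsTracelessForm ψ ∧
      (IsCompactlySupported φ → IsCompactlySupported ψ) ∧
      φ = ((((m + 4 : ℕ) : ℝ) - 3) / 24) • epsDual ψ := by
  obtain ⟨φ, h, hA, rfl⟩ := IsTracelessForm.exists_ev (p := m) (q := q + 1) hφ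
  push_cast at h
  obtain ⟨ψ, h1, h2, h3, rfl⟩ := exists_star_eq h hA
  refine ⟨ev 4 (q + 1) ψ, isTracelessForm_ev (p := 4) (q := q + 1) (by push_cast; exact h1) h2,
    fun hc => isCompactlySupported_ev (p := 4) (q := q + 1) (h3 (mem_cs_of_ev (p := m) (q := q + 1)
      (by push_cast; exact h) hc)), ?_⟩
  rw [epsDual_four]
  change _ = (_ • ev m (q + 1) ((24 : ℝ) • star ψ) : Ten (m + 4) m (q + 1))
  rw [← ev_smul, smul_smul]
  congr 2
  push_cast
  ring

/-- Every parameter is dual to some `ψ`, so the gauge variation is the dual field of the traceless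
potential `opDb ψ`, and no separate computation is needed. -/
lemma isDualField_dualGauge (φ : Ten (m + 4) (m + 4 - 4) (q + 2 - 1)) (hφ : IsTracelessForm φ) :
    IsDualField (q + 2) (dualGauge (q + 2) φ) := by
  obtain ⟨φ, h, hA, rfl⟩ := IsTracelessForm.exists_ev (p := m) (q := q + 1) hφ
  push_cast at h
  obtain ⟨ψ, h1, h2, -, rfl⟩ := exists_star_eq h hA
  have hD : Homog 3 ((q : ℝ) + 1) (opDb ψ) := h1.Db.congr (by norm_num) rfl
  have h3 : gaugeF q (((m : ℝ) + 1) • star ψ) = dualF q (opDb ψ) := by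
    rw [dualF_Db]
    simp only [gaugeF, map_smul]
    module
  rw [dualGauge_ev, h3]
  exact (isDualField_ev (dualF_homog hD)).2 (isDualField_dualF hD (by rw [A_Db, h2, map_zero]))

end

end SpinDuality

namespace SpinDuality

noncomputable section

variable {m q : ℕ}

/-! ### The dual Lagrangian -/

/-- The dual Lagrangian as a function on families. -/
def dualLF (q : ℕ) (t : Fock (m + 4)) (x : Fin (m + 4) → ℝ) : ℝ :=
  (-(2 * ((q : ℝ) + 1)) / ((q : ℝ) + 2) * ((q + 1).factorial : ℝ)) *
    (pairGrad t t x - pair (opDb t) (opDb t) x - pair (opDa t) (opDa t) x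
      - 2 * pair (opM t) (opDa (opDb t)) x - pair (opA t) (opDa (opDa t)) x
      - pairGrad (opM t) (opM t) x - 1 / 2 * pairGrad (opA t) (opA t) x
      + pair (opDb (opM t)) (opDb (opM t)) x - pair (opDa (opM t)) (opDb (opA t)) x
      + 1 / 4 * pair (opDb (opA t)) (opDb (opA t)) x
      - 1 / 4 * pair (opDa (opA t)) (opDa (opA t)) x)

/-- The prefactors in `n` and `s` are those produced by the factorials of lowered degrees, so they
disappear. In the degenerate cases of small `m` or `q` they vanish together with the truncated
terms. -/
lemma dual_ev {t : Fock (m + 4)} (h : Homog ((m : ℝ) + 1) ((q : ℝ) + 1) t) (x) :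
    dualLagrangian (q + 2) (ev (m + 1) (q + 1) t : Ten (m + 4) (m + 4 - 3) (q + 2 - 1)) x
      = dualLF q t x := by
  have h0 : Homog ((m + 1 : ℕ) : ℝ) ((q + 1 : ℕ) : ℝ) t := by push_cast; exact h
  have hDb : Homog (m : ℝ) ((q + 1 : ℕ) : ℝ) (opDb t) := h0.Db.congr (by push_cast; ring) rfl
  have hDa : Homog ((m + 1 : ℕ) : ℝ) (q : ℝ) (opDa t) := h0.Da.congr rfl (by push_cast; ring)
  have hM : Homog (m : ℝ) (q : ℝ) (opM t) := h0.M.congr (by push_cast; ring) (by push_cast; ring)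
  have hA' : Homog ((m + 1 : ℕ) : ℝ) ((q : ℝ) - 1) (opA t) := h0.A.congr rfl (by push_cast; ring)
  have hA : Homog ((m + 1 : ℕ) : ℝ) ((q - 1 : ℕ) : ℝ) (opA t) := homog_A_ev h0
  have e1 : divB (ev (m + 1) (q + 1) t) = ev m (q + 1) (opDb t) := divB_ev h0
  have e2 : divA (ev (m + 1) (q + 1) t) = ev (m + 1) q (opDa t) := divA_ev h0
  have e3 : trM (ev (m + 1) (q + 1) t) = ev m q (opM t) := trM_ev h0
  have e4 : trA (ev (m + 1) (q + 1) t) = ev (m + 1) (q - 1) (opA t) := trA_ev h0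
  have e5 : divA (ev m (q + 1) (opDb t)) = ev m q (opDa (opDb t)) := divA_ev hDb
  have e6 : divA (ev (m + 1) q (opDa t)) = ev (m + 1) (q - 1) (opDa (opDa t)) := divA_ev hDa
  have e7 : divB (ev m q (opM t)) = ev (m - 1) q (opDb (opM t)) := divB_ev hM
  have e8 : divA (ev m q (opM t)) = ev m (q - 1) (opDa (opM t)) := divA_ev hM
  have e9 : divB (ev (m + 1) (q - 1) (opA t)) = ev m (q - 1) (opDb (opA t)) := divB_ev hA
  have e10 : divA (ev (m + 1) (q - 1) (opA t)) = ev (m + 1) (q - 1 - 1) (opDa (opA t)) := divA_ev hA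
  have c3 : ((m + 4 : ℕ) : ℝ) - 3 = m + 1 := by push_cast; ring
  have c4 : ((m + 4 : ℕ) : ℝ) - 4 = m := by push_cast; ring
  have s0 : ((q + 2 : ℕ) : ℝ) = q + 2 := by push_cast; ring
  have s1 : ((q + 2 : ℕ) : ℝ) - 1 = q + 1 := by push_cast; ring
  have s2 : ((q + 2 : ℕ) : ℝ) - 2 = q := by push_cast; ring
  have s3 : ((q + 2 : ℕ) : ℝ) - 3 = q - 1 := by push_cast; ring
  have key : dualLagrangian (q + 2) (ev (m + 1) (q + 1) t : Ten (m + 4) (m + 4 - 3) (q + 2 - 1)) x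
      = (-(2 * ((q : ℝ) + 1)) / (((q : ℝ) + 2) * ((m + 1).factorial : ℝ))) *
      (kin (ev (m + 1) (q + 1) t) x
        - ((m : ℝ) + 1) * contr (ev m (q + 1) (opDb t)) (ev m (q + 1) (opDb t)) x
      + ((q : ℝ) + 1) * (-contr (ev (m + 1) q (opDa t)) (ev (m + 1) q (opDa t)) x
        - 2 * ((m : ℝ) + 1) * contr (ev m q (opM t)) (ev m q (opDa (opDb t))) x
        - q * contr (ev (m + 1) (q - 1) (opA t)) (ev (m + 1) (q - 1) (opDa (opDa t))) x
        - ((m : ℝ) + 1) * kin (ev m q (opM t)) x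
        - ((q : ℝ) / 2) * kin (ev (m + 1) (q - 1) (opA t)) x
        + (((m : ℝ) + 1) * m) * contr (ev (m - 1) q (opDb (opM t))) (ev (m - 1) q (opDb (opM t))) x
        - ((q : ℝ) * ((m : ℝ) + 1))
          * contr (ev m (q - 1) (opDa (opM t))) (ev m (q - 1) (opDb (opA t))) x
        + ((q : ℝ) * ((m : ℝ) + 1) / 4)
          * contr (ev m (q - 1) (opDb (opA t))) (ev m (q - 1) (opDb (opA t))) x
        - ((q : ℝ) * (q - 1) / 4)
          * contr (ev (m + 1) (q - 1 - 1) (opDa (opA t))) (ev (m + 1) (q - 1 - 1) (opDa (opA t))) x)) := by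
    rw [← e10, ← e9, ← e8, ← e7, ← e6, ← e5, ← e4, ← e3, ← e2, ← e1, ← c3, ← s1, ← s3, ← s0]
    rw [← c4]
    conv_rhs => rw [← s2]
    rfl
  have k1 := mul_contr_ev_right (p := m + 1) (q := q) hA' (opDa (opDa t)) x
  have k2 := mul_kin_ev_right (p := m + 1) (q := q) hA' x
  have k3 := mul_contr_ev_left (p := m) (q := q) (f := opDb (opM t)) hM.Db (opDb (opM t)) x
  have k4 := mul_contr_ev_right (p := m) (q := q) (f := opDa (opM t)) hM.Da (opDb (opA t)) x
  have k5 := mul_contr_ev_right (p := m) (q := q) (f := opDb (opA t))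
    (hA'.Db.congr (by push_cast; ring) rfl) (opDb (opA t)) x
  have k6 := mul_contr_ev_right_two (p := m + 1) (q := q) (f := opDa (opA t))
    (hA'.Da.congr rfl (by ring)) (opDa (opA t)) x
  rw [key, kin_ev h0, contr_ev hDb, contr_ev hDa, contr_ev hM, kin_ev hM, dualLF]
  have hq2 : (q : ℝ) + 2 ≠ 0 := by positivity
  have hf1 : ((m.factorial : ℕ) : ℝ) ≠ 0 := by positivity
  have hm1 : (m : ℝ) + 1 ≠ 0 := by positivity
  simp only [Nat.factorial_succ] at k1 k2 k6 ⊢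
  push_cast at k1 k2 k6 ⊢
  have hc (a b c d E G : ℝ) (hb : b ≠ 0) (hc : c ≠ 0) (h : E = c * d * G) :
      a / (b * c) * E = a / b * d * G := by
    rw [h]
    field_simp
  refine hc _ _ _ _ _ _ hq2 (by positivity) ?_
  linear_combination ((q : ℝ) + 1) * (-k1 - 1 / 2 * k2
    + (m + 1) * k3 - (m + 1) * k4 + (m + 1) / 4 * k5 - 1 / 4 * k6)

/-- The polarization of the dual action, up to normalization. -/
def dualB (t t' : Fock (m + 4)) : ℝ :=
  -ip t (box t') - ip (opDb t) (opDb t') - ip (opDa t) (opDa t')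
    - (ip (opM t) (opDa (opDb t')) + ip (opDa (opDb t)) (opM t'))
    - 1 / 2 * (ip (opA t) (opDa (opDa t')) + ip (opDa (opDa t)) (opA t'))
    + ip (opM t) (box (opM t')) + 1 / 2 * ip (opA t) (box (opA t'))
    + ip (opDb (opM t)) (opDb (opM t'))
    - 1 / 2 * (ip (opDa (opM t)) (opDb (opA t')) + ip (opDb (opA t)) (opDa (opM t')))
    + 1 / 4 * ip (opDb (opA t)) (opDb (opA t')) - 1 / 4 * ip (opDa (opA t)) (opDa (opA t'))

lemma polar_dualLF (q : ℕ) : Polar (dualLF (m := m) q)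
    (fun t t' => (-(2 * ((q : ℝ) + 1)) / ((q : ℝ) + 2) * ((q + 1).factorial : ℝ)) * dualB t t') := by
  have h1 := polar_pairGrad (n := m + 4) LinearMap.id fun g hg => hg
  have h2 := polar_pair (n := m + 4) opDb opDb (fun g hg => cs_Db hg) fun g hg => cs_Db hg
  have h3 := polar_pair (n := m + 4) opDa opDa (fun g hg => cs_Da hg) fun g hg => cs_Da hg
  have h4 := polar_pair (n := m + 4) opM (opDa ∘ₗ opDb) (fun g hg => cs_M hg)
    fun g hg => cs_Da (cs_Db hg)
  have h5 := polar_pair (n := m + 4) opA (opDa ∘ₗ opDa) (fun g hg => cs_A hg)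
    fun g hg => cs_Da (cs_Da hg)
  have h6 := polar_pairGrad (n := m + 4) opM fun g hg => cs_M hg
  have h7 := polar_pairGrad (n := m + 4) opA fun g hg => cs_A hg
  have h8 := polar_pair (n := m + 4) (opDb ∘ₗ opM) (opDb ∘ₗ opM) (fun g hg => cs_Db (cs_M hg))
    fun g hg => cs_Db (cs_M hg)
  have h9 := polar_pair (n := m + 4) (opDa ∘ₗ opM) (opDb ∘ₗ opA) (fun g hg => cs_Da (cs_M hg))
    fun g hg => cs_Db (cs_A hg)
  have h10 := polar_pair (n := m + 4) (opDb ∘ₗ opA) (opDb ∘ₗ opA) (fun g hg => cs_Db (cs_A hg))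
    fun g hg => cs_Db (cs_A hg)
  have h11 := polar_pair (n := m + 4) (opDa ∘ₗ opA) (opDa ∘ₗ opA) (fun g hg => cs_Da (cs_A hg))
    fun g hg => cs_Da (cs_A hg)
  have h := (((((((((h1.sub h2).sub h3).sub (h4.smul 2)).sub h5).sub h6).sub (h7.smul (1 / 2))).add
    h8).sub h9).add (h10.smul (1 / 4))).sub (h11.smul (1 / 4))
  refine (congrArg (Polar _) ?_).mpr
    (h.smul (-(2 * ((q : ℝ) + 1)) / ((q : ℝ) + 2) * ((q + 1).factorial : ℝ)))
  funext f g
  simp only [dualB, LinearMap.coe_comp, Function.comp_apply, LinearMap.id_coe, id_eq]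
  ring_nf

/-- The second-order operator of the dual action, in terms of the trace-free potential. -/
def dualOp (Y : Fock (m + 4)) : Fock (m + 4) :=
  box Y - opDb (opGb Y) - opGa (opDa Y) + opS (opDa (opGb Y)) + opDb (opGa (opR Y))
    + (1 / 2 : ℝ) • (opA' (opDa (opDa Y)) + opGa (opGa (opA Y))) - opS (box (opR Y))
    - (1 / 2 : ℝ) • opA' (box (opA Y)) + opS (opDb (opGb (opR Y)))
    - (1 / 2 : ℝ) • (opS (opGa (opGb (opA Y))) + opA' (opDb (opDa (opR Y))))
    + (1 / 4 : ℝ) • opA' (opDb (opGb (opA Y))) - (1 / 4 : ℝ) • opA' (opGa (opDa (opA Y)))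

/-- The Hodge dictionary rewrites each term by operators on `X` and `Y`, with one overall sign from
`ip_star`; adjunction and integration by parts then free `X` of all operators. -/
lemma dualB_star (X : Fock (m + 4)) {Y : Fock (m + 4)} (hc : Y ∈ cs (m + 4)) :
    dualB (star X) (star Y) = ip X (dualOp Y) := by
  have hn : 0 < m + 4 := by omega
  have hA := cs_A hc
  have hR := cs_R hc
  have hG := cs_Gb hc
  have hDa := cs_Da hc
  have s1 (c : ℝ) {x : Fock (m + 4)} (hx : x ∈ cs (m + 4)) : c • x ∈ cs (m + 4) :=
    Submodule.smul_mem _ _ hx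
  have c1 := cs_box hc
  have c2 := cs_Db hG
  have c3 := cs_Ga hDa
  have c4 := cs_S (cs_Da hG)
  have c5 := cs_Db (cs_Ga hR)
  have c6 := cs_A' (cs_Da hDa)
  have c6' := cs_Ga (cs_Ga hA)
  have c7 := cs_S (cs_box hR)
  have c8 := cs_A' (cs_box hA)
  have c9 := cs_S (cs_Db (cs_Gb hR))
  have c10 := cs_S (cs_Ga (cs_Gb hA))
  have c10' := cs_A' (cs_Db (cs_Da hR))
  have c11 := cs_A' (cs_Db (cs_Gb hA))
  have c12 := cs_A' (cs_Ga (cs_Da hA))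
  have d2 := sub_mem c1 c2
  have d3 := sub_mem d2 c3
  have d4 := add_mem d3 c4
  have d5 := add_mem d4 c5
  have d6 := add_mem d5 (s1 (1 / 2) (add_mem c6 c6'))
  have d7 := sub_mem d6 c7
  have d8 := sub_mem d7 (s1 (1 / 2) c8)
  have d9 := add_mem d8 c9
  have d10 := sub_mem d9 (s1 (1 / 2) (add_mem c10 c10'))
  have d11 := add_mem d10 (s1 (1 / 4) c11)
  rw [dualOp, ip_sub_right _ d11 (s1 _ c12), ip_add_right _ d10 (s1 _ c11),
    ip_sub_right _ d9 (s1 _ (add_mem c10 c10')), ip_add_right _ d8 c9, ip_sub_right _ d7 (s1 _ c8),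
    ip_sub_right _ d6 c7, ip_add_right _ d5 (s1 _ (add_mem c6 c6')), ip_add_right _ d4 c5,
    ip_add_right _ d3 c4, ip_sub_right _ d2 c3, ip_sub_right _ c1 c2]
  simp only [ip_smul_right]
  rw [ip_add_right _ c6 c6', ip_add_right _ c10 c10']
  simp only [dualB, ← star_R, ← star_Gb, ← star_Da, ← star_A, ← star_box, ip_star hn]
  rw [ip_Gb_left _ hG, ip_Da_left _ hDa, ip_R_left, ip_Da_left _ hR, ip_Gb_left _ (cs_Ga hR),
    ip_A_left, ip_Da_left _ hA, ip_Da_left _ (cs_Ga hA), ip_R_left, ip_A_left,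
    ip_Gb_left _ (cs_Gb hR), ip_R_left, ip_Da_left _ (cs_Gb hA), ip_R_left,
    ip_Gb_left _ (cs_Da hR), ip_A_left, ip_Gb_left _ (cs_Gb hA), ip_A_left,
    ip_Da_left _ (cs_Da hA), ip_A_left]
  ring

end

end SpinDuality

namespace SpinDuality

noncomputable section

variable {m q : ℕ}

/-! ### The dual action -/

/-- The second-order operator of the parent action on potentials `X - c M' S A X` reduces to the one
of the dual action. -/
lemma pair_dualOp {Q : ℝ} (hQ : 0 < Q) {X Y : Fock (m + 4)} (hY : Homog 3 Q Y)
    (hMX : opM X = 0) (hMY : opM Y = 0) (hAX : opA (opA X) = 0)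
    (hRX : opR (opA X) = 0) (hRY : opR (opA Y) = 0) (x) {N c : ℝ} (hN : N = m + 1 + Q)
    (hc : c = 1 / (2 * (Q + 1))) {f w : Fock (m + 4)} (hf : f = Y - c • opM' (opS (opA Y)))
    (hw : w = -((Q + 1) • opGb (opDb f)) + opGb (opR (opS (opDb f)))
      + ((Q - 1) / N) • opGb (opM' (opM (opDb f)))) :
    pair X (w - c • opA' (opR (opM w))) x = pair X (dualOp Y) x := by
  have hAh : Homog 3 (Q - 2) (opA Y) := hY.A
  have hMA : opM (opA Y) = 0 := by rw [← A_M, hMY, map_zero]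
  have hMAX : opM (opA X) = 0 := by rw [← A_M, hMX, map_zero]
  have hRS : opR (opS (opA Y)) = (Q + 1) • opA Y := by
    have h := S_R (opA Y)
    rw [hRY, map_zero, hAh.1, hAh.2, eq_comm, sub_eq_zero] at h
    rw [← h]
    module
  have hN0 : N ≠ 0 := by rw [hN]; positivity
  -- The constraints say that `X` is orthogonal to the image of `opM'`, and its trace to the images
  -- of `opM'`, `opA'` and `opS`. In normal order most terms therefore drop out.
  have p1 (w) : pair X (opM' w) x = 0 := by rw [← pair_M_left, hMX, pair_zero_left]
  have p2 (w) : pair X (opA' w) x = pair (opA X) w x := by rw [← pair_A_left]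
  have p3 (w) : pair (opA X) (opM' w) x = 0 := by rw [← pair_M_left, hMAX, pair_zero_left]
  have p4 (w) : pair (opA X) (opA' w) x = 0 := by rw [← pair_A_left, hAX, pair_zero_left]
  have p5 (w) : pair (opA X) (opS w) x = 0 := by rw [← pair_R_left, hRX, pair_zero_left]
  have hQ1 : Q + 1 ≠ 0 := by positivity
  have b1 (w) : pair X (box (opM' w)) x = 0 := by rw [← box_M', p1]
  have b2 (w) : pair X (box (opA' w)) x = pair (opA X) (box w) x := by rw [← box_A', p2]
  have b3 (w) : pair (opA X) (box (opM' w)) x = 0 := by rw [← box_M', p3]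
  have b4 (w) : pair (opA X) (box (opA' w)) x = 0 := by rw [← box_A', p4]
  simp only [hw, hf, dualOp]
  simp only [map_add, map_sub, map_neg, map_smul, alg, algD, algN, algB, P_Gb, P_Db, P_Da, Q_Gb, Q_Db, Q_Da, hMY, hRY, hMA, hRS, hAh.1, hAh.2, hY.1, hY.2, map_zero, smul_zero,
    neg_zero, add_zero, sub_zero, zero_add, zero_sub, neg_neg]
  simp only [pair_add_right, pair_sub_right, pair_neg_right, pair_smul_right, pair_zero_right, p1, p2, p3, p4, b1, b2, b3, b4, mul_zero, neg_zero, add_zero, sub_zero, zero_add, zero_sub, neg_neg]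
  -- Normal ordering leaves one linear dependence among the remaining pairings; it is read off from
  -- the orthogonality of `opA X` to an element of the image of `opS`.
  have p6 : pair (opA X) (opGb (opDa (opS (opA Y)))) x = pair (opA X) (opGa (opDa (opA Y))) x + pair (opA X) (opGb (opDb (opA Y))) x := by
    have h := p5 (opGb (opDa (opA Y)))
    simp only [algD, map_sub, pair_sub_right] at h
    linear_combination -h
  simp only [p6, hc, hN]
  push_cast
  rw [← sub_eq_zero]
  rw [hN] at hN0
  field_simp
  ring

/-- The polarization of the parent action, restricted to divergences of trace-free potentials. -/
lemma ip_Db_xF_Db {Q : ℝ} (hQ : 0 < Q) {X Y : Fock (m + 4)} (hY : Homog 3 Q Y)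
    (hMX : opM X = 0) (hMY : opM Y = 0) (hAX : opA (opA X) = 0)
    (hRX : opR (opA X) = 0) (hRY : opR (opA Y) = 0) (hcY : Y ∈ cs (m + 4))
    {c : ℝ} (hc : c = 1 / (2 * (Q + 1))) {f g : Fock (m + 4)}
    (hf : f = X - c • opM' (opS (opA X))) (hg : g = Y - c • opM' (opS (opA Y)))
    (hA : opA f = 0) :
    ip (opDb f) (xF Q (opDb g)) = (2 * Q / (Q + 1)) * ip X (dualOp Y) := by
  have hQ1 : Q + 1 ≠ 0 := by positivity
  have hcg : g ∈ cs (m + 4) := by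
    rw [hg]
    exact sub_mem hcY (Submodule.smul_mem _ _ (cs_M' (cs_S (cs_A hcY))))
  have hMAY : opM (opA Y) = 0 := by rw [← A_M, hMY, map_zero]
  have hAh : Homog 3 (Q - 2) (opA Y) := hY.A
  -- `opM g` is a multiple of `opS (opA Y)`, and `opS` squares to zero. The term of `xF` with `opS
  -- opM` thus drops out.
  have hSM : opS (opM g) = 0 := by
    simp only [hg, map_sub, map_smul, alg, algN, hMY, hMAY, map_zero, hAh.1, hAh.2, hRY,
      smul_zero, sub_zero, add_zero, neg_zero, zero_add]
    simp only [map_add, map_smul, S_S, smul_zero, add_zero, sub_zero]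
  have hSMD : opS (opM (opDb g)) = 0 := by
    simp only [algD, map_neg, hSM, map_zero, neg_zero, map_sub, map_add]
  have hAD : opA (opDb f) = 0 := by rw [A_Db, hA, map_zero]
  set N : ℝ := m + 1 + Q with hN
  have hN0 : N ≠ 0 := by rw [hN]; positivity
  -- Against traceless fields, `xF Q (opDb g)` acts as `2Q/(Q+1)` times this simpler field.
  set v : Fock (m + 4) := (Q + 1) • opDb g - opR (opS (opDb g))
    - ((Q - 1) / N) • opM' (opM (opDb g)) with hv
  have hcv : v ∈ cs (m + 4) := sub_mem (sub_mem (Submodule.smul_mem _ _ (cs_Db hcg))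
    (cs_R (cs_S (cs_Db hcg)))) (Submodule.smul_mem _ _ (cs_M' (cs_M (cs_Db hcg))))
  have h1 (x) : pair (opDb f) (xF Q (opDb g)) x = (2 * Q / (Q + 1)) * pair (opDb f) v x := by
    rw [pair_xF hAD, hSMD, pair_zero_right, hv, pair_sub_right, pair_sub_right, pair_smul_right,
      pair_smul_right, ← pair_M_left, ← pair_S_left]
    have : ((m + 4 : ℕ) : ℝ) + Q - 3 = N := by rw [hN]; push_cast; ring
    rw [this]
    field_simp
    ring
  have h2 : ip (opDb f) (xF Q (opDb g)) = (2 * Q / (Q + 1)) * ip (opDb f) v := by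
    simp only [ip, h1]
    exact MeasureTheory.integral_const_mul _ _
  have h3 (x) : pair f (-opGb v) x = pair X (dualOp Y) x := by
    rw [← pair_dualOp hQ hY hMX hMY hAX hRX hRY x hN hc hg (w := -opGb v)
      (by rw [hv]; simp only [map_sub, map_smul]; module), hf, pair_sub_left, pair_smul_left,
      pair_sub_right, pair_smul_right, ← pair_A_left, ← pair_S_left,
      pair_comm (opM' _), ← pair_M_left, pair_comm (opM _)]
  rw [h2, ip_Db_left _ hcv, ← ip_neg_right]
  congr 1
  exact MeasureTheory.integral_congr_ae (Filter.Eventually.of_forall h3)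

variable {f g : Fock (m + 4)}

lemma xPart_spec (hf : Homog 3 ((q : ℝ) + 1) f) (hA : opA f = 0) :
    opA (opA (xPart q f)) = 0 ∧ opR (opA (xPart q f)) = 0 := by
  have h := isDualField_dualF hf hA
  have hn : 0 < m + 4 := by omega
  constructor
  · rw [← star_eq_zero hn, star_A, star_A]
    exact h.2.1
  · rw [← A_R, ← star_eq_zero hn, star_A, star_R]
    exact h.2.2

lemma potF_dualF (f : Fock (m + 4)) :
    potF q (dualF q f) = xPart q f - (1 / (2 * ((q : ℝ) + 2))) • opM' (opS (opA (xPart q f))) := by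
  rw [potF, dualF, star_star_dual]
  simp only [map_smul]
  rw [smul_comm _ (hsgn _ _), ← smul_sub, smul_smul, hsgn_sq, one_smul]

/-- The polarization of the parent action in terms of the dual field. -/
lemma ip_Db_xF_Db_eq_dualB (hf : Homog 3 ((q : ℝ) + 1) f) (hA : opA f = 0)
    (hg : Homog 3 ((q : ℝ) + 1) g) (hA' : opA g = 0) (hc : g ∈ cs (m + 4)) :
    ip (opDb f) (xF ((q : ℝ) + 1) (opDb g))
      = (2 * ((q : ℝ) + 1) / ((q : ℝ) + 2)) * dualB (dualF q f) (dualF q g) := by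
  have hQ : (0 : ℝ) < (q : ℝ) + 1 := by positivity
  have hn : (4 : ℝ) ≤ ((m + 4 : ℕ) : ℝ) := by push_cast; linarith [(Nat.cast_nonneg m : (0 : ℝ) ≤ m)]
  -- `f` and the standard potential of its dual field differ by a shift, whose divergence `xF` maps
  -- to the gradient `opGb α`. Paired with a divergence this gradient integrates to zero, so both
  -- entries may be replaced by standard potentials.
  have key {f : Fock (m + 4)} (hf : Homog 3 ((q : ℝ) + 1) f) (hA : opA f = 0) :
      ∃ α, (f ∈ cs (m + 4) → α ∈ cs (m + 4)) ∧ opA (potF q (dualF q f)) = 0 ∧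
        xF ((q : ℝ) + 1) (opDb f)
          = xF ((q : ℝ) + 1) (opDb (potF q (dualF q f))) + opGb α := by
    obtain ⟨k1, k2, k3⟩ := isDualField_dualF hf hA
    obtain ⟨h1, h2, h3⟩ := potF_spec (dualF_homog hf) k1 k2 k3
    obtain ⟨α, hα, hS, hAα, hcα, h4⟩ := exists_hook (hf.sub h1)
      (by rw [map_sub, hA, h2, sub_zero]) (by
        rw [xPart_sub, ← star_eq_zero (n := m + 4) (by omega), map_sub, sub_eq_zero]
        exact h3.symm)
    refine ⟨α, fun hc => hcα (sub_mem hc (cs_potF (cs_star (cs_xPart hc)))), h2, ?_⟩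
    have hG : Homog 2 ((q : ℝ) + 1) (opGb α) := hα.Gb.congr (by norm_num) rfl
    rw [← xF_yF hG (by rw [A_Gb, hAα, map_zero]) hQ hn, ← Db_shift hQ hS hAα, ← h4, ← xF_add,
      ← map_add, add_sub_cancel]
  obtain ⟨α, -, h1, h2⟩ := key hf hA
  obtain ⟨β, hcβ, h3, h4⟩ := key hg hA'
  have hAD {f : Fock (m + 4)} (h : opA f = 0) : opA (opDb f) = 0 := by rw [A_Db, h, map_zero]
  have hcp : potF q (dualF q g) ∈ cs (m + 4) := cs_potF (cs_star (cs_xPart hc))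
  rw [ip_xF_symm (hAD hA) (hAD hA'), h2, ip_comm, ip_add_left _ _ (cs_Db hc),
    ip_Gb_left _ (cs_Db hc), Db_Db, ip_zero_right, neg_zero, add_zero, ip_comm,
    ip_xF_symm (hAD hA') (hAD h1), h4, ip_add_right _ (cs_xF (cs_Db hcp)) (cs_Gb (hcβ hc)),
    ip_Db_left _ (cs_Gb (hcβ hc)), Gb_Gb, ip_zero_right, neg_zero, add_zero]
  obtain ⟨k1, k2⟩ := xPart_spec hf hA
  have k4 := (xPart_spec hg hA').2
  have e : (2 : ℝ) * ((q : ℝ) + 2) = 2 * ((q : ℝ) + 1 + 1) := by ring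
  rw [ip_Db_xF_Db hQ (xPart_homog hg) (M_xPart hf) (M_xPart hg) k1 k2 k4
    (cs_xPart hc) (by rw [e]) (potF_dualF f) (potF_dualF g) h1, ← dualB_star _ (cs_xPart hc),
    dualF, dualF]
  ring

/-- The terms with `e` pair a gradient with a divergence and vanish. The rest is `-(s-1)!` times the
form `⟨Db f, xF (Db g)⟩`, which is the polarization of the dual action. -/
lemma actionDiff_dualLagrangian (e δe : Ten (m + 4) 1 (q + 2 - 1)) (P δP : Ten (m + 4) 3 (q + 2 - 1))
    (T δT : Ten (m + 4) (m + 4 - 3) (q + 2 - 1)) (he0 : IsTracelessForm e) (hδe0 : IsVariation δe)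
    (hP0 : IsTracelessForm P) (hδP0 : IsVariation δP) (hT0 : IsDualField (q + 2) T)
    (hPT : IsDualTo (q + 2) P T) (hδT0 : IsDualField (q + 2) δT) (hδPT : IsDualTo (q + 2) δP δT) :
    actionDiff (fun F : Ten (m + 4) 1 (q + 2 - 1) × Ten (m + 4) 2 (q + 2 - 1) =>
      parentLagrangian (q + 2) F.1 F.2) (e, divB P) (δe, divB δP)
      = actionDiff (dualLagrangian (q + 2)) T δT := by
  obtain ⟨e, he, hAe, rfl⟩ := IsTracelessForm.exists_ev (p := 1) (q := q + 1) he0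
  obtain ⟨δ, hδ, hAδ, hcδ, rfl⟩ := IsVariation.exists_ev (p := 1) (q := q + 1) hδe0
  obtain ⟨f, hf, hA, rfl⟩ := IsTracelessForm.exists_ev (p := 3) (q := q + 1) hP0
  obtain ⟨g, hg, hA', hcg, rfl⟩ := IsVariation.exists_ev (p := 3) (q := q + 1) hδP0
  obtain ⟨t, ht, hR, -, -, rfl⟩ := hT0.exists_ev
  obtain ⟨t', ht', hR', -, -, rfl⟩ := hδT0.exists_ev
  have hDP (f : Fock (m + 4)) (hf : Homog ((3 : ℕ) : ℝ) ((q + 1 : ℕ) : ℝ) f) :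
      divB (ev 3 (q + 1) f : Ten (m + 4) 3 (q + 2 - 1))
        = (ev 2 (q + 1) (opDb f) : Ten (m + 4) 2 (q + 2 - 1)) := divB_ev hf
  rw [hDP f hf, hDP g hg]
  push_cast at he hδ hf hg
  have hQ : (0 : ℝ) < (q : ℝ) + 1 := by positivity
  have hn : (4 : ℝ) ≤ ((m + 4 : ℕ) : ℝ) := by push_cast; linarith [(Nat.cast_nonneg m : (0 : ℝ) ≤ m)]
  have e1 := (isDualTo_ev hf ht hR).1 hPT
  have e2 := (isDualTo_ev hg ht' hR').1 hδPT
  have hDf : Homog 2 ((q : ℝ) + 1) (opDb f) := hf.Db.congr (by norm_num) rfl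
  have hDg : Homog 2 ((q : ℝ) + 1) (opDb g) := hg.Db.congr (by norm_num) rfl
  have hAD {f : Fock (m + 4)} (h : opA f = 0) : opA (opDb f) = 0 := by rw [A_Db, h, map_zero]
  have h3 := integral_parentF (q := q) e (hAD hA) (hAD hA') hcδ (cs_Db hcg)
  have h4 : ∀ x, parentLagrangian (q + 2) ((ev 1 (q + 1) e : Ten (m + 4) 1 (q + 2 - 1))
      + ev 1 (q + 1) δ)
      ((ev 2 (q + 1) (opDb f) : Ten (m + 4) 2 (q + 2 - 1)) + ev 2 (q + 1) (opDb g)) x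
      = parentF q (e + δ) (opDb f + opDb g) x := fun x =>
    parent_ev (e + δ) (hDf.add hDg) (by rw [map_add, hAD hA, hAD hA', add_zero]) hn x
  have h5 : ∀ x, parentLagrangian (q + 2) (ev 1 (q + 1) e : Ten (m + 4) 1 (q + 2 - 1))
      (ev 2 (q + 1) (opDb f) : Ten (m + 4) 2 (q + 2 - 1)) x = parentF q e (opDb f) x := fun x =>
    parent_ev e hDf (hAD hA) hn x
  refine (MeasureTheory.integral_congr_ae (Filter.Eventually.of_forall fun x =>
    congrArg₂ (· - ·) (h4 x) (h5 x))).trans ?_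
  have h6 := (polar_dualLF (m := m) q).actionDiff_ev (p := m + 1) (q := q + 1)
    (T := fun T : Ten (m + 4) (m + 1) (q + 1) =>
      dualLagrangian (q + 2) (T : Ten (m + 4) (m + 4 - 3) (q + 2 - 1)))
    (C := Homog ((m : ℝ) + 1) ((q : ℝ) + 1)) (fun f hf => funext (dual_ev hf))
    (f := t) (g := t') ht (ht.add ht') (by rw [e2]; exact cs_star (cs_xPart hcg))
  refine Eq.trans ?_ h6.symm
  rw [h3, ip_comm (xF _ _) (opDb g), ip_xF_symm (hAD hA') (hAD hA), ip_comm (xF _ _) (opDb g),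
    ip_Db_xF_Db_eq_dualB hf hA hg hA' hcg, ip_Db_xF_Db_eq_dualB hg hA' hg hA' hcg,
    ip_Db_left _ (cs_Gb hcδ), Gb_Gb, ip_Gb_left _ (cs_Db hcg), Db_Db, ip_zero_right, ip_zero_right,
    ← e1, ← e2]
  ring

/-- The gauge invariance of the dual action. -/
lemma actionDiff_dualGauge (T : Ten (m + 4) (m + 4 - 3) (q + 2 - 1))
    (φ : Ten (m + 4) (m + 4 - 4) (q + 2 - 1)) (hT : IsDualField (q + 2) T) (hφ : IsVariation φ) :
    actionDiff (dualLagrangian (q + 2)) T (dualGauge (q + 2) φ) = 0 := by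
  obtain ⟨P, hP, hPT, -⟩ := exists_potential T hT
  obtain ⟨ψ, hψ, hc, rfl⟩ := exists_potential_of_parameter φ hφ.1
  have h1 := (gauge_of_potential ψ hψ).2
  have h2 := isDualField_dualGauge _ hφ.1
  obtain ⟨ψ', h, hA, hcs, rfl⟩ := IsVariation.exists_ev (p := 4) (q := q + 1) ⟨hψ, hc hφ.2⟩
  have hD : divB (ev 4 (q + 1) ψ' : Ten (m + 4) 4 (q + 2 - 1))
      = (ev 3 (q + 1) (opDb ψ') : Ten (m + 4) 3 (q + 2 - 1)) := divB_ev h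
  have hDh : Homog ((3 : ℕ) : ℝ) ((q + 1 : ℕ) : ℝ) (opDb ψ') :=
    h.Db.congr (by norm_num) rfl
  have hAD : opA (opDb ψ') = 0 := by rw [A_Db, hA, map_zero]
  have hDD : divB (ev 3 (q + 1) (opDb ψ') : Ten (m + 4) 3 (q + 2 - 1)) = 0 := by
    have h := divB_ev hDh
    rw [Db_Db] at h
    exact h.trans (ev_zero 2 (q + 1))
  have h0 : IsVariation (0 : Ten (m + 4) 1 (q + 2 - 1)) := by
    have := isVariation_ev (p := 1) (q := q + 1) (f := (0 : Fock (m + 4)))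
      (by constructor <;> simp) (map_zero _) (Submodule.zero_mem _)
    rwa [ev_zero] at this
  rw [hD] at h1
  -- The potential of the gauge variation is a divergence, so it does not change the field `Y` of
  -- the parent action; the vielbein is set to zero.
  have h3 := actionDiff_dualLagrangian 0 0 P _ T _ h0.1 h0 hP
    (isVariation_ev (p := 3) (q := q + 1) hDh hAD (cs_Db hcs)) hT hPT h2 h1
  rw [← h3, hDD]
  simp only [actionDiff, Prod.mk_add_mk, add_zero, sub_self, MeasureTheory.integral_zero]

end

end SpinDuality

namespace SpinDuality

noncomputable section

variable {q : ℕ}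

/-! ### Four dimensions -/

section
variable {n : ℕ} {h : Fock n} {k : ℝ}

/-- On fields without first-group indices `opR` merely splits off one symmetric index. It preserves
the pairing up to the factor `k`, which carries the four-dimensional theory over to `h`. -/
lemma S_R_of (hh : Homog 0 k h) : opS (opR h) = k • h := by
  have hS : opS h = 0 := hh.S.eq_zero (Or.inl (by norm_num))
  rw [S_R, hS, hh.1, hh.2, map_zero, zero_smul, zero_add, sub_zero]

lemma pair_R_R (hh : Homog 0 k h) (f : Fock n) (x) :
    pair (opR f) (opR h) x = k * pair f h x := by
  rw [pair_R_left, S_R_of hh, pair_smul_right]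

lemma pairGrad_R_R (hh : Homog 0 k h) (f : Fock n) (x) :
    pairGrad (opR f) (opR h) x = k * pairGrad f h x := by
  simp only [pairGrad, ← del_R, pair_R_R (hh.del _), Finset.mul_sum]
  exact Finset.sum_congr rfl fun c _ => by ring

lemma R_S_of {t : Fock n} (ht : Homog 1 k t) (hR : opR t = 0) : opR (opS t) = (1 + k) • t := by
  have h := S_R t
  rw [hR, map_zero, ht.1, ht.2, eq_comm, sub_eq_zero] at h
  rw [← h]
  module

lemma pull_ev (h : Fock n) :
    pull (ev 0 (q + 2) h) = (ev 1 (q + 1) (opR h) : Ten n 1 (q + 1)) := by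
  have h1 := asym_pull_ev 0 (q + 1) h
  rw [asym_one] at h1
  refine h1.trans ?_
  simp

lemma symPart_grad (φ : Fock n) :
    fronsdalGauge (q + 2) (ev 0 (q + 1) φ : Ten n 0 (q + 2 - 1))
      = symPart (q + 2) (ev 1 (q + 1) (opGb φ) : Ten n 1 (q + 2 - 1)) := by
  have h1 := asym_grad_ev 0 (q + 1) φ
  rw [asym_one] at h1
  refine congrArg (fun W : Ten n 1 (q + 1) => symPart (q + 2) (W : Ten n 1 (q + 2 - 1)))
    (h1.trans ?_)
  simp

end

/-- As `h` has no index in its first group, mixed trace and divergence of `opR h` are the trace and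
the divergence of `h`; all terms then become pairings of symmetric tensors. -/
lemma dualLF_R {h : Fock (0 + 4)} (hh : Homog 0 ((q : ℝ) + 2) h) (x) :
    dualLF q (opR h) x = 4 * ((q : ℝ) + 1) / ((q : ℝ) + 2) * fronsdalF (q + 2) h x := by
  have hDb : opDb h = 0 := hh.Db.eq_zero (Or.inl (by norm_num))
  have hM : opM h = 0 := hh.M.eq_zero (Or.inl (by norm_num))
  have hDbA : opDb (opA h) = 0 := hh.A.Db.eq_zero (Or.inl (by norm_num))
  have hA : Homog 0 (q : ℝ) (opA h) := hh.A.congr rfl (by ring)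
  have hD : Homog 0 ((q : ℝ) + 1) (opDa h) := hh.Da.congr rfl (by ring)
  have hDD : Homog 0 (q : ℝ) (opDa (opDa h)) := hD.Da.congr rfl (by ring)
  have hDA : Homog 0 ((q : ℝ) - 1) (opDa (opA h)) := hA.Da
  have e1 : opDb (opR h) = opDa h := by
    have := R_Db h
    rw [hDb, map_zero, eq_comm, sub_eq_zero] at this
    exact this.symm
  have e2 : opDb (opR (opA h)) = opDa (opA h) := by
    have := R_Db (opA h)
    rw [hDbA, map_zero, eq_comm, sub_eq_zero] at this
    exact this.symm
  have e3 : opM (opR h) = opA h := by rw [M_R, hM, map_zero, sub_zero]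
  rw [dualLF, fronsdalF, A_R, e1, e2, e3, hDbA, ← R_Da, ← R_Da, ← R_Da, pairGrad_R_R hh,
    pairGrad_R_R hA, pair_R_R hD, pair_R_R hDD, pair_R_R hDA, Nat.factorial_succ (q + 1),
    pair_zero_left, pair_comm (opDa (opDa h))]
  push_cast
  field_simp
  ring

/-- With one index in the first group, `opR t = 0` makes `opR (opS t)` equal to `(q+2) t`; thus `t`
is recovered from its total symmetrization. -/
lemma symPart_dualField {T : Ten (0 + 4) 1 (q + 2 - 1)}
    (hT : IsDualField (n := 0 + 4) (q + 2) T) :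
    ∃ h : Fock (0 + 4), Homog 0 ((q : ℝ) + 2) h ∧ opA (opA h) = 0 ∧
      T = (ev 1 (q + 1) (opR h) : Ten (0 + 4) 1 (q + 1)) ∧ symPart (q + 2) T = ev 0 (q + 2) h := by
  obtain ⟨t, ht, hR, hAA, hAM, rfl⟩ := hT.exists_ev
  have ht1 : Homog 1 ((q : ℝ) + 1) t := ht.congr (by simp) rfl
  have hq : (q : ℝ) + 2 ≠ 0 := by positivity
  refine ⟨(1 / ((q : ℝ) + 2)) • opS t, (ht1.S.smul _).congr (by norm_num) (by ring), ?_, ?_,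
    symPart_ev' t⟩
  · rw [map_smul, map_smul, A_S, map_add, map_smul, hAM, A_S, hAA, map_zero, ← A_M, hAM]
    simp
  · rw [map_smul, R_S_of ht1 hR, smul_smul]
    have : 1 / ((q : ℝ) + 2) * (1 + (q + 1)) = 1 := by field_simp; ring
    rw [this, one_smul]

lemma isDualField_R {h : Fock (0 + 4)} (hh : Homog 0 ((q : ℝ) + 2) h) (hA : opA (opA h) = 0) :
    IsDualField (n := 0 + 4) (q + 2) (ev 1 (q + 1) (opR h) : Ten (0 + 4) 1 (q + 2 - 1)) := by
  have hR : Homog (((0 : ℕ) : ℝ) + 1) ((q : ℝ) + 1) (opR h) :=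
    hh.R.congr (by simp) (by ring)
  have hM : opM h = 0 := hh.M.eq_zero (Or.inl (by norm_num))
  refine (isDualField_ev (m := 0) hR).2 ⟨R_R _, by rw [A_R, A_R, hA, map_zero], ?_⟩
  rw [M_R, hM, map_zero, sub_zero, hA]

lemma symPart_R {n : ℕ} {h : Fock n} (hh : Homog 0 ((q : ℝ) + 2) h) :
    symPart (q + 2) (ev 1 (q + 1) (opR h) : Ten n 1 (q + 2 - 1)) = ev 0 (q + 2) h := by
  have hq : (q : ℝ) + 2 ≠ 0 := by positivity
  rw [symPart_ev', S_R_of hh, smul_smul, one_div_mul_cancel hq, one_smul]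

/-- In four dimensions dual fields are Fronsdal fields. -/
lemma dualField_four (T : Ten 4 1 (q + 2 - 1)) (hT : IsDualField (n := 4) (q + 2) T) :
    IsFronsdalField (symPart (q + 2) T) ∧
    (∀ (b : Fin 1 → Fin 4) (a : Fin (q + 2 - 1) → Fin 4) (c : Fin (q + 2) → Fin 4),
      (∀ i : Fin (q + 2), c i = if _h : (i : ℕ) = 0 then b 0 else a ⟨i - 1, by omega⟩) →
      symPart (q + 2) T ![] c = T b a) ∧
    dualLagrangian (n := 4) (q + 2) T
      = (4 * (((q + 2 : ℕ) : ℝ) - 1) / ((q + 2 : ℕ) : ℝ)) • fronsdalLagrangian (symPart (q + 2) T) := by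
  obtain ⟨h, hh, hA, rfl, hs⟩ := symPart_dualField (T := T) hT
  have hh2 : Homog 0 ((q + 2 : ℕ) : ℝ) h := by push_cast; exact hh
  have hR : Homog (((0 : ℕ) : ℝ) + 1) ((q : ℝ) + 1) (opR h) := hh.R.congr (by simp) (by ring)
  refine ⟨?_, fun b a c hc => ?_, ?_⟩
  · rw [hs]
    exact (isFronsdalField_ev hh2).2 hA
  · rw [hs]
    refine Eq.trans ?_ (congrFun (congrFun (pull_ev (q := q) h) b) a)
    have : c = Matrix.vecCons (b (Fin.last 0)) a := by
      funext i
      rw [hc i]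
      refine Fin.cases ?_ (fun j => ?_) i
      · rfl
      · simp
    rw [this]
    exact congrArg (fun b => ev 0 (q + 2) h b _) (Subsingleton.elim _ _)
  · rw [hs]
    funext x
    refine (dual_ev (m := 0) hR x).trans ?_
    rw [dualLF_R hh, Pi.smul_apply, fronsdal_ev hh, smul_eq_mul]
    congr 2
    · push_cast; ring
    · push_cast; ring

lemma existsUnique_dualField_four (h : Ten 4 0 (q + 2)) (hh : IsFronsdalField h) :
    ∃! T : Ten 4 1 (q + 2 - 1), IsDualField (n := 4) (q + 2) T ∧ symPart (q + 2) T = h := by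
  obtain ⟨h, h1, rfl⟩ := SpinDuality.exists_ev hh.1 hh.2.1
  have h2 : Homog 0 ((q + 2 : ℕ) : ℝ) h := h1.congr (by simp) rfl
  have h3 : Homog 0 ((q : ℝ) + 2) h := by push_cast at h2; exact h2
  have hA := (isFronsdalField_ev h2).1 hh
  refine ⟨_, ⟨isDualField_R h3 hA, symPart_R h3⟩, ?_⟩
  rintro T ⟨hT, hs⟩
  obtain ⟨h', hh', -, rfl, hs'⟩ := symPart_dualField (T := T) hT
  have h4 := (ev_inj (p := 0) (q := q + 2) (hh'.congr (by simp) (by push_cast; ring)) h1).1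
    (hs'.symm.trans hs)
  rw [h4]

lemma symPart_dualGauge_four (φ : Ten 4 0 (q + 2 - 1)) (hφ : IsTracelessForm φ) :
    symPart (q + 2) (dualGauge (n := 4) (q + 2) φ) = fronsdalGauge (q + 2) φ := by
  obtain ⟨φ, -, rfl⟩ := SpinDuality.exists_ev (p := 0) (q := q + 1) hφ.1 hφ.2.1
  refine (congrArg (fun W : Ten 4 1 (q + 2 - 1) => symPart (q + 2) W)
    (dualGauge_ev (m := 0) (q := q) φ)).trans ?_
  rw [symPart_grad]
  refine (symPart_ev' (n := 4) (q := q) (gaugeF (m := 0) q φ)).trans ?_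
  rw [symPart_ev']
  congr 2
  rw [gaugeF, map_smul, map_sub, map_smul, S_S]
  simp

end

end SpinDuality

namespace SpinDuality

noncomputable section

/-! ### Spin two in five dimensions -/

section
variable {n q : ℕ}

lemma sum_fin_one {M : Type*} [AddCommMonoid M] (F : (Fin 1 → Fin n) → M) :
    ∑ a, F a = ∑ i, F ![i] :=
  (Fintype.sum_equiv (Equiv.funUnique (Fin 1) (Fin n)) _ _ fun a => congrArg F (by
    funext i
    rw [Subsingleton.elim i 0]
    rfl))

lemma contr_one_one (A B : Ten n 1 1) (x) :
    contr A B x = ∑ b, ∑ c, eta b * eta c * A ![b] ![c] x * B ![b] ![c] x := by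
  simp [contr, sum_fin_one]

lemma contr_zero_zero (A B : Ten n 0 0) (x) : contr A B x = A ![] ![] x * B ![] ![] x := by
  simp only [contr, Fintype.sum_unique]
  rw [Subsingleton.elim (default : Fin 0 → Fin n) ![]]
  simp

lemma contr_one_zero (A B : Ten n 1 0) (x) :
    contr A B x = ∑ b, eta b * A ![b] ![] x * B ![b] ![] x := by
  simp only [contr, Fintype.sum_unique, sum_fin_one]
  rw [Subsingleton.elim (default : Fin 0 → Fin n) ![]]
  simp

lemma sum_fin_two {M : Type*} [AddCommMonoid M] (F : (Fin 2 → Fin n) → M) :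
    ∑ b, F b = ∑ i, ∑ j, F ![i, j] := by
  rw [← Fintype.sum_prod_type' (f := fun i j => F ![i, j])]
  exact Fintype.sum_equiv (finTwoArrowEquiv (Fin n)) _ _ fun b => congrArg F (by
    funext i
    fin_cases i <;> rfl)

lemma contr_two_zero (A B : Ten n 2 0) (x) :
    contr A B x = ∑ b, ∑ c, eta b * eta c * A ![b, c] ![] x * B ![b, c] ![] x := by
  simp only [contr, Fintype.sum_unique, sum_fin_two]
  rw [Subsingleton.elim (default : Fin 0 → Fin n) ![]]
  simp

lemma sum_perm_fin_three (F : Equiv.Perm (Fin 3) → ℝ) :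
    ∑ σ, F σ = F 1 + F (Equiv.swap 0 1) + F (Equiv.swap 0 2) + F (Equiv.swap 1 2)
      + F (Equiv.swap 0 1 * Equiv.swap 1 2) + F (Equiv.swap 1 2 * Equiv.swap 0 1) := by
  have h : (Finset.univ : Finset (Equiv.Perm (Fin 3))) = {1, Equiv.swap 0 1, Equiv.swap 0 2,
      Equiv.swap 1 2, Equiv.swap 0 1 * Equiv.swap 1 2, Equiv.swap 1 2 * Equiv.swap 0 1} := by
    decide
  rw [h, Finset.sum_insert (by decide), Finset.sum_insert (by decide), Finset.sum_insert (by decide),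
    Finset.sum_insert (by decide), Finset.sum_insert (by decide), Finset.sum_singleton]
  ring

lemma asym_fin_three (T : Ten n 3 q) (i j k : Fin n) (a x) :
    asym T ![i, j, k] a x = 1 / 6 * (T ![i, j, k] a x - T ![j, i, k] a x - T ![k, j, i] a x
      - T ![i, k, j] a x + T ![j, k, i] a x + T ![k, i, j] a x) := by
  have e (σ : Equiv.Perm (Fin 3)) : (![i, j, k] : Fin 3 → Fin n) ∘ σ
      = ![(![i, j, k] : Fin 3 → Fin n) (σ 0), (![i, j, k] : Fin 3 → Fin n) (σ 1),
        (![i, j, k] : Fin 3 → Fin n) (σ 2)] := by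
    funext l
    fin_cases l <;> rfl
  have s1 : Equiv.Perm.sign (Equiv.swap (0 : Fin 3) 1) = -1 := by decide
  have s2 : Equiv.Perm.sign (Equiv.swap (0 : Fin 3) 2) = -1 := by decide
  have s3 : Equiv.Perm.sign (Equiv.swap (1 : Fin 3) 2) = -1 := by decide
  have h1 : (Equiv.swap (0 : Fin 3) 2) 1 = 1 := by decide
  have h2 : (Equiv.swap (1 : Fin 3) 2) 0 = 0 := by decide
  have h3 : (Equiv.swap (0 : Fin 3) 1) 2 = 2 := by decide
  have h4 : (![i, j, k] : Fin 3 → Fin n) 2 = k := rfl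
  simp only [asym, sum_perm_fin_three, e, Equiv.Perm.sign_mul, s1, s2, s3, Equiv.Perm.mul_apply,
    Equiv.swap_apply_left, Equiv.swap_apply_right, h1, h2, h3, h4,
    Equiv.Perm.one_apply, Equiv.Perm.sign_one, Matrix.cons_val_zero, Matrix.cons_val_one]
  norm_num [Nat.factorial]
  ring

lemma asym_fin_two (T : Ten n 2 q) (i j : Fin n) (a x) :
    asym T ![i, j] a x = 1 / 2 * (T ![i, j] a x - T ![j, i] a x) := by
  have h : (Finset.univ : Finset (Equiv.Perm (Fin 2))) = {1, Equiv.swap 0 1} := by decide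
  have e : (![i, j] : Fin 2 → Fin n) ∘ Equiv.swap 0 1 = ![j, i] := by
    funext l
    fin_cases l <;> rfl
  have e1 : (![i, j] : Fin 2 → Fin n) ∘ (1 : Equiv.Perm (Fin 2)) = ![i, j] := rfl
  have s1 : Equiv.Perm.sign (Equiv.swap (0 : Fin 2) 1) = -1 := by decide
  rw [asym, h, Finset.sum_insert (by decide), Finset.sum_singleton, e, e1, s1]
  norm_num [Nat.factorial]
  ring

lemma sym_one (T : Ten n 2 1) : sym T = T := by
  funext b a x
  simp only [sym]
  rw [Fintype.sum_unique]
  simp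

lemma fin_three_eta (b : Fin 3 → Fin n) : b = ![b 0, b 1, b 2] := by
  funext l
  fin_cases l <;> rfl

lemma fin_two_eta (b : Fin 2 → Fin n) : b = ![b 0, b 1] := by
  funext l
  fin_cases l <;> rfl

lemma fin_one_eta (b : Fin 1 → Fin n) : b = ![b 0] := by
  funext l
  fin_cases l
  rfl

lemma isBiSym_two_one (T : Ten n 2 1) :
    IsBiSym T ↔ ∀ a b c x, T ![a, b] ![c] x = -T ![b, a] ![c] x := by
  have e (i j : Fin n) : (![i, j] : Fin 2 → Fin n) ∘ Equiv.swap 0 1 = ![j, i] := by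
    funext l
    fin_cases l <;> rfl
  have s1 : Equiv.Perm.sign (Equiv.swap (0 : Fin 2) 1) = -1 := by decide
  constructor
  · intro h a b c x
    have := h (Equiv.swap 0 1) 1 ![b, a] ![c] x
    rw [e, s1] at this
    simpa using this
  · intro h σ τ b a x
    rw [Subsingleton.elim τ 1, fin_two_eta b, fin_one_eta a]
    have hσ : σ = 1 ∨ σ = Equiv.swap 0 1 := by
      revert σ
      decide
    rcases hσ with rfl | rfl
    · simp
    · rw [e, s1]
      simpa using h (b 1) (b 0) (a 0) x

lemma pull_two_one (T : Ten n 2 1) (i j k : Fin n) (a x) :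
    pull T ![i, j, k] a x = T ![i, j] ![k] x := by
  refine congrFun (congrArg₂ T ?_ ?_) x
  · funext l
    fin_cases l <;> rfl
  · funext l
    fin_cases l
    rfl

end

lemma isDualField_five (T : Ten 5 2 1) : IsDualField (n := 5) 2 T ↔ IsSmooth T ∧
    ∀ a b c x, T ![a, b] ![c] x = -T ![b, a] ![c] x ∧
      T ![a, b] ![c] x + T ![b, c] ![a] x + T ![c, a] ![b] x = 0 := by
  have h : IsDualField (n := 5) 2 T ↔ IsSmooth T ∧ IsBiSym T ∧ asym (pull T) = 0 := by
    refine ⟨fun h => ⟨h.1, h.2.1, h.2.2.1⟩, fun h => ⟨h.1, h.2.1, h.2.2, rfl, rfl⟩⟩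
  rw [h, isBiSym_two_one]
  refine and_congr_right fun _ => ⟨fun ⟨h1, h2⟩ a b c x => ⟨h1 a b c x, ?_⟩,
    fun h1 => ⟨fun a b c x => (h1 a b c x).1, ?_⟩⟩
  · have h3 := congrFun (congrFun (congrFun h2 ![a, b, c]) ![]) x
    rw [asym_fin_three] at h3
    simp only [pull_two_one, Pi.zero_apply] at h3
    linarith [h1 a b c x, h1 b c a x, h1 c a b x]
  · funext b a x
    rw [fin_three_eta b, asym_fin_three]
    simp only [pull_two_one, Pi.zero_apply]
    linarith [(h1 (b 0) (b 1) (b 2) x).1, (h1 (b 1) (b 2) (b 0) x).1, (h1 (b 2) (b 0) (b 1) x).1,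
      (h1 (b 0) (b 1) (b 2) x).2]

lemma pd_sum_eta {n : ℕ} {f : Fin n → (Fin n → ℝ) → ℝ} (hf : ∀ c, Differentiable ℝ (f c))
    (i : Fin n) (x) : pd i (fun x => ∑ c, eta c * f c x) x = ∑ c, eta c * pd i (f c) x := by
  simp only [pd]
  rw [fderiv_fun_sum fun c _ => ((hf c x).const_mul (eta c)), _root_.sum_apply]
  refine Finset.sum_congr rfl fun c _ => ?_
  rw [fderiv_const_mul (hf c x)]
  rfl

lemma pd_comm {n : ℕ} {f : (Fin n → ℝ) → ℝ} (hf : ContDiff ℝ ∞ f) (i j : Fin n) :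
    pd i (pd j f) = pd j (pd i f) :=
  congrArg Subtype.val (pdS_comm i j ⟨f, hf⟩)

lemma differentiable_pd {n : ℕ} {f : (Fin n → ℝ) → ℝ} (hf : ContDiff ℝ ∞ f) (i : Fin n) :
    Differentiable ℝ (pd i f) := by
  have h : ContDiff ℝ ∞ (pd i f) :=
    (hf.fderiv_right (m := ∞) (by simp)).clm_apply contDiff_const
  exact h.differentiable (by simp)

section
variable {ι : Type*} [Fintype ι] (w : ι → ℝ)

/-- This and the next three lemmas regroup the fourfold sums of Curtright's Lagrangian into
contractions of divergences and traces. -/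
lemma sum_four_outer (P Q : ι → ι → ι → ℝ) :
    ∑ a, ∑ b, ∑ c, ∑ d, w a * w b * w c * w d * (P a b c * Q d b c)
      = ∑ b, ∑ c, w b * w c * (∑ a, w a * P a b c) * ∑ d, w d * Q d b c := by
  rw [Finset.sum_comm]
  refine Finset.sum_congr rfl fun b _ => ?_
  rw [Finset.sum_comm]
  refine Finset.sum_congr rfl fun c _ => ?_
  conv_rhs => rw [mul_comm]
  simp only [Finset.sum_mul, Finset.mul_sum]
  refine Finset.sum_congr rfl fun a _ => Finset.sum_congr rfl fun d _ => by ring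

lemma sum_four_mixed (P : ι → ι → ℝ) (Q : ι → ι → ι → ℝ) :
    ∑ a, ∑ b, ∑ c, ∑ d, w a * w b * w c * w d * (P a b * Q b c d)
      = ∑ b, w b * (∑ a, w a * P a b) * ∑ d, w d * ∑ c, w c * Q b c d := by
  rw [Finset.sum_comm]
  refine Finset.sum_congr rfl fun b _ => ?_
  conv_rhs => rw [mul_comm]
  simp only [Finset.sum_mul, Finset.mul_sum]
  refine Finset.sum_congr rfl fun a _ => ?_
  rw [Finset.sum_comm]
  refine Finset.sum_congr rfl fun d _ => Finset.sum_congr rfl fun c _ => by ring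

lemma sum_four_inner (P Q : ι → ι → ι → ℝ) :
    ∑ a, ∑ b, ∑ c, ∑ d, w a * w b * w c * w d * (P a c b * Q a c d)
      = ∑ a, ∑ c, w a * w c * (∑ b, w b * P a c b) * ∑ d, w d * Q a c d := by
  refine Finset.sum_congr rfl fun a _ => ?_
  rw [Finset.sum_comm]
  refine Finset.sum_congr rfl fun c _ => ?_
  conv_rhs => rw [mul_comm]
  simp only [Finset.sum_mul, Finset.mul_sum]
  refine Finset.sum_congr rfl fun b _ => Finset.sum_congr rfl fun d _ => by ring

lemma sum_four_split (P Q : ι → ι → ℝ) :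
    ∑ a, ∑ b, ∑ c, ∑ d, w a * w b * w c * w d * (P a b * Q c d)
      = (∑ a, w a * ∑ b, w b * P a b) * ∑ c, w c * ∑ d, w d * Q c d := by
  conv_rhs => rw [mul_comm]
  simp only [Finset.sum_mul, Finset.mul_sum]
  refine Finset.sum_congr rfl fun a _ => Finset.sum_congr rfl fun b _ =>
    Finset.sum_congr rfl fun c _ => Finset.sum_congr rfl fun d _ => by ring

end

/-- For spin two the terms with the factor `s - 2` drop out and the overall constant is `-1/2`. The
rest agrees term by term by rearranging sums and commuting derivatives, without use of the Young
symmetry. -/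
lemma dualLagrangian_five (T : Ten 5 2 1) (hT : IsSmooth T) :
    dualLagrangian (n := 5) 2 T = curtrightLagrangian T := by
  funext x
  have hd (b a) : Differentiable ℝ (T b a) := (hT b a).differentiable (by simp)
  have e1 (b c x) : divB T ![b] ![c] x = ∑ a, eta a * pd a (T ![a, b] ![c]) x := rfl
  have e2 (b c x) : divA T ![b, c] ![] x = ∑ a, eta a * pd a (T ![b, c] ![a]) x := rfl
  have e3 (b x) : trM T ![b] ![] x = ∑ a, eta a * T ![a, b] ![a] x := rfl
  have e4 (b x) : divA (divB T) ![b] ![] x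
      = ∑ d, eta d * ∑ c, eta c * pd c (pd d (T ![c, b] ![d])) x := by
    change ∑ d, eta d * pd d (fun x => ∑ c, eta c * pd c (T ![c, b] ![d]) x) x = _
    exact Finset.sum_congr rfl fun d _ => by
      rw [pd_sum_eta fun c => differentiable_pd (hT _ _) c]
      simp only [pd_comm (hT _ _) d]
  have e5 (a b x) : pd a (trM T ![b] ![]) x = ∑ c, eta c * pd a (T ![c, b] ![c]) x :=
    pd_sum_eta (fun c => hd _ _) a x
  have e6 (x) : divB (trM T) ![] ![] x = ∑ a, eta a * ∑ b, eta b * pd a (T ![b, a] ![b]) x :=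
    Finset.sum_congr rfl fun a _ => by rw [← e5]
  have key : dualLagrangian (n := 5) 2 T x = -(1 / 2) * (kin T x
      - 2 * contr (divB T) (divB T) x - contr (divA T) (divA T) x
      - 4 * contr (trM T) (divA (divB T)) x - 2 * kin (trM T) x
      + 2 * contr (divB (trM T)) (divB (trM T)) x) := by
    simp only [dualLagrangian, Pi.smul_apply, Pi.add_apply, Pi.sub_apply, Pi.neg_apply, smul_eq_mul]
    norm_num
    ring
  have t1 : kin T x = ∑ a, ∑ b, ∑ c, ∑ d, eta a * eta b * eta c * eta d *
      (pd a (T ![b, c] ![d]) x * pd a (T ![b, c] ![d]) x) := by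
    simp only [kin, contr, sum_fin_two, sum_fin_one, Fin.prod_univ_two, Fin.prod_univ_one,
      Finset.mul_sum, Matrix.cons_val_zero, Matrix.cons_val_one]
    refine Finset.sum_congr rfl fun a _ => Finset.sum_congr rfl fun b _ =>
      Finset.sum_congr rfl fun c _ => Finset.sum_congr rfl fun d _ => by ring
  have t2 : contr (divB T) (divB T) x = ∑ a, ∑ b, ∑ c, ∑ d, eta a * eta b * eta c * eta d *
      (pd a (T ![a, b] ![c]) x * pd d (T ![d, b] ![c]) x) := by
    rw [sum_four_outer eta (fun a b c => pd a (T ![a, b] ![c]) x)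
      (fun d b c => pd d (T ![d, b] ![c]) x)]
    exact contr_one_one (divB T : Ten 5 1 1) (divB T : Ten 5 1 1) x
  have t3 : contr (divA T) (divA T) x = ∑ a, ∑ b, ∑ c, ∑ d, eta a * eta b * eta c * eta d *
      (pd a (T ![b, c] ![a]) x * pd d (T ![b, c] ![d]) x) := by
    rw [sum_four_outer eta (fun a b c => pd a (T ![b, c] ![a]) x)
      (fun d b c => pd d (T ![b, c] ![d]) x)]
    exact contr_two_zero (divA T : Ten 5 2 0) (divA T : Ten 5 2 0) x
  have t4 : contr (trM T) (divA (divB T)) x = ∑ a, ∑ b, ∑ c, ∑ d,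
      eta a * eta b * eta c * eta d *
      (T ![a, b] ![a] x * pd c (pd d (T ![c, b] ![d])) x) := by
    rw [sum_four_mixed eta (fun a b => T ![a, b] ![a] x)
      (fun b c d => pd c (pd d (T ![c, b] ![d])) x)]
    refine (contr_one_zero (trM T : Ten 5 1 0) (divA (divB T) : Ten 5 1 0) x).trans
      (Finset.sum_congr rfl fun b _ => ?_)
    rw [← e4]
    rfl
  have t5 : kin (trM T) x = ∑ a, ∑ b, ∑ c, ∑ d, eta a * eta b * eta c * eta d *
      (pd a (T ![b, c] ![b]) x * pd a (T ![d, c] ![d]) x) := by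
    rw [sum_four_inner eta (fun a c b => pd a (T ![b, c] ![b]) x)
      (fun a c d => pd a (T ![d, c] ![d]) x)]
    refine Finset.sum_congr rfl fun a _ => ?_
    refine (congrArg (eta a * ·) (contr_one_zero (fun b c => pd a ((trM T : Ten 5 1 0) b c))
      (fun b c => pd a ((trM T : Ten 5 1 0) b c)) x)).trans ?_
    simp only [Finset.mul_sum]
    refine Finset.sum_congr rfl fun c _ => ?_
    have e5' := e5 a c x
    change pd a ((trM T : Ten 5 1 0) ![c] ![]) x = _ at e5'
    rw [e5']
    simp only [Finset.mul_sum, Finset.sum_mul]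
    refine Finset.sum_congr rfl fun b _ => Finset.sum_congr rfl fun d _ => by ring
  have t6 : contr (divB (trM T)) (divB (trM T)) x = ∑ a, ∑ b, ∑ c, ∑ d,
      eta a * eta b * eta c * eta d *
      (pd a (T ![b, a] ![b]) x * pd c (T ![d, c] ![d]) x) := by
    rw [sum_four_split eta (fun a b => pd a (T ![b, a] ![b]) x)
      (fun c d => pd c (T ![d, c] ![d]) x), ← e6]
    exact contr_zero_zero (divB (trM T) : Ten 5 0 0) (divB (trM T) : Ten 5 0 0) x
  rw [key, curtrightLagrangian, t1, t2, t3, t4, t5, t6]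
  congr 1
  simp only [Finset.mul_sum, ← Finset.sum_sub_distrib, ← Finset.sum_add_distrib]
  refine Finset.sum_congr rfl fun a _ => Finset.sum_congr rfl fun b _ =>
    Finset.sum_congr rfl fun c _ => Finset.sum_congr rfl fun d _ => by ring

lemma dualGauge_five (S A : Fin 5 → Fin 5 → (Fin 5 → ℝ) → ℝ)
    (h : ∀ a b, ContDiff ℝ ∞ (S a b) ∧ ContDiff ℝ ∞ (A a b) ∧ S a b = S b a ∧ A a b = -A b a)
    (a b c x) :
    dualGauge (n := 5) 2 (fun b c => (-2 : ℝ) • (S (b 0) (c 0) + A (b 0) (c 0))) ![a, b] ![c] x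
      = -(pd a (S b c) x - pd b (S a c) x)
        - (1 / 3) * (pd a (A b c) x + pd b (A c a) x - 2 * pd c (A a b) x) := by
  have hpd (a b c) (x) : pd a ((-2 : ℝ) • (S b c + A b c)) x
      = -2 * (pd a (S b c) x + pd a (A b c) x) := by
    have h1 := (h b c).1.differentiable (by simp) x
    have h2 := (h b c).2.1.differentiable (by simp) x
    rw [pd, fderiv_const_smul (h1.add h2), fderiv_add h1 h2]
    rfl
  have hS (a b c) : pd a (S b c) x = pd a (S c b) x := by rw [(h b c).2.2.1]
  have hA (a b c) : pd a (A b c) x = -pd a (A c b) x := by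
    rw [(h b c).2.2.2, pd, fderiv_neg]
    rfl
  set φ : Ten 5 1 1 := fun b c => (-2 : ℝ) • (S (b 0) (c 0) + A (b 0) (c 0)) with hφ
  set D : Ten 5 2 1 := asym (grad (p := 2) φ) with hD
  have hDv (i j k) (x) : D ![i, j] ![k] x
      = 1 / 2 * (-2 * (pd i (S j k) x + pd i (A j k) x) - -2 * (pd j (S i k) x + pd j (A i k) x)) := by
    rw [hD, asym_fin_two, ← hpd, ← hpd]
    rfl
  -- Here `(s-1)(n-2)/(n+s-4) = 1`, and symmetrization over a single index is trivial.
  have h1 : dualGauge (n := 5) 2 φ ![a, b] ![c] x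
      = D ![a, b] ![c] x - asym (pull D) ![a, b, c] ![] x := by
    have h2 : dualGauge (n := 5) 2 φ = sym (D - (((((2 : ℕ) : ℝ) - 1) * (((5 : ℕ) : ℝ) - 2))
      / (((5 : ℕ) : ℝ) + ((2 : ℕ) : ℝ) - 4)) • (unpull (asym (pull D)) : Ten 5 2 1)) := rfl
    have h3 : (unpull (asym (pull D)) : Ten 5 2 1) ![a, b] ![c] x
        = asym (pull D) ![a, b, c] ![] x := by
      change asym (pull D) _ _ x = _
      refine congrFun (congrArg₂ (asym (pull D)) ?_ (funext fun i => i.elim0)) x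
      funext l
      fin_cases l <;> rfl
    rw [h2, sym_one, ← h3]
    norm_num
  rw [h1, asym_fin_three]
  simp only [pull_two_one, hDv]
  linear_combination (1 / 3 : ℝ) * (hS a b c - hS b a c + hS c a b - hA a b c + 2 * hA b a c
    - hA c a b)

end

end SpinDuality
-- Assembly of the theorem.
theorem mainTheorem12 :
    (∀ n s : ℕ, 4 ≤ n → 2 ≤ s →
      -- from Vasiliev's action to the parent action
      (∀ B : Ten n 2 (s - 1), IsTracelessForm B ↔
        ∃ Ω : Ten n 2 (s - 1), IsSpinConnection s Ω ∧ bOfOmega Ω = B) ∧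
      (∀ B : Ten n 2 (s - 1), IsTracelessForm B → IsTracelessForm (yOfB s B)) ∧
      (∀ Y : Ten n 2 (s - 1), IsTracelessForm Y →
        ∃! B : Ten n 2 (s - 1), IsTracelessForm B ∧ yOfB s B = Y) ∧
      (∀ (e : Ten n 1 (s - 1)) (B : Ten n 2 (s - 1)),
        IsTracelessForm e → IsTracelessForm B →
        vasilievLagrangian s e B = parentLagrangian s e (yOfB s B)) ∧
      -- gauge invariance of the parent action
      (∀ (e : Ten n 1 (s - 1)) (Y : Ten n 2 (s - 1)) (ξ : Ten n 0 (s - 1)) (α : Ten n 1 (s - 1)),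
        IsTracelessForm e → IsTracelessForm Y → IsVariation ξ → IsVariation α → IsHook s α →
        actionDiff (fun F : Ten n 1 (s - 1) × Ten n 2 (s - 1) => parentLagrangian s F.1 F.2)
          (e, Y) (grad ξ + α, (3 : ℝ) • divB (shift s α)) = 0) ∧
      -- elimination of `Y`: the Fronsdal theory
      (∀ (e : Ten n 1 (s - 1)) (Y : Ten n 2 (s - 1)), IsTracelessForm e → IsTracelessForm Y →
        (IsStationaryPoint (parentLagrangian s e) IsVariation Y ↔
          Y = yOfB s ((2 : ℝ) • asym (grad e)))) ∧
      (∀ e : Ten n 1 (s - 1), IsTracelessForm e → IsFronsdalField (symPart s e)) ∧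
      (∀ h : Ten n 0 s, IsFronsdalField h →
        ∃ e : Ten n 1 (s - 1), IsTracelessForm e ∧ symPart s e = h ∧
          (IsCompactlySupported h → IsCompactlySupported e)) ∧
      (∀ e e' : Ten n 1 (s - 1), IsTracelessForm e → IsTracelessForm e' →
        (symPart s e = symPart s e' ↔ IsHook s (e - e'))) ∧
      (∀ e δe : Ten n 1 (s - 1), IsTracelessForm e → IsVariation δe →
        actionDiff
          (fun e : Ten n 1 (s - 1) => parentLagrangian s e (yOfB s ((2 : ℝ) • asym (grad e))))
          e δe
        = ((s : ℝ) / (s - 1)) * actionDiff fronsdalLagrangian (symPart s e) (symPart s δe)) ∧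
      -- `e` as a Lagrange multiplier, and the solution of the constraint
      (∀ (e : Ten n 1 (s - 1)) (Y : Ten n 2 (s - 1)), IsTracelessForm e → IsTracelessForm Y →
        (IsStationaryPoint (fun e : Ten n 1 (s - 1) => parentLagrangian s e Y) IsVariation e ↔
          divB Y = 0)) ∧
      (∀ Y : Ten n 2 (s - 1), IsTracelessForm Y →
        (divB Y = 0 ↔ ∃ P : Ten n 3 (s - 1), IsTracelessForm P ∧ divB P = Y) ∧
        (IsCompactlySupported Y → divB Y = 0 → ∃ P : Ten n 3 (s - 1), IsVariation P ∧ divB P = Y)) ∧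
      (∀ P : Ten n 3 (s - 1), IsTracelessForm P →
        (divB P = 0 ↔ ∃ ψ : Ten n 4 (s - 1), IsTracelessForm ψ ∧ divB ψ = P) ∧
        (IsCompactlySupported P → divB P = 0 → ∃ ψ : Ten n 4 (s - 1), IsVariation ψ ∧ divB ψ = P)) ∧
      -- the dual field
      (∀ P : Ten n 3 (s - 1), IsTracelessForm P →
        ∃! T : Ten n (n - 3) (s - 1), IsDualField s T ∧ IsDualTo s P T) ∧
      (∀ T : Ten n (n - 3) (s - 1), IsDualField s T →
        ∃ P : Ten n 3 (s - 1), IsTracelessForm P ∧ IsDualTo s P T ∧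
          (IsCompactlySupported T → IsCompactlySupported P)) ∧
      (∀ (P P' : Ten n 3 (s - 1)) (T T' : Ten n (n - 3) (s - 1)),
        IsTracelessForm P → IsTracelessForm P' → IsDualField s T → IsDualField s T' →
        IsDualTo s P T → IsDualTo s P' T' →
        (T = T' ↔ ∃ α : Ten n 1 (s - 1), IsSmooth α ∧ IsHook s α ∧
          P = P' + (3 : ℝ) • shift s α)) ∧
      -- the dual action
      (∀ (e δe : Ten n 1 (s - 1)) (P δP : Ten n 3 (s - 1)) (T δT : Ten n (n - 3) (s - 1)),
        IsTracelessForm e → IsVariation δe → IsTracelessForm P → IsVariation δP →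
        IsDualField s T → IsDualTo s P T → IsDualField s δT → IsDualTo s δP δT →
        actionDiff (fun F : Ten n 1 (s - 1) × Ten n 2 (s - 1) => parentLagrangian s F.1 F.2)
          (e, divB P) (δe, divB δP)
        = actionDiff (dualLagrangian s) T δT) ∧
      -- the gauge symmetries of the dual action
      (∀ ψ : Ten n 4 (s - 1), IsTracelessForm ψ →
        IsTracelessForm (epsDual ψ : Ten n (n - 4) (s - 1)) ∧
        IsDualTo s (divB ψ) (dualGauge s ((((n : ℝ) - 3) / 24) • epsDual ψ))) ∧
      (∀ φ : Ten n (n - 4) (s - 1), IsTracelessForm φ →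
        ∃ ψ : Ten n 4 (s - 1), IsTracelessForm ψ ∧ φ = (((n : ℝ) - 3) / 24) • epsDual ψ) ∧
      (∀ φ : Ten n (n - 4) (s - 1), IsTracelessForm φ → IsDualField s (dualGauge s φ)) ∧
      (∀ (T : Ten n (n - 3) (s - 1)) (φ : Ten n (n - 4) (s - 1)),
        IsDualField s T → IsVariation φ →
        actionDiff (dualLagrangian s) T (dualGauge s φ) = 0)) ∧
    -- four dimensions: Fronsdal is dual to Fronsdal
    (∀ s : ℕ, 2 ≤ s →
      (∀ T : Ten 4 1 (s - 1), IsDualField (n := 4) s T →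
        IsFronsdalField (symPart s T) ∧
        (∀ (b : Fin 1 → Fin 4) (a : Fin (s - 1) → Fin 4) (c : Fin s → Fin 4),
          (∀ i : Fin s, c i = if h : (i : ℕ) = 0 then b 0 else a ⟨i - 1, by omega⟩) →
          symPart s T ![] c = T b a) ∧
        dualLagrangian (n := 4) s T
          = (4 * ((s : ℝ) - 1) / s) • fronsdalLagrangian (symPart s T)) ∧
      (∀ h : Ten 4 0 s, IsFronsdalField h →
        ∃! T : Ten 4 1 (s - 1), IsDualField (n := 4) s T ∧ symPart s T = h) ∧
      (∀ φ : Ten 4 0 (s - 1), IsTracelessForm φ →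
        symPart s (dualGauge (n := 4) s φ) = fronsdalGauge s φ)) ∧
    -- spin two in five dimensions: Curtright's theory
    (∀ T : Ten 5 2 1,
      (IsDualField (n := 5) 2 T ↔ IsSmooth T ∧
        ∀ a b c x, T ![a, b] ![c] x = -T ![b, a] ![c] x ∧
          T ![a, b] ![c] x + T ![b, c] ![a] x + T ![c, a] ![b] x = 0) ∧
      (IsDualField (n := 5) 2 T → dualLagrangian (n := 5) 2 T = curtrightLagrangian T)) ∧
    (∀ S A : Fin 5 → Fin 5 → (Fin 5 → ℝ) → ℝ,
      (∀ a b, ContDiff ℝ ∞ (S a b) ∧ ContDiff ℝ ∞ (A a b) ∧ S a b = S b a ∧ A a b = -A b a) →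
      ∀ a b c x,
        dualGauge (n := 5) 2 (fun b c => (-2 : ℝ) • (S (b 0) (c 0) + A (b 0) (c 0)))
            ![a, b] ![c] x
          = -(pd a (S b c) x - pd b (S a c) x)
            - (1 / 3) * (pd a (A b c) x + pd b (A c a) x - 2 * pd c (A a b) x)) := by
  refine ⟨fun n s hn hs => ?_, fun s hs => ?_,
    fun T => ⟨isDualField_five T, fun hT => dualLagrangian_five T hT.1⟩,
    fun S A h a b c x => dualGauge_five S A h a b c x⟩
  -- With `n = m + 4` and `s = q + 2` the truncated differences `n - 3`, `n - 4`, `s - 1` reduce to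
  -- `m + 1`, `m`, `q + 1`.
  · obtain ⟨m, rfl⟩ : ∃ m, n = m + 4 := ⟨n - 4, by omega⟩
    obtain ⟨q, rfl⟩ : ∃ q, s = q + 2 := ⟨s - 2, by omega⟩
    have hn' : (4 : ℝ) ≤ ((m + 4 : ℕ) : ℝ) := by exact_mod_cast hn
    exact ⟨isTracelessForm_iff_exists_connection hn, isTracelessForm_yOfB,
      existsUnique_yOfB hn', vasilievLagrangian_eq_parentLagrangian hn',
      actionDiff_parentLagrangian_gauge hn', parentLagrangian_stationary_iff hn',
      isFronsdalField_symPart, exists_symPart_eq hn', symPart_eq_iff,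
      actionDiff_eliminated hn', parentLagrangian_stationary_vielbein_iff hn',
      fun Y hY => ⟨divB_eq_zero_iff (by omega) Y hY, exists_divB_eq_of_compact Y hY⟩,
      fun P hP => ⟨divB_eq_zero_iff (by omega) P hP, exists_divB_eq_of_compact P hP⟩,
      existsUnique_dual, exists_potential, dual_eq_iff, actionDiff_dualLagrangian,
      gauge_of_potential,
      fun φ hφ => (exists_potential_of_parameter φ hφ).imp fun ψ h => ⟨h.1, h.2.2⟩,
      isDualField_dualGauge, actionDiff_dualGauge⟩
  · obtain ⟨q, rfl⟩ : ∃ q, s = q + 2 := ⟨s - 2, by omega⟩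
    exact ⟨dualField_four, existsUnique_dualField_four, symPart_dualGauge_four⟩
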